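/- **Setting.** Let $J$ be a doubly infinite Jacobi matrix with bounded real entries $a_k$ (diagonal) and $b_k\neq 0$ (off-diagonal, coupling $k$ and $k+1$), $k\in\mathbb Z$, with $b_{-1}>0$. Let $P_k(\lambda),Q_k(\lambda)$ be the solutions of $b_{k-1}\omega_{k-1}+(a_k-\lambda)\omega_k+b_k\omega_{k+1}=0$, $k\in\mathbb Z$, with $P_0=1,P_{-1}=0$, $Q_0=0,Q_{-1}=1$. The Weyl functions $m^R,m^L$ are the functions for which, for every nonreal $\lambda$, $m^R(\lambda)P_k(\lambda)-Q_k(\lambda)/b_{-1}$ is square-summable at $k\to+\infty$ and $-P_k(\lambda)/b_{-1}+m^L(\lambda)Q_k(\lambda)$ is square-summable at $k\to-\infty$; they have the representations $$b_{-1}m^R(\lambda)=\int\frac{d\rho_R(\tau)}{\tau-\lambda},\qquad -\frac1{b_{-1}m^L(\lambda)}=\frac{\lambda}{b_{-1}}+\beta+\int\frac{d\rho_L(\tau)}{\tau-\lambda}$$ with finite measures $d\rho_R,d\rho_L$ and $\beta\in\mathbb R$; these formulas also define $m^R$ and $-1/m^L$ at real $\lambda$ outside the supports. Let $\rho_R',\rho_L'$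 be the derivatives of the distribution functions, $M=b_{-1}m^R-1/(b_{-1}m^L)$, and let $\eta^R,\eta^L,\eta$ be the limits, as $\varepsilon\downarrow0$, of the arguments of $m^R$, $-1/m^L$, $M$ at $\tau+i\varepsilon$. Let $\tilde\Omega^R,\tilde\Omega^L$ be the supports of $d\rho_R,d\rho_L$, let $\tilde\Omega_1$ be their symmetric difference, $\tilde\Omega_2^s$ the set of common poles of $m^R$ and $-1/m^L$, and $\tilde\Omega_2^a=(\tilde\Omega^R\cap\tilde\Omega^L)\setminus\tilde\Omega_2^s$. Assume: A) $\tilde\Omega_1,\tilde\Omega_2^s,\tilde\Omega_2^a$ have positive mutual distances, $[-2,2]\subset\tilde\Omega_2^a$, and $\tilde\Omega_2^s$ is finite or empty. B) For some $\varepsilon>0$, $\varepsilon<\eta^R<\pi-\varepsilon$ and $\varepsilon<\eta^L<\pi-\varepsilon$ almost everywhere on $\tilde\Omega_2^a$. C) $\eta^R-\eta^L$ satisfies a Hölder condition in a neighbourhood of $\tilde\Omega_2^a$. D) $\tilde\Omega_2^a\setminus[-2,2]$ is covered by mutually disjoint open intervals on each of which $\operatorname{ess\,sup}\eta^R-\operatorname{ess\,inf}\eta^R<\pi$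 and $\operatorname{ess\,sup}\eta^L-\operatorname{ess\,inf}\eta^L<\pi$. E) For some $\varepsilon>0$ and $0<\alpha<\varepsilon$, $\eta^R(2+\alpha)=\eta^L(2+\alpha)=0$ and $\eta^R(-2-\alpha)=\eta^L(-2-\alpha)=\pi$; moreover $\eta^R$ and $\eta^L$ satisfy a Hölder condition on $[-2,2]$. (The functions $\eta^R,\eta^L$ matter only up to null sets, and the conditions are understood so.) **The functions $n,\psi$.** Put $n(z)=-b_{-1}m^R(z+z^{-1})$ for $|z|<1$, $n(z)=-1/(b_{-1}m^L(z+z^{-1}))$ for $|z|>1$, $N(z)=n(z)-n(z^{-1})$, and $\psi(k,z)=n(z)P_k(z+z^{-1})+Q_k(z+z^{-1})$. Put $h_k=b_{-1}\cdots b_{k-1}$ for $k\ge0$, $h_{-1}=1$, $h_k=(b_k\cdots b_{-2})^{-1}$ for $k\le-2$. For $|\xi|=1$ let $f^+(\xi)=\lim_{r\uparrow1}f(r\xi)$ and $f^-(\xi)=\lim_{r\downarrow1}f(r\xi)$. **The function $R$.** For $A\subset\mathbb R\setminus\{0\}$ write $V(A)=\{t:t^{-1}\in A\}$. Let $\Omega=\{0<|t|<1,\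 t+t^{-1}\in\tilde\Omega^R\}\cup\{|t|>1,\ t+t^{-1}\in\tilde\Omega^L\}\subset\mathbb R$, $\Omega_1=\Omega\setminus V(\Omega)$, and let $\Omega_2^s,\Omega_2^a\subset\mathbb R\setminus\{0,\pm1\}$ be the preimages of $\tilde\Omega_2^s,\tilde\Omega_2^a$ under $t\mapsto t+t^{-1}$. The open set $\{|t|>1\}\setminus(\Omega_1\cup V(\Omega_1)\cup\Omega_2^s)$ is a union of disjoint open intervals $\Delta_k=(\alpha_k,\beta_k)$; each contains or has as an endpoint a point $\varphi_k$ such that, off $\Omega_2^a$, $N<0$ on $(\alpha_k,\varphi_k)$ and $N>0$ on $(\varphi_k,\beta_k)$, one of these intervals being possibly empty. Let $\alpha_k^*=\alpha_k^{-1}$ if $\alpha_k\in V(\Omega_1)$ and $\alpha_k^*=\alpha_k$ otherwise; let $\varphi_k^*=\varphi_k$ if $\alpha_k,\beta_k\in\Omega_1$, $\varphi_k^*=\varphi_k^{-1}$ if $\alpha_k,\beta_k\in V(\Omega_1)$, and in all other cases $\varphi_k^*=\varphi_k^{-1}$ if $\varphi_k\in V(\Omega_1)$, $\varphi_k^*=\varphi_k$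 if not. Let $\chi_1,\chi_2^a,\chi_0$ be the indicators of $\Omega_1$, $\Omega_2^a$, $\Delta^{(1)}\cup V(\Delta^{(1)})$, where $\Delta^{(1)}=\bigcup_k(\alpha_k,\varphi_k)$, and let $s(t)=1$ for $|t|>1$, $s(t)=-1$ for $|t|<1$. With $$\mathcal P(z,\gamma)=\exp\Big\{\frac1\pi\int_{-\infty}^\infty\gamma(t)\Big(\frac1{t-z}-\frac t{1+t^2}\Big)dt\Big\},\qquad \hat{\mathcal P}(z,\hat\gamma)=\exp\Big\{-\frac1{2\pi i}\int_{-\pi}^{\pi}\frac{e^{i\theta}+z}{e^{i\theta}-z}\hat\gamma(\theta)\,d\theta\Big\}$$ put $R=C\,R_0R_1R_2R_3R_\mu$, where $$R_0(z)=\prod_k\frac{z-\alpha_k^*}{z-\varphi_k^*}$$ (the numerator being omitted for the interval with $\alpha_k=-\infty$ and the denominator for the interval with $\beta_k=-1$), $R_1(z)=\mathcal P(z,-\gamma_1)$ and $R_2(z)=\mathcal P(z,-\gamma_2)$ with $\gamma_1(t)=\chi_1(t)s(t)\eta(t+t^{-1})$ and $\gamma_2(t)=\tfrac12\chi_2^a(t)s(t)(\eta(t+t^{-1})-\pi\chi_0(t))$,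 $R_3(z)=\hat{\mathcal P}(z,-\hat\gamma_3/2)$ with $\hat\gamma_3(\theta)=-\eta(2\cos\theta)+\frac\pi2$ for $0<\theta<\pi$ and $\hat\gamma_3(\theta)=\eta(2\cos\theta)-\frac\pi2$ for $-\pi<\theta<0$, and $$R_\mu(z)=\exp\Big\{-\frac1{2\pi}\int_{-\pi}^{\pi}\frac{e^{i\theta}}{e^{i\theta}-z}\ln\mu(2\cos\theta)\,d\theta\Big\},\qquad \mu=\sqrt{\rho_R'/\rho_L'} .$$ **Statement (Lemma 3.7).** There is a constant $C>0$ such that $\dfrac{z-z^{-1}}{N(z)}=R(z)R(z^{-1})$ for all nonreal $z$ with $|z|\ne1$, and for this $C$ the limit $R(\infty)=\lim_{z\to\infty}R(z)$ exists and is nonzero. Put $$g(k,z)=\frac{R(z)}{R(\infty)}z^{-(k+1)}h_k\psi(k,z).$$ For every $k\in\mathbb Z$ and almost every $\xi$ on the unit circle, the boundary values $g^\pm(k,\xi)$, $g^\pm(k,\xi^{-1})$ exist and $$\xi^{2(k+1)}\big(g^+(k,\xi)-g^-(k,\xi)\big)=-\hat r(\xi)\big(g^+(k,\xi^{-1})+g^-(k,\xi^{-1})\big),$$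 where $$\hat r(\xi)=\frac1{1+q(\xi)}\cdot\frac{n^+(\xi)-n^-(\xi)}{\xi-\xi^{-1}}\,R^+(\xi)R^-(\xi),\qquad q(\xi)=2\pi\frac{\sqrt{\rho_R'(\xi+\xi^{-1})\,\rho_L'(\xi+\xi^{-1})}}{|n^+(\xi)-n^-(\xi^{-1})|}.$$ The boundary values $n^\pm(\xi),R^\pm(\xi)$ and the derivatives $\rho_R'(\xi+\xi^{-1}),\rho_L'(\xi+\xi^{-1})$ exist for all $\xi\ne\pm1$ on the unit circle. Moreover, there is a constant $c<1$ with $|\hat r(\xi)|<c$ for all $\xi\neq\pm1$ on the unit circle. -/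

import Mathlib

open Filter Topology MeasureTheory Set
open scoped NNReal

noncomputable section

/-- A doubly infinite Jacobi matrix: real bounded entries, diagonal `a k`, off-diagonal `b k ≠ 0`
(the entry coupling `k` and `k + 1`), normalised by `b (-1) > 0`. -/
structure JacobiMatrix where
  a : ℤ → ℝ
  b : ℤ → ℝ
  bounded : ∃ K : ℝ, ∀ k, |a k| ≤ K ∧ |b k| ≤ K
  b_ne_zero : ∀ k, b k ≠ 0
  b_neg_one_pos : 0 < b (-1)

/-- Radial boundary value of `f` at `ξ` from inside the unit circle (the superscript `+`). -/
def innerLim (f : ℂ → ℂ) (ξ : ℂ) : ℂ := limUnder (𝓝[<] (1 : ℝ)) fun r : ℝ => f (r * ξ)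

/-- Radial boundary value of `f` at `ξ` from outside the unit circle (the superscript `-`). -/
def outerLim (f : ℂ → ℂ) (ξ : ℂ) : ℂ := limUnder (𝓝[>] (1 : ℝ)) fun r : ℝ => f (r * ξ)

/-- Both radial boundary values of `f` at `ξ` exist. -/
def HasCircleLimits (f : ℂ → ℂ) (ξ : ℂ) : Prop :=
  (∃ y, Tendsto (fun r : ℝ => f (r * ξ)) (𝓝[<] (1 : ℝ)) (𝓝 y)) ∧
  (∃ y, Tendsto (fun r : ℝ => f (r * ξ)) (𝓝[>] (1 : ℝ)) (𝓝 y))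

/-- `lim_{ε ↓ 0} arg f(τ + iε)`. -/
def boundaryArg (f : ℂ → ℂ) (τ : ℝ) : ℝ :=
  limUnder (𝓝[>] (0 : ℝ)) fun ε : ℝ => Complex.arg (f (τ + ε * Complex.I))

/-- Image of a set of nonzero reals under `t ↦ t⁻¹`. -/
def invSet (A : Set ℝ) : Set ℝ := {t | t ≠ 0 ∧ t⁻¹ ∈ A}

/-- `exp { (1/π) ∫ γ(t) (1/(t - z) - t/(1 + t²)) dt }`. -/
def expLine (z : ℂ) (γ : ℝ → ℝ) : ℂ :=
  Complex.exp ((1 / (Real.pi : ℂ)) *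
    ∫ t : ℝ, (γ t : ℂ) * (1 / ((t : ℂ) - z) - (t : ℂ) / (1 + (t : ℂ) ^ 2)))

/-- `exp { -(1/2πi) ∫_{-π}^{π} (e^{iθ} + z)/(e^{iθ} - z) γ(θ) dθ }`. -/
def expCircle (z : ℂ) (γ : ℝ → ℝ) : ℂ :=
  Complex.exp (-(1 / (2 * (Real.pi : ℂ) * Complex.I)) *
    ∫ θ in (-Real.pi)..Real.pi,
      (Complex.exp (θ * Complex.I) + z) / (Complex.exp (θ * Complex.I) - z) * (γ θ : ℂ))

/-- `1` outside and `-1` inside the unit circle. -/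
def sideSign (t : ℝ) : ℝ := if 1 < |t| then 1 else -1

/-- `f` agrees almost everywhere on `S` with a function satisfying a Hölder condition on `S`. -/
def IsAEHolderOn (f : ℝ → ℝ) (S : Set ℝ) : Prop :=
  ∃ (K r : ℝ≥0) (h : ℝ → ℝ), 0 < r ∧ HolderOnWith K r h S ∧ ∀ᵐ τ : ℝ, τ ∈ S → f τ = h τ

namespace JacobiMatrix

variable (J : JacobiMatrix)

/-! ### Solutions of `b_{k-1} ω_{k-1} + (a_k - w) ω_k + b_k ω_{k+1} = 0`, `k ∈ ℤ` -/

/-- The pair `(ω_{n-1}, ω_n)` for `n ≥ 0`, started from `(ω_{-1}, ω_0) = init`. -/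
def forward (w : ℂ) (init : ℂ × ℂ) : ℕ → ℂ × ℂ
  | 0 => init
  | n + 1 =>
    let p := forward w init n
    (p.2, ((w - J.a n) * p.2 - J.b ((n : ℤ) - 1) * p.1) / J.b n)

/-- The pair `(ω_{-1-n}, ω_{-n})` for `n ≥ 0`, started from `(ω_{-1}, ω_0) = init`. -/
def backward (w : ℂ) (init : ℂ × ℂ) : ℕ → ℂ × ℂ
  | 0 => init
  | n + 1 =>
    let p := backward w init n
    (((w - J.a (-1 - (n : ℤ))) * p.1 - J.b (-1 - (n : ℤ)) * p.2) / J.b (-2 - (n : ℤ)), p.1)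

/-- The solution `ω` of the difference equation with `(ω_{-1}, ω_0) = init`. -/
def solution (w : ℂ) (init : ℂ × ℂ) : ℤ → ℂ
  | Int.ofNat n => (J.forward w init n).2
  | Int.negSucc n => (J.backward w init n).1

/-- `P_k(w)`: the solution with `P_0 = 1`, `P_{-1} = 0`. -/
def P (k : ℤ) (w : ℂ) : ℂ := J.solution w (0, 1) k

/-- `Q_k(w)`: the solution with `Q_0 = 0`, `Q_{-1} = 1`. -/
def Q (k : ℤ) (w : ℂ) : ℂ := J.solution w (1, 0) k

/-! ### Weyl functions and spectral measures -/

/-- `ρ` is the finite measure for which `m^R`, given by `b_{-1} m^R(w) = ∫ dρ(τ) / (τ - w)`, makes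
`φ^R(k, w) = m^R(w) P_k(w) - Q_k(w) / b_{-1}` square-summable at `+∞` for every nonreal `w`.
Such a measure exists and is unique; it is `b_{-1}` times the spectral measure of the
half-infinite matrix `(J_{ij})_{i,j ≥ 0}` at its first basis vector. -/
def IsRightMeasure (ρ : Measure ℝ) : Prop :=
  IsFiniteMeasure ρ ∧ ∀ w : ℂ, w.im ≠ 0 →
    Summable fun k : ℕ =>
      ‖(1 / (J.b (-1) : ℂ) * ∫ τ : ℝ, 1 / ((τ : ℂ) - w) ∂ρ) * J.P k w
        - J.Q k w / (J.b (-1) : ℂ)‖ ^ 2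

/-- `(β, ρ)` are the number and the finite measure for which `m^L`, given by
`-1 / (b_{-1} m^L(w)) = w / b_{-1} + β + ∫ dρ(τ) / (τ - w)`, makes
`φ^L(k, w) = -P_k(w) / b_{-1} + m^L(w) Q_k(w)` square-summable at `-∞` for every nonreal `w`.
Such a pair exists and is unique; up to a constant factor, `ρ` is the spectral measure of the
half-infinite matrix `(J_{ij})_{i,j ≤ -2}` at the basis vector with index `-2`. -/
def IsLeftMeasure (d : ℝ × Measure ℝ) : Prop :=
  IsFiniteMeasure d.2 ∧ ∀ w : ℂ, w.im ≠ 0 →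
    Summable fun k : ℕ =>
      ‖-J.P (-(k : ℤ)) w / (J.b (-1) : ℂ)
        + (-1 / ((J.b (-1) : ℂ) *
            (w / (J.b (-1) : ℂ) + (d.1 : ℂ) + ∫ τ : ℝ, 1 / ((τ : ℂ) - w) ∂d.2)))
          * J.Q (-(k : ℤ)) w‖ ^ 2

/-- The measure `dρ_R`. -/
def rhoR : Measure ℝ := Classical.epsilon J.IsRightMeasure

/-- The number `β` together with the measure `dρ_L`. -/
def leftData : ℝ × Measure ℝ := Classical.epsilon J.IsLeftMeasure

/-- The measure `dρ_L`. -/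
def rhoL : Measure ℝ := J.leftData.2

/-- The right Weyl function `m^R`. -/
def mR (w : ℂ) : ℂ := 1 / (J.b (-1) : ℂ) * ∫ τ : ℝ, 1 / ((τ : ℂ) - w) ∂J.rhoR

/-- The left Weyl function `m^L`. -/
def mL (w : ℂ) : ℂ :=
  -1 / ((J.b (-1) : ℂ) *
    (w / (J.b (-1) : ℂ) + (J.leftData.1 : ℂ) + ∫ τ : ℝ, 1 / ((τ : ℂ) - w) ∂J.rhoL))

/-- `M(w) = b_{-1} m^R(w) - 1 / (b_{-1} m^L(w))`. -/
def M (w : ℂ) : ℂ := (J.b (-1) : ℂ) * J.mR w - 1 / ((J.b (-1) : ℂ) * J.mL w)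

/-- The derivative `ρ_R'(τ)` of the nondecreasing function `ρ_R(τ) = ρ_R((-∞, τ])`. -/
def rhoR' (τ : ℝ) : ℝ := deriv (fun t => J.rhoR.real (Iic t)) τ

/-- The derivative `ρ_L'(τ)` of the nondecreasing function `ρ_L(τ) = ρ_L((-∞, τ])`. -/
def rhoL' (τ : ℝ) : ℝ := deriv (fun t => J.rhoL.real (Iic t)) τ

/-- `η^R(τ) = lim_{ε ↓ 0} arg m^R(τ + iε)`. -/
def etaR : ℝ → ℝ := boundaryArg J.mR

/-- `η^L(τ) = lim_{ε ↓ 0} arg (-1 / m^L(τ + iε))`. -/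
def etaL : ℝ → ℝ := boundaryArg fun w => -1 / J.mL w

/-- `η(τ) = lim_{ε ↓ 0} arg M(τ + iε)`. -/
def eta : ℝ → ℝ := boundaryArg J.M

/-! ### Parts of the spectrum in the `w`-plane -/

/-- Support of `dρ_R`. -/
def specR : Set ℝ := J.rhoR.support

/-- Support of `dρ_L`. -/
def specL : Set ℝ := J.rhoL.support

/-- The asymmetric part of the two supports. -/
def spec1 : Set ℝ := (J.specR \ J.specL) ∪ (J.specL \ J.specR)

/-- The common poles of `m^R` and `-1 / m^L`. -/
def spec2s : Set ℝ :=
  {x | meromorphicOrderAt J.mR (x : ℂ) < 0 ∧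
    meromorphicOrderAt (fun w => -1 / J.mL w) (x : ℂ) < 0}

/-- The common part of the supports without the common poles. -/
def spec2a : Set ℝ := (J.specR ∩ J.specL) \ J.spec2s

/-! ### The standing conditions on the spectrum -/

/-- Condition A. -/
def CondA : Prop :=
  Metric.AreSeparated J.spec1 J.spec2s ∧ Metric.AreSeparated J.spec1 J.spec2a ∧
  Metric.AreSeparated J.spec2s J.spec2a ∧ Icc (-2) 2 ⊆ J.spec2a ∧ J.spec2s.Finite

/-- Condition B. -/
def CondB : Prop :=
  ∃ ε : ℝ, 0 < ε ∧ ∀ᵐ τ : ℝ, τ ∈ J.spec2a →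
    (ε < J.etaR τ ∧ J.etaR τ < Real.pi - ε) ∧ (ε < J.etaL τ ∧ J.etaL τ < Real.pi - ε)

/-- Condition C. -/
def CondC : Prop :=
  ∃ U : Set ℝ, IsOpen U ∧ J.spec2a ⊆ U ∧ IsAEHolderOn (fun τ => J.etaR τ - J.etaL τ) U

/-- Condition D. -/
def CondD : Prop :=
  ∃ S : Set (Set ℝ),
    (∀ I ∈ S, IsOpen I ∧ I.OrdConnected ∧
      essSup J.etaR (volume.restrict I) - essInf J.etaR (volume.restrict I) < Real.pi ∧
      essSup J.etaL (volume.restrict I) - essInf J.etaL (volume.restrict I) < Real.pi) ∧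
    S.PairwiseDisjoint id ∧ J.spec2a \ Icc (-2) 2 ⊆ ⋃₀ S

/-- Condition E. -/
def CondE : Prop :=
  (∃ ε : ℝ, 0 < ε ∧ ∀ᵐ x : ℝ, x ∈ Ioo 0 ε →
    J.etaR (2 + x) = 0 ∧ J.etaL (2 + x) = 0 ∧
    J.etaR (-2 - x) = Real.pi ∧ J.etaL (-2 - x) = Real.pi) ∧
  IsAEHolderOn J.etaR (Icc (-2) 2) ∧ IsAEHolderOn J.etaL (Icc (-2) 2)

/-! ### The `z`-plane, `w = z + z⁻¹` -/

/-- The Weyl function `n(z)`. -/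
def n (z : ℂ) : ℂ :=
  if ‖z‖ < 1 then -((J.b (-1) : ℂ) * J.mR (z + z⁻¹)) else -1 / ((J.b (-1) : ℂ) * J.mL (z + z⁻¹))

/-- `N(z) = n(z) - n(z⁻¹)`. -/
def N (z : ℂ) : ℂ := J.n z - J.n z⁻¹

/-- The Weyl solution `ψ(k, z) = n(z) P_k(z + z⁻¹) + Q_k(z + z⁻¹)`. -/
def psi (k : ℤ) (z : ℂ) : ℂ := J.n z * J.P k (z + z⁻¹) + J.Q k (z + z⁻¹)

/-- `h_k = b_{-1} ⋯ b_{k-1}` for `k ≥ 0`, `h_{-1} = 1`, `h_k = 1 / (b_k ⋯ b_{-2})` for `k ≤ -2`. -/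
def h (k : ℤ) : ℝ := (∏ j ∈ Finset.Ico (-1) k, J.b j) / ∏ j ∈ Finset.Ico k (-1), J.b j

/-- The singularities of `n` on the real line. -/
def Omega : Set ℝ :=
  {t | t ≠ 0 ∧ |t| < 1 ∧ t + t⁻¹ ∈ J.specR} ∪ {t | 1 < |t| ∧ t + t⁻¹ ∈ J.specL}

/-- `Ω_1`. -/
def Omega1 : Set ℝ := J.Omega \ invSet J.Omega

/-- `Ω_2^s`. -/
def Omega2s : Set ℝ := {t | t ≠ 0 ∧ t + t⁻¹ ∈ J.spec2s}

/-- `Ω_2^a`. -/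
def Omega2a : Set ℝ := {t | t ≠ 0 ∧ t ≠ 1 ∧ t ≠ -1 ∧ t + t⁻¹ ∈ J.spec2a}

/-- The complement of `(-1, 1) ∪ Ω_1 ∪ Ω_1⁻¹ ∪ Ω_2^s`, without the points `±1`. -/
def Delta : Set ℝ := {t | 1 < |t|} \ (J.Omega1 ∪ invSet J.Omega1 ∪ J.Omega2s)

/-- The disjoint open intervals `Δ_k = (α_k, β_k)` that make up `Delta`. For such an interval `I`,
`α_k = sInf I` if `I` is bounded below and `β_k = sSup I` if `I` is bounded above. -/
def gaps : Set (Set ℝ) := {I | ∃ t ∈ J.Delta, I = connectedComponentIn J.Delta t}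

/-- The points of `I` outside `Ω_2^a` at which `N < 0` (`N` is real there). -/
def negPart (I : Set ℝ) : Set ℝ := {t | t ∈ I ∧ t ∉ J.Omega2a ∧ (J.N t).re < 0}

open Classical in
/-- The point `φ_k` that splits `Δ_k`: off `Ω_2^a`, `N < 0` on `(α_k, φ_k)` and `N > 0` on
`(φ_k, β_k)`; one of the two intervals may be empty. -/
def phi (I : Set ℝ) : ℝ := if (J.negPart I).Nonempty then sSup (J.negPart I) else sInf I

open Classical in
/-- `α_k^*`. -/
def alphaStar (I : Set ℝ) : ℝ := if sInf I ∈ invSet J.Omega1 then (sInf I)⁻¹ else sInf I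

open Classical in
/-- `φ_k^*`. (If `I` is unbounded on one side, then `sInf I` or `sSup I` is `0`, which belongs to
neither of the two sets, so that the last two cases apply.) -/
def phiStar (I : Set ℝ) : ℝ :=
  if sInf I ∈ J.Omega1 ∧ sSup I ∈ J.Omega1 then J.phi I
  else if sInf I ∈ invSet J.Omega1 ∧ sSup I ∈ invSet J.Omega1 then (J.phi I)⁻¹
  else if J.phi I ∈ invSet J.Omega1 then (J.phi I)⁻¹ else J.phi I

/-- The union of the intervals `(α_k, φ_k)`. -/
def Delta1 : Set ℝ := {t | ∃ I ∈ J.gaps, t ∈ I ∧ t < J.phi I}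

/-! ### The function `R` -/

open Classical in
/-- The product over all intervals `Δ_k` of `(z - α_k^*) / (z - φ_k^*)`, where the numerator is
omitted for the interval with `α_k = -∞` and the denominator for the interval with `β_k = -1`. -/
def R0 (z : ℂ) : ℂ :=
  ∏' I : J.gaps,
    (if BddBelow (I : Set ℝ) then z - (J.alphaStar I : ℂ) else 1) /
      (if sSup (I : Set ℝ) = -1 then 1 else z - (J.phiStar I : ℂ))

/-- `γ_1 = χ_1 s η(t + t⁻¹)`. -/
def gamma1 : ℝ → ℝ := J.Omega1.indicator fun t => sideSign t * J.eta (t + t⁻¹)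

open Classical in
/-- `γ_2 = ½ χ_2^a s (η(t + t⁻¹) - χ_0 π)`. -/
def gamma2 : ℝ → ℝ := J.Omega2a.indicator fun t =>
  1 / 2 * sideSign t *
    (J.eta (t + t⁻¹) - if t ∈ J.Delta1 ∪ invSet J.Delta1 then Real.pi else 0)

/-- The odd function equal to `-η(e^{iθ} + e^{-iθ}) + π/2` for `0 < θ < π`. -/
def gamma3 (θ : ℝ) : ℝ :=
  if 0 < θ then -J.eta (2 * Real.cos θ) + Real.pi / 2 else J.eta (2 * Real.cos θ) - Real.pi / 2

/-- `μ = √(ρ_R' / ρ_L')`. -/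
def mu (τ : ℝ) : ℝ := Real.sqrt (J.rhoR' τ / J.rhoL' τ)

/-- `R_μ`. -/
def Rmu (z : ℂ) : ℂ :=
  Complex.exp (-(1 / (2 * (Real.pi : ℂ))) * ∫ θ in (-Real.pi)..Real.pi,
    Complex.exp (θ * Complex.I) / (Complex.exp (θ * Complex.I) - z) *
      (Real.log (J.mu (2 * Real.cos θ)) : ℂ))

/-- `R = C R_0 R_1 R_2 R_3 R_μ`. -/
def R (C : ℝ) (z : ℂ) : ℂ :=
  C * J.R0 z * expLine z (fun t => -J.gamma1 t) * expLine z (fun t => -J.gamma2 t) *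
    expCircle z (fun θ => -J.gamma3 θ / 2) * J.Rmu z

/-- `C` is the positive constant for which `(z - z⁻¹) / N(z) = R(z) R(z⁻¹)`. -/
def IsFactorConstant (C : ℝ) : Prop :=
  0 < C ∧ ∀ z : ℂ, z.im ≠ 0 → ‖z‖ ≠ 1 → (z - z⁻¹) / J.N z = J.R C z * J.R C z⁻¹

/-- `R(∞)`. -/
def Rinfty (C : ℝ) : ℂ := limUnder (Bornology.cobounded ℂ) (J.R C)

/-- `g(k, z) = R(z) / R(∞) · z^{-(k+1)} h_k ψ(k, z)`. -/
def g (C : ℝ) (k : ℤ) (z : ℂ) : ℂ :=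
  J.R C z / J.Rinfty C * z ^ (-(k + 1)) * (J.h k : ℂ) * J.psi k z

/-! ### The coefficient -/

/-- `q(ξ) = 2π √(ρ_R'(ξ + ξ⁻¹) ρ_L'(ξ + ξ⁻¹)) / |n⁺(ξ) - n⁻(ξ⁻¹)|`. -/
def q (ξ : ℂ) : ℝ :=
  2 * Real.pi * Real.sqrt (J.rhoR' (ξ + ξ⁻¹).re * J.rhoL' (ξ + ξ⁻¹).re) /
    ‖innerLim J.n ξ - outerLim J.n ξ⁻¹‖

/-- `r̂(ξ) = 1 / (1 + q(ξ)) · (n⁺(ξ) - n⁻(ξ)) / (ξ - ξ⁻¹) · R⁺(ξ) R⁻(ξ)`. -/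
def rHat (C : ℝ) (ξ : ℂ) : ℂ :=
  1 / (1 + (J.q ξ : ℂ)) * ((innerLim J.n ξ - outerLim J.n ξ) / (ξ - ξ⁻¹)) *
    innerLim (J.R C) ξ * outerLim (J.R C) ξ

end JacobiMatrix

end

noncomputable section

open Complex Metric
open scoped InnerProductSpace ENNReal Real ComplexConjugate
variable {J : JacobiMatrix} {c t x C : ℝ} {w z ξ : ℂ} {f u v : ℝ → ℝ} {F : ℂ → ℂ}

lemma norm_ofReal (r : ℝ) : ‖(r : ℂ)‖ = |r| := norm_real r

lemma ne_zero_of_im (hz : z.im ≠ 0) : z ≠ 0 := by rintro rfl; exact hz rfl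

lemma im_inv_ne_zero (hz : z.im ≠ 0) : z⁻¹.im ≠ 0 := by
  rw [inv_im]; exact div_ne_zero (neg_ne_zero.2 hz) (normSq_pos.2 (ne_zero_of_im hz)).ne'

lemma LinearMap.IsSymmetric.eq_zero_of_nonreal_eigen {E : Type*} [NormedAddCommGroup E]
    [InnerProductSpace ℂ E] {T : E →ₗ[ℂ] E} (hT : T.IsSymmetric) (hw : w.im ≠ 0) {u : E}
    (hu : T u = w • u) : u = 0 := by
  by_contra h
  have := hT.conj_eigenvalue_eq_self (Module.End.hasEigenvalue_of_hasEigenvector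
    (Module.End.hasEigenvector_iff.2 ⟨Module.End.mem_eigenspace_iff.2 hu, h⟩))
  exact hw (conj_eq_iff_im.1 this)

section Spectral

variable {E : Type*} [NormedAddCommGroup E] [InnerProductSpace ℂ E] [CompleteSpace E]

/-- The quadratic form `f ↦ re ⟪e, f(T) e⟫` of the continuous functional calculus. -/
def spectralFunctional (T : E →L[ℂ] E) (hT : IsSelfAdjoint T) (e : E) :
    CompactlySupportedContinuousMap (spectrum ℝ T) ℝ →ₚ[ℝ] ℝ :=
  PositiveLinearMap.mk₀
    { toFun := fun f => (⟪e, cfcHom (R := ℝ) hT (f : C(spectrum ℝ T, ℝ)) e⟫_ℂ).re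
      map_add' := fun f g => by
        have : ((f + g : CompactlySupportedContinuousMap (spectrum ℝ T) ℝ) : C(spectrum ℝ T, ℝ))
          = (f : C(spectrum ℝ T, ℝ)) + g := by ext; rfl
        rw [this, map_add]; simp
      map_smul' := fun c f => by
        have : ((c • f : CompactlySupportedContinuousMap (spectrum ℝ T) ℝ) : C(spectrum ℝ T, ℝ))
          = c • (f : C(spectrum ℝ T, ℝ)) := by ext; rfl
        rw [this, map_smul]; simp }
    (fun f hf => by
      have h0 : (0 : C(spectrum ℝ T, ℝ)) ≤ (f : C(spectrum ℝ T, ℝ)) := fun x => hf x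
      have h1 := (cfcHom_nonneg_iff (R := ℝ) hT).2 h0
      rw [ContinuousLinearMap.nonneg_iff_isPositive] at h1; exact h1.re_inner_nonneg_right e)

lemma exists_spectral_measure (T : E →L[ℂ] E) (hT : IsSelfAdjoint T) (e : E) :
    ∃ ρ : Measure ℝ, IsFiniteMeasure ρ ∧ (∃ K : ℝ, ρ (Icc (-K) K)ᶜ = 0) ∧ ∀ w : ℂ, w.im ≠ 0 → ∃ u : E, T u - w • u = e ∧
        ⟪e, u⟫_ℂ = ∫ τ : ℝ, 1 / (τ - w) ∂ρ := by
  set ν := RealRMK.rieszMeasure (spectralFunctional T hT e) with hν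
  have hint : ∀ f : C(spectrum ℝ T, ℝ), ∫ x, f x ∂ν = (⟪e, cfcHom (R := ℝ) hT f e⟫_ℂ).re := by
    intro f
    exact RealRMK.integral_rieszMeasure (spectralFunctional T hT e)
      (CompactlySupportedContinuousMap.continuousMapEquiv f)
  have hsymm : ∀ f : C(spectrum ℝ T, ℝ), (⟪e, cfcHom (R := ℝ) hT f e⟫_ℂ).im = 0 := by
    intro f
    have h1 : IsSelfAdjoint (cfcHom (R := ℝ) hT f) := cfcHom_predicate hT f
    have h3 := (ContinuousLinearMap.isSelfAdjoint_iff_isSymmetric.1 h1) e e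
    simp only [ContinuousLinearMap.coe_coe] at h3
    have h4 := congrArg im (inner_conj_symm (𝕜 := ℂ) e (cfcHom (R := ℝ) hT f e))
    rw [h3, conj_im] at h4; linarith
  have hval : ∀ f : C(spectrum ℝ T, ℝ), ⟪e, cfcHom (R := ℝ) hT f e⟫_ℂ = ((∫ x, f x ∂ν : ℝ) : ℂ) := fun f =>
    Complex.ext (by simp [hint]) (by simp [hsymm])
  have hcpt : CompactSpace (spectrum ℝ T) := isCompact_iff_compactSpace.1 (spectrum.isCompact T)
  have hfin : IsFiniteMeasure ν := CompactSpace.isFiniteMeasure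
  refine ⟨ν.map Subtype.val, inferInstance, ?_, fun w hw => ?_⟩
  · obtain ⟨K, hK⟩ := (spectrum.isCompact (𝕜 := ℝ) T).isBounded.subset_closedBall 0
    refine ⟨K, ?_⟩
    rw [Measure.map_apply measurable_subtype_coe measurableSet_Icc.compl]
    convert measure_empty (μ := ν)
    ext x
    have := hK x.2
    rw [mem_closedBall, Real.dist_eq, sub_zero, abs_le] at this; simp [this.1, this.2]
  · have hD : ∀ τ : ℝ, (τ - w.re) ^ 2 + w.im ^ 2 ≠ 0 := fun τ => by positivity
    let X : C(spectrum ℝ T, ℝ) := (ContinuousMap.id ℝ).restrict (spectrum ℝ T)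
    let r : C(spectrum ℝ T, ℝ) :=
      ⟨fun τ => (τ - w.re) / ((τ - w.re) ^ 2 + w.im ^ 2), by
        refine Continuous.div (by fun_prop) (by fun_prop) fun τ => hD _⟩
    let s : C(spectrum ℝ T, ℝ) :=
      ⟨fun τ => w.im / ((τ - w.re) ^ 2 + w.im ^ 2), by refine Continuous.div (by fun_prop) (by fun_prop) fun τ => hD _⟩
    have hX : cfcHom (R := ℝ) hT X = T := cfcHom_id hT
    have hTf : ∀ (f : C(spectrum ℝ T, ℝ)) (v : E),
        T (cfcHom (R := ℝ) hT f v) = cfcHom (R := ℝ) hT (X * f) v := by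
      intro f v; rw [map_mul, hX]; rfl
    have e1 : X * r = 1 + w.re • r - w.im • s := by
      ext τ
      have := hD τ
      simp only [X, r, s, ContinuousMap.mul_apply, ContinuousMap.sub_apply, ContinuousMap.add_apply,
        ContinuousMap.one_apply, ContinuousMap.smul_apply, ContinuousMap.coe_mk, smul_eq_mul,
        ContinuousMap.restrict_apply, ContinuousMap.id_apply]
      field_simp; ring
    have e2 : X * s = w.re • s + w.im • r := by
      ext τ
      have := hD τ
      simp only [X, r, s, ContinuousMap.mul_apply, ContinuousMap.add_apply,
        ContinuousMap.smul_apply, ContinuousMap.coe_mk, smul_eq_mul,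
        ContinuousMap.restrict_apply, ContinuousMap.id_apply]
      field_simp; ring
    have hri : Integrable (fun x => (r x : ℂ)) ν :=
      (r.continuous.integrable_of_hasCompactSupport (HasCompactSupport.of_compactSpace _)).ofReal
    have hsi : Integrable (fun x => (s x : ℂ)) ν :=
      (s.continuous.integrable_of_hasCompactSupport (HasCompactSupport.of_compactSpace _)).ofReal
    refine ⟨cfcHom (R := ℝ) hT r e + I • cfcHom (R := ℝ) hT s e, ?_, ?_⟩
    · rw [map_add, map_smul, hTf, hTf, e1, e2]
      simp only [map_add, map_sub, map_smul, map_one, add_apply, sub_apply, smul_apply, one_apply_eq_self]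
      have : w = (w.re : ℂ) + w.im * I := (re_add_im w).symm
      nth_rw 5 [this]
      simp only [← coe_smul]
      match_scalars
      · ring
      · ring
      · linear_combination (-(w.im : ℂ)) * I_mul_I
    · rw [inner_add_right, inner_smul_right, hval, hval, ← integral_complex_ofReal,
        ← integral_complex_ofReal, ← integral_const_mul, ← integral_add hri (hsi.const_mul _),
        integral_map measurable_subtype_coe.aemeasurable]
      · refine integral_congr_ae (.of_forall fun x => ?_)
        have h0 := hD x
        have h1 : (((x:ℝ) : ℂ) - w) ≠ 0 := by intro h; apply hw; have := congrArg im h; simpa using this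
        have h2 : (((x : ℝ) : ℂ) - w.re) ^ 2 + (w.im : ℂ) ^ 2 ≠ 0 := by exact_mod_cast h0
        have h3 : w = (w.re : ℂ) + w.im * I := (re_add_im w).symm
        simp only [r, s, ContinuousMap.coe_mk]; push_cast; rw [eq_div_iff h1]; field_simp
        linear_combination (-((x : ℝ) - w.re + I * w.im : ℂ)) * h3 - (w.im : ℂ) ^ 2 * I_sq
      · exact Measurable.aestronglyMeasurable (by fun_prop)

end Spectral

/-- The Hilbert space of square-summable sequences. -/
abbrev ellTwo : Type := lp (fun _ : ℕ => ℂ) 2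

lemma memℓp_two_iff (u : ℕ → ℂ) :
    Memℓp (E := fun _ : ℕ => ℂ) u 2 ↔ Summable fun n => ‖u n‖ ^ 2 := by
  rw [memℓp_gen_iff (by norm_num)]; simp

lemma ellTwo_norm_sq (u : ellTwo) : ‖u‖ ^ 2 = ∑' n, ‖u n‖ ^ 2 := by
  have := lp.norm_rpow_eq_tsum (p := 2) (by norm_num) u
  simpa using this

lemma ellTwo_summable (u : ellTwo) : Summable fun n => ‖u n‖ ^ 2 := (memℓp_two_iff _).1 (lp.memℓp u)

/-- The tridiagonal map on sequences with diagonal `α` and off-diagonal `β`. -/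
def tridiag (α β : ℕ → ℝ) (u : ℕ → ℂ) : ℕ → ℂ
  | 0 => α 0 * u 0 + β 0 * u 1
  | n + 1 => β n * u n + α (n + 1) * u (n + 1) + β (n + 1) * u (n + 2)

lemma tridiag_add (α β : ℕ → ℝ) (u v : ℕ → ℂ) (n : ℕ) :
    tridiag α β (u + v) n = tridiag α β u n + tridiag α β v n := by
  cases n <;> simp [tridiag] <;> ring

lemma tridiag_smul (α β : ℕ → ℝ) (c : ℂ) (u : ℕ → ℂ) (n : ℕ) :
    tridiag α β (c • u) n = c * tridiag α β u n := by
  cases n <;> simp [tridiag] <;> ring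

lemma norm_tridiag_sq_le {α β : ℕ → ℝ} {K : ℝ} (hα : ∀ n, |α n| ≤ K) (hβ : ∀ n, |β n| ≤ K)
    (u : ℕ → ℂ) (n : ℕ) : ‖tridiag α β u n‖ ^ 2 ≤
      3 * K ^ 2 * (‖u (n - 1)‖ ^ 2 + ‖u n‖ ^ 2 + ‖u (n + 1)‖ ^ 2) := by
  have hK : 0 ≤ K := (abs_nonneg _).trans (hα 0)
  have key : ∀ x y z : ℂ, ∀ p q r : ℝ, |p| ≤ K → |q| ≤ K → |r| ≤ K →
      ‖p * x + q * y + r * z‖ ^ 2 ≤ 3 * K ^ 2 * (‖x‖ ^ 2 + ‖y‖ ^ 2 + ‖z‖ ^ 2) := by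
    intro x y z p q r hp hq hr
    have h1 : ‖(p * x + q * y + r * z : ℂ)‖ ≤ K * (‖x‖ + ‖y‖ + ‖z‖) := by
      refine (norm_add₃_le).trans ?_
      simp only [norm_mul, norm_ofReal]
      have := mul_le_mul_of_nonneg_right hp (norm_nonneg x)
      have := mul_le_mul_of_nonneg_right hq (norm_nonneg y)
      linarith [mul_le_mul_of_nonneg_right hr (norm_nonneg z)]
    calc _ ≤ (K * (‖x‖ + ‖y‖ + ‖z‖)) ^ 2 := by gcongr
      _ ≤ _ := by
        rw [mul_pow]
        have : (‖x‖ + ‖y‖ + ‖z‖) ^ 2 ≤ 3 * (‖x‖ ^ 2 + ‖y‖ ^ 2 + ‖z‖ ^ 2) := by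
          nlinarith [sq_nonneg (‖x‖ - ‖y‖), sq_nonneg (‖y‖ - ‖z‖), sq_nonneg (‖x‖ - ‖z‖)]
        nlinarith [sq_nonneg K]
  cases n with
  | zero => simpa [tridiag] using key (u 0) (u 0) (u 1) 0 (α 0) (β 0) (by simpa using hK) (hα 0) (hβ 0)
  | succ n => simpa [tridiag] using key (u n) (u (n + 1)) (u (n + 2)) _ _ _ (hβ n) (hα _) (hβ _)

lemma summable_three {f : ℕ → ℝ} (hf0 : ∀ n, 0 ≤ f n) (hf : Summable f) :
    Summable (fun n => f (n - 1) + f n + f (n + 1)) ∧ ∑' n, (f (n - 1) + f n + f (n + 1)) ≤ 4 * ∑' n, f n := by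
  have h1 : Summable fun n => f (n + 1) := (summable_nat_add_iff 1).2 hf
  have h2 : Summable fun n => f (n - 1) := (summable_nat_add_iff 1).1 (by simpa using hf)
  refine ⟨(h2.add hf).add h1, ?_⟩
  rw [(h2.add hf).tsum_add h1, h2.tsum_add hf, h2.tsum_eq_zero_add]
  have e1 := hf.tsum_eq_zero_add
  have := hf.le_tsum 0 fun j _ => hf0 j
  have := hf0 0
  simp only [Nat.add_sub_cancel, zero_tsub]; linarith

/-- The half-infinite Jacobi matrix with diagonal `α` and off-diagonal `β` as an operator. -/
def halfLine (α β : ℕ → ℝ) {K : ℝ} (hα : ∀ n, |α n| ≤ K) (hβ : ∀ n, |β n| ≤ K) :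
    ellTwo →L[ℂ] ellTwo :=
  LinearMap.mkContinuous
    { toFun := fun u => ⟨tridiag α β u, (memℓp_two_iff _).2
        (((summable_three (fun _ => by positivity) (ellTwo_summable u)).1.mul_left
          (3 * K ^ 2)).of_nonneg_of_le (fun _ => by positivity)
          fun n => norm_tridiag_sq_le hα hβ u n)⟩
      map_add' := fun u v => lp.ext (funext fun n => tridiag_add α β u v n)
      map_smul' := fun c u => lp.ext (funext fun n => tridiag_smul α β c u n) }
    (√(12 * K ^ 2)) fun u => by
      have hs := summable_three (fun _ => by positivity) (ellTwo_summable u)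
      rw [← Real.sqrt_sq (norm_nonneg u), ← Real.sqrt_mul (by positivity)]
      refine Real.le_sqrt_of_sq_le ?_
      rw [ellTwo_norm_sq, ellTwo_norm_sq]
      calc _ ≤ ∑' n, 3 * K ^ 2 * (‖u (n - 1)‖ ^ 2 + ‖u n‖ ^ 2 + ‖u (n + 1)‖ ^ 2) := by
            refine Summable.tsum_le_tsum (fun n => norm_tridiag_sq_le hα hβ u n) ?_ (hs.1.mul_left _)
            exact (hs.1.mul_left _).of_nonneg_of_le (fun _ => by positivity) fun n => norm_tridiag_sq_le hα hβ u n
        _ ≤ _ := by rw [tsum_mul_left]; nlinarith [hs.2, sq_nonneg K]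

variable {α β : ℕ → ℝ} {K : ℝ} (hα : ∀ n, |α n| ≤ K) (hβ : ∀ n, |β n| ≤ K)

lemma halfLine_apply (u : ellTwo) (n : ℕ) : halfLine α β hα hβ u n = tridiag α β u n := rfl

lemma isSelfAdjoint_halfLine : IsSelfAdjoint (halfLine α β hα hβ) := by
  rw [ContinuousLinearMap.isSelfAdjoint_iff_isSymmetric]; intro u v; simp only [ContinuousLinearMap.coe_coe]
  have s1 := lp.summable_inner (𝕜 := ℂ) (halfLine α β hα hβ u) v
  have s2 := lp.summable_inner (𝕜 := ℂ) u (halfLine α β hα hβ v)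
  rw [lp.inner_eq_tsum, lp.inner_eq_tsum, ← sub_eq_zero, ← s1.tsum_sub s2]
  have hsum : ∀ N : ℕ, ∑ n ∈ Finset.range (N + 1),
      (inner ℂ (halfLine α β hα hβ u n) (v n) - inner ℂ (u n) (halfLine α β hα hβ v n)) =
        β N * (conj (u (N + 1)) * v N - conj (u N) * v (N + 1)) := by
    intro N
    induction N with
    | zero => simp [halfLine_apply, tridiag]; ring
    | succ N ih => rw [Finset.sum_range_succ, ih]; simp [halfLine_apply, tridiag]; ring
  have hl := ((s1.sub s2).hasSum.tendsto_sum_nat).comp (tendsto_add_atTop_nat 1)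
  refine tendsto_nhds_unique hl ?_
  simp only [Function.comp_def, hsum]
  have hz : ∀ w : ellTwo, Tendsto (fun n => ‖w n‖) atTop (𝓝 0) := by
    intro w
    have := (ellTwo_summable w).tendsto_atTop_zero
    have h2 := (Real.continuous_sqrt.tendsto 0).comp this
    simpa [Function.comp_def] using h2
  rw [tendsto_zero_iff_norm_tendsto_zero]
  have hb : Tendsto (fun N => K * (‖u (N + 1)‖ * ‖v N‖ + ‖u N‖ * ‖v (N + 1)‖)) atTop (𝓝 0) := by
    have hu := (hz u).comp (tendsto_add_atTop_nat 1)
    have hv := (hz v).comp (tendsto_add_atTop_nat 1)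
    simpa using ((hu.mul (hz v)).add ((hz u).mul hv)).const_mul K
  refine squeeze_zero (fun _ => norm_nonneg _) (fun N => ?_) hb
  rw [norm_mul, norm_ofReal]
  refine mul_le_mul (hβ N) ?_ (norm_nonneg _) ((abs_nonneg _).trans (hβ N))
  refine (norm_sub_le _ _).trans ?_
  simp

lemma eq_of_tridiag_eq (hβ0 : ∀ n, β n ≠ 0) {u v : ℕ → ℂ}
    (h : ∀ n, tridiag α β u n - w * u n = tridiag α β v n - w * v n) (h0 : u 0 = v 0) : u = v := by
  have key : ∀ n, u n = v n ∧ u (n + 1) = v (n + 1) := by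
    intro n
    induction n with
    | zero =>
      refine ⟨h0, ?_⟩
      have := h 0
      simp only [tridiag, h0] at this
      refine mul_left_cancel₀ (ofReal_ne_zero.2 (hβ0 0)) ?_
      linear_combination this
    | succ n ih =>
      refine ⟨ih.2, ?_⟩
      have := h (n + 1)
      simp only [tridiag, ih.1, ih.2] at this
      refine mul_left_cancel₀ (ofReal_ne_zero.2 (hβ0 (n + 1))) ?_
      linear_combination this
  exact funext fun n => (key n).1

/-- The Weyl function `⟪e₀, (T - w)⁻¹ e₀⟫` of a half-infinite Jacobi matrix, as the Stieltjes
transform of a compactly supported measure, together with its characterisation by square-summable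
solutions. -/
lemma exists_weyl_measure (hα : ∀ n, |α n| ≤ K) (hβ : ∀ n, |β n| ≤ K) (hβ0 : ∀ n, β n ≠ 0) :
    ∃ ρ : Measure ℝ, IsFiniteMeasure ρ ∧ (∃ K : ℝ, ρ (Icc (-K) K)ᶜ = 0) ∧ ∀ w : ℂ, w.im ≠ 0 → ∀ (u : ℕ → ℂ) (c : ℂ),
        (∀ n, tridiag α β u n - w * u n = if n = 0 then c else 0) →
        ((Summable fun n => ‖u n‖ ^ 2) ↔ u 0 = c * ∫ τ : ℝ, 1 / (τ - w) ∂ρ) := by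
  set T := halfLine α β hα hβ with hT
  have hsa : IsSelfAdjoint T := isSelfAdjoint_halfLine hα hβ
  set e : ellTwo := lp.single 2 0 (1 : ℂ) with he
  have he_apply : ∀ n, e n = if n = 0 then 1 else 0 := by
    intro n
    by_cases hn : n = 0
    · subst hn; simp [he]
    · simp [he, hn]
  obtain ⟨ρ, h1, h2, h3⟩ := exists_spectral_measure T hsa e
  refine ⟨ρ, h1, h2, fun w hw u c hu => ?_⟩
  obtain ⟨v, hv, hv0⟩ := h3 w hw
  have hv0' : v 0 = ∫ τ : ℝ, 1 / (τ - w) ∂ρ := by rw [← hv0, he, lp.inner_single_left]; simp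
  have hvn : ∀ n, tridiag α β (c • (v : ℕ → ℂ)) n - w * (c • (v : ℕ → ℂ)) n = if n = 0 then c else 0 := by
    intro n
    have := congrArg (fun x : ellTwo => (x : ℕ → ℂ) n) hv
    simp only [lp.coeFn_sub, lp.coeFn_smul, Pi.sub_apply, Pi.smul_apply, smul_eq_mul, he_apply,
      hT, halfLine_apply] at this
    rw [tridiag_smul, Pi.smul_apply, smul_eq_mul]
    by_cases hn : n = 0
    · simp only [hn, if_true] at this ⊢; linear_combination c * this
    · simp only [hn, if_false] at this ⊢; linear_combination c * this
  constructor
  · intro hs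
    let U : ellTwo := ⟨u, (memℓp_two_iff _).2 hs⟩
    have hz : U - c • v = 0 := by
      refine LinearMap.IsSymmetric.eq_zero_of_nonreal_eigen
        (ContinuousLinearMap.isSelfAdjoint_iff_isSymmetric.1 hsa) hw ?_
      have hU : T U - w • U = c • e := by
        refine lp.ext (funext fun n => ?_)
        have := hu n
        simp only [lp.coeFn_sub, lp.coeFn_smul, Pi.sub_apply, Pi.smul_apply, smul_eq_mul, he_apply, hT, halfLine_apply]
        rw [mul_ite, mul_one, mul_zero]; exact this
      simp only [ContinuousLinearMap.coe_coe, map_sub, map_smul]; rw [sub_eq_iff_eq_add] at hU hv; rw [hU, hv]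
      module
    have := congrArg (fun x : ellTwo => (x : ℕ → ℂ) 0) hz
    simp only [lp.coeFn_sub, lp.coeFn_smul, Pi.sub_apply, Pi.smul_apply, smul_eq_mul, hv0',
      lp.coeFn_zero, Pi.zero_apply] at this
    exact sub_eq_zero.1 this
  · intro h0
    have : u = c • (v : ℕ → ℂ) := eq_of_tridiag_eq hβ0 (fun n => by rw [hu, hvn]) (by
      rw [h0, Pi.smul_apply, smul_eq_mul, hv0'])
    rw [this]; exact ellTwo_summable (c • v)

namespace JacobiMatrix

variable (J : JacobiMatrix)

lemma forward_fst (w : ℂ) (init : ℂ × ℂ) (n : ℕ) : (J.forward w init n).1 = J.solution w init ((n : ℤ) - 1) := by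
  cases n with
  | zero => rfl
  | succ n =>
    have : ((n + 1 : ℕ) : ℤ) - 1 = Int.ofNat n := by simp
    rw [this]; rfl

lemma backward_snd (w : ℂ) (init : ℂ × ℂ) (n : ℕ) : (J.backward w init n).2 = J.solution w init (-(n : ℤ)) := by
  cases n with
  | zero => rfl
  | succ n => rfl

lemma solution_rec (w : ℂ) (init : ℂ × ℂ) (k : ℤ) :
    J.b (k - 1) * J.solution w init (k - 1) + (J.a k - w) * J.solution w init k
      + J.b k * J.solution w init (k + 1) = 0 := by
  have hb : ∀ j, (J.b j : ℂ) ≠ 0 := fun j => ofReal_ne_zero.2 (J.b_ne_zero j)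
  rcases le_or_gt 0 k with hk | hk
  · lift k to ℕ using hk
    have e1 : J.solution w init ((k : ℤ) + 1) = (J.forward w init (k + 1)).2 := rfl
    have e2 : J.solution w init (k : ℤ) = (J.forward w init k).2 := rfl
    rw [e1, e2, ← forward_fst, forward]; field_simp [hb k]; ring
  · obtain ⟨n, rfl⟩ : ∃ n : ℕ, k = -1 - n := ⟨(-1 - k).toNat, by omega⟩
    have e1 : J.solution w init (-1 - (n : ℤ) - 1) = (J.backward w init (n + 1)).1 := by
      have : -1 - (n : ℤ) - 1 = Int.negSucc (n + 1) := by omega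
      rw [this]; rfl
    have e2 : J.solution w init (-1 - (n : ℤ)) = (J.backward w init n).1 := by
      have : -1 - (n : ℤ) = Int.negSucc n := by omega
      rw [this]; rfl
    have e3 : -1 - (n : ℤ) + 1 = -n := by ring
    have e4 : -1 - (n : ℤ) - 1 = -2 - n := by ring
    rw [e3, e1, e2, ← backward_snd, backward, e4]; field_simp [hb (-2 - n)]; ring

lemma P_rec (w : ℂ) (k : ℤ) : J.b (k - 1) * J.P (k - 1) w + (J.a k - w) * J.P k w + J.b k * J.P (k + 1) w = 0 :=
  J.solution_rec w _ k

lemma Q_rec (w : ℂ) (k : ℤ) : J.b (k - 1) * J.Q (k - 1) w + (J.a k - w) * J.Q k w + J.b k * J.Q (k + 1) w = 0 :=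
  J.solution_rec w _ k

end JacobiMatrix

/-- The Stieltjes transform `w ↦ ∫ dρ(τ) / (τ - w)`. -/
def stieltjes (ρ : Measure ℝ) (w : ℂ) : ℂ := ∫ τ : ℝ, 1 / (τ - w) ∂ρ

lemma ofReal_sub_ne_zero (hw : w.im ≠ 0) (τ : ℝ) : (τ : ℂ) - w ≠ 0 := by
  intro h; apply hw; have := congrArg im h; simpa using this

lemma abs_im_le_norm_ofReal_sub (w : ℂ) (τ : ℝ) : |w.im| ≤ ‖(τ : ℂ) - w‖ := by
  have := abs_im_le_norm (τ - w)
  simpa using this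

lemma continuous_cauchyKernel (hw : w.im ≠ 0) :
    Continuous fun τ : ℝ => 1 / (τ - w) :=
  continuous_const.div (by fun_prop) (ofReal_sub_ne_zero hw)

lemma norm_cauchyKernel_le (hw : w.im ≠ 0) (τ : ℝ) : ‖1 / (τ - w)‖ ≤ 1 / |w.im| := by
  rw [norm_div, norm_one]; exact one_div_le_one_div_of_le (abs_pos.2 hw) (abs_im_le_norm_ofReal_sub w τ)

lemma integrable_cauchyKernel (ρ : Measure ℝ) [IsFiniteMeasure ρ] (hw : w.im ≠ 0) :
    Integrable (fun τ : ℝ => 1 / (τ - w)) ρ :=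
  Integrable.of_bound (continuous_cauchyKernel hw).aestronglyMeasurable (1 / |w.im|)
    (.of_forall (norm_cauchyKernel_le hw))

lemma im_cauchyKernel (w : ℂ) (τ : ℝ) : (1 / (τ - w)).im = w.im / ((τ - w.re) ^ 2 + w.im ^ 2) := by
  rw [one_div, inv_im, normSq_apply]; simp; ring

lemma im_stieltjes (ρ : Measure ℝ) [IsFiniteMeasure ρ] (hw : w.im ≠ 0) :
    (stieltjes ρ w).im = ∫ τ : ℝ, w.im / ((τ - w.re) ^ 2 + w.im ^ 2) ∂ρ := by
  rw [stieltjes, ← imCLM_apply, ← ContinuousLinearMap.integral_comp_comm _ (integrable_cauchyKernel ρ hw)]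
  exact integral_congr_ae (.of_forall fun τ => im_cauchyKernel w τ)

lemma im_stieltjes_nonneg (ρ : Measure ℝ) [IsFiniteMeasure ρ] (hw : 0 < w.im) :
    0 ≤ (stieltjes ρ w).im := by
  rw [im_stieltjes ρ hw.ne']; exact integral_nonneg fun τ => by positivity

lemma stieltjes_conj (ρ : Measure ℝ) (w : ℂ) :
    stieltjes ρ (conj w) = conj (stieltjes ρ w) := by
  rw [stieltjes, stieltjes, ← integral_conj]; exact integral_congr_ae (.of_forall fun τ => by simp)

lemma stieltjes_smul (ρ : Measure ℝ) (hc : 0 ≤ c) (w : ℂ) :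
    stieltjes (ENNReal.ofReal c • ρ) w = c * stieltjes ρ w := by
  rw [stieltjes, integral_smul_measure, ENNReal.toReal_ofReal hc, stieltjes, real_smul]

lemma hasDerivAt_stieltjes (ρ : Measure ℝ) [IsFiniteMeasure ρ] (hw : ∀ x ∈ ρ.support, w ≠ (x : ℂ)) :
    HasDerivAt (stieltjes ρ) (∫ τ : ℝ, 1 / (τ - w) ^ 2 ∂ρ) w := by
  have h := hasDerivAt_resolventTransform (𝕜 := ℝ) (A := ℂ) (μ := ρ) (a := w) (by
    rintro ⟨x, hx, rfl⟩; exact hw x hx rfl)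
  have e1 : stieltjes ρ = resolventTransform ρ := by
    funext z; rw [resolventTransform_apply, stieltjes]
    exact integral_congr_ae (.of_forall fun τ => by simp [resolvent])
  have e2 : ∫ τ : ℝ, 1 / (τ - w) ^ 2 ∂ρ = ∫ x : ℝ, resolvent w x ^ 2 ∂ρ :=
    integral_congr_ae (.of_forall fun τ => by simp [resolvent])
  rw [e1, e2]; exact h

lemma stieltjes_ofReal_im (ρ : Measure ℝ) (x : ℝ) : (stieltjes ρ x).im = 0 := by
  have := stieltjes_conj ρ x
  rw [conj_ofReal] at this; exact conj_eq_iff_im.1 this.symm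

lemma integral_poisson (s t τ : ℝ) {ε : ℝ} (hε : 0 < ε) :
    ∫ x in s..t, ε / ((τ - x) ^ 2 + ε ^ 2) = Real.arctan ((t - τ) / ε) - Real.arctan ((s - τ) / ε) := by
  refine intervalIntegral.integral_eq_sub_of_hasDerivAt (f := fun x => Real.arctan ((x - τ) / ε)) (fun x _ => ?_) ?_
  · have h1 : HasDerivAt (fun x : ℝ => (x - τ) / ε) (1 / ε) x := ((hasDerivAt_id x).sub_const τ).div_const ε
    refine h1.arctan.congr_deriv ?_
    have : (0:ℝ) < (τ - x) ^ 2 + ε ^ 2 := by positivity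
    have : (0:ℝ) < ε ^ 2 + (x - τ) ^ 2 := by positivity
    field_simp; ring
  · apply Continuous.intervalIntegrable; exact continuous_const.div (by fun_prop) fun x => by positivity

lemma tendsto_arctan_div (u : ℝ) : Tendsto (fun ε : ℝ => Real.arctan (u / ε)) (𝓝[>] 0) (𝓝 (Real.sign u * (π / 2))) := by
  rcases lt_trichotomy u 0 with h | h | h
  · rw [Real.sign_of_neg h, neg_one_mul]
    refine (tendsto_nhds_of_tendsto_nhdsWithin Real.tendsto_arctan_atBot).comp ?_
    exact (tendsto_inv_nhdsGT_zero (𝕜 := ℝ)).const_mul_atTop_of_neg h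
  · simp [h]
  · rw [Real.sign_of_pos h, one_mul]
    refine (tendsto_nhds_of_tendsto_nhdsWithin Real.tendsto_arctan_atTop).comp ?_
    exact (tendsto_inv_nhdsGT_zero (𝕜 := ℝ)).const_mul_atTop h

/-- The Stieltjes inversion formula. -/
lemma stieltjes_inversion (ρ : Measure ℝ) [IsFiniteMeasure ρ] {s t : ℝ} (hst : s < t) :
    Tendsto (fun ε : ℝ => ∫ x in s..t, (stieltjes ρ (x + ε * I)).im) (𝓝[>] 0)
      (𝓝 (π / 2 * (ρ.real (Ioo s t) + ρ.real (Icc s t)))) := by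
  have h1 : ∀ ε : ℝ, 0 < ε → ∫ x in s..t, (stieltjes ρ (x + ε * I)).im =
      ∫ τ, (Real.arctan ((t - τ) / ε) - Real.arctan ((s - τ) / ε)) ∂ρ := by
    intro ε hε
    have h2 : ∀ x : ℝ, (stieltjes ρ (x + ε * I)).im = ∫ τ, ε / ((τ - x) ^ 2 + ε ^ 2) ∂ρ := fun x => by
      rw [im_stieltjes ρ (by simpa using hε.ne')]; simp
    simp only [h2]; rw [intervalIntegral.integral_of_le hst.le, integral_integral_swap]
    · refine integral_congr_ae (.of_forall fun τ => ?_)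
      simp only; rw [← integral_poisson s t τ hε, intervalIntegral.integral_of_le hst.le]
    · have hc : Continuous fun p : ℝ × ℝ => ε / ((p.2 - p.1) ^ 2 + ε ^ 2) :=
        continuous_const.div (by fun_prop) fun x => by positivity
      refine Integrable.of_bound hc.aestronglyMeasurable (1 / ε) (.of_forall fun p => ?_)
      have : (0:ℝ) < (p.2 - p.1) ^ 2 + ε ^ 2 := by positivity
      rw [Function.uncurry_apply_pair, Real.norm_of_nonneg (by positivity), div_le_div_iff₀ this hε]
      nlinarith [sq_nonneg (p.2 - p.1)]
  have h3 : Tendsto (fun ε : ℝ => ∫ τ, (Real.arctan ((t - τ) / ε) - Real.arctan ((s - τ) / ε)) ∂ρ)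
      (𝓝[>] 0) (𝓝 (∫ τ, (Real.sign (t - τ) * (π / 2) - Real.sign (s - τ) * (π / 2)) ∂ρ)) := by
    refine tendsto_integral_filter_of_dominated_convergence (fun _ => π) ?_ ?_ (integrable_const _) ?_
    · refine .of_forall fun ε => Measurable.aestronglyMeasurable ?_
      fun_prop
    · refine .of_forall fun ε => .of_forall fun τ => ?_
      rw [Real.norm_eq_abs, abs_le]
      constructor <;>
      linarith [Real.arctan_lt_pi_div_two ((t - τ) / ε), Real.arctan_lt_pi_div_two ((s - τ) / ε),
        Real.neg_pi_div_two_lt_arctan ((t - τ) / ε), Real.neg_pi_div_two_lt_arctan ((s - τ) / ε)]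
    · exact .of_forall fun τ => (tendsto_arctan_div _).sub (tendsto_arctan_div _)
  have h4 : ∫ τ, (Real.sign (t - τ) * (π / 2) - Real.sign (s - τ) * (π / 2)) ∂ρ =
      π / 2 * (ρ.real (Ioo s t) + ρ.real (Icc s t)) := by
    have : ∀ τ, Real.sign (t - τ) * (π / 2) - Real.sign (s - τ) * (π / 2) =
        π / 2 * ((Ioo s t).indicator 1 τ + (Icc s t).indicator 1 τ) := by
      intro τ; simp only [indicator_apply, mem_Ioo, mem_Icc, Pi.one_apply]
      rcases lt_trichotomy τ s with h | h | h
      · rw [Real.sign_of_pos (by linarith), Real.sign_of_pos (by linarith), if_neg (by grind), if_neg (by grind)]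
        ring
      · rw [Real.sign_of_pos (by linarith), h, sub_self, Real.sign_zero, if_neg (by grind), if_pos (by grind)]
        ring
      · rw [Real.sign_of_neg (by linarith : s - τ < 0)]
        rcases lt_trichotomy τ t with h' | h' | h'
        · rw [Real.sign_of_pos (by linarith), if_pos (by grind), if_pos (by grind)]; ring
        · rw [h', sub_self, Real.sign_zero, if_neg (by grind), if_pos (by grind)]; ring
        · rw [Real.sign_of_neg (by linarith), if_neg (by grind), if_neg (by grind)]; ring
    simp only [this]
    rw [integral_const_mul, integral_add, integral_indicator_one measurableSet_Ioo,
      integral_indicator_one measurableSet_Icc]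
    · exact (integrable_indicator_iff measurableSet_Ioo).2 (integrable_const (1:ℝ)).integrableOn
    · exact (integrable_indicator_iff measurableSet_Icc).2 (integrable_const (1:ℝ)).integrableOn
  rw [h4] at h3
  refine h3.congr' ?_
  filter_upwards [self_mem_nhdsWithin] with ε hε using (h1 ε hε).symm

lemma continuous_im_stieltjes (ρ : Measure ℝ) [IsFiniteMeasure ρ] {ε : ℝ} (hε : 0 < ε) :
    Continuous fun x : ℝ => (stieltjes ρ (x + ε * I)).im := by
  refine continuous_im.comp (continuous_iff_continuousAt.2 fun x => ?_)
  have h : ContinuousAt (stieltjes ρ) (x + ε * I) := (hasDerivAt_stieltjes ρ fun y _ hy => by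
    have := congrArg im hy
    simp at this; exact hε.ne' this).continuousAt
  exact ContinuousAt.comp (f := fun x : ℝ => (x + ε * I : ℂ)) h (by fun_prop)

/-- If the imaginary part of the Stieltjes transform is bounded near `[s, t]` and tends to zero
there, the measure does not charge `[s, t]`. -/
lemma measure_Icc_eq_zero (ρ : Measure ℝ) [IsFiniteMeasure ρ] {s t B : ℝ} (hst : s < t)
    (hB : ∀ᶠ ε : ℝ in 𝓝[>] 0, ∀ x ∈ Icc s t, |(stieltjes ρ (x + ε * I)).im| ≤ B)
    (h0 : ∀ x ∈ Icc s t, Tendsto (fun ε : ℝ => (stieltjes ρ (x + ε * I)).im) (𝓝[>] 0) (𝓝 0)) :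
    ρ (Icc s t) = 0 := by
  have h1 : Tendsto (fun ε : ℝ => ∫ x in s..t, (stieltjes ρ (x + ε * I)).im) (𝓝[>] 0) (𝓝 (∫ x in s..t, (0:ℝ))) := by
    refine intervalIntegral.tendsto_integral_filter_of_dominated_convergence (fun _ => B) ?_ ?_
      intervalIntegrable_const ?_
    · filter_upwards [self_mem_nhdsWithin] with ε hε using (continuous_im_stieltjes ρ hε).aestronglyMeasurable
    · filter_upwards [hB] with ε hε
      refine .of_forall fun x hx => ?_
      rw [uIoc_of_le hst.le] at hx; exact hε x (Ioc_subset_Icc_self hx)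
    · refine .of_forall fun x hx => ?_
      rw [uIoc_of_le hst.le] at hx; exact h0 x (Ioc_subset_Icc_self hx)
  have h2 := tendsto_nhds_unique (stieltjes_inversion ρ hst) h1
  rw [intervalIntegral.integral_zero] at h2
  have h3 : ρ.real (Ioo s t) + ρ.real (Icc s t) = 0 := by
    have := Real.pi_pos
    rcases mul_eq_zero.1 h2 with h | h
    · linarith
    · exact h
  have h4 : ρ.real (Icc s t) = 0 := by
    have := measureReal_nonneg (μ := ρ) (s := Ioo s t)
    linarith [measureReal_nonneg (μ := ρ) (s := Icc s t)]
  exact (measureReal_eq_zero_iff).1 h4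

lemma measure_Icc_eq_zero_of_continuousAt (ρ : Measure ℝ) [IsFiniteMeasure ρ] {s t : ℝ}
    (hst : s < t) {G : ℂ → ℂ} (hG : ∀ x ∈ Icc s t, ContinuousAt G (x : ℂ))
    (hre : ∀ x ∈ Icc s t, (G (x : ℂ)).im = 0)
    (heq : ∀ᶠ ε : ℝ in 𝓝[>] 0, ∀ x ∈ Icc s t, (stieltjes ρ (x + ε * I)).im = (G (x + ε * I)).im) :
    ρ (Icc s t) = 0 := by
  have hc : ∀ x ∈ Icc s t, Tendsto (fun p : ℝ × ℝ => (G (p.1 + p.2 * I)).im) (𝓝 (x, 0)) (𝓝 0) := by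
    intro x hx
    have h1 : Tendsto (fun p : ℝ × ℝ => (p.1 + p.2 * I : ℂ)) (𝓝 (x, 0)) (𝓝 (x : ℂ)) := by
      have : Continuous fun p : ℝ × ℝ => (p.1 + p.2 * I : ℂ) := by fun_prop
      simpa using this.tendsto (x, 0)
    have h2 := (continuous_im.tendsto _).comp ((hG x hx).tendsto.comp h1)
    rw [hre x hx] at h2; exact h2
  refine measure_Icc_eq_zero ρ (B := 1) hst ?_ fun x hx => ?_
  · have h1 : ∀ᶠ ε : ℝ in 𝓝 0, ∀ x ∈ Icc s t, |(G (x + ε * I)).im| ≤ 1 := by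
      refine isCompact_Icc.eventually_forall_of_forall_eventually
        (P := fun ε x => |(G ((x : ℝ) + (ε : ℝ) * I)).im| ≤ 1) fun x hx => ?_
      have h0 : Tendsto (fun p : ℝ × ℝ => p.swap) (𝓝 ((0 : ℝ), x)) (𝓝 (x, (0 : ℝ))) := continuous_swap.tendsto _
      have := h0.eventually ((hc x hx).eventually (closedBall_mem_nhds (0:ℝ) one_pos))
      filter_upwards [this] with p hp
      simpa [Real.dist_eq] using hp
    filter_upwards [heq, h1.filter_mono nhdsWithin_le_nhds] with ε h2 h3 x hx
    rw [h2 x hx]; exact h3 x hx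
  · have h1 : Tendsto (fun ε : ℝ => (x, ε)) (𝓝[>] 0) (𝓝 (x, (0:ℝ))) := by
      rw [nhds_prod_eq]; exact tendsto_const_nhds.prodMk (tendsto_nhdsWithin_of_tendsto_nhds tendsto_id)
    refine ((hc x hx).comp h1).congr' ?_
    filter_upwards [heq] with ε h2
    exact (h2 x hx).symm

lemma im_mul_im_stieltjes_nonneg (ρ : Measure ℝ) [IsFiniteMeasure ρ] (hw : w.im ≠ 0) :
    0 ≤ w.im * (stieltjes ρ w).im := by
  rw [im_stieltjes ρ hw, ← integral_const_mul]
  refine integral_nonneg fun τ => ?_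
  rw [Pi.zero_apply, ← mul_div_assoc]; exact div_nonneg (mul_self_nonneg _) (by positivity)

lemma support_subset_of_im_stieltjes_eq {ρ ν : Measure ℝ} [IsFiniteMeasure ρ]
    [IsFiniteMeasure ν] {c K : ℝ} (hν : ν (Icc (-K) K)ᶜ = 0)
    (h : ∀ w : ℂ, w.im ≠ 0 → (stieltjes ρ w).im = c * (stieltjes ν w).im) :
    ρ.support ⊆ Icc (-K) K := by
  have hsupp : ν.support ⊆ Icc (-K) K := Measure.support_subset_of_isClosed isClosed_Icc (mem_ae_iff.2 hν)
  intro x hx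
  by_contra hxK
  obtain ⟨δ, hδ, hb⟩ := isOpen_iff.1 isClosed_Icc.isOpen_compl x hxK
  have hsub : Icc (x - δ / 2) (x + δ / 2) ⊆ (Icc (-K) K)ᶜ := by
    refine Subset.trans (fun y hy => ?_) hb
    rw [Real.ball_eq_Ioo]
    constructor <;> linarith [hy.1, hy.2]
  have hz : ρ (Icc (x - δ / 2) (x + δ / 2)) = 0 := by
    refine measure_Icc_eq_zero_of_continuousAt ρ (by linarith) (G := fun w => c * stieltjes ν w)
      (fun y hy => ?_) (fun y hy => ?_) ?_
    · refine continuousAt_const.mul (hasDerivAt_stieltjes ν fun z hz hyz => ?_).continuousAt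
      exact hsub hy (by rw [ofReal_inj.1 hyz]; exact hsupp hz)
    · simp [stieltjes_ofReal_im]
    · filter_upwards [self_mem_nhdsWithin] with ε hε y _
      rw [h _ (by simpa using (ne_of_gt hε))]; simp
  have h2 := (Measure.mem_support_iff_forall x).1 hx _
    (Icc_mem_nhds (show x - δ / 2 < x by linarith) (show x < x + δ / 2 by linarith))
  rw [hz] at h2; exact lt_irrefl _ h2

namespace JacobiMatrix

variable (J : JacobiMatrix)

lemma b_ofReal_ne_zero (k : ℤ) : (J.b k : ℂ) ≠ 0 := ofReal_ne_zero.2 (J.b_ne_zero k)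

lemma exists_right_weyl_measure : ∃ ν : Measure ℝ, IsFiniteMeasure ν ∧
    (∃ K : ℝ, ν (Icc (-K) K)ᶜ = 0) ∧ ∀ ρ : Measure ℝ, J.IsRightMeasure ρ ↔
      IsFiniteMeasure ρ ∧ ∀ w : ℂ, w.im ≠ 0 → stieltjes ρ w = J.b (-1) * stieltjes ν w := by
  obtain ⟨K, hK⟩ := J.bounded
  obtain ⟨ν, h1, h2, h3⟩ := exists_weyl_measure (α := fun n : ℕ => J.a n) (β := fun n : ℕ => J.b n)
    (fun n => (hK n).1) (fun n => (hK n).2) (fun n => J.b_ne_zero n)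
  refine ⟨ν, h1, h2, fun ρ => and_congr_right fun _ => forall₂_congr fun w hw => ?_⟩
  have hb := J.b_ofReal_ne_zero (-1)
  have hrec : ∀ k : ℤ, J.b (k - 1) * ((1 / (J.b (-1) : ℂ) * stieltjes ρ w) * J.P (k - 1) w
        - J.Q (k - 1) w / (J.b (-1) : ℂ))
      + (J.a k - w) * ((1 / (J.b (-1) : ℂ) * stieltjes ρ w) * J.P k w - J.Q k w / (J.b (-1) : ℂ))
      + J.b k * ((1 / (J.b (-1) : ℂ) * stieltjes ρ w) * J.P (k + 1) w - J.Q (k + 1) w / (J.b (-1) : ℂ)) = 0 := by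
    intro k
    linear_combination (1 / (J.b (-1) : ℂ) * stieltjes ρ w) * J.P_rec w k - 1 / (J.b (-1) : ℂ) * J.Q_rec w k
  have key := h3 w hw (fun n : ℕ => (1 / (J.b (-1) : ℂ) * stieltjes ρ w) * J.P n w - J.Q n w / (J.b (-1) : ℂ)) 1 (by
      intro n
      cases n with
      | zero =>
        have := hrec 0
        have p1 : J.P (0 - 1) w = 0 := rfl
        have q1 : J.Q (0 - 1) w = 1 := rfl
        rw [p1, q1] at this
        simp only [tridiag, if_true, Nat.cast_zero, Nat.cast_one, zero_add, zero_sub] at this ⊢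
        have h5 : (J.b (-1) : ℂ) * (1 / J.b (-1)) = 1 := by field_simp
        linear_combination this + h5
      | succ n =>
        have := hrec (n + 1)
        simp only [tridiag, Nat.cast_add, Nat.cast_one, add_sub_cancel_right, Nat.succ_ne_zero,
          if_false, Nat.cast_ofNat] at this ⊢
        have e : ((n : ℤ) + 1 + 1) = n + 2 := by ring
        rw [e] at this
        linear_combination this)
  have p0 : J.P ((0 : ℕ) : ℤ) w = 1 := rfl
  have q0 : J.Q ((0 : ℕ) : ℤ) w = 0 := rfl
  rw [p0, q0] at key
  refine key.trans ?_
  change _ = 1 * stieltjes ν w ↔ _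
  constructor
  · intro h; field_simp at h; simpa using h
  · intro h; rw [h]; field_simp; ring

lemma isRightMeasure_rhoR : J.IsRightMeasure J.rhoR := by
  obtain ⟨ν, h1, h2, h3⟩ := J.exists_right_weyl_measure
  refine Classical.epsilon_spec (p := J.IsRightMeasure) ⟨ENNReal.ofReal (J.b (-1)) • ν, (h3 _).2 ⟨?_, fun w _ => ?_⟩⟩
  · exact Measure.smul_finite ν ENNReal.ofReal_ne_top
  · exact stieltjes_smul ν J.b_neg_one_pos.le w

instance isFiniteMeasure_rhoR : IsFiniteMeasure J.rhoR := J.isRightMeasure_rhoR.1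

lemma exists_support_rhoR_subset : ∃ K : ℝ, J.rhoR.support ⊆ Icc (-K) K := by
  obtain ⟨ν, h1, ⟨K, h2⟩, h3⟩ := J.exists_right_weyl_measure
  refine ⟨K, support_subset_of_im_stieltjes_eq (ν := ν) (c := J.b (-1)) h2 fun w hw => ?_⟩
  rw [((h3 _).1 J.isRightMeasure_rhoR).2 w hw]; simp

lemma exists_left_weyl_measure : ∃ ν : Measure ℝ, IsFiniteMeasure ν ∧
    (∃ K : ℝ, ν (Icc (-K) K)ᶜ = 0) ∧ ∀ d : ℝ × Measure ℝ, J.IsLeftMeasure d ↔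
      IsFiniteMeasure d.2 ∧ ∀ w : ℂ, w.im ≠ 0 → (J.b (-1) : ℂ) * (w / J.b (-1) + d.1 +
        stieltjes d.2 w) = w - J.a (-1) + J.b (-2) ^ 2 * stieltjes ν w := by
  obtain ⟨K, hK⟩ := J.bounded
  obtain ⟨ν, h1, h2, h3⟩ := exists_weyl_measure (α := fun n : ℕ => J.a (-2 - n)) (β := fun n : ℕ => J.b (-3 - n))
    (fun n => (hK _).1) (fun n => (hK _).2) (fun n => J.b_ne_zero _)
  refine ⟨ν, h1, h2, fun d => and_congr_right fun _ => forall₂_congr fun w hw => ?_⟩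
  have hb := J.b_ofReal_ne_zero (-1)
  have hb2 := J.b_ofReal_ne_zero (-2)
  set G : ℂ := w / J.b (-1) + d.1 + stieltjes d.2 w with hG
  set m : ℂ := -1 / ((J.b (-1) : ℂ) * G) with hm
  set φ : ℤ → ℂ := fun k => -J.P k w / (J.b (-1) : ℂ) + m * J.Q k w with hφ
  have hrec : ∀ k : ℤ, J.b (k - 1) * φ (k - 1) + (J.a k - w) * φ k + J.b k * φ (k + 1) = 0 := by
    intro k; simp only [hφ]
    linear_combination -(1 / (J.b (-1) : ℂ)) * J.P_rec w k + m * J.Q_rec w k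
  have key := h3 w hw (fun n : ℕ => φ (-2 - n)) (-J.b (-2) * m) (by
    intro n
    have hφ1 : φ (-1) = m := by
      have p1 : J.P (-1) w = 0 := rfl
      have q1 : J.Q (-1) w = 1 := rfl
      simp [hφ, p1, q1]
    cases n with
    | zero =>
      have := hrec (-2)
      norm_num at this; rw [hφ1] at this; simp only [tridiag, if_true, Nat.cast_zero, Nat.cast_one, sub_zero]
      norm_num
      linear_combination this
    | succ n =>
      have := hrec (-3 - n)
      have e1 : (-3 - (n : ℤ) - 1) = -4 - n := by ring
      have e2 : (-3 - (n : ℤ) + 1) = -2 - n := by ring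
      have e3 : (-2 - ((n + 1 : ℕ) : ℤ)) = -3 - n := by push_cast; ring
      have e4 : (-2 - ((n + 2 : ℕ) : ℤ)) = -4 - n := by push_cast; ring
      have e5 : (-3 - ((n + 1 : ℕ) : ℤ)) = -4 - n := by push_cast; ring
      rw [e1, e2] at this; simp only [tridiag, e3, e4, e5, Nat.succ_ne_zero, if_false]
      linear_combination this)
  have hs : (Summable fun k : ℕ => ‖-J.P (-(k : ℤ)) w / (J.b (-1) : ℂ) + m * J.Q (-(k : ℤ)) w‖ ^ 2)
      ↔ Summable fun n : ℕ => ‖φ (-2 - n)‖ ^ 2 := by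
    rw [← summable_nat_add_iff 2]
    have : ∀ n : ℕ, (-((n + 2 : ℕ) : ℤ)) = -2 - n := fun n => by push_cast; ring
    simp only [this, hφ]
  refine hs.trans (key.trans ?_)
  change φ (-2 - ((0 : ℕ) : ℤ)) = -J.b (-2) * m * stieltjes ν w ↔ _
  have h0 := hrec (-1)
  norm_num at h0
  have hφ0 : φ 0 = -1 / J.b (-1) := by
    have p1 : J.P 0 w = 1 := rfl
    have q1 : J.Q 0 w = 0 := rfl
    simp [hφ, p1, q1]
  have hφ1 : φ (-1) = m := by
    have p1 : J.P (-1) w = 0 := rfl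
    have q1 : J.Q (-1) w = 1 := rfl
    simp [hφ, p1, q1]
  have h5 : (J.b (-1) : ℂ) * φ 0 = -1 := by rw [hφ0]; field_simp
  rw [hφ1, h5] at h0
  have e0 : (-2 - ((0 : ℕ) : ℤ)) = -2 := by norm_num
  rw [e0]
  have him : w - J.a (-1) + J.b (-2) ^ 2 * stieltjes ν w ≠ 0 := by
    intro h
    have hh := congrArg im h
    have h6 := im_mul_im_stieltjes_nonneg ν hw
    have h7 : ((J.b (-2) : ℂ) ^ 2 * stieltjes ν w).im = J.b (-2) ^ 2 * (stieltjes ν w).im := by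
      rw [← ofReal_pow, im_ofReal_mul]
    simp only [add_im, sub_im, ofReal_im, h7, zero_im] at hh
    have : w.im * w.im + J.b (-2) ^ 2 * (w.im * (stieltjes ν w).im) = 0 := by linear_combination w.im * hh
    have h8 : 0 < w.im * w.im := mul_self_pos.2 hw
    nlinarith [mul_nonneg (sq_nonneg (J.b (-2))) h6]
  have hiff : φ (-2) = -J.b (-2) * m * stieltjes ν w ↔
      m * (w - J.a (-1) + J.b (-2) ^ 2 * stieltjes ν w) = -1 := by
    constructor
    · intro h; rw [h] at h0
      linear_combination -h0
    · intro h
      refine mul_left_cancel₀ hb2 ?_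
      linear_combination h0 + h
  rw [hiff]
  constructor
  · intro h
    have hG0 : (J.b (-1) : ℂ) * G ≠ 0 := by intro h0; rw [hm, h0, div_zero, zero_mul] at h; norm_num at h
    rw [hm, div_mul_eq_mul_div, div_eq_iff hG0] at h
    linear_combination h
  · intro h; rw [hm, h]; field_simp

lemma isLeftMeasure_leftData : J.IsLeftMeasure J.leftData := by
  obtain ⟨ν, h1, h2, h3⟩ := J.exists_left_weyl_measure
  have hc : 0 ≤ J.b (-2) ^ 2 / J.b (-1) := div_nonneg (sq_nonneg _) J.b_neg_one_pos.le
  refine Classical.epsilon_spec (p := J.IsLeftMeasure)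
    ⟨(-J.a (-1) / J.b (-1), ENNReal.ofReal (J.b (-2) ^ 2 / J.b (-1)) • ν), (h3 _).2 ⟨?_, fun w _ => ?_⟩⟩
  · exact Measure.smul_finite ν ENNReal.ofReal_ne_top
  · have hb := J.b_ofReal_ne_zero (-1)
    rw [stieltjes_smul ν hc]; push_cast; field_simp; ring

instance isFiniteMeasure_rhoL : IsFiniteMeasure J.rhoL := J.isLeftMeasure_leftData.1

lemma exists_support_rhoL_subset : ∃ K : ℝ, J.rhoL.support ⊆ Icc (-K) K := by
  obtain ⟨ν, h1, ⟨K, h2⟩, h3⟩ := J.exists_left_weyl_measure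
  refine ⟨K, support_subset_of_im_stieltjes_eq (ν := ν) (c := J.b (-2) ^ 2 / J.b (-1)) h2 fun w hw => ?_⟩
  have h := ((h3 _).1 J.isLeftMeasure_leftData).2 w hw
  have hb := J.b_ofReal_ne_zero (-1)
  have e : stieltjes J.rhoL w = ((-J.a (-1) / J.b (-1) - J.leftData.1 : ℝ) : ℂ) +
      ((J.b (-2) ^ 2 / J.b (-1) : ℝ) : ℂ) * stieltjes ν w := by
    push_cast; field_simp; field_simp at h; rw [rhoL]
    linear_combination h
  rw [e, add_im, ofReal_im, im_ofReal_mul, zero_add]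

end JacobiMatrix

lemma integrable_of_norm_le_div_sq {g : ℝ → ℂ} (hg : Continuous g) {C K : ℝ}
    (h : ∀ t, K ≤ |t| → ‖g t‖ ≤ C / t ^ 2) : Integrable g := by
  set L := max K 1 with hL
  obtain ⟨M, hM⟩ := (isCompact_Icc (a := -L) (b := L)).exists_bound_of_continuousOn hg.continuousOn
  have hL1 : 1 ≤ L := le_max_right _ _
  have hM0 : 0 ≤ M := (norm_nonneg _).trans (hM 0 ⟨by linarith, by linarith⟩)
  have hC : 0 ≤ C := by
    have := (norm_nonneg _).trans (h L (by rw [abs_of_pos (by linarith)]; exact le_max_left _ _))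
    by_contra hc
    push Not at hc
    have : C / L ^ 2 < 0 := div_neg_of_neg_of_pos hc (by positivity)
    linarith
  refine (integrable_inv_one_add_sq.const_mul (M * (1 + L ^ 2) + 2 * C)).mono'
    hg.aestronglyMeasurable (.of_forall fun t => ?_)
  have hp : 0 < 1 + t ^ 2 := by positivity
  rw [← div_eq_mul_inv, le_div_iff₀ hp]
  by_cases ht : |t| ≤ L
  · have h1 := hM t (abs_le.1 ht)
    have h2 : t ^ 2 ≤ L ^ 2 := sq_le_sq' (abs_le.1 ht).1 (abs_le.1 ht).2
    nlinarith [mul_le_mul h1 (by linarith : 1 + t ^ 2 ≤ 1 + L ^ 2) hp.le hM0]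
  · push Not at ht
    have h1 := h t ((le_max_left _ _).trans ht.le)
    have h2 : 1 ≤ t ^ 2 := by rw [← sq_abs]; nlinarith [abs_nonneg t]
    have h3 : ‖g t‖ * t ^ 2 ≤ C := by rwa [le_div_iff₀ (by linarith)] at h1
    nlinarith [mul_nonneg hM0 (by positivity : (0:ℝ) ≤ 1 + L ^ 2), norm_nonneg (g t)]

/-- Cauchy's theorem in the closed upper half plane. -/
lemma integral_eq_zero_of_differentiableAt_halfPlane {G : ℂ → ℂ}
    (hG : ∀ w : ℂ, 0 ≤ w.im → DifferentiableAt ℂ G w) {C K : ℝ}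
    (hC : ∀ w : ℂ, 0 ≤ w.im → K ≤ ‖w‖ → ‖G w‖ ≤ C / ‖w‖ ^ 2) :
    Integrable (fun t : ℝ => G t) ∧ ∫ t : ℝ, G t = 0 := by
  have hcont : Continuous fun t : ℝ => G t := by
    refine continuous_iff_continuousAt.2 fun t => ?_
    exact ContinuousAt.comp (f := fun t : ℝ => (t : ℂ)) (hG t (by simp)).continuousAt (by fun_prop)
  have hint : Integrable fun t : ℝ => G t :=
    integrable_of_norm_le_div_sq hcont (C := C) (K := K) fun t ht => by simpa using hC t (by simp) (by simpa using ht)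
  refine ⟨hint, ?_⟩
  have hlim := intervalIntegral_tendsto_integral hint tendsto_neg_atTop_atBot tendsto_id
  refine tendsto_nhds_unique hlim ?_
  have hC0 : 0 ≤ C := by
    set L := max K 1
    have hL1 : 1 ≤ L := le_max_right _ _
    have h1 := (norm_nonneg _).trans (hC L (by simp) (by
      rw [norm_ofReal, abs_of_pos (by linarith)]; exact le_max_left _ _))
    have h2 : 0 < ‖(L : ℂ)‖ ^ 2 := by
      have : (L : ℂ) ≠ 0 := ofReal_ne_zero.2 (by linarith)
      positivity
    by_contra hc
    push Not at hc; linarith [div_neg_of_neg_of_pos hc h2]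
  have hbound : ∀ᶠ T : ℝ in atTop, ‖∫ t in (-T)..T, G t‖ ≤ 4 * C / T := by
    filter_upwards [eventually_ge_atTop (max K 1)] with T hT
    have hT1 : 1 ≤ T := (le_max_right _ _).trans hT
    have hTK : K ≤ T := (le_max_left _ _).trans hT
    have hrect := integral_boundary_rect_eq_zero_of_differentiableOn G (-T : ℂ) (T + T * I) (fun w hw => by
        refine (hG w ?_).differentiableWithinAt
        have := hw.2
        simp only [mem_preimage, neg_im, ofReal_im, neg_zero, add_im, mul_im, ofReal_re, I_im, mul_one, I_re, mul_zero,
          add_zero, zero_add] at this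
        rw [uIcc_of_le (by linarith)] at this; exact this.1)
    simp only [neg_re, ofReal_re, add_re, mul_re, I_re, mul_zero, ofReal_im, I_im, mul_one, sub_self, add_zero, neg_im,
      neg_zero, add_im, mul_im, zero_add, ofReal_zero, zero_mul,
      smul_eq_mul] at hrect
    have hgen : ∀ w : ℂ, 0 ≤ w.im → T ≤ ‖w‖ → ‖G w‖ ≤ C / T ^ 2 := fun w hw hTw =>
      (hC w hw (hTK.trans hTw)).trans (by gcongr)
    have b1 : ‖∫ x : ℝ in (-T)..T, G (x + T * I)‖ ≤ C / T ^ 2 * |T - (-T)| := by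
      refine intervalIntegral.norm_integral_le_of_norm_le_const fun x _ => hgen _ ?_ ?_
      · simp; linarith
      · refine le_trans (le_of_eq ?_) (abs_im_le_norm _)
        simp [abs_of_pos (by linarith : 0 < T)]
    have b2 : ∀ c : ℝ, |c| = T → ‖∫ y : ℝ in (0:ℝ)..T, G (c + y * I)‖ ≤ C / T ^ 2 * |T - 0| := fun c hc => by
      refine intervalIntegral.norm_integral_le_of_norm_le_const fun y hy => hgen _ ?_ ?_
      · rw [uIoc_of_le (by linarith)] at hy; simpa using hy.1.le
      · refine le_trans (le_of_eq ?_) (abs_re_le_norm _)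
        simp [hc]
    have b3 := b2 (-T) (by rw [abs_neg, abs_of_pos (by linarith)])
    have b2 := b2 T (abs_of_pos (by linarith))
    push_cast at b3
    have heq : ∫ t in (-T)..T, G t = (∫ x : ℝ in (-T)..T, G (x + T * I)) - I * (∫ y : ℝ in (0:ℝ)..T, G (T + y * I))
        + I * (∫ y : ℝ in (0:ℝ)..T, G (-T + y * I)) := by
      push_cast at hrect
      linear_combination hrect
    rw [heq]
    refine (norm_add_le _ _).trans ((add_le_add_left (norm_sub_le _ _) _).trans ?_)
    rw [norm_mul, norm_mul, norm_I, one_mul, one_mul]; rw [abs_of_pos (by linarith)] at b1 b2 b3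
    have : C / T ^ 2 * (T - -T) + C / T ^ 2 * (T - 0) + C / T ^ 2 * (T - 0) = 4 * C / T := by field_simp; ring
    linarith
  have h0 : Tendsto (fun T : ℝ => 4 * C / T) atTop (𝓝 0) := tendsto_const_nhds.div_atTop tendsto_id
  exact squeeze_zero_norm' hbound h0

lemma integral_poisson_univ (x : ℝ) {y : ℝ} (hy : 0 < y) : Integrable (fun t : ℝ => y / ((t - x) ^ 2 + y ^ 2)) ∧
      ∫ t : ℝ, y / ((t - x) ^ 2 + y ^ 2) = π := by
  have e : (fun t : ℝ => y / ((t - x) ^ 2 + y ^ 2)) =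
      fun t => y⁻¹ * (fun s : ℝ => (1 + s ^ 2)⁻¹) (y⁻¹ * (t - x)) := by
    funext t
    have : (t - x) ^ 2 + y ^ 2 ≠ 0 := by positivity
    have : 1 + (y⁻¹ * (t - x)) ^ 2 ≠ 0 := by positivity
    have : y ^ 2 + (t - x) ^ 2 ≠ 0 := by positivity
    field_simp; ring
  have hi : Integrable fun t : ℝ => (fun s : ℝ => (1 + s ^ 2)⁻¹) (y⁻¹ * (t - x)) :=
    (integrable_inv_one_add_sq.comp_mul_left' (inv_ne_zero hy.ne')).comp_sub_right x
  rw [e]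
  refine ⟨hi.const_mul _, ?_⟩
  rw [integral_const_mul, integral_sub_right_eq_self (fun t => (fun s : ℝ => (1 + s ^ 2)⁻¹) (y⁻¹ * t)) x,
    Measure.integral_comp_mul_left (fun s : ℝ => (1 + s ^ 2)⁻¹), integral_univ_inv_one_add_sq]
  rw [inv_inv, abs_of_pos hy, smul_eq_mul]; field_simp

/-- A function analytic in the closed upper half plane which decays at infinity is the Cauchy
integral of its imaginary part. -/
lemma eq_integral_im_of_differentiableAt_halfPlane {Φ : ℂ → ℂ}
    (hΦ : ∀ w : ℂ, 0 ≤ w.im → DifferentiableAt ℂ Φ w) {C K : ℝ}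
    (hC : ∀ w : ℂ, 0 ≤ w.im → K ≤ ‖w‖ → ‖Φ w‖ ≤ C / ‖w‖) (hw : 0 < w.im) :
    ∫ t : ℝ, ((Φ t).im : ℂ) * (1 / (t - w)) = π * Φ w := by
  set w' := conj w with hw'
  have hne : ∀ ζ : ℂ, 0 ≤ ζ.im → ζ - w' ≠ 0 := by
    intro ζ hζ h
    have := congrArg im h
    simp [hw'] at this; linarith
  have hn' : ‖w'‖ = ‖w‖ := by simp [hw']
  set L := max (max K 1) (2 * ‖w‖) with hL
  have hLK : K ≤ L := (le_max_left _ _).trans (le_max_left _ _)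
  have hL1 : 1 ≤ L := (le_max_right _ _).trans (le_max_left _ _)
  have hLw : 2 * ‖w‖ ≤ L := le_max_right _ _
  have hdist : ∀ ζ v : ℂ, ‖v‖ = ‖w‖ → L ≤ ‖ζ‖ → ‖ζ‖ / 2 ≤ ‖ζ - v‖ := by intro ζ v hv hζ; linarith [norm_sub_norm_le ζ v]
  have hC0 : 0 ≤ C := by
    have h1 := (norm_nonneg _).trans (hC L (by simp) (by rw [norm_ofReal, abs_of_pos (by linarith)]; exact hLK))
    rw [norm_ofReal, abs_of_pos (by linarith)] at h1
    by_contra hc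
    push Not at hc; linarith [div_neg_of_neg_of_pos hc (by linarith : 0 < L)]
  have h1 := integral_eq_zero_of_differentiableAt_halfPlane (G := fun ζ => Φ ζ / (ζ - w'))
    (fun ζ hζ => (hΦ ζ hζ).div (by fun_prop) (hne ζ hζ)) (C := 2 * C) (K := L) (fun ζ hζ hLζ => by
      have hp : 0 < ‖ζ‖ := by linarith
      rw [norm_div, div_le_div_iff₀ (by linarith [hdist ζ w' hn' hLζ]) (by positivity)]
      have h2 := hC ζ hζ (hLK.trans hLζ)
      rw [le_div_iff₀ hp] at h2
      have h3 := hdist ζ w' hn' hLζ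
      nlinarith [mul_le_mul h2 (le_refl ‖ζ‖) hp.le hC0, mul_le_mul_of_nonneg_left h3 hC0])
  set φ : ℂ → ℂ := fun ζ => Φ ζ - Φ w * (w - w') / (ζ - w') with hφ
  have hφw : φ w = 0 := by simp only [hφ]; rw [mul_div_assoc, div_self (hne w hw.le), mul_one, sub_self]
  have hφd : ∀ ζ : ℂ, 0 ≤ ζ.im → DifferentiableAt ℂ φ ζ := fun ζ hζ =>
    (hΦ ζ hζ).sub ((differentiableAt_const _).div (by fun_prop) (hne ζ hζ))
  have hds : ∀ ζ : ℂ, ζ ≠ w → dslope φ w ζ = φ ζ / (ζ - w) := by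
    intro ζ hζ; rw [dslope_of_ne _ hζ, slope_def_field, hφw, sub_zero]
  have h2 := integral_eq_zero_of_differentiableAt_halfPlane (G := dslope φ w) (fun ζ hζ => by
      by_cases h : ζ = w
      · have : DifferentiableOn ℂ (dslope φ w) {z : ℂ | 0 < z.im} := by
          rw [differentiableOn_dslope ((isOpen_lt continuous_const continuous_im).mem_nhds hw)]
          exact fun z hz => (hφd z (le_of_lt hz)).differentiableWithinAt
        rw [h]; exact this.differentiableAt ((isOpen_lt continuous_const continuous_im).mem_nhds hw)
      · exact (differentiableAt_dslope_of_ne h).2 (hφd ζ hζ))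
    (C := 2 * (C + 2 * ‖Φ w * (w - w')‖)) (K := L + 2 * ‖w‖ + 1) (fun ζ hζ hLζ => by
      have hw0 := norm_nonneg w
      have hLζ' : L ≤ ‖ζ‖ := by linarith
      have hp : 0 < ‖ζ‖ := by linarith
      have hζw : ζ ≠ w := by rintro rfl; linarith
      rw [hds ζ hζw, norm_div]
      have h3 := hC ζ hζ (hLK.trans hLζ')
      have h4 : ‖φ ζ‖ ≤ (C + 2 * ‖Φ w * (w - w')‖) / ‖ζ‖ := by
        refine (norm_sub_le _ _).trans ?_
        rw [add_div]
        refine add_le_add h3 ?_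
        rw [norm_div, div_le_div_iff₀ (by linarith [hdist ζ w' hn' hLζ']) hp]
        nlinarith [hdist ζ w' hn' hLζ', norm_nonneg (Φ w * (w - w'))]
      have h5 := hdist ζ w rfl hLζ'
      rw [le_div_iff₀ hp] at h4; rw [div_le_div_iff₀ (by linarith) (by positivity)]
      have h6 : 0 ≤ C + 2 * ‖Φ w * (w - w')‖ := by positivity
      nlinarith [mul_le_mul h4 (le_refl ‖ζ‖) hp.le h6, mul_le_mul_of_nonneg_left h5 h6])
  have h3 : (fun t : ℝ => dslope φ w t) = fun t : ℝ => Φ t / (t - w) -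
      Φ w * (2 * I * ((w.im / ((t - w.re) ^ 2 + w.im ^ 2) : ℝ) : ℂ)) := by
    funext t
    have ht : (t : ℂ) ≠ w := by intro h; have := congrArg im h; simp at this; linarith
    have ht1 : (t : ℂ) - w ≠ 0 := sub_ne_zero.2 ht
    have ht2 : (t : ℂ) - w' ≠ 0 := hne t (by simp)
    rw [hds _ ht]
    have e1 : w - w' = 2 * I * w.im := by rw [hw', sub_conj]; push_cast; ring
    have e2 : (((t - w.re) ^ 2 + w.im ^ 2 : ℝ) : ℂ) = (t - w) * ((t : ℂ) - w') := by
      have a1 := re_add_im w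
      have a2 : conj w = w.re - w.im * I := by apply Complex.ext <;> simp
      rw [hw', a2]; push_cast
      linear_combination (w.im : ℂ) ^ 2 * I_sq - ((t : ℂ) - w.re + w.im * I) * a1
    rw [ofReal_div, e2]; simp only [hφ, e1]; field_simp
  rw [h3] at h2
  have hP := integral_poisson_univ w.re hw
  have hPc : Integrable fun t : ℝ => ((w.im / ((t - w.re) ^ 2 + w.im ^ 2) : ℝ) : ℂ) := hP.1.ofReal
  have h4 : Integrable fun t : ℝ => Φ t / (t - w) := by
    have := h2.1.add (hPc.const_mul (Φ w * (2 * I)))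
    refine this.congr (.of_forall fun t => ?_)
    simp only [Pi.add_apply]; push_cast; ring
  have h5 : ∫ t : ℝ, Φ t / (t - w) = 2 * I * π * Φ w := by
    have h6 := h2.2
    rw [integral_sub h4 ((hPc.const_mul _).const_mul _)] at h6
    rw [integral_const_mul, integral_const_mul] at h6
    have h7 : ∫ t : ℝ, ((w.im / ((t - w.re) ^ 2 + w.im ^ 2) : ℝ) : ℂ) = π := by rw [integral_complex_ofReal, hP.2]
    rw [h7] at h6
    linear_combination h6
  have h6 : ∫ t : ℝ, conj (Φ t) / (t - w) = 0 := by
    have := congrArg conj h1.2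
    rw [← integral_conj, map_zero] at this; rw [← this]
    refine integral_congr_ae (.of_forall fun t => ?_)
    simp [hw']
  have h7 : Integrable fun t : ℝ => conj (Φ t) / (t - w) := by
    have := (LinearIsometryEquiv.integrable_comp_iff conjLIE).2 h1.1
    refine this.congr (.of_forall fun t => ?_)
    simp [hw']
  have h8 : ∀ t : ℝ, ((Φ t).im : ℂ) * (1 / (t - w)) = (2 * I)⁻¹ * (Φ t / (t - w) - conj (Φ t) / (t - w)) := by
    intro t
    have e1 : Φ t - conj (Φ t) = 2 * I * (Φ t).im := by rw [sub_conj]; push_cast; ring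
    rw [← sub_div, e1]
    have := I_ne_zero
    field_simp
  simp only [h8]; rw [integral_const_mul, integral_sub h4 h7, h5, h6, sub_zero]
  have := I_ne_zero
  field_simp

lemma memLp_two_of_abs_le {g : ℝ → ℝ} (hg : AEStronglyMeasurable g) {D : ℝ}
    (h : ∀ t, |g t| ≤ D / √(1 + t ^ 2)) : MemLp g 2 := by
  rw [memLp_two_iff_integrable_sq hg]
  refine (integrable_inv_one_add_sq.const_mul (D ^ 2)).mono' (hg.pow 2) (.of_forall fun t => ?_)
  have hp : 0 ≤ 1 + t ^ 2 := by positivity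
  have h1 : |g t| ^ 2 ≤ (D / √(1 + t ^ 2)) ^ 2 := by gcongr; exact h t
  rw [div_pow, Real.sq_sqrt hp, sq_abs] at h1
  rw [Real.norm_of_nonneg (sq_nonneg _), ← div_eq_mul_inv]; exact h1

lemma memLp_majorant (D : ℝ) : MemLp (fun t : ℝ => |D| / √(1 + t ^ 2)) 2 :=
  memLp_two_of_abs_le (D := |D|)
    (Continuous.aestronglyMeasurable (continuous_const.div (by fun_prop) fun t => by positivity))
    fun t => by rw [abs_of_nonneg (by positivity)]

lemma sqrt_one_add_sq_mul_cauchyKernel_le (hw : w.im ≠ 0) : ∃ D : ℝ, ∀ t : ℝ, ‖1 / (t - w)‖ ≤ D / √(1 + t ^ 2) := by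
  refine ⟨1 + (1 + ‖w‖) / |w.im|, fun t => ?_⟩
  have h0 : 0 < |w.im| := abs_pos.2 hw
  have h1 := abs_im_le_norm_ofReal_sub w t
  have h2 : √(1 + t ^ 2) ≤ 1 + |t| := by rw [Real.sqrt_le_left (by positivity)]; nlinarith [abs_nonneg t, sq_abs t]
  have h3 : |t| ≤ ‖(t : ℂ) - w‖ + ‖w‖ := by
    have := norm_add_le (t - w) w
    simpa using this
  have h4 : 0 < ‖(t : ℂ) - w‖ := lt_of_lt_of_le h0 h1
  rw [norm_div, norm_one, div_le_div_iff₀ h4 (by positivity), one_mul]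
  have h5 : (1 + ‖w‖) ≤ (1 + ‖w‖) / |w.im| * ‖(t : ℂ) - w‖ := by
    rw [div_mul_eq_mul_div, le_div_iff₀ h0]; exact mul_le_mul_of_nonneg_left h1 (by positivity)
  linarith

lemma memLp_re_cauchyKernel (hw : w.im ≠ 0) :
    MemLp (fun t : ℝ => (1 / (t - w)).re) 2 := by
  obtain ⟨D, hD⟩ := sqrt_one_add_sq_mul_cauchyKernel_le hw
  exact memLp_two_of_abs_le (continuous_re.comp (continuous_cauchyKernel hw)).aestronglyMeasurable
    fun t => (abs_re_le_norm _).trans (hD t)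

lemma memLp_im_cauchyKernel (hw : w.im ≠ 0) :
    MemLp (fun t : ℝ => (1 / (t - w)).im) 2 := by
  obtain ⟨D, hD⟩ := sqrt_one_add_sq_mul_cauchyKernel_le hw
  exact memLp_two_of_abs_le (continuous_im.comp (continuous_cauchyKernel hw)).aestronglyMeasurable
    fun t => (abs_im_le_norm _).trans (hD t)

lemma integrable_mul_cauchyKernel (hf : MemLp f 2) (hw : w.im ≠ 0) :
    Integrable fun t : ℝ => f t * (1 / (t - w)) := by
  have h1 := (hf.integrable_mul (memLp_re_cauchyKernel hw)).ofReal (𝕜 := ℂ)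
  have h2 := (hf.integrable_mul (memLp_im_cauchyKernel hw)).ofReal (𝕜 := ℂ)
  refine (h1.add (h2.mul_const I)).congr (.of_forall fun t => ?_)
  apply Complex.ext <;> simp

/-- Weak compactness of bounded sets in `L²`, tested against a fixed element. -/
lemma exists_weak_limit {U : ℝ → ℝ → ℝ} {D : ℝ} (hU : ∀ δ, 0 < δ → Continuous (U δ))
    (hD : ∀ δ, 0 < δ → ∀ t, |U δ t| ≤ D / √(1 + t ^ 2)) :
    ∃ f : ℝ → ℝ, Measurable f ∧ MemLp f 2 ∧ ∀ k : ℝ → ℝ, MemLp k 2 → ∀ l : ℝ,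
      Tendsto (fun δ => ∫ t, U δ t * k t) (𝓝[>] 0) (𝓝 l) → ∫ t, f t * k t = l := by
  have hm : ∀ δ, 0 < δ → MemLp (U δ) 2 := fun δ hδ => memLp_two_of_abs_le (hU δ hδ).aestronglyMeasurable (hD δ hδ)
  classical
  let E := Lp ℝ 2 (volume : Measure ℝ)
  let V : ℝ → E := fun δ => if hδ : 0 < δ then (hm δ hδ).toLp _ else 0
  set R := ‖(memLp_majorant D).toLp _‖ with hR
  have hV : ∀ δ, ‖V δ‖ ≤ R := by
    intro δ
    by_cases hδ : 0 < δ
    · simp only [V, hδ, dif_pos]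
      refine Lp.norm_le_norm_of_ae_le ?_
      filter_upwards [(hm δ hδ).coeFn_toLp, (memLp_majorant D).coeFn_toLp] with t h1 h2
      rw [h1, h2, Real.norm_eq_abs, Real.norm_eq_abs]
      refine (hD δ hδ t).trans ((div_le_div_of_nonneg_right (le_abs_self D) (Real.sqrt_nonneg _)).trans (le_abs_self _))
    · simp only [V, hδ, dif_neg, not_false_eq_true, norm_zero]; exact norm_nonneg _
  let X : ℝ → WeakDual ℝ E := fun δ => StrongDual.toWeakDual (InnerProductSpace.toDual ℝ E (V δ))
  have hcpt := WeakDual.isCompact_closedBall (𝕜 := ℝ) (E := E) 0 R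
  let 𝓤 : Ultrafilter ℝ := Ultrafilter.of (𝓝[>] (0:ℝ))
  have h𝓤 : (𝓤 : Filter ℝ) ≤ 𝓝[>] 0 := Ultrafilter.of_le _
  obtain ⟨φ, -, hφ⟩ := hcpt.ultrafilter_le_nhds (𝓤.map X) (by
    rw [Ultrafilter.coe_map, le_principal_iff, mem_map]
    refine Filter.univ_mem' fun δ => ?_
    simp only [mem_preimage, X]; rw [mem_closedBall_zero_iff]
    have : ‖(InnerProductSpace.toDual ℝ E) (V δ)‖ ≤ R := by rw [LinearIsometryEquiv.norm_map]; exact hV δ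
    exact this)
  have hlim : Tendsto X 𝓤 (𝓝 φ) := hφ
  let f : E := (InnerProductSpace.toDual ℝ E).symm (WeakDual.toStrongDual φ)
  refine ⟨f, (Lp.stronglyMeasurable f).measurable, Lp.memLp f, fun k hk l hl => ?_⟩
  have h1 : Tendsto (fun δ => X δ (hk.toLp k)) 𝓤 (𝓝 (φ (hk.toLp k))) :=
    ((WeakDual.eval_continuous (hk.toLp k)).tendsto φ).comp hlim
  have h2 : φ (hk.toLp k) = ∫ t, f t * k t := by
    have : φ (hk.toLp k) = ⟪f, hk.toLp k⟫_ℝ := by simp only [f]; rw [InnerProductSpace.toDual_symm_apply]; rfl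
    rw [this, L2.inner_def]
    refine integral_congr_ae ?_
    filter_upwards [hk.coeFn_toLp] with t ht
    rw [ht]; simp [mul_comm]
  have h3 : ∀ δ, 0 < δ → X δ (hk.toLp k) = ∫ t, U δ t * k t := by
    intro δ hδ
    have : X δ (hk.toLp k) = ⟪V δ, hk.toLp k⟫_ℝ := rfl
    rw [this, L2.inner_def]
    refine integral_congr_ae ?_
    simp only [V, hδ, dif_pos]
    filter_upwards [hk.coeFn_toLp, (hm δ hδ).coeFn_toLp] with t ht h4
    rw [ht, h4]; simp [mul_comm]
  rw [h2] at h1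
  refine tendsto_nhds_unique h1 ((hl.mono_left h𝓤).congr' ?_)
  filter_upwards [h𝓤 self_mem_nhdsWithin] with δ hδ
  exact (h3 δ hδ).symm

/-- A function analytic in the upper half plane with bounded imaginary part that decays at infinity
is the Cauchy integral of a square-integrable density. -/
lemma exists_density {H : ℂ → ℂ} (hH : ∀ w : ℂ, 0 < w.im → DifferentiableAt ℂ H w) {B C K : ℝ}
    (hB : ∀ w : ℂ, 0 < w.im → |(H w).im| ≤ B)
    (hC : ∀ w : ℂ, 0 < w.im → K ≤ ‖w‖ → ‖H w‖ ≤ C / ‖w‖) :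
    ∃ f : ℝ → ℝ, Measurable f ∧ MemLp f 2 ∧ ∀ w : ℂ, 0 < w.im → ∫ t, f t * (1 / (t - w)) = π * H w := by
  have him : ∀ (t δ : ℝ), ((t : ℂ) + δ * I).im = δ := by intro t δ; simp
  have hnorm : ∀ (t δ : ℝ), |t| ≤ ‖(t : ℂ) + δ * I‖ := fun t δ => by simpa using abs_re_le_norm ((t : ℂ) + δ * I)
  set L := max K 1 with hL
  have hL1 : 1 ≤ L := le_max_right _ _
  have hB0 : 0 ≤ B := (abs_nonneg _).trans (hB I (by simp))
  have hcont : ∀ δ : ℝ, 0 < δ → Continuous fun t : ℝ => (H (t + δ * I)).im := by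
    intro δ hδ
    refine continuous_im.comp (continuous_iff_continuousAt.2 fun t => ?_)
    exact ContinuousAt.comp (f := fun t : ℝ => (t + δ * I : ℂ))
      (hH _ (by rw [him]; exact hδ)).continuousAt (by fun_prop)
  have hbound : ∀ δ : ℝ, 0 < δ → ∀ t : ℝ, |(H (t + δ * I)).im| ≤ (B * (1 + L) + 2 * |C|) / √(1 + t ^ 2) := by
    intro δ hδ t
    have hs : 0 < √(1 + t ^ 2) := by positivity
    have h2 : √(1 + t ^ 2) ≤ 1 + |t| := by rw [Real.sqrt_le_left (by positivity)]; nlinarith [abs_nonneg t, sq_abs t]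
    rw [le_div_iff₀ hs]
    by_cases ht : |t| ≤ L
    · have h1 := hB (t + δ * I) (by rw [him]; exact hδ)
      have := mul_le_mul h1 (h2.trans (by linarith : 1 + |t| ≤ 1 + L)) hs.le hB0
      linarith [abs_nonneg C]
    · push Not at ht
      have htn := hnorm t δ
      have h1 := (abs_im_le_norm _).trans (hC (t + δ * I) (by rw [him]; exact hδ)
        ((le_max_left _ _).trans (ht.le.trans htn)))
      have h3 : C / ‖(t : ℂ) + δ * I‖ ≤ |C| / |t| := by
        have : 0 < |t| := by linarith
        calc _ ≤ |C| / ‖(t : ℂ) + δ * I‖ := by gcongr; exact le_abs_self C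
          _ ≤ _ := by gcongr
      have h4 := h1.trans h3
      rw [le_div_iff₀ (by linarith)] at h4
      have h5 : √(1 + t ^ 2) ≤ 2 * |t| := by linarith
      have := mul_le_mul_of_nonneg_left h5 (abs_nonneg (H (t + δ * I)).im)
      have : 0 ≤ B * (1 + L) := by positivity
      nlinarith
  obtain ⟨f, hfm, hf, hlim⟩ := exists_weak_limit hcont hbound
  refine ⟨f, hfm, hf, fun w hw => ?_⟩
  have hwne : w.im ≠ 0 := hw.ne'
  have hrep : ∀ δ : ℝ, 0 < δ → ∫ t : ℝ, ((H (t + δ * I)).im : ℂ) * (1 / (t - w)) =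
      π * H (w + δ * I) := by
    intro δ hδ
    refine eq_integral_im_of_differentiableAt_halfPlane (Φ := fun ζ => H (ζ + δ * I))
      (C := 2 * |C|) (K := max (2 * δ) (K + δ)) (fun ζ hζ => ?_) (fun ζ hζ hKζ => ?_) hw
    · exact DifferentiableAt.comp (f := fun ζ => ζ + δ * I) ζ (hH _ (by simp; linarith)) (by fun_prop)
    · have h1 := (le_max_left _ _).trans hKζ
      have h2 := (le_max_right _ _).trans hKζ
      have h3 : ‖ζ‖ - δ ≤ ‖ζ + δ * I‖ := by
        have := norm_sub_norm_le ζ (-(δ * I))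
        simpa [abs_of_pos hδ] using this
      have hp : 0 < ‖ζ‖ := by linarith
      have hp2 : 0 < ‖ζ + δ * I‖ := by linarith
      refine (hC _ (by simp; linarith) (by linarith)).trans ?_
      rw [div_le_div_iff₀ hp2 hp]
      have := le_abs_self C
      nlinarith [abs_nonneg C]
  have hlimH : Tendsto (fun δ : ℝ => (π : ℂ) * H (w + δ * I)) (𝓝[>] 0) (𝓝 (π * H w)) := by
    refine (Tendsto.mono_left ?_ nhdsWithin_le_nhds).const_mul _
    have h1 : Tendsto (fun δ : ℝ => w + δ * I) (𝓝 0) (𝓝 w) := by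
      have : Continuous fun δ : ℝ => w + δ * I := by fun_prop
      simpa using this.tendsto 0
    exact (hH w hw).continuousAt.tendsto.comp h1
  have hmemU : ∀ δ : ℝ, 0 < δ → MemLp (fun t : ℝ => (H (t + δ * I)).im) 2 := fun δ hδ =>
    memLp_two_of_abs_le (hcont δ hδ).aestronglyMeasurable (hbound δ hδ)
  have hsplit : ∀ g : ℝ → ℝ, MemLp g 2 → ∫ t, g t * (1 / (t - w)) = ((∫ t, g t * (1 / (t - w)).re : ℝ) : ℂ) +
          ((∫ t, g t * (1 / (t - w)).im : ℝ) : ℂ) * I := by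
    intro g hg
    rw [← integral_complex_ofReal, ← integral_complex_ofReal, ← integral_mul_const, ← integral_add]
    · refine integral_congr_ae (.of_forall fun t => ?_)
      apply Complex.ext <;> simp
    · exact (hg.integrable_mul (memLp_re_cauchyKernel hwne)).ofReal
    · exact ((hg.integrable_mul (memLp_im_cauchyKernel hwne)).ofReal).mul_const _
  have hre := hlim _ (memLp_re_cauchyKernel hwne) (π * H w).re (by
    refine ((continuous_re.tendsto _).comp hlimH).congr' ?_
    filter_upwards [self_mem_nhdsWithin] with δ hδ
    rw [Function.comp_apply, ← hrep δ hδ, hsplit _ (hmemU δ hδ)]; simp)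
  have himm := hlim _ (memLp_im_cauchyKernel hwne) (π * H w).im (by
    refine ((continuous_im.tendsto _).comp hlimH).congr' ?_
    filter_upwards [self_mem_nhdsWithin] with δ hδ
    rw [Function.comp_apply, ← hrep δ hδ, hsplit _ (hmemU δ hδ)]; simp)
  rw [hsplit f hf, hre, himm, re_add_im]

lemma integral_deriv_poisson (s δ : ℝ) {ε : ℝ} (hε : 0 < ε) :
    ∫ a in s..δ, 2 * a * ε / (a ^ 2 + ε ^ 2) ^ 2 = ε / (s ^ 2 + ε ^ 2) - ε / (δ ^ 2 + ε ^ 2) := by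
  have h := intervalIntegral.integral_eq_sub_of_hasDerivAt (a := s) (b := δ)
    (f := fun a : ℝ => -(ε / (a ^ 2 + ε ^ 2))) (f' := fun a => 2 * a * ε / (a ^ 2 + ε ^ 2) ^ 2)
    (fun a _ => by
      have h1 : HasDerivAt (fun a : ℝ => a ^ 2 + ε ^ 2) (2 * a) a := by
        simpa using (hasDerivAt_pow 2 a).add_const (ε ^ 2)
      have h0 : a ^ 2 + ε ^ 2 ≠ 0 := by positivity
      refine ((hasDerivAt_const a ε).div h1 h0).neg.congr_deriv ?_
      field_simp; ring)
    (Continuous.intervalIntegrable (by refine Continuous.div (by fun_prop) (by fun_prop) fun a => by positivity) _ _)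
  rw [h]; ring

lemma lintegral_poisson_ball_le {g : ℝ → ℝ≥0∞} (hg : Measurable g) {x δ η : ℝ} (hδ : 0 < δ) (hη : 0 ≤ η)
    (h : ∀ a, 0 < a → a ≤ δ → ∫⁻ t in closedBall x a, g t ≤ ENNReal.ofReal (η * a))
    {ε : ℝ} (hε : 0 < ε) :
    ∫⁻ t in closedBall x δ, ENNReal.ofReal (ε / ((t - x) ^ 2 + ε ^ 2)) * g t ≤ ENNReal.ofReal (η * (2 * π + 1)) := by
  set k : ℝ → ℝ := fun a => 2 * a * ε / (a ^ 2 + ε ^ 2) ^ 2 with hk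
  have hkc : Continuous k := Continuous.div (by fun_prop) (by fun_prop) fun a => by positivity
  set S : Set (ℝ × ℝ) := {p | |p.1 - x| ≤ p.2} with hS
  have hSm : MeasurableSet S := measurableSet_le (by fun_prop) (by fun_prop)
  have hpt : ∀ t ∈ closedBall x δ, ENNReal.ofReal (ε / ((t - x) ^ 2 + ε ^ 2)) * g t ≤
      (∫⁻ a in Ioc 0 δ, S.indicator (fun p => ENNReal.ofReal (k p.2) * g p.1) (t, a)) +
        ENNReal.ofReal (ε / (δ ^ 2 + ε ^ 2)) * g t := by
    intro t ht; rw [mem_closedBall, Real.dist_eq] at ht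
    have h1 := integral_deriv_poisson |t - x| δ hε
    rw [sq_abs] at h1
    have h2 : ENNReal.ofReal (∫ a in |t - x|..δ, k a) = ∫⁻ a in Ioc |t - x| δ, ENNReal.ofReal (k a) := by
      rw [intervalIntegral.integral_of_le ht]
      refine ofReal_integral_eq_lintegral_ofReal
        ((intervalIntegrable_iff_integrableOn_Ioc_of_le ht).1 (hkc.intervalIntegrable _ _)) ?_
      filter_upwards [ae_restrict_mem measurableSet_Ioc] with a ha
      have : 0 < a := (abs_nonneg _).trans_lt ha.1
      simp only [hk, Pi.zero_apply]; positivity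
    have h3 : ε / ((t - x) ^ 2 + ε ^ 2) = (∫ a in |t - x|..δ, k a) + ε / (δ ^ 2 + ε ^ 2) := by rw [h1]; ring
    rw [h3, ENNReal.ofReal_add (intervalIntegral.integral_nonneg ht fun a ha => by
      have : 0 ≤ a := (abs_nonneg _).trans ha.1
      simp only [hk]; positivity) (by positivity), add_mul]
    refine add_le_add_left ?_ _
    rw [h2, ← lintegral_mul_const _ (by fun_prop)]
    calc _ = ∫⁻ a in Ioc |t - x| δ, S.indicator (fun p => ENNReal.ofReal (k p.2) * g p.1) (t, a) := by
          refine setLIntegral_congr_fun measurableSet_Ioc fun a ha => ?_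
          rw [indicator_of_mem]; exact ha.1.le
      _ ≤ _ := lintegral_mono_set (Ioc_subset_Ioc_left (abs_nonneg _))
  have hjm : Measurable (S.indicator fun p : ℝ × ℝ => ENNReal.ofReal (k p.2) * g p.1) := by
    refine Measurable.indicator ?_ hSm
    exact ((hkc.measurable.comp measurable_snd).ennreal_ofReal).mul (hg.comp measurable_fst)
  calc _ ≤ ∫⁻ t in closedBall x δ, ((∫⁻ a in Ioc 0 δ, S.indicator (fun p => ENNReal.ofReal (k p.2) * g p.1) (t, a)) +
        ENNReal.ofReal (ε / (δ ^ 2 + ε ^ 2)) * g t) :=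
        setLIntegral_mono' isClosed_closedBall.measurableSet hpt
    _ = (∫⁻ a in Ioc 0 δ, ∫⁻ t in closedBall x δ, S.indicator (fun p => ENNReal.ofReal (k p.2) * g p.1) (t, a)) +
        ENNReal.ofReal (ε / (δ ^ 2 + ε ^ 2)) * ∫⁻ t in closedBall x δ, g t := by
        rw [lintegral_add_right _ (by fun_prop), lintegral_const_mul _ hg, lintegral_lintegral_swap
            (f := fun t a => S.indicator (fun p => ENNReal.ofReal (k p.2) * g p.1) (t, a))
            hjm.aemeasurable]
    _ ≤ (∫⁻ a in Ioc 0 δ, ENNReal.ofReal (η * (2 * (ε / ((a - 0) ^ 2 + ε ^ 2))))) + ENNReal.ofReal η := by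
        refine add_le_add ?_ ?_
        · refine setLIntegral_mono' measurableSet_Ioc fun a ha => ?_
          have e : ∀ t, S.indicator (fun p => ENNReal.ofReal (k p.2) * g p.1) (t, a) =
              (closedBall x a).indicator (fun t => ENNReal.ofReal (k a) * g t) t := by
            intro t
            by_cases hta : |t - x| ≤ a
            · rw [indicator_of_mem (show (t, a) ∈ S from hta), indicator_of_mem]
              rw [mem_closedBall, Real.dist_eq]; exact hta
            · rw [indicator_of_notMem (show (t, a) ∉ S from hta), indicator_of_notMem]
              rw [mem_closedBall, Real.dist_eq]; exact hta
          simp only [e]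
          have hka : 0 ≤ k a := by
            have := ha.1
            simp only [hk]; positivity
          calc _ ≤ ∫⁻ t, (closedBall x a).indicator (fun t => ENNReal.ofReal (k a) * g t) t :=
                setLIntegral_le_lintegral _ _
            _ = ENNReal.ofReal (k a) * ∫⁻ t in closedBall x a, g t := by
                rw [lintegral_indicator isClosed_closedBall.measurableSet, lintegral_const_mul _ hg]
            _ ≤ ENNReal.ofReal (k a) * ENNReal.ofReal (η * a) := by gcongr; exact h a ha.1 ha.2
            _ = ENNReal.ofReal (k a * (η * a)) := (ENNReal.ofReal_mul hka).symm
            _ ≤ _ := by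
                refine ENNReal.ofReal_le_ofReal ?_
                have hp : 0 < a ^ 2 + ε ^ 2 := by positivity
                have : k a * a ≤ 2 * (ε / ((a - 0) ^ 2 + ε ^ 2)) := by
                  simp only [hk, sub_zero]
                  rw [div_mul_eq_mul_div, ← mul_div_assoc, div_le_div_iff₀ (by positivity) hp]
                  nlinarith [mul_pos hε hp, mul_nonneg (sq_nonneg ε) (mul_pos hε hp).le]
                calc k a * (η * a) = η * (k a * a) := by ring
                  _ ≤ _ := mul_le_mul_of_nonneg_left this hη
        · refine (mul_le_mul_right (h δ hδ le_rfl) _).trans ?_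
          rw [← ENNReal.ofReal_mul (by positivity)]
          refine ENNReal.ofReal_le_ofReal ?_
          rw [div_mul_eq_mul_div, div_le_iff₀ (by positivity)]
          nlinarith [mul_nonneg hη (sq_nonneg (δ - ε)), mul_nonneg hη (by positivity : 0 ≤ ε * δ), mul_nonneg hη (sq_nonneg δ), mul_nonneg hη (sq_nonneg ε)]
    _ ≤ ENNReal.ofReal (η * (2 * π)) + ENNReal.ofReal η := by
        refine add_le_add_left ?_ _
        have hP := integral_poisson_univ 0 hε
        refine (setLIntegral_le_lintegral _ _).trans (le_of_eq ?_)
        rw [← ofReal_integral_eq_lintegral_ofReal ((hP.1.const_mul 2).const_mul η)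
          (.of_forall fun a => by simp only [Pi.zero_apply]; positivity), integral_const_mul, integral_const_mul, hP.2]
    _ = _ := by rw [← ENNReal.ofReal_add (by positivity) hη]; ring_nf

/-- Fatou's theorem: the Poisson integral of `f` tends to `f` almost everywhere. -/
lemma ae_tendsto_poisson (hfm : Measurable f) (hf : MemLp f 2) :
    ∀ᵐ x : ℝ, Tendsto (fun ε : ℝ => ∫ t, f t * (ε / ((t - x) ^ 2 + ε ^ 2))) (𝓝[>] 0) (𝓝 (π * f x)) := by
  have hloc : LocallyIntegrable f := hf.locallyIntegrable (by norm_num)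
  filter_upwards [IsUnifLocDoublingMeasure.ae_tendsto_average_norm_sub volume hloc 1] with x hx
  have hav : Tendsto (fun a : ℝ => ⨍ t in closedBall x a, ‖f t - f x‖) (𝓝[>] 0) (𝓝 0) := by
    refine hx (fun _ => x) id tendsto_id ?_
    filter_upwards [self_mem_nhdsWithin] with a ha
    exact mem_closedBall_self (by rw [one_mul]; exact le_of_lt ha)
  have hPint : ∀ ε : ℝ, 0 < ε → Integrable fun t : ℝ => f t * (ε / ((t - x) ^ 2 + ε ^ 2)) := by
    intro ε hε
    have hw : ((x : ℂ) + ε * I).im ≠ 0 := by simpa using hε.ne'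
    refine (hf.integrable_mul (memLp_im_cauchyKernel hw)).congr (.of_forall fun t => ?_)
    simp only [im_cauchyKernel]; simp
  have hfx : ∀ ε : ℝ, 0 < ε → Integrable fun t : ℝ => f x * (ε / ((t - x) ^ 2 + ε ^ 2)) :=
    fun ε hε => (integral_poisson_univ x hε).1.const_mul _
  have hdiff : ∀ ε : ℝ, 0 < ε → (∫ t, f t * (ε / ((t - x) ^ 2 + ε ^ 2))) - π * f x =
      ∫ t, (f t - f x) * (ε / ((t - x) ^ 2 + ε ^ 2)) := by
    intro ε hε; simp only [sub_mul]
    rw [integral_sub (hPint ε hε) (hfx ε hε), integral_const_mul, (integral_poisson_univ x hε).2]; ring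
  have hone : Integrable fun t : ℝ => |f t - f x| * (1 / ((t - x) ^ 2 + 1 ^ 2)) := by
    have h1 := ((hPint 1 one_pos).sub (hfx 1 one_pos)).norm
    refine h1.congr (.of_forall fun t => ?_)
    simp only [Pi.sub_apply, ← sub_mul, norm_mul, Real.norm_eq_abs]
    rw [abs_of_nonneg (by positivity : (0:ℝ) ≤ 1 / ((t - x) ^ 2 + 1 ^ 2))]
  set A := ∫ t : ℝ, |f t - f x| * (1 / ((t - x) ^ 2 + 1 ^ 2)) with hA
  have hA0 : 0 ≤ A := integral_nonneg fun t => by positivity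
  rw [tendsto_iff_norm_sub_tendsto_zero, Metric.tendsto_nhds]; intro r hr
  set η := r / (2 * (2 * π + 1)) with hη
  have hpi := Real.pi_pos
  have hη0 : 0 < η := by positivity
  have h1 := (Metric.tendsto_nhds.1 hav) (η / 2) (by positivity)
  obtain ⟨δ, hδ, hδ'⟩ := mem_nhdsGT_iff_exists_Ioc_subset.1 h1
  rw [mem_Ioi] at hδ
  have hball : ∀ a, 0 < a → a ≤ δ → ∫⁻ t in closedBall x a, ‖f t - f x‖ₑ ≤ ENNReal.ofReal (η * a) := by
    intro a ha haδ
    have h2 := hδ' ⟨ha, haδ⟩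
    simp only [mem_ofPred_eq, dist_zero_right] at h2
    have hint : IntegrableOn (fun t => f t - f x) (closedBall x a) :=
      (hloc.integrableOn_isCompact (isCompact_closedBall x a)).sub (integrableOn_const measure_closedBall_lt_top.ne)
    rw [setAverage_eq, Real.volume_real_closedBall ha.le, smul_eq_mul,
      Real.norm_of_nonneg (mul_nonneg (by positivity) (integral_nonneg fun t => norm_nonneg _)),
      inv_mul_lt_iff₀ (by positivity)] at h2
    rw [← ofReal_integral_norm_eq_lintegral_enorm hint]; exact ENNReal.ofReal_le_ofReal (by nlinarith)
  have hsmall : ∀ᶠ ε : ℝ in 𝓝[>] 0, ε * ((1 / δ ^ 2 + 1) * A) < r / 2 := by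
    have : Tendsto (fun ε : ℝ => ε * ((1 / δ ^ 2 + 1) * A)) (𝓝[>] 0) (𝓝 0) := by
      have h3 : Continuous fun ε : ℝ => ε * ((1 / δ ^ 2 + 1) * A) := by fun_prop
      simpa using (h3.tendsto 0).mono_left (nhdsWithin_le_nhds (s := Ioi 0))
    exact this.eventually (gt_mem_nhds (by positivity))
  filter_upwards [hsmall, self_mem_nhdsWithin] with ε hεs hε
  rw [mem_Ioi] at hε; rw [dist_zero_right, norm_norm, hdiff ε hε]
  have hgi : Integrable fun t : ℝ => |f t - f x| * (ε / ((t - x) ^ 2 + ε ^ 2)) := by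
    refine (((hPint ε hε).sub (hfx ε hε)).norm).congr (.of_forall fun t => ?_)
    simp only [Pi.sub_apply, ← sub_mul, norm_mul, Real.norm_eq_abs]
    rw [abs_of_nonneg (by positivity : (0:ℝ) ≤ ε / ((t - x) ^ 2 + ε ^ 2))]
  have hle : ‖∫ t, (f t - f x) * (ε / ((t - x) ^ 2 + ε ^ 2))‖ ≤ ∫ t : ℝ, |f t - f x| * (ε / ((t - x) ^ 2 + ε ^ 2)) := by
    refine norm_integral_le_of_norm_le hgi (.of_forall fun t => ?_)
    rw [norm_mul, Real.norm_eq_abs, Real.norm_of_nonneg (by positivity : (0:ℝ) ≤ ε / ((t - x) ^ 2 + ε ^ 2))]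
  refine hle.trans_lt ?_
  rw [← integral_add_compl (isClosed_closedBall (x := x) (ε := δ)).measurableSet hgi]
  have hin : ∫ t in closedBall x δ, |f t - f x| * (ε / ((t - x) ^ 2 + ε ^ 2)) ≤ r / 2 := by
    have h4 := lintegral_poisson_ball_le (g := fun t => ‖f t - f x‖ₑ) (by fun_prop) hδ hη0.le hball hε
    have h5 : η * (2 * π + 1) = r / 2 := by rw [hη]; field_simp
    rw [h5] at h4
    rw [integral_eq_lintegral_of_nonneg_ae (.of_forall fun t => by
      simp only [Pi.zero_apply]; positivity) hgi.aestronglyMeasurable.restrict]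
    refine ENNReal.toReal_le_of_le_ofReal (by positivity) (le_trans (le_of_eq ?_) h4)
    refine lintegral_congr fun t => ?_
    rw [mul_comm, ENNReal.ofReal_mul (by positivity), ← Real.norm_eq_abs, ofReal_norm]
  have hout : ∫ t in (closedBall x δ)ᶜ, |f t - f x| * (ε / ((t - x) ^ 2 + ε ^ 2)) ≤
      ε * ((1 / δ ^ 2 + 1) * A) := by
    calc _ ≤ ∫ t in (closedBall x δ)ᶜ,
          ε * ((1 / δ ^ 2 + 1) * (|f t - f x| * (1 / ((t - x) ^ 2 + 1 ^ 2)))) := by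
          refine setIntegral_mono_on hgi.integrableOn ((hone.const_mul _).const_mul _).integrableOn
            isClosed_closedBall.measurableSet.compl fun t ht => ?_
          have ht' : δ ^ 2 ≤ (t - x) ^ 2 := by
            rw [mem_compl_iff, mem_closedBall, Real.dist_eq, not_le] at ht; rw [← sq_abs (t - x)]; gcongr
          have hs : 0 < (t - x) ^ 2 := lt_of_lt_of_le (by positivity) ht'
          have : ε / ((t - x) ^ 2 + ε ^ 2) ≤ ε * ((1 / δ ^ 2 + 1) * (1 / ((t - x) ^ 2 + 1 ^ 2))) := by
            rw [div_eq_mul_one_div]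
            refine mul_le_mul_of_nonneg_left ?_ hε.le
            rw [mul_one_div, div_le_div_iff₀ (by positivity) (by positivity)]
            have h6 : 1 ≤ 1 / δ ^ 2 * (t - x) ^ 2 := by
              rw [one_div, inv_mul_eq_div, one_le_div (by positivity)]; exact ht'
            nlinarith [sq_nonneg ε, (by positivity : 0 ≤ 1 / δ ^ 2 * ε ^ 2)]
          calc _ ≤ |f t - f x| * (ε * ((1 / δ ^ 2 + 1) * (1 / ((t - x) ^ 2 + 1 ^ 2)))) := by
                gcongr
            _ = _ := by ring
      _ ≤ ∫ t, ε * ((1 / δ ^ 2 + 1) * (|f t - f x| * (1 / ((t - x) ^ 2 + 1 ^ 2)))) :=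
          setIntegral_le_integral ((hone.const_mul _).const_mul _)
            (.of_forall fun t => by simp only [Pi.zero_apply]; positivity)
      _ = _ := by rw [integral_const_mul, integral_const_mul]
  linarith

/-- `F` is analytic off the closed bounded set `S ⊆ ℝ`, maps the upper half plane to itself, is
real and strictly increasing on `ℝ \ S`. -/
structure IsPick (F : ℂ → ℂ) (S : Set ℝ) : Prop where
  closed : IsClosed S
  bounded : ∃ K : ℝ, S ⊆ Icc (-K) K
  differentiableAt : ∀ w : ℂ, (∀ x ∈ S, w ≠ (x : ℂ)) → DifferentiableAt ℂ F w
  im_pos : ∀ w : ℂ, 0 < w.im → 0 < (F w).im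
  conj_eq : ∀ w : ℂ, F (conj w) = conj (F w)
  deriv_pos : ∀ x : ℝ, x ∉ S → ∃ d : ℝ, 0 < d ∧ HasDerivAt F (d : ℂ) (x : ℂ)

lemma tendsto_add_mul_I (t : ℝ) :
    Tendsto (fun ε : ℝ => (t : ℂ) + ε * I) (𝓝[>] 0) (𝓝 (t : ℂ)) := by
  have : Continuous fun ε : ℝ => (t : ℂ) + ε * I := by fun_prop
  simpa using (this.tendsto 0).mono_left (nhdsWithin_le_nhds (s := Ioi 0))

/-- The argument of `F` tends to `a` vertically at `t`. -/
abbrev HasBoundaryArg (F : ℂ → ℂ) (t a : ℝ) : Prop := Tendsto (fun ε : ℝ => arg (F (t + ε * I))) (𝓝[>] 0) (𝓝 a)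

lemma boundaryArg_eq {f : ℂ → ℂ} {t l : ℝ} (h : HasBoundaryArg f t l) :
    boundaryArg f t = l := h.limUnder_eq

/-- `F` has boundary arguments, and these differ from `g` by an integrable function of bounded support. -/
structure HasRelativeArg (F : ℂ → ℂ) (g : ℝ → ℝ) : Prop where
  tendsto : ∀ᵐ t : ℝ, HasBoundaryArg F t (boundaryArg F t)
  eq_of_le : ∃ K : ℝ, ∀ᵐ t : ℝ, K ≤ |t| → boundaryArg F t = g t
  integrable : Integrable fun t => boundaryArg F t - g t

namespace IsPick

variable {F : ℂ → ℂ} {S : Set ℝ} (hF : IsPick F S)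
include hF

lemma differentiableAt_of_im (hw : w.im ≠ 0) : DifferentiableAt ℂ F w :=
  hF.differentiableAt w fun x _ h => hw (by rw [h]; simp)

lemma differentiableAt_ofReal (hx : x ∉ S) : DifferentiableAt ℂ F x :=
  hF.differentiableAt x fun y hy h => hx (by rwa [ofReal_inj.1 h])

lemma im_ofReal (x : ℝ) : (F x).im = 0 := by
  have := hF.conj_eq x
  rw [conj_ofReal] at this; exact conj_eq_iff_im.1 this.symm

lemma ofReal_re (x : ℝ) : ((F x).re : ℂ) = F x := Complex.ext (by simp) (by simp [hF.im_ofReal])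

lemma ne_zero (hw : w.im ≠ 0) : F w ≠ 0 := by
  rcases lt_or_gt_of_ne hw with h | h
  · intro h0
    have h1 := hF.im_pos (conj w) (by simpa using h)
    rw [hF.conj_eq, h0] at h1; simp at h1
  · intro h0
    have h1 := hF.im_pos w h
    rw [h0] at h1; simp at h1

lemma tendsto_vertical (ht : t ∉ S) :
    Tendsto (fun ε : ℝ => F (t + ε * I)) (𝓝[>] 0) (𝓝 (F t)) :=
  (hF.differentiableAt_ofReal ht).continuousAt.tendsto.comp (tendsto_add_mul_I t)

lemma tendsto_arg_of_pos (ht : t ∉ S) (h : 0 < (F t).re) :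
    HasBoundaryArg F t 0 := by
  have h1 : arg (F t) = 0 := by rw [← hF.ofReal_re t]; exact arg_ofReal_of_nonneg h.le
  have h2 := (continuousAt_arg (Or.inl h)).tendsto.comp (hF.tendsto_vertical ht)
  rwa [h1] at h2

lemma tendsto_arg_of_neg (ht : t ∉ S) (h : (F t).re < 0) :
    HasBoundaryArg F t π := by
  refine (tendsto_arg_nhdsWithin_im_nonneg_of_re_neg_of_im_zero h (hF.im_ofReal t)).comp ?_
  refine tendsto_nhdsWithin_iff.2 ⟨hF.tendsto_vertical ht, ?_⟩
  filter_upwards [self_mem_nhdsWithin] with ε hε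
  exact (hF.im_pos _ (by simpa using hε)).le

lemma boundaryArg_of_pos (ht : t ∉ S) (h : 0 < (F t).re) : boundaryArg F t = 0 :=
  boundaryArg_eq (hF.tendsto_arg_of_pos ht h)

lemma boundaryArg_of_neg (ht : t ∉ S) (h : (F t).re < 0) : boundaryArg F t = π :=
  boundaryArg_eq (hF.tendsto_arg_of_neg ht h)

lemma hasDerivAt_re (hx : x ∉ S) : ∃ d : ℝ, 0 < d ∧ HasDerivAt (fun t : ℝ => (F t).re) d x := by
  obtain ⟨d, hd, h⟩ := hF.deriv_pos x hx
  exact ⟨d, hd, by simpa using h.real_of_complex⟩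

lemma strictMonoOn {x y : ℝ} (h : Icc x y ⊆ Sᶜ) :
    StrictMonoOn (fun t : ℝ => (F t).re) (Icc x y) := by
  refine strictMonoOn_of_deriv_pos (convex_Icc x y) (fun t ht => ?_) fun t ht => ?_
  · obtain ⟨d, -, hd⟩ := hF.hasDerivAt_re (h ht)
    exact hd.continuousAt.continuousWithinAt
  · obtain ⟨d, hd0, hd⟩ := hF.hasDerivAt_re (h (interior_subset ht))
    rw [hd.deriv]; exact hd0

lemma ae_ne_zero : ∀ᵐ t : ℝ, t ∉ S → (F t).re ≠ 0 := by
  have : volume {t : ℝ | t ∉ S ∧ (F t).re = 0} = 0 := by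
    refine measure_null_of_locally_null _ fun x hx => ?_
    obtain ⟨d, hd0, hd⟩ := hF.hasDerivAt_re hx.1
    have h1 := hd.eventually_ne (c := 0) hd0.ne'
    refine ⟨{t : ℝ | t ∉ S ∧ (F t).re = 0} ∩ {x}, ?_, measure_mono_null inter_subset_right (by simp)⟩
    rw [eventually_nhdsWithin_iff] at h1; rw [mem_nhdsWithin_iff_eventually]
    filter_upwards [h1] with t ht hts
    refine ⟨hts, ?_⟩
    by_contra hne; exact ht hne hts.2
  filter_upwards [measure_eq_zero_iff_ae_notMem.1 this] with t ht hS h0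
  exact ht ⟨hS, h0⟩

lemma ae_boundaryArg_compl : ∀ᵐ t : ℝ, t ∉ S → (boundaryArg F t = 0 ∧ 0 < (F t).re) ∨
    (boundaryArg F t = π ∧ (F t).re < 0) := by
  filter_upwards [hF.ae_ne_zero] with t ht hS
  rcases lt_or_gt_of_ne (ht hS) with h | h
  · exact Or.inr ⟨hF.boundaryArg_of_neg hS h, h⟩
  · exact Or.inl ⟨hF.boundaryArg_of_pos hS h, h⟩

/-- Exponential representation relative to a reference function `G` with the same behaviour at
infinity. -/
lemma exists_exp_rep {G : ℂ → ℂ} {g : ℝ → ℝ} {C K : ℝ}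
    (hGd : ∀ w : ℂ, 0 < w.im → DifferentiableAt ℂ G w) (hGi : ∀ w : ℂ, 0 < w.im → 0 < (G w).im)
    (hGr : ∀ t : ℝ, K ≤ |t| → ContinuousAt G t ∧ G t ≠ 0)
    (hg : ∀ᵐ t : ℝ, HasBoundaryArg G t (g t))
    (hFG : ∀ w : ℂ, K ≤ ‖w‖ → ‖F w / G w - 1‖ ≤ C / ‖w‖)
    (hFGr : ∀ t : ℝ, (F t / G t).im = 0) :
    HasRelativeArg F g ∧ ∀ w : ℂ, 0 < w.im → F w = G w * exp (1 / π * ∫ t : ℝ, ((boundaryArg F t - g t : ℝ) : ℂ) * (1 / (t - w))) := by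
  set H : ℂ → ℂ := fun w => log (F w) - log (G w) with hH
  have hargF : ∀ w : ℂ, 0 < w.im → 0 < arg (F w) ∧ arg (F w) < π := by
    intro w hw
    have h := hF.im_pos w hw
    refine ⟨lt_of_le_of_ne (arg_nonneg_iff.2 h.le) fun h0 => ?_, arg_lt_pi_iff.2 (Or.inr h.ne')⟩
    exact h.ne' (arg_eq_zero_iff.1 h0.symm).2
  have hargG : ∀ w : ℂ, 0 < w.im → 0 < arg (G w) ∧ arg (G w) < π := by
    intro w hw
    have h := hGi w hw
    refine ⟨lt_of_le_of_ne (arg_nonneg_iff.2 h.le) fun h0 => ?_, arg_lt_pi_iff.2 (Or.inr h.ne')⟩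
    exact h.ne' (arg_eq_zero_iff.1 h0.symm).2
  have hne : ∀ z : ℂ, 0 < z.im → z ≠ 0 := by rintro z hz rfl; simp at hz
  have hHim : ∀ w, (H w).im = arg (F w) - arg (G w) := fun w => by simp [hH, log_im]
  have hexp : ∀ w : ℂ, 0 < w.im → exp (H w) = F w / G w := by
    intro w hw; rw [hH, exp_sub, exp_log (hne _ (hF.im_pos w hw)), exp_log (hne _ (hGi w hw))]
  have hlog : ∀ w : ℂ, 0 < w.im → H w = log (F w / G w) := by
    intro w hw; rw [← hexp w hw, log_exp]
    · rw [hHim]; linarith [(hargF w hw).1, (hargG w hw).2]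
    · rw [hHim]; linarith [(hargF w hw).2, (hargG w hw).1]
  have hHd : ∀ w : ℂ, 0 < w.im → DifferentiableAt ℂ H w := fun w hw =>
    ((hF.differentiableAt_of_im hw.ne').clog (Or.inr (hF.im_pos w hw).ne')).sub
      ((hGd w hw).clog (Or.inr (hGi w hw).ne'))
  obtain ⟨f, hfm, hf2, hrep⟩ := exists_density hHd (B := π) (C := 3 / 2 * C)
    (K := max (max K 1) (2 * |C|)) (fun w hw => by
      rw [hHim, abs_le]
      constructor <;> linarith [(hargF w hw).1, (hargG w hw).2, (hargF w hw).2, (hargG w hw).1])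
    (fun w hw hKw => by
      have h1 : K ≤ ‖w‖ := ((le_max_left _ _).trans (le_max_left _ _)).trans hKw
      have h2 : 1 ≤ ‖w‖ := ((le_max_right _ _).trans (le_max_left _ _)).trans hKw
      have h3 : 2 * |C| ≤ ‖w‖ := (le_max_right _ _).trans hKw
      have h4 := hFG w h1
      have h5 : ‖F w / G w - 1‖ ≤ 1 / 2 := by
        refine h4.trans ?_
        rw [div_le_div_iff₀ (by linarith) two_pos]; linarith [le_abs_self C]
      have h6 := norm_log_one_add_half_le_self h5
      rw [add_sub_cancel] at h6; rw [hlog w hw]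
      refine h6.trans ?_
      rw [mul_div_assoc]; exact mul_le_mul_of_nonneg_left h4 (by norm_num))
  have hPoi : ∀ x ε : ℝ, 0 < ε → ∫ t, f t * (ε / ((t - x) ^ 2 + ε ^ 2)) =
      π * (H (x + ε * I)).im := by
    intro x ε hε
    have hw : ((x : ℂ) + ε * I).im = ε := by simp
    have h1 := congrArg im (hrep (x + ε * I) (by rw [hw]; exact hε))
    rw [im_ofReal_mul] at h1
    rw [← h1, ← imCLM_apply, ← ContinuousLinearMap.integral_comp_comm _
      (integrable_mul_cauchyKernel hf2 (by rw [hw]; exact hε.ne'))]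
    refine integral_congr_ae (.of_forall fun t => ?_)
    simp only [imCLM_apply, im_ofReal_mul, im_cauchyKernel]; simp
  have hlim : ∀ᵐ x : ℝ, Tendsto (fun ε : ℝ => (H (x + ε * I)).im) (𝓝[>] 0) (𝓝 (f x)) := by
    filter_upwards [ae_tendsto_poisson hfm hf2] with x hx
    have h1 := hx.const_mul (1 / π)
    have e : 1 / π * (π * f x) = f x := by field_simp
    rw [e] at h1
    refine h1.congr' ?_
    filter_upwards [self_mem_nhdsWithin] with ε hε
    rw [hPoi x ε hε]; field_simp
  have hmain : ∀ᵐ t : ℝ, HasBoundaryArg F t (f t + g t) := by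
    filter_upwards [hlim, hg] with t h1 h2
    refine (h1.add h2).congr fun ε => ?_
    rw [hHim]; ring
  have hba : ∀ᵐ t : ℝ, boundaryArg F t = f t + g t := by filter_upwards [hmain] with t h1 using boundaryArg_eq h1
  have hfe : ∀ᵐ t : ℝ, f t = boundaryArg F t - g t := by
    filter_upwards [hba] with t h1
    rw [h1]; ring
  have hbd : ∀ᵐ t : ℝ, |f t| ≤ π := by
    filter_upwards [hlim] with t h1
    refine le_of_tendsto h1.abs ?_
    filter_upwards [self_mem_nhdsWithin] with ε hε
    have hw : 0 < ((t : ℂ) + ε * I).im := by simpa using hε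
    rw [hHim, abs_le]
    constructor <;> linarith [(hargF _ hw).1, (hargG _ hw).2, (hargF _ hw).2, (hargG _ hw).1]
  obtain ⟨K₁, hK₁⟩ := hF.bounded
  set K₂ := max (max K 1) (max (2 * |C| + 1) (|K₁| + 1)) with hK₂
  have hsupp : ∀ᵐ t : ℝ, K₂ ≤ |t| → f t = 0 := by
    filter_upwards [hlim] with t h1 ht
    have k1 : K ≤ |t| := ((le_max_left _ _).trans (le_max_left _ _)).trans ht
    have k2 : 1 ≤ |t| := ((le_max_right _ _).trans (le_max_left _ _)).trans ht
    have k3 : 2 * |C| + 1 ≤ |t| := ((le_max_left _ _).trans (le_max_right _ _)).trans ht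
    have k4 : |K₁| + 1 ≤ |t| := ((le_max_right _ _).trans (le_max_right _ _)).trans ht
    have htS : t ∉ S := fun h => by
      have := hK₁ h
      have h3 : |t| ≤ K₁ := abs_le.2 this
      linarith [le_abs_self K₁]
    have hq : Tendsto (fun ε : ℝ => F (t + ε * I) / G (t + ε * I)) (𝓝[>] 0) (𝓝 (F t / G t)) :=
      (hF.tendsto_vertical htS).div ((hGr t k1).1.tendsto.comp (tendsto_add_mul_I t)) (hGr t k1).2
    have h4 := hFG t (by simpa using k1)
    have h5 : ‖F t / G t - 1‖ < 1 := by
      refine h4.trans_lt ?_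
      rw [norm_ofReal, div_lt_one (by linarith)]; linarith [le_abs_self C, abs_nonneg C]
    have h6 : 0 < (F t / G t).re := by
      have := (abs_re_le_norm _).trans_lt h5
      rw [sub_re, one_re, abs_lt] at this; linarith
    have h7 : arg (F t / G t) = 0 := arg_eq_zero_iff.2 ⟨h6.le, hFGr t⟩
    have h8 := (continuousAt_arg (Or.inl h6)).tendsto.comp hq
    rw [h7] at h8
    refine tendsto_nhds_unique h1 (h8.congr' ?_)
    filter_upwards [self_mem_nhdsWithin] with ε hε
    rw [hlog _ (by simpa using hε), log_im]; rfl
  have hfint : Integrable f := by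
    have h1 : IntegrableOn f (Icc (-K₂) K₂) :=
      Measure.integrableOn_of_bounded (M := π) measure_Icc_lt_top.ne hfm.aestronglyMeasurable (ae_restrict_of_ae hbd)
    refine (integrable_indicator_iff measurableSet_Icc).2 h1 |>.congr ?_
    filter_upwards [hsupp] with t ht
    by_cases h : t ∈ Icc (-K₂) K₂
    · rw [indicator_of_mem h]
    · rw [indicator_of_notMem h, ht]
      by_contra h2; exact h (abs_le.1 (not_le.1 h2).le)
  refine ⟨⟨?_, ⟨K₂, ?_⟩, hfint.congr hfe⟩, fun w hw => ?_⟩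
  · filter_upwards [hmain, hba] with t h1 h2
    rw [h2]; exact h1
  · filter_upwards [hsupp, hba] with t h1 h2 h3
    rw [h2, h1 h3, zero_add]
  · have h1 : ∫ t : ℝ, ((boundaryArg F t - g t : ℝ) : ℂ) * (1 / (t - w)) = π * H w := by
      rw [← hrep w hw]
      refine integral_congr_ae ?_
      filter_upwards [hfe] with t h2
      rw [h2]
    rw [h1]
    have : (1 / π * (π * H w) : ℂ) = H w := by
      have : (π : ℂ) ≠ 0 := by exact_mod_cast Real.pi_ne_zero
      field_simp
    rw [this, hexp w hw, mul_div_cancel₀ _ (hne _ (hGi w hw))]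

end IsPick

lemma isPick_linear (hc : 0 < c) (x₀ : ℝ) : IsPick (fun w => c * (w - x₀)) ∅ where
  closed := isClosed_empty
  bounded := ⟨0, empty_subset _⟩
  differentiableAt w _ := by fun_prop
  im_pos w hw := by simpa using mul_pos hc hw
  conj_eq w := by simp
  deriv_pos x _ := ⟨c, hc, by simpa using ((hasDerivAt_id (x : ℂ)).sub_const (x₀ : ℂ)).const_mul (c : ℂ)⟩

lemma isPick_pole (hc : 0 < c) (x₀ : ℝ) : IsPick (fun w => c / (x₀ - w)) {x₀} where
  closed := isClosed_singleton
  bounded := ⟨|x₀|, by simpa using ⟨neg_abs_le x₀, le_abs_self x₀⟩⟩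
  differentiableAt w hw := by
    have : (x₀ : ℂ) - w ≠ 0 := sub_ne_zero.2 (hw x₀ rfl).symm
    fun_prop (disch := assumption)
  im_pos w hw := by
    have h : (x₀ : ℂ) - w ≠ 0 := fun h => by have := congrArg im h; simp at this; exact hw.ne' this
    rw [div_im]
    simp only [ofReal_im, ofReal_re, zero_mul, zero_div, zero_sub, sub_im, mul_neg, neg_div, neg_neg]
    exact div_pos (mul_pos hc hw) (normSq_pos.2 h)
  conj_eq w := by simp
  deriv_pos x hx := by
    have h : x₀ - x ≠ 0 := sub_ne_zero.2 fun h => hx h.symm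
    have h' : (x₀ : ℂ) - x ≠ 0 := by exact_mod_cast h
    refine ⟨c / (x₀ - x) ^ 2, by positivity, ?_⟩
    have h1 := (((hasDerivAt_id (x : ℂ)).const_sub (x₀ : ℂ)).inv h').const_mul (c : ℂ)
    refine h1.congr_deriv ?_ |>.congr_of_eventuallyEq (.of_forall fun w => ?_)
    · simp; ring
    · simp [div_eq_mul_inv]

namespace IsPick

variable {F : ℂ → ℂ} {S : Set ℝ} (hF : IsPick F S)
include hF

lemma exp_rep_of_reference {G : ℂ → ℂ} {S' : Set ℝ} {g : ℝ → ℝ} {C K : ℝ} (hG : IsPick G S')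
    (hG0 : ∀ t : ℝ, K ≤ |t| → t ∉ S' ∧ G t ≠ 0)
    (hg : ∀ᵐ t : ℝ, HasBoundaryArg G t (g t))
    (hFG : ∀ w : ℂ, K ≤ ‖w‖ → ‖F w / G w - 1‖ ≤ C / ‖w‖) :
    HasRelativeArg F g ∧ ∀ w : ℂ, w.im ≠ 0 → F w = G w * exp (1 / π * ∫ t : ℝ, ((boundaryArg F t - g t : ℝ) : ℂ) * (1 / (t - w))) := by
  obtain ⟨h1, h5⟩ := hF.exists_exp_rep (fun w hw => hG.differentiableAt_of_im hw.ne')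
    hG.im_pos (fun t ht => ⟨(hG.differentiableAt_ofReal (hG0 t ht).1).continuousAt, (hG0 t ht).2⟩)
    hg hFG (fun t => by rw [← hF.ofReal_re, ← hG.ofReal_re, ← ofReal_div]; simp)
  refine ⟨h1, fun w hw => ?_⟩
  rcases lt_or_gt_of_ne hw with hw | hw
  · have h6 := h5 (conj w) (by simpa using hw)
    rw [hF.conj_eq, hG.conj_eq] at h6
    have h7 := congrArg conj h6
    rw [conj_conj, map_mul, conj_conj, ← exp_conj, map_mul, ← integral_conj] at h7; rw [h7]
    congr 2; simp
  · exact h5 w hw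

lemma ae_boundaryArg_mem (h : ∀ᵐ t : ℝ, HasBoundaryArg F t (boundaryArg F t)) : ∀ᵐ t : ℝ, boundaryArg F t ∈ Icc 0 π := by
  filter_upwards [h] with t ht
  refine isClosed_Icc.mem_of_tendsto ht ?_
  filter_upwards [self_mem_nhdsWithin] with ε hε
  exact ⟨arg_nonneg_iff.2 (hF.im_pos _ (by simpa using hε)).le, arg_le_pi _⟩

open Classical in
lemma exp_rep_of_linear {c C K : ℝ} (hc : 0 < c) (h : ∀ w : ℂ, K ≤ ‖w‖ → ‖F w - c * w‖ ≤ C) (x₀ : ℝ) :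
    HasRelativeArg F (fun t => if t < x₀ then π else 0) ∧ ∀ w : ℂ, w.im ≠ 0 → F w = c * (w - x₀) * exp (1 / π *
      ∫ t : ℝ, ((boundaryArg F t - if t < x₀ then π else 0 : ℝ) : ℂ) * (1 / (t - w))) := by
  have hG := isPick_linear hc x₀
  have key := hF.exp_rep_of_reference (g := fun t => if t < x₀ then π else 0)
    (C := 2 * (|C| + c * |x₀|) / c) (K := max (max K 1) (2 * |x₀| + 1)) hG (fun t ht => ?_) ?_
    (fun w hw => ?_)
  · exact key
  · refine ⟨notMem_empty _, ?_⟩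
    have h1 : 2 * |x₀| + 1 ≤ |t| := (le_max_right _ _).trans ht
    have h2 : t - x₀ ≠ 0 := sub_ne_zero.2 fun h => by rw [h] at h1; linarith [abs_nonneg x₀]
    exact_mod_cast mul_ne_zero hc.ne' h2
  · filter_upwards [(compl_mem_ae_iff.2 (measure_singleton x₀) : {x₀}ᶜ ∈ ae volume)] with t ht
    rcases lt_or_gt_of_ne (show t ≠ x₀ from ht) with h1 | h1
    · rw [if_pos h1]
      refine hG.tendsto_arg_of_neg (notMem_empty _) ?_
      simp only [← ofReal_sub, ← ofReal_mul, ofReal_re]; exact mul_neg_of_pos_of_neg hc (by linarith)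
    · rw [if_neg h1.not_gt]
      refine hG.tendsto_arg_of_pos (notMem_empty _) ?_
      simp only [← ofReal_sub, ← ofReal_mul, ofReal_re]; exact mul_pos hc (by linarith)
  · have k1 : K ≤ ‖w‖ := ((le_max_left _ _).trans (le_max_left _ _)).trans hw
    have k2 : 1 ≤ ‖w‖ := ((le_max_right _ _).trans (le_max_left _ _)).trans hw
    have k3 : 2 * |x₀| + 1 ≤ ‖w‖ := (le_max_right _ _).trans hw
    have hb : ‖w‖ / 2 ≤ ‖w - x₀‖ := by
      have := norm_sub_norm_le w x₀
      rw [norm_ofReal] at this; linarith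
    have hne : (w - x₀ : ℂ) ≠ 0 := norm_pos_iff.1 (by linarith)
    have hcc : (c : ℂ) ≠ 0 := by exact_mod_cast hc.ne'
    have e : F w / (c * (w - x₀)) - 1 = (F w - c * w + c * x₀) / (c * (w - x₀)) := by field_simp; ring
    rw [e, norm_div, norm_mul, norm_ofReal, abs_of_pos hc, div_le_div_iff₀ (mul_pos hc (by linarith)) (by linarith)]
    have h3 : ‖F w - c * w + c * x₀‖ ≤ |C| + c * |x₀| := by
      refine (norm_add_le _ _).trans (add_le_add ((h w k1).trans (le_abs_self C)) ?_)
      rw [norm_mul, norm_real, norm_ofReal, Real.norm_eq_abs, abs_of_pos hc]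
    have h4 : 0 ≤ |C| + c * |x₀| := by positivity
    calc ‖F w - c * w + c * x₀‖ * ‖w‖ ≤ (|C| + c * |x₀|) * ‖w‖ := by gcongr
      _ ≤ (|C| + c * |x₀|) * (2 * ‖w - x₀‖) := by gcongr; linarith
      _ = 2 * (|C| + c * |x₀|) / c * (c * ‖w - x₀‖) := by field_simp

open Classical in
lemma exp_rep_of_decay {c C K : ℝ} (hc : 0 < c) (h : ∀ w : ℂ, K ≤ ‖w‖ → ‖w * F w + c‖ ≤ C / ‖w‖) (x₀ : ℝ) :
    HasRelativeArg F (fun t => if x₀ < t then π else 0) ∧ ∀ w : ℂ, w.im ≠ 0 → F w = c / (x₀ - w) * exp (1 / π *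
      ∫ t : ℝ, ((boundaryArg F t - if x₀ < t then π else 0 : ℝ) : ℂ) * (1 / (t - w))) := by
  have hG := isPick_pole hc x₀
  have key := hF.exp_rep_of_reference (g := fun t => if x₀ < t then π else 0)
    (C := (|x₀| * (c + |C|) + |C|) / c) (K := max (max K 1) (2 * |x₀| + 1)) hG (fun t ht => ?_) ?_
    (fun w hw => ?_)
  · exact key
  · have h1 : 2 * |x₀| + 1 ≤ |t| := (le_max_right _ _).trans ht
    have h2 : x₀ - t ≠ 0 := sub_ne_zero.2 fun h => by rw [← h] at h1; linarith [abs_nonneg x₀]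
    refine ⟨fun h => h2 (by rw [mem_singleton_iff.1 h, sub_self]), ?_⟩
    exact_mod_cast div_ne_zero hc.ne' h2
  · filter_upwards [(compl_mem_ae_iff.2 (measure_singleton x₀) : {x₀}ᶜ ∈ ae volume)] with t ht
    rcases lt_or_gt_of_ne (show t ≠ x₀ from ht) with h1 | h1
    · rw [if_neg h1.not_gt]
      refine hG.tendsto_arg_of_pos ht ?_
      simp only [← ofReal_sub, ← ofReal_div, ofReal_re]; exact div_pos hc (by linarith)
    · rw [if_pos h1]
      refine hG.tendsto_arg_of_neg ht ?_
      simp only [← ofReal_sub, ← ofReal_div, ofReal_re]; exact div_neg_of_pos_of_neg hc (by linarith)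
  · have k1 : K ≤ ‖w‖ := ((le_max_left _ _).trans (le_max_left _ _)).trans hw
    have k2 : 1 ≤ ‖w‖ := ((le_max_right _ _).trans (le_max_left _ _)).trans hw
    have hcc : (c : ℂ) ≠ 0 := by exact_mod_cast hc.ne'
    have e : F w / (c / (x₀ - w)) - 1 = (x₀ * F w - (w * F w + c)) / c := by field_simp; ring
    have h1 : ‖w * F w + c‖ ≤ |C| / ‖w‖ := (h w k1).trans (by gcongr; exact le_abs_self C)
    have hC1 : |C| / ‖w‖ ≤ |C| := div_le_self (abs_nonneg C) k2
    have h2 : ‖F w‖ ≤ (c + |C|) / ‖w‖ := by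
      rw [le_div_iff₀ (by linarith), mul_comm, ← norm_mul]
      calc ‖w * F w‖ = ‖(w * F w + c) - c‖ := by rw [add_sub_cancel_right]
        _ ≤ ‖w * F w + c‖ + ‖(c : ℂ)‖ := norm_sub_le _ _
        _ ≤ _ := by rw [norm_ofReal, abs_of_pos hc]; linarith
    rw [e, norm_div, norm_ofReal, abs_of_pos hc, div_div, mul_comm c, ← div_div]; gcongr
    calc ‖x₀ * F w - (w * F w + c)‖ ≤ ‖x₀ * F w‖ + ‖w * F w + c‖ := norm_sub_le _ _
      _ ≤ |x₀| * ((c + |C|) / ‖w‖) + |C| / ‖w‖ := by rw [norm_mul, norm_ofReal]; gcongr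
      _ = _ := by ring

end IsPick

/-- The Cauchy integral `∫ f(t) / (t - w) dt`. -/
def cauchyInt (f : ℝ → ℝ) (w : ℂ) : ℂ := ∫ t, f t * (1 / (t - w))

lemma norm_one_div_sub_sq_le (t : ℝ) (w : ℂ) : ‖1 / (t - w) ^ 2‖ = 1 / ((t - w.re) ^ 2 + w.im ^ 2) := by
  rw [norm_div, norm_one, norm_pow, Complex.sq_norm, normSq_apply]; simp; ring

lemma integrable_mul_cauchyKernel_sq (hf : Integrable f) (hw : w.im ≠ 0) :
    Integrable fun t : ℝ => f t * (1 / (t - w) ^ 2) := by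
  refine hf.ofReal.mul_bdd (c := 1 / w.im ^ 2) ?_ (.of_forall fun t => ?_)
  · exact (Continuous.div continuous_const (by fun_prop) fun t =>
      pow_ne_zero 2 (ofReal_sub_ne_zero hw t)).aestronglyMeasurable
  · rw [norm_one_div_sub_sq_le]
    have : 0 < w.im ^ 2 := by positivity
    gcongr; nlinarith [sq_nonneg (t - w.re)]

lemma integrable_mul_cauchyKernel' (hf : Integrable f)
    (hw : w.im ≠ 0) : Integrable fun t : ℝ => f t * (1 / (t - w)) := by
  refine hf.ofReal.mul_bdd (c := 1 / |w.im|) ?_ (.of_forall fun t => ?_)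
  · exact (Continuous.div continuous_const (by fun_prop) fun t => ofReal_sub_ne_zero hw t).aestronglyMeasurable
  · rw [norm_div, norm_one]
    have : 0 < |w.im| := abs_pos.2 hw
    gcongr; exact abs_im_le_norm_ofReal_sub w t

lemma hasDerivAt_cauchyInt (hf : Integrable f) (hw : w.im ≠ 0) :
    HasDerivAt (cauchyInt f) (∫ t, f t * (1 / (t - w) ^ 2)) w := by
  have hpos : 0 < |w.im| / 2 := half_pos (abs_pos.2 hw)
  have him : ∀ x ∈ ball w (|w.im| / 2), |w.im| / 2 ≤ |x.im| := by
    intro x hx; rw [mem_ball, dist_eq_norm] at hx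
    have h1 := (abs_im_le_norm (x - w)).trans_lt hx
    rw [sub_im] at h1
    have h2 := abs_sub_abs_le_abs_sub w.im x.im
    rw [abs_sub_comm] at h2; linarith
  have hne : ∀ x ∈ ball w (|w.im| / 2), x.im ≠ 0 := fun x hx h0 => by
    have := him x hx
    rw [h0, abs_zero] at this; linarith
  refine (hasDerivAt_integral_of_dominated_loc_of_deriv_le (bound := fun t => |f t| * (1 / (|w.im| / 2) ^ 2))
    (ball_mem_nhds w hpos) (F' := fun z t => f t * (1 / (t - z) ^ 2)) ?_
    (integrable_mul_cauchyKernel' hf hw)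
    (integrable_mul_cauchyKernel_sq hf hw).aestronglyMeasurable ?_ (hf.abs.mul_const _) ?_).2
  · filter_upwards [ball_mem_nhds w hpos] with x hx
    exact (integrable_mul_cauchyKernel' hf (hne x hx)).aestronglyMeasurable
  · refine .of_forall fun t x hx => ?_
    rw [norm_mul, norm_ofReal, norm_one_div_sub_sq_le]; gcongr
    calc (|w.im| / 2) ^ 2 ≤ |x.im| ^ 2 := by gcongr; exact him x hx
      _ ≤ _ := by rw [sq_abs]; nlinarith [sq_nonneg (t - x.re)]
  · refine .of_forall fun t x hx => ?_
    have h0 := ofReal_sub_ne_zero (hne x hx) t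
    have h1 := (((hasDerivAt_id x).const_sub (t : ℂ)).inv h0).const_mul (f t : ℂ)
    refine (h1.congr_deriv ?_).congr_of_eventuallyEq (.of_forall fun z => ?_)
    · simp
    · simp [div_eq_mul_inv]

lemma integral_holder_kernel_le {r : ℝ} (hr0 : 0 < r) (hr1 : r < 1) :
    ∃ A : ℝ, 0 ≤ A ∧ ∀ x y : ℝ, 0 < y → Integrable (fun t : ℝ => |t - x| ^ r / ((t - x) ^ 2 + y ^ 2)) ∧
      ∫ t : ℝ, |t - x| ^ r / ((t - x) ^ 2 + y ^ 2) ≤ A * y ^ (r - 1) := by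
  set φ : ℝ → ℝ := fun s => (1 + s ^ 2) ^ (r / 2 - 1) with hφ
  have hφi : Integrable φ := by
    have := integrable_rpow_neg_one_add_norm_sq (E := ℝ) (μ := volume) (r := 2 - r) (by simp; linarith)
    refine this.congr (.of_forall fun s => ?_)
    simp only [hφ, Real.norm_eq_abs, sq_abs]
    congr 1; ring
  have hφ0 : ∀ s, 0 ≤ φ s := fun s => by positivity
  refine ⟨∫ s, φ s, integral_nonneg hφ0, fun x y hy => ?_⟩
  have hle : ∀ t : ℝ, |t - x| ^ r / ((t - x) ^ 2 + y ^ 2) ≤ y ^ (r - 2) * φ ((t - x) / y) := by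
    intro t
    set s := (t - x) / y with hs
    have e : t - x = y * s := by rw [hs]; field_simp
    have h1 : |s| ^ r ≤ (1 + s ^ 2) ^ (r / 2) := by
      rw [show r = 2 * (r / 2) by ring, Real.rpow_mul (abs_nonneg s)]; norm_num; gcongr; linarith
    have e2 : y ^ (r - 2) = y ^ r / y ^ 2 := by rw [Real.rpow_sub hy]; norm_num
    have e3 : φ s = (1 + s ^ 2) ^ (r / 2) / (1 + s ^ 2) := by
      rw [hφ]; simp only []; rw [Real.rpow_sub (by positivity), Real.rpow_one]
    rw [e, e2, e3, abs_mul, abs_of_pos hy, Real.mul_rpow hy.le (abs_nonneg s),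
      show (y * s) ^ 2 + y ^ 2 = y ^ 2 * (1 + s ^ 2) by ring, mul_div_mul_comm]
    gcongr
  have hint : Integrable fun t : ℝ => y ^ (r - 2) * φ ((t - x) / y) :=
    ((hφi.comp_div hy.ne').comp_sub_right x).const_mul _
  have hint' : Integrable (fun t : ℝ => |t - x| ^ r / ((t - x) ^ 2 + y ^ 2)) := by
    refine hint.mono' ?_ (.of_forall fun t => ?_)
    · exact Measurable.aestronglyMeasurable (by fun_prop)
    · rw [Real.norm_of_nonneg (by positivity)]; exact hle t
  refine ⟨hint', (integral_mono hint' hint hle).trans (le_of_eq ?_)⟩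
  rw [integral_const_mul, integral_sub_right_eq_self (fun t => φ (t / y)) x,
    Measure.integral_comp_div φ y, abs_of_pos hy, smul_eq_mul, ← mul_assoc,
    show r - 1 = (r - 2) + 1 by ring, Real.rpow_add_one hy.ne']
  ring

/-- The Hardy–Littlewood bound for the derivative of a Cauchy integral. -/
lemma norm_deriv_cauchyInt_le {f h : ℝ → ℝ} {a b a' b' K r : ℝ} (hf : Integrable f)
    (hfh : ∀ᵐ t : ℝ, t ∈ Ioo a b → f t = h t) (hK : 0 ≤ K) (hr0 : 0 < r) (hr1 : r < 1)
    (hh : ∀ s ∈ Ioo a b, ∀ t ∈ Ioo a b, |h s - h t| ≤ K * |s - t| ^ r)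
    (ha : a < a') (hab : a' ≤ b') (hb : b' < b) :
    ∃ C : ℝ, 0 ≤ C ∧ ∀ w : ℂ, w.re ∈ Icc a' b' → 0 < w.im → ‖∫ t, f t * (1 / (t - w) ^ 2)‖ ≤ C * w.im ^ (r - 1) := by
  obtain ⟨A, hA0, hA⟩ := integral_holder_kernel_le hr0 hr1
  set d := min (a' - a) (b - b') with hd
  have hd0 : 0 < d := lt_min (by linarith) (by linarith)
  have hd1 : d ≤ a' - a := min_le_left _ _
  have hd2 : d ≤ b - b' := min_le_right _ _
  set B := |h a'| + K * (b' - a') ^ r with hB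
  have hB0 : 0 ≤ B := by
    have : 0 ≤ b' - a' := by linarith
    positivity
  set I := ∫ t, |f t| with hI
  have hI0 : 0 ≤ I := integral_nonneg fun t => abs_nonneg _
  have hbound : ∀ x ∈ Icc a' b', |h x| ≤ B := by
    intro x hx
    have h1 := hh x ⟨by linarith [hx.1], by linarith [hx.2]⟩ a' ⟨by linarith, by linarith⟩
    have h2 : |x - a'| ^ r ≤ (b' - a') ^ r := by gcongr; rw [abs_of_nonneg (by linarith [hx.1])]; linarith [hx.2]
    have h3 := abs_sub_abs_le_abs_sub (h x) (h a')
    have h4 : K * |x - a'| ^ r ≤ K * (b' - a') ^ r := by gcongr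
    rw [hB]; linarith
  refine ⟨K * A + B * (2 / d) + I / d ^ 2 + I, by positivity, fun w hx hy => ?_⟩
  have hyr : 0 < w.im ^ (r - 1) := Real.rpow_pos_of_pos hy _
  rcases le_total 1 w.im with h1 | h1
  · have h2 : ‖∫ t, f t * (1 / (t - w) ^ 2)‖ ≤ I * w.im ^ (r - 1) := by
      refine (norm_integral_le_integral_norm _).trans ?_
      rw [hI, ← integral_mul_const]
      refine integral_mono (integrable_mul_cauchyKernel_sq hf hy.ne').norm (hf.abs.mul_const _) fun t => ?_
      simp only [norm_mul, norm_ofReal, norm_one_div_sub_sq_le]; gcongr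
      calc 1 / ((t - w.re) ^ 2 + w.im ^ 2) ≤ 1 / w.im ^ 2 := by
            gcongr; nlinarith [sq_nonneg (t - w.re)]
        _ = w.im ^ (-2 : ℝ) := by rw [Real.rpow_neg hy.le]; norm_num
        _ ≤ w.im ^ (r - 1) := Real.rpow_le_rpow_of_exponent_le h1 (by linarith)
    refine h2.trans ?_
    gcongr
    have : 0 ≤ K * A + B * (2 / d) + I / d ^ 2 := by positivity
    linarith
  · have hy1 : 1 ≤ w.im ^ (r - 1) := by
      have := Real.one_le_rpow_of_pos_of_le_one_of_nonpos hy h1 (show r - 1 ≤ 0 by linarith)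
      exact this
    have hint := integrable_mul_cauchyKernel_sq hf hy.ne'
    rw [← integral_add_compl measurableSet_Ioo hint (s := Ioo a b)]
    have hxab : w.re ∈ Ioo a b := ⟨by linarith [hx.1], by linarith [hx.2]⟩
    have hout : ‖∫ t in (Ioo a b)ᶜ, f t * (1 / (t - w) ^ 2)‖ ≤ I / d ^ 2 := by
      refine (norm_integral_le_integral_norm _).trans ?_
      calc ∫ t in (Ioo a b)ᶜ, ‖f t * (1 / (t - w) ^ 2)‖ ≤ ∫ t in (Ioo a b)ᶜ, |f t| * (1 / d ^ 2) := by
            refine setIntegral_mono_on hint.norm.integrableOn (hf.abs.mul_const _).integrableOn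
              measurableSet_Ioo.compl fun t ht => ?_
            rw [norm_mul, norm_ofReal, norm_one_div_sub_sq_le]; gcongr
            have h2 : d ^ 2 ≤ (t - w.re) ^ 2 := by
              rw [mem_compl_iff, mem_Ioo, not_and_or, not_lt, not_lt] at ht
              rcases ht with ht | ht
              · rw [← neg_sq (t - w.re)]; gcongr; linarith [hx.1]
              · gcongr; linarith [hx.2]
            nlinarith [sq_nonneg w.im]
        _ ≤ ∫ t, |f t| * (1 / d ^ 2) :=
            setIntegral_le_integral (hf.abs.mul_const _) (.of_forall fun t => by simp only [Pi.zero_apply]; positivity)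
        _ = I / d ^ 2 := by rw [integral_mul_const]; ring
    have hftc : ∫ t in Ioo a b, (1 / (t - w) ^ 2 : ℂ) = 1 / (a - w) - 1 / (b - w) := by
      rw [← integral_Ioc_eq_integral_Ioo, ← intervalIntegral.integral_of_le (by linarith)]
      have : ∀ t ∈ uIcc a b, HasDerivAt (fun t : ℝ => -(1 / (t - w))) (1 / (t - w) ^ 2) t := by
        intro t _
        have h0 := ofReal_sub_ne_zero hy.ne' t
        have h1 : HasDerivAt (fun s : ℂ => -(1 / (s - w))) (1 / (t - w) ^ 2) (t : ℂ) := by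
          have := (((hasDerivAt_id (t : ℂ)).sub_const w).inv h0).neg
          refine (this.congr_deriv ?_).congr_of_eventuallyEq (.of_forall fun z => ?_)
          · simp [neg_div]
          · simp
        exact h1.comp_ofReal
      rw [intervalIntegral.integral_eq_sub_of_hasDerivAt this]
      · ring
      · apply Continuous.intervalIntegrable
        exact Continuous.div continuous_const (by fun_prop) fun t => pow_ne_zero 2 (ofReal_sub_ne_zero hy.ne' t)
    have hconst : ‖∫ t in Ioo a b, h w.re * (1 / (t - w) ^ 2)‖ ≤ B * (2 / d) := by
      rw [integral_const_mul, hftc, norm_mul, norm_ofReal]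
      refine mul_le_mul (hbound _ hx) ?_ (norm_nonneg _) hB0
      have k1 : ‖1 / (a - w)‖ ≤ 1 / d := by
        rw [norm_div, norm_one]; gcongr
        have := abs_re_le_norm (a - w)
        rw [sub_re, ofReal_re, abs_sub_comm, abs_of_nonneg (by linarith [hx.1])] at this; linarith [hx.1]
      have k2 : ‖1 / (b - w)‖ ≤ 1 / d := by
        rw [norm_div, norm_one]; gcongr
        have := abs_re_le_norm (b - w)
        rw [sub_re, ofReal_re, abs_of_nonneg (by linarith [hx.2])] at this; linarith [hx.2]
      calc _ ≤ 1 / d + 1 / d := (norm_sub_le _ _).trans (add_le_add k1 k2)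
        _ = 2 / d := by ring
    have hcint : IntegrableOn (fun t : ℝ => h w.re * (1 / (t - w) ^ 2)) (Ioo a b) := by
      refine Integrable.const_mul ?_ _
      have : ContinuousOn (fun t : ℝ => 1 / (t - w) ^ 2) (Icc a b) :=
        (Continuous.div continuous_const (by fun_prop) fun t =>
          pow_ne_zero 2 (ofReal_sub_ne_zero hy.ne' t)).continuousOn
      exact this.integrableOn_Icc.mono_set Ioo_subset_Icc_self
    have hhol : ‖∫ t in Ioo a b, (f t * (1 / (t - w) ^ 2) -
        h w.re * (1 / (t - w) ^ 2))‖ ≤ K * A * w.im ^ (r - 1) := by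
      refine (norm_integral_le_integral_norm _).trans ?_
      calc ∫ t in Ioo a b, ‖f t * (1 / (t - w) ^ 2) - h w.re * (1 / (t - w) ^ 2)‖
          ≤ ∫ t in Ioo a b, K * (|t - w.re| ^ r / ((t - w.re) ^ 2 + w.im ^ 2)) := by
            refine setIntegral_mono_ae_restrict (hint.integrableOn.sub hcint).norm
              ((hA w.re w.im hy).1.const_mul K).integrableOn ?_
            filter_upwards [ae_restrict_of_ae hfh, ae_restrict_mem measurableSet_Ioo] with t h2 ht
            rw [h2 ht, ← sub_mul, norm_mul, norm_one_div_sub_sq_le, ← ofReal_sub,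
              norm_ofReal, mul_one_div, ← mul_div_assoc]
            gcongr; exact hh t ht _ hxab
        _ ≤ ∫ t, K * (|t - w.re| ^ r / ((t - w.re) ^ 2 + w.im ^ 2)) :=
            setIntegral_le_integral ((hA w.re w.im hy).1.const_mul K) (.of_forall fun t => by
              simp only [Pi.zero_apply]; positivity)
        _ ≤ _ := by rw [integral_const_mul, mul_assoc]; exact mul_le_mul_of_nonneg_left (hA w.re w.im hy).2 hK
    rw [integral_sub hint.integrableOn hcint] at hhol
    have e : ∫ t in Ioo a b, f t * (1 / (t - w) ^ 2) = ((∫ t in Ioo a b, f t * (1 / (t - w) ^ 2)) -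
        ∫ t in Ioo a b, h w.re * (1 / (t - w) ^ 2)) +
      ∫ t in Ioo a b, h w.re * (1 / (t - w) ^ 2) := by ring
    rw [e]
    refine (norm_add₃_le).trans ?_
    have h5 : 0 ≤ B * (2 / d) := by positivity
    have h6 : 0 ≤ I / d ^ 2 := by positivity
    nlinarith [mul_le_mul_of_nonneg_left hy1 h5, mul_le_mul_of_nonneg_left hy1 h6, mul_nonneg hI0 hyr.le]

lemma integral_rpow_sub_one_bound {Φ : ℂ → ℂ} {Φ' : ℂ → ℂ} {C r x y δ : ℝ} (hr : 0 < r) (hr1 : r < 1)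
    (hC : 0 ≤ C) (hy : 0 < y) (hδ : 0 ≤ δ)
    (hd : ∀ w : ℂ, 0 < w.im → HasDerivAt Φ (Φ' w) w)
    (hb : ∀ w : ℂ, w.re = x → 0 < w.im → ‖Φ' w‖ ≤ C * w.im ^ (r - 1)) :
    ‖Φ (x + (y + δ : ℝ) * I) - Φ (x + y * I)‖ ≤ C / r * δ ^ r := by
  have hpath : ∀ s : ℝ, 0 < s → HasDerivAt (fun s : ℝ => Φ (x + s * I)) (Φ' (x + s * I) * I) s := by
    intro s hs
    have h1 : HasDerivAt (fun s : ℂ => (x : ℂ) + s * I) I (s : ℂ) := by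
      simpa using ((hasDerivAt_id (s : ℂ)).mul_const I).const_add (x : ℂ)
    exact (HasDerivAt.comp (s : ℂ) (hd _ (by simpa using hs)) h1).comp_ofReal
  have key := image_norm_le_of_norm_deriv_right_le_deriv_boundary'
    (f := fun s : ℝ => Φ (x + s * I) - Φ (x + y * I)) (a := y) (b := y + δ)
    (f' := fun s : ℝ => Φ' (x + s * I) * I)
    (B := fun s => C / r * (s ^ r - y ^ r)) (B' := fun s => C * s ^ (r - 1))
    (fun s hs => ((hpath s (hy.trans_le hs.1)).sub_const _).continuousAt.continuousWithinAt)
    (fun s hs => ((hpath s (hy.trans_le hs.1)).sub_const _).hasDerivWithinAt)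
    (by simp)
    (fun s hs => by
      have : s ≠ 0 := (hy.trans_le hs.1).ne'
      exact (ContinuousAt.mul continuousAt_const ((Real.continuousAt_rpow_const _ _ (Or.inl this)).sub
        continuousAt_const)).continuousWithinAt)
    (fun s hs => by
      have h0 : s ≠ 0 := (hy.trans_le hs.1).ne'
      have := (((Real.hasDerivAt_rpow_const (p := r) (Or.inl h0)).sub_const (y ^ r)).const_mul (C / r))
      refine (this.congr_deriv ?_).hasDerivWithinAt
      field_simp)
    (fun s hs => by
      have hs0 : 0 < s := hy.trans_le hs.1
      have := hb (x + s * I) (by simp) (by simpa using hs0)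
      rw [norm_mul, norm_I, mul_one]; simpa using this)
    (right_mem_Icc.2 (by linarith))
  refine key.trans ?_
  have := Real.rpow_add_le_add_rpow hy.le hδ hr.le hr1.le
  have h0 : 0 ≤ C / r := by positivity
  have h2 : (y + δ) ^ r - y ^ r ≤ δ ^ r := by linarith
  exact mul_le_mul_of_nonneg_left h2 h0

/-- A Cauchy integral of a locally Hölder continuous function has Hölder continuous boundary
values. -/
lemma exists_cauchyInt_boundary {a b a' b' : ℝ} (hf : Integrable f)
    (hfh : IsAEHolderOn f (Ioo a b)) (ha : a < a') (hab : a' < b') (hb : b' < b) :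
    ∃ (Φ : ℝ → ℂ) (C r : ℝ), 0 < r ∧ r < 1 ∧
      (∀ x ∈ Ioo a' b', Tendsto (cauchyInt f) (𝓝[{w | 0 < w.im}] (x : ℂ)) (𝓝 (Φ x))) ∧
      ∀ x ∈ Ioo a' b', ∀ y ∈ Ioo a' b', ‖Φ x - Φ y‖ ≤ C * |x - y| ^ r := by
  obtain ⟨K, r, h, hr, hh, hfh⟩ := hfh
  have hh' := hh.of_le (D := Real.toNNReal (b - a)) (s := min r (1 / 2)) (fun s hs t ht => by
    rw [edist_dist, Real.dist_eq]
    refine ENNReal.ofReal_le_ofReal ?_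
    rw [abs_le]; constructor <;> linarith [hs.1, hs.2, ht.1, ht.2]) (min_le_left _ _)
  set r' : ℝ≥0 := min r (1 / 2) with hr'
  have hr0 : (0:ℝ) < r' := by
    have : 0 < r' := lt_min hr (by norm_num)
    exact_mod_cast this
  have hr1 : (r' : ℝ) < 1 := by
    have : r' ≤ 1 / 2 := min_le_right _ _
    have : (r' : ℝ) ≤ 1 / 2 := by exact_mod_cast this
    linarith
  obtain ⟨C, hC0, hC⟩ := norm_deriv_cauchyInt_le hf hfh (NNReal.coe_nonneg
    (K * Real.toNNReal (b - a) ^ ((r : ℝ) - r'))) hr0 hr1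
    (fun s hs t ht => by
      have := hh'.dist_le hs ht
      rwa [Real.dist_eq, Real.dist_eq] at this) ha hab.le hb
  set Φ₀ := cauchyInt f
  have hd : ∀ w : ℂ, 0 < w.im → HasDerivAt Φ₀ (∫ t, f t * (1 / (t - w) ^ 2)) w :=
    fun w hw => hasDerivAt_cauchyInt hf hw.ne'
  set D := C / r' + C + C / r' with hD
  have hD0 : 0 ≤ D := by positivity
  have hol : ∀ w₁ w₂ : ℂ, w₁.re ∈ Icc a' b' → w₂.re ∈ Icc a' b' → 0 < w₁.im → 0 < w₂.im →
      ‖Φ₀ w₁ - Φ₀ w₂‖ ≤ D * ‖w₁ - w₂‖ ^ (r' : ℝ) := by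
    intro w₁ w₂ h1 h2 i1 i2
    set δ := ‖w₁ - w₂‖ with hδ
    rcases (norm_nonneg (w₁ - w₂)).eq_or_lt with h0 | h0
    · have : w₁ = w₂ := sub_eq_zero.1 (norm_eq_zero.1 h0.symm)
      rw [this, sub_self, norm_zero]; positivity
    have up : ∀ w : ℂ, w.re ∈ Icc a' b' → 0 < w.im → ‖Φ₀ (w + δ * I) - Φ₀ w‖ ≤ C / r' * δ ^ (r' : ℝ) := by
      intro w hw hi
      have := integral_rpow_sub_one_bound (x := w.re) (δ := δ) hr0 hr1 hC0 hi h0.le hd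
        (fun v hv hvi => hC v (by rw [hv]; exact hw) hvi)
      have e : (w.re : ℂ) + w.im * I = w := re_add_im w
      have e2 : (w.re : ℂ) + (w.im + δ : ℝ) * I = w + δ * I := by
        conv_rhs => rw [← re_add_im w]
        push_cast; ring
      rwa [e, e2] at this
    have across : ‖Φ₀ (w₁ + δ * I) - Φ₀ (w₂ + δ * I)‖ ≤ C * δ ^ (r' : ℝ) := by
      set s : Set ℂ := {w | w.re ∈ Icc a' b' ∧ δ ≤ w.im} with hs
      have hconv : Convex ℝ s := by
        have : s = reCLM ⁻¹' Icc a' b' ∩ imCLM ⁻¹' Ici δ := by ext w; simp [hs]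
        rw [this]
        exact ((convex_Icc a' b').is_linear_preimage reCLM.isLinear).inter
          ((convex_Ici δ).is_linear_preimage imCLM.isLinear)
      have := hconv.norm_image_sub_le_of_norm_hasDerivWithin_le (f := Φ₀) (C := C * δ ^ ((r' : ℝ) - 1))
        (fun w hw => (hd w (h0.trans_le hw.2)).hasDerivWithinAt) (fun w hw => by
          refine (hC w hw.1 (h0.trans_le hw.2)).trans ?_
          gcongr ?_ * ?_; exact Real.rpow_le_rpow_of_nonpos h0 hw.2 (by linarith))
        (x := w₂ + δ * I) (y := w₁ + δ * I)
        ⟨by simpa using h2, by simpa using i2.le⟩ ⟨by simpa using h1, by simpa using i1.le⟩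
      refine this.trans (le_of_eq ?_)
      rw [add_sub_add_right_eq_sub, ← hδ, mul_assoc, ← Real.rpow_add_one h0.ne', sub_add_cancel]
    calc ‖Φ₀ w₁ - Φ₀ w₂‖ = ‖-(Φ₀ (w₁ + δ * I) - Φ₀ w₁) +
          (Φ₀ (w₁ + δ * I) - Φ₀ (w₂ + δ * I)) + (Φ₀ (w₂ + δ * I) - Φ₀ w₂)‖ := by congr 1; ring
      _ ≤ C / r' * δ ^ (r' : ℝ) + C * δ ^ (r' : ℝ) + C / r' * δ ^ (r' : ℝ) := by
          refine norm_add₃_le.trans ?_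
          rw [norm_neg]; exact add_le_add (add_le_add (up w₁ h1 i1) across) (up w₂ h2 i2)
      _ = D * δ ^ (r' : ℝ) := by rw [hD]; ring
  set s : Set ℂ := {w | w.re ∈ Icc a' b' ∧ 0 < w.im} with hs
  have hmem : ∀ x ∈ Ioo a' b', s ∈ 𝓝[{w : ℂ | 0 < w.im}] (x : ℂ) := by
    intro x hx
    have h1 : {w : ℂ | w.re ∈ Ioo a' b'} ∈ 𝓝 (x : ℂ) := (isOpen_Ioo.preimage continuous_re).mem_nhds (by simpa using hx)
    filter_upwards [mem_nhdsWithin_of_mem_nhds h1, self_mem_nhdsWithin] with w h2 h3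
    exact ⟨Ioo_subset_Icc_self h2, h3⟩
  have hneb : ∀ x : ℝ, (𝓝[{w : ℂ | 0 < w.im}] (x : ℂ)).NeBot := by
    intro x
    refine Tendsto.neBot (x := 𝓝[>] (0:ℝ)) (f := fun ε : ℝ => (x : ℂ) + ε * I) ?_
    refine tendsto_nhdsWithin_iff.2 ⟨tendsto_add_mul_I x, ?_⟩
    filter_upwards [self_mem_nhdsWithin] with ε hε
    simpa using hε
  have hex : ∀ x ∈ Ioo a' b', ∃ l, Tendsto Φ₀ (𝓝[{w | 0 < w.im}] (x : ℂ)) (𝓝 l) := by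
    intro x hx
    have := hneb x
    refine CompleteSpace.complete (f := map Φ₀ (𝓝[{w | 0 < w.im}] (x : ℂ))) ?_
    refine Metric.cauchy_iff.2 ⟨inferInstance, fun ε hε => ?_⟩
    have h1 : Tendsto (fun u : ℝ => D * u ^ (r' : ℝ)) (𝓝 0) (𝓝 0) := by
      have : Continuous fun u : ℝ => D * u ^ (r' : ℝ) := continuous_const.mul (Real.continuous_rpow_const hr0.le)
      simpa [Real.zero_rpow hr0.ne'] using this.tendsto 0
    obtain ⟨η, hη, hη'⟩ := Metric.eventually_nhds_iff.1 (h1.eventually (gt_mem_nhds hε))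
    refine ⟨Φ₀ '' (s ∩ ball (x : ℂ) (η / 2)), image_mem_map (inter_mem (hmem x hx)
      (mem_nhdsWithin_of_mem_nhds (ball_mem_nhds _ (half_pos hη)))), ?_⟩
    rintro _ ⟨u, ⟨hu1, hu2⟩, rfl⟩ _ ⟨v, ⟨hv1, hv2⟩, rfl⟩; rw [dist_eq_norm]
    refine (hol u v hu1.1 hv1.1 hu1.2 hv1.2).trans_lt (hη' ?_)
    rw [Real.dist_eq, sub_zero, abs_of_nonneg (norm_nonneg _), ← dist_eq_norm]; rw [mem_ball] at hu2 hv2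
    calc dist u v ≤ dist u x + dist v x := dist_triangle_right _ _ _
      _ < η := by linarith
  choose! Φ hΦ using hex
  refine ⟨Φ, D, r', hr0, hr1, hΦ, fun x hx y hy => ?_⟩
  have t1 : ∀ x ∈ Ioo a' b', Tendsto (fun ε : ℝ => Φ₀ (x + ε * I)) (𝓝[>] 0) (𝓝 (Φ x)) := by
    intro x hx
    refine (hΦ x hx).comp (tendsto_nhdsWithin_iff.2 ⟨tendsto_add_mul_I x, ?_⟩)
    filter_upwards [self_mem_nhdsWithin] with ε hε
    simpa using hε
  refine le_of_tendsto ((t1 x hx).sub (t1 y hy)).norm ?_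
  filter_upwards [self_mem_nhdsWithin] with ε hε
  have := hol (x + ε * I) (y + ε * I) (by simpa using Ioo_subset_Icc_self hx)
    (by simpa using Ioo_subset_Icc_self hy) (by simpa using hε) (by simpa using hε)
  rwa [add_sub_add_right_eq_sub, ← ofReal_sub, norm_ofReal] at this

/-! ### Nevanlinna functions -/

lemma ae_dist_support_le (ρ : Measure ℝ) (hx : x ∉ ρ.support) : ∃ d : ℝ, 0 < d ∧ ∀ᵐ τ ∂ρ, d ≤ |τ - x| := by
  obtain ⟨d, hd, hball⟩ := isOpen_iff.1 Measure.isOpen_compl_support x hx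
  refine ⟨d, hd, ?_⟩
  filter_upwards [Measure.support_mem_ae (μ := ρ)] with τ hτ
  by_contra h; exact hball (by rw [mem_ball, Real.dist_eq]; exact not_le.1 h) hτ

lemma integral_inv_sq_pos (ρ : Measure ℝ) [IsFiniteMeasure ρ] (hρ : ρ ≠ 0)
    (hx : x ∉ ρ.support) : 0 < ∫ τ, 1 / (τ - x) ^ 2 ∂ρ := by
  obtain ⟨d, hd, hd'⟩ := ae_dist_support_le ρ hx
  have hint : Integrable (fun τ => 1 / (τ - x) ^ 2) ρ := by
    refine Integrable.of_bound (Measurable.aestronglyMeasurable (by fun_prop)) (1 / d ^ 2) ?_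
    filter_upwards [hd'] with τ hτ
    rw [Real.norm_of_nonneg (by positivity), ← sq_abs (τ - x)]; gcongr
  rw [integral_pos_iff_support_of_nonneg (fun τ => by positivity) hint]
  have : (univ : Set ℝ) ≤ᵐ[ρ] Function.support fun τ => 1 / (τ - x) ^ 2 := by
    filter_upwards [hd'] with τ hτ _
    have : τ - x ≠ 0 := abs_pos.1 (hd.trans_le hτ)
    exact (show 1 / (τ - x) ^ 2 ≠ 0 by positivity)
  exact (Measure.measure_univ_pos.2 hρ).trans_le (measure_mono_ae this)

lemma integral_inv_sq_nonneg (ρ : Measure ℝ) (x : ℝ) : 0 ≤ ∫ τ, 1 / (τ - x) ^ 2 ∂ρ :=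
  integral_nonneg fun τ => by positivity

lemma isPick_nevanlinna (ρ : Measure ℝ) [IsFiniteMeasure ρ] (hc : 0 ≤ c) (β : ℝ)
    (h : 0 < c ∨ ρ ≠ 0) (hK : ∃ K : ℝ, ρ.support ⊆ Icc (-K) K) :
    IsPick (fun w => c * w + β + stieltjes ρ w) ρ.support where
  closed := Measure.isClosed_support
  bounded := hK
  differentiableAt w hw := by
    have := (hasDerivAt_stieltjes ρ hw).differentiableAt
    fun_prop
  im_pos w hw := by
    have h1 := im_stieltjes_nonneg ρ hw
    have e : ((c : ℂ) * w + β + stieltjes ρ w).im = c * w.im + (stieltjes ρ w).im := by simp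
    rw [e]
    rcases h with h | h
    · have := mul_pos h hw; linarith
    · have h2 : 0 < (stieltjes ρ w).im := by
        rw [im_stieltjes ρ hw.ne', integral_pos_iff_support_of_nonneg (fun τ => by positivity)]
        · have : Function.support (fun τ : ℝ => w.im / ((τ - w.re) ^ 2 + w.im ^ 2)) = univ := by
            ext τ
            have : w.im / ((τ - w.re) ^ 2 + w.im ^ 2) ≠ 0 := by positivity
            simpa using this
          rw [this]; exact Measure.measure_univ_pos.2 h
        · exact (integrable_cauchyKernel ρ hw.ne').im.congr (.of_forall fun τ => im_cauchyKernel w τ)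
      have := mul_nonneg hc hw.le; linarith
  conj_eq w := by simp [stieltjes_conj]
  deriv_pos x hx := by
    refine ⟨c + ∫ τ, 1 / (τ - x) ^ 2 ∂ρ, ?_, ?_⟩
    · rcases h with h | h
      · linarith [integral_inv_sq_nonneg ρ x]
      · linarith [integral_inv_sq_pos ρ h hx]
    · have h1 := hasDerivAt_stieltjes ρ (w := (x : ℂ)) fun y hy hxy => hx (by rwa [ofReal_inj.1 hxy])
      have e : ∫ τ : ℝ, 1 / ((τ : ℂ) - x) ^ 2 ∂ρ = ((∫ τ, 1 / (τ - x) ^ 2 ∂ρ : ℝ) : ℂ) := by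
        rw [← integral_complex_ofReal]; exact integral_congr_ae (.of_forall fun τ => by simp)
      rw [e] at h1
      have h2 := (((hasDerivAt_id (x : ℂ)).const_mul (c : ℂ)).add_const (β : ℂ)).add h1
      refine (h2.congr_deriv ?_)
      simp

lemma IsPick.add {F G : ℂ → ℂ} {S T : Set ℝ} (hF : IsPick F S) (hG : IsPick G T) :
    IsPick (fun w => F w + G w) (S ∪ T) where
  closed := hF.closed.union hG.closed
  bounded := by
    obtain ⟨K, hK⟩ := hF.bounded
    obtain ⟨L, hL⟩ := hG.bounded
    refine ⟨max K L, union_subset (hK.trans ?_) (hL.trans ?_)⟩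
    · exact Icc_subset_Icc (neg_le_neg (le_max_left _ _)) (le_max_left _ _)
    · exact Icc_subset_Icc (neg_le_neg (le_max_right _ _)) (le_max_right _ _)
  differentiableAt w hw := (hF.differentiableAt w fun x hx => hw x (Or.inl hx)).add
    (hG.differentiableAt w fun x hx => hw x (Or.inr hx))
  im_pos w hw := by rw [add_im]; exact add_pos (hF.im_pos w hw) (hG.im_pos w hw)
  conj_eq w := by rw [hF.conj_eq, hG.conj_eq, map_add]
  deriv_pos x hx := by
    obtain ⟨d, hd, h1⟩ := hF.deriv_pos x fun h => hx (Or.inl h)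
    obtain ⟨e, he, h2⟩ := hG.deriv_pos x fun h => hx (Or.inr h)
    exact ⟨d + e, add_pos hd he, by push_cast; exact h1.add h2⟩

lemma ae_norm_cauchyKernel_le (ρ : Measure ℝ) {K : ℝ} (hK : ρ.support ⊆ Icc (-K) K) (w : ℂ) :
    ∀ᵐ τ : ℝ ∂ρ, |τ| ≤ K ∧ ‖w‖ - K ≤ ‖(τ : ℂ) - w‖ := by
  filter_upwards [Measure.support_mem_ae (μ := ρ)] with τ hτ
  have h1 : |τ| ≤ K := abs_le.2 (hK hτ)
  refine ⟨h1, ?_⟩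
  have := norm_sub_norm_le w (τ : ℂ)
  rw [norm_ofReal, norm_sub_rev] at this; linarith

lemma norm_stieltjes_le (ρ : Measure ℝ) [IsFiniteMeasure ρ] {K : ℝ} (hK : ρ.support ⊆ Icc (-K) K) (hw : K < ‖w‖) :
    ‖stieltjes ρ w‖ ≤ ρ.real univ / (‖w‖ - K) := by
  have := norm_integral_le_of_norm_le_const (μ := ρ) (f := fun τ : ℝ => 1 / (τ - w)) (C := 1 / (‖w‖ - K)) (by
      filter_upwards [ae_norm_cauchyKernel_le ρ hK w] with τ hτ
      rw [norm_div, norm_one]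
      have : 0 < ‖w‖ - K := by linarith
      gcongr; exact hτ.2)
  rw [stieltjes]
  refine this.trans (le_of_eq (by ring))

lemma norm_mul_stieltjes_add_le (ρ : Measure ℝ) [IsFiniteMeasure ρ] {K : ℝ}
    (hK : ρ.support ⊆ Icc (-K) K) (hw : K < ‖w‖) :
    ‖w * stieltjes ρ w + ρ.real univ‖ ≤ |K| * ρ.real univ / (‖w‖ - K) := by
  have hpos : 0 < ‖w‖ - K := by linarith
  have hint : Integrable (fun τ : ℝ => 1 / (τ - w)) ρ := by
    refine Integrable.of_bound (Measurable.aestronglyMeasurable (by fun_prop)) (1 / (‖w‖ - K)) ?_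
    filter_upwards [ae_norm_cauchyKernel_le ρ hK w] with τ hτ
    rw [norm_div, norm_one]; gcongr; exact hτ.2
  have e : w * stieltjes ρ w + ρ.real univ = ∫ τ : ℝ, (τ : ℂ) / (τ - w) ∂ρ := by
    have h1 : ((ρ.real univ : ℝ) : ℂ) = ∫ _ : ℝ, (1 : ℂ) ∂ρ := by simp
    rw [stieltjes, ← integral_const_mul, h1, ← integral_add (hint.const_mul w) (integrable_const _)]
    refine integral_congr_ae ?_
    filter_upwards [ae_norm_cauchyKernel_le ρ hK w] with τ hτ
    have : (τ : ℂ) - w ≠ 0 := norm_pos_iff.1 (hpos.trans_le hτ.2)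
    field_simp; ring
  rw [e]
  have := norm_integral_le_of_norm_le_const (μ := ρ) (f := fun τ : ℝ => (τ : ℂ) / (τ - w)) (C := |K| / (‖w‖ - K)) (by
      filter_upwards [ae_norm_cauchyKernel_le ρ hK w] with τ hτ
      rw [norm_div, norm_ofReal]; exact div_le_div₀ (abs_nonneg K) (hτ.1.trans (le_abs_self K)) hpos hτ.2)
  refine this.trans (le_of_eq (by ring))

/-! ### Cauchy integrals of functions vanishing near a point -/

lemma cauchyInt_conj (f : ℝ → ℝ) (w : ℂ) :
    cauchyInt f (conj w) = conj (cauchyInt f w) := by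
  rw [cauchyInt, cauchyInt, ← integral_conj]; exact integral_congr_ae (.of_forall fun τ => by simp)

lemma cauchyInt_ofReal_im (f : ℝ → ℝ) (x : ℝ) : (cauchyInt f x).im = 0 := by
  have := cauchyInt_conj f x
  rw [conj_ofReal] at this; exact conj_eq_iff_im.1 this.symm

lemma continuousAt_cauchyInt (hf : Integrable f) {d : ℝ} (hd : 0 < d)
    (h : ∀ᵐ t : ℝ, ‖(t : ℂ) - w‖ < d → f t = 0) : ContinuousAt (cauchyInt f) w := by
  refine continuousAt_of_dominated (bound := fun t => |f t| * (1 / (d / 2)))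
    (.of_forall fun v => ?_) ?_ (hf.abs.mul_const _) ?_
  · exact hf.ofReal.aestronglyMeasurable.mul (Measurable.aestronglyMeasurable (by fun_prop))
  · filter_upwards [ball_mem_nhds w (half_pos hd)] with v hv
    rw [mem_ball, dist_eq_norm] at hv
    filter_upwards [h] with t ht
    rw [norm_mul, norm_ofReal, norm_div, norm_one]
    by_cases h1 : ‖(t : ℂ) - w‖ < d
    · rw [ht h1]; simp
    · gcongr
      have := norm_sub_norm_le (t - w) (v - w)
      rw [sub_sub_sub_cancel_right] at this
      push Not at h1; linarith
  · filter_upwards [h] with t ht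
    by_cases h1 : ‖(t : ℂ) - w‖ < d
    · rw [ht h1]; simpa using continuousAt_const
    · have h2 : (t : ℂ) - w ≠ 0 := norm_pos_iff.1 (hd.trans_le (not_lt.1 h1))
      exact continuousAt_const.mul (continuousAt_const.div (by fun_prop) h2)

lemma disjoint_support_of_exp_rep (ρ : Measure ℝ) [IsFiniteMeasure ρ] {F G : ℂ → ℂ}
    {c β a b : ℝ} (hF : ∀ w, F w = c * w + β + stieltjes ρ w)
    (hG : ∀ x ∈ Ioo a b, ContinuousAt G (x : ℂ)) (hGr : ∀ x ∈ Ioo a b, (G (x : ℂ)).im = 0)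
    (hf : Integrable f) (hf0 : ∀ᵐ t : ℝ, t ∈ Ioo a b → f t = 0)
    (hrep : ∀ w : ℂ, w.im ≠ 0 → F w = G w * exp (1 / π * cauchyInt f w)) :
    Disjoint (Ioo a b) ρ.support := by
  have hcont : ∀ x ∈ Ioo a b, ContinuousAt (cauchyInt f) (x : ℂ) := by
    intro x hx
    refine continuousAt_cauchyInt hf (d := min (x - a) (b - x)) (lt_min (by linarith [hx.1]) (by linarith [hx.2])) ?_
    filter_upwards [hf0] with t ht h1
    rw [← ofReal_sub, norm_ofReal, lt_min_iff, abs_lt, abs_lt] at h1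
    exact ht ⟨by linarith [h1.1.1], by linarith [h1.2.2]⟩
  have key : ∀ s t, a < s → s < t → t < b → ρ (Icc s t) = 0 := by
    intro s t has hst htb
    have hsub : Icc s t ⊆ Ioo a b := fun x hx => ⟨has.trans_le hx.1, hx.2.trans_lt htb⟩
    refine measure_Icc_eq_zero_of_continuousAt ρ hst (G := fun w => G w * exp (1 / π * cauchyInt f w) - (c * w + β))
      (fun x hx => ?_) (fun x hx => ?_) ?_
    · have h1 := hG x (hsub hx)
      have h2 := hcont x (hsub hx)
      fun_prop
    · have e1 : ((1 / π * cauchyInt f x : ℂ)) = ((1 / π * (cauchyInt f x).re : ℝ) : ℂ) := by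
        apply Complex.ext <;> simp [cauchyInt_ofReal_im, ← ofReal_inv]
      have e2 : G x = ((G x).re : ℂ) := Complex.ext (by simp) (by simp [hGr x (hsub hx)])
      rw [e1, e2, ← ofReal_exp, ← ofReal_mul, ← ofReal_mul, ← ofReal_add, ← ofReal_sub, ofReal_im]
    · filter_upwards [self_mem_nhdsWithin] with ε hε x _
      rw [← hrep _ (by simpa using hε.ne'), hF]
      congr 1; ring
  rw [disjoint_left]; intro x hx hxs
  have := (Measure.mem_support_iff_forall x).1 hxs (Icc ((a + x) / 2) ((x + b) / 2))
    (Icc_mem_nhds (by linarith [hx.1]) (by linarith [hx.2]))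
  rw [key _ _ (by linarith [hx.1]) (by linarith [hx.1, hx.2]) (by linarith [hx.2])] at this
  exact lt_irrefl _ this

/-! ### Boundary values from the upper half plane -/

/-- The open upper half plane. -/
def upperHalf : Set ℂ := {w | 0 < w.im}

lemma tendsto_vertical_upperHalf (x : ℝ) :
    Tendsto (fun ε : ℝ => (x : ℂ) + ε * I) (𝓝[>] 0) (𝓝[upperHalf] (x : ℂ)) := by
  refine tendsto_nhdsWithin_iff.2 ⟨tendsto_add_mul_I x, ?_⟩
  filter_upwards [self_mem_nhdsWithin] with ε hε
  simpa [upperHalf] using hε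

instance neBot_upperHalf (x : ℝ) : (𝓝[upperHalf] (x : ℂ)).NeBot := (tendsto_vertical_upperHalf x).neBot

lemma ofReal_mem_closure_upperHalf (x : ℝ) : (x : ℂ) ∈ closure upperHalf :=
  mem_closure_iff_nhdsWithin_neBot.2 inferInstance

lemma continuousOn_extendFrom_upperHalf {a b : ℝ} (hF : ∀ w : ℂ, 0 < w.im → ContinuousAt F w)
    (hlim : ∀ x ∈ Ioo a b, ∃ l, Tendsto F (𝓝[upperHalf] (x : ℂ)) (𝓝 l)) :
    ContinuousOn (extendFrom upperHalf F) (upperHalf ∪ ofReal '' Ioo a b) := by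
  refine continuousOn_extendFrom ?_ ?_
  · rintro w (hw | ⟨x, -, rfl⟩)
    · exact subset_closure hw
    · exact ofReal_mem_closure_upperHalf x
  · rintro w (hw | ⟨x, hx, rfl⟩)
    · exact ⟨F w, (hF w hw).continuousWithinAt⟩
    · exact hlim x hx

lemma extendFrom_upperHalf_of_mem (hw : 0 < w.im) (hF : ContinuousAt F w) :
    extendFrom upperHalf F w = F w :=
  extendFrom_eq (subset_closure hw) hF.continuousWithinAt

lemma tendsto_extendFrom_upperHalf (h : ∃ l, Tendsto F (𝓝[upperHalf] (x : ℂ)) (𝓝 l)) :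
    Tendsto F (𝓝[upperHalf] (x : ℂ)) (𝓝 (extendFrom upperHalf F x)) :=
  tendsto_extendFrom h

lemma hasDerivAt_distribution (ρ : Measure ℝ) [IsFiniteMeasure ρ] {a b : ℝ}
    (hlim : ∀ x ∈ Ioo a b, ∃ l, Tendsto (stieltjes ρ) (𝓝[upperHalf] (x : ℂ)) (𝓝 l))
    (hx : x ∈ Ioo a b) : HasDerivAt (fun t => ρ.real (Iic t))
      (1 / π * (extendFrom upperHalf (stieltjes ρ) x).im) x := by
  set E := extendFrom upperHalf (stieltjes ρ) with hE
  have hSc : ∀ w : ℂ, 0 < w.im → ContinuousAt (stieltjes ρ) w := fun w hw =>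
    (hasDerivAt_stieltjes ρ fun y _ h => by rw [h] at hw; simp at hw).continuousAt
  have hEc : ContinuousOn E (upperHalf ∪ ofReal '' Ioo a b) := continuousOn_extendFrom_upperHalf hSc hlim
  have hEr : ContinuousOn (fun x : ℝ => (E x).im) (Ioo a b) :=
    continuous_im.comp_continuousOn (hEc.comp continuous_ofReal.continuousOn fun x hx => Or.inr ⟨x, hx, rfl⟩)
  have hint : ∀ s t, s ∈ Ioo a b → t ∈ Ioo a b → s < t →
      π / 2 * (ρ.real (Ioo s t) + ρ.real (Icc s t)) = ∫ x in s..t, (E x).im := by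
    intro s t hs ht hst
    have hsub : Icc s t ⊆ Ioo a b := fun y hy => ⟨hs.1.trans_le hy.1, hy.2.trans_lt ht.2⟩
    have hmaps : ∀ p ∈ Icc s t ×ˢ Icc (0:ℝ) 1, (p.1 : ℂ) + p.2 * I ∈
        upperHalf ∪ ofReal '' Ioo a b := by
      rintro ⟨y, ε⟩ ⟨hy, hε⟩
      rcases hε.1.eq_or_lt with h | h
      · exact Or.inr ⟨y, hsub hy, by simp only at h; simp [← h]⟩
      · exact Or.inl (by simpa [upperHalf] using h)
    have hcomp : ContinuousOn (fun p : ℝ × ℝ => E (p.1 + p.2 * I)) (Icc s t ×ˢ Icc (0:ℝ) 1) :=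
      hEc.comp (Continuous.continuousOn (by fun_prop)) hmaps
    obtain ⟨B, hB⟩ := (isCompact_Icc.prod isCompact_Icc).exists_bound_of_continuousOn hcomp
    have h1 : Tendsto (fun ε : ℝ => ∫ x in s..t, (stieltjes ρ (x + ε * I)).im) (𝓝[>] 0)
        (𝓝 (∫ x in s..t, (E x).im)) := by
      refine intervalIntegral.tendsto_integral_filter_of_dominated_convergence (fun _ => B) ?_ ?_
        intervalIntegrable_const ?_
      · filter_upwards [self_mem_nhdsWithin] with ε hε using (continuous_im_stieltjes ρ hε).aestronglyMeasurable
      · filter_upwards [self_mem_nhdsWithin, Ioo_mem_nhdsGT one_pos] with ε hε hε1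
        refine .of_forall fun y hy => ?_
        rw [uIoc_of_le hst.le] at hy
        have hw : 0 < ((y : ℂ) + ε * I).im := by simpa using hε
        rw [← extendFrom_upperHalf_of_mem hw (hSc _ hw)]
        exact (abs_im_le_norm _).trans (hB (y, ε) ⟨Ioc_subset_Icc_self hy, hε1.1.le, hε1.2.le⟩)
      · refine .of_forall fun y hy => ?_
        rw [uIoc_of_le hst.le] at hy
        exact (continuous_im.tendsto _).comp ((tendsto_extendFrom_upperHalf
          (hlim y (hsub (Ioc_subset_Icc_self hy)))).comp (tendsto_vertical_upperHalf y))
    exact tendsto_nhds_unique (stieltjes_inversion ρ hst) h1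
  have hatom : ∀ y ∈ Ioo a b, ρ {y} = 0 := by
    intro y hy
    have hb : ∀ᶠ δ : ℝ in 𝓝[>] 0, π / 2 * ρ.real {y} ≤ ∫ x in (y - δ)..(y + δ), (E x).im := by
      filter_upwards [self_mem_nhdsWithin, Ioo_mem_nhdsGT (sub_pos.2 hy.1),
        Ioo_mem_nhdsGT (sub_pos.2 hy.2)] with δ h1 h2 h3
      have h1' : 0 < δ := h1
      rw [← hint (y - δ) (y + δ) ⟨by linarith [h2.2], by linarith [hy.2]⟩
        ⟨by linarith [hy.1], by linarith [h3.2]⟩ (by linarith)]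
      gcongr
      have : ρ.real {y} ≤ ρ.real (Icc (y - δ) (y + δ)) := measureReal_mono
        (singleton_subset_iff.2 ⟨by linarith, by linarith⟩)
      linarith [measureReal_nonneg (μ := ρ) (s := Ioo (y - δ) (y + δ))]
    have hlim0 : Tendsto (fun δ : ℝ => ∫ x in (y - δ)..(y + δ), (E x).im) (𝓝[>] 0) (𝓝 0) := by
      set s := (a + y) / 2
      set t := (y + b) / 2
      have hs : s ∈ Ioo a b := ⟨by simp only [s]; linarith [hy.1], by simp only [s]; linarith [hy.1, hy.2]⟩
      have ht : t ∈ Ioo a b := ⟨by simp only [t]; linarith [hy.1, hy.2], by simp only [t]; linarith [hy.2]⟩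
      have hsy : s < y := by simp only [s]; linarith [hy.1]
      have hyt : y < t := by simp only [t]; linarith [hy.2]
      have hsub : Icc s t ⊆ Ioo a b := fun y hy => ⟨hs.1.trans_le hy.1, hy.2.trans_lt ht.2⟩
      obtain ⟨B, hB⟩ := isCompact_Icc.exists_bound_of_continuousOn (hEr.mono hsub)
      refine squeeze_zero_norm' (a := fun δ => B * |2 * δ|) ?_ ?_
      · filter_upwards [self_mem_nhdsWithin, Ioo_mem_nhdsGT (sub_pos.2 hsy),
          Ioo_mem_nhdsGT (sub_pos.2 hyt)] with δ h1 h2 h3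
        have h1' : 0 < δ := h1
        have := intervalIntegral.norm_integral_le_of_norm_le_const (a := y - δ) (b := y + δ)
          (f := fun x : ℝ => (E x).im) (C := B) (fun x hx => by
            rw [uIoc_of_le (by linarith)] at hx
            exact hB x ⟨by linarith [hx.1, h2.2], by linarith [hx.2, h3.2]⟩)
        rwa [show y + δ - (y - δ) = 2 * δ by ring] at this
      · have : Continuous fun δ : ℝ => B * |2 * δ| := by fun_prop
        simpa using (this.tendsto 0).mono_left nhdsWithin_le_nhds
    have h0 : π / 2 * ρ.real {y} ≤ 0 := ge_of_tendsto hlim0 hb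
    have h1 : ρ.real {y} = 0 := le_antisymm (by
      have := Real.pi_pos
      by_contra h
      push Not at h
      have : 0 < π / 2 * ρ.real {y} := by positivity
      linarith) measureReal_nonneg
    exact (measureReal_eq_zero_iff).1 h1
  have hIoc : ∀ s t, s ∈ Ioo a b → t ∈ Ioo a b → s < t →
      ρ.real (Iic t) - ρ.real (Iic s) = 1 / π * ∫ x in s..t, (E x).im := by
    intro s t hs ht hst
    have e1 : ρ.real (Iic t) = ρ.real (Iic s) + ρ.real (Ioc s t) := by
      rw [← measureReal_union (by rw [disjoint_left]; intro u hu hu'; exact hu'.1.not_ge hu)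
        measurableSet_Ioc, Iic_union_Ioc_eq_Iic hst.le]
    have e2 : ρ.real (Ioo s t) = ρ.real (Ioc s t) := by
      refine measureReal_congr ?_
      rw [← Ioo_union_right hst]; exact (union_ae_eq_left_of_ae_eq_empty (ae_eq_empty.2 (hatom t ht))).symm
    have e3 : ρ.real (Icc s t) = ρ.real (Ioc s t) := by
      refine measureReal_congr ?_
      rw [← Ioc_union_left hst.le]; exact union_ae_eq_left_of_ae_eq_empty (ae_eq_empty.2 (hatom s hs))
    have := hint s t hs ht hst
    rw [← this, e1, e2, e3]; field_simp; ring
  have hFTC : HasDerivAt (fun t => ∫ y in x..t, (E y).im) ((E x).im) x := by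
    refine intervalIntegral.integral_hasDerivAt_right (by simp) ?_ (hEr.continuousAt (Ioo_mem_nhds hx.1 hx.2))
    exact ContinuousOn.stronglyMeasurableAtFilter isOpen_Ioo hEr x hx
  have h1 := (hFTC.const_mul (1 / π)).const_add (ρ.real (Iic x))
  refine h1.congr_of_eventuallyEq ?_
  filter_upwards [Ioo_mem_nhds hx.1 hx.2] with t ht
  rcases lt_trichotomy x t with h | h | h
  · rw [← hIoc x t hx ht h]; ring
  · rw [h]; simp
  · rw [intervalIntegral.integral_symm, mul_neg, ← hIoc t x ht hx h]; ring

/-! ### Pointwise Hölder conditions -/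

/-- `f` satisfies a Hölder condition at the point `x`. -/
def IsHolderAt {E : Type*} [NormedAddCommGroup E] (f : ℝ → E) (x : ℝ) : Prop :=
  ∃ r : ℝ, 0 < r ∧ (fun y => f y - f x) =O[𝓝 x] fun y => |y - x| ^ r

lemma abs_sub_rpow_isBigO (x : ℝ) {r s : ℝ} (hrs : r ≤ s) (hr : 0 < r) :
    (fun y : ℝ => |y - x| ^ s) =O[𝓝 x] fun y => |y - x| ^ r := by
  refine Asymptotics.IsBigO.of_bound 1 ?_
  filter_upwards [ball_mem_nhds x one_pos] with y hy
  rw [mem_ball, Real.dist_eq] at hy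
  rw [one_mul, Real.norm_of_nonneg (by positivity), Real.norm_of_nonneg (by positivity)]
  rcases (abs_nonneg (y - x)).eq_or_lt with h | h
  · rw [← h, Real.zero_rpow hr.ne', Real.zero_rpow (hr.trans_le hrs).ne']
  · exact Real.rpow_le_rpow_of_exponent_ge h hy.le hrs

namespace IsHolderAt

variable {E : Type*} [NormedAddCommGroup E] {x : ℝ}

lemma continuousAt {f : ℝ → E} (h : IsHolderAt f x) : ContinuousAt f x := by
  obtain ⟨r, hr, h⟩ := h
  have : Tendsto (fun y : ℝ => |y - x| ^ r) (𝓝 x) (𝓝 0) := by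
    have : Continuous fun y : ℝ => |y - x| ^ r := by exact (Real.continuous_rpow_const hr.le).comp (by fun_prop)
    simpa [Real.zero_rpow hr.ne'] using this.tendsto x
  have := (h.trans_tendsto this).add_const (f x)
  simpa [ContinuousAt] using this

lemma congr {f g : ℝ → E} (h : IsHolderAt f x) (hfg : f =ᶠ[𝓝 x] g) : IsHolderAt g x := by
  obtain ⟨r, hr, h⟩ := h
  refine ⟨r, hr, h.congr' ?_ EventuallyEq.rfl⟩
  filter_upwards [hfg] with y hy
  rw [hy, hfg.eq_of_nhds]

lemma sub {f g : ℝ → E} (hf : IsHolderAt f x) (hg : IsHolderAt g x) :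
    IsHolderAt (fun y => f y - g y) x := by
  obtain ⟨r, hr, hf⟩ := hf
  obtain ⟨s, hs, hg⟩ := hg
  refine ⟨min r s, lt_min hr hs, ?_⟩
  refine ((hf.trans (abs_sub_rpow_isBigO x (min_le_left _ _) (lt_min hr hs))).sub
    (hg.trans (abs_sub_rpow_isBigO x (min_le_right _ _) (lt_min hr hs)))).congr_left fun y => ?_
  exact sub_sub_sub_comm _ _ _ _

lemma mul {f g : ℝ → ℂ} (hf : IsHolderAt f x) (hg : IsHolderAt g x) :
    IsHolderAt (fun y => f y * g y) x := by
  have hc := hg.continuousAt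
  obtain ⟨r, hr, hf⟩ := hf
  obtain ⟨s, hs, hg⟩ := hg
  refine ⟨min r s, lt_min hr hs, ?_⟩
  have h1 := ((hf.trans (abs_sub_rpow_isBigO x (min_le_left _ _) (lt_min hr hs))).mul (hc.isBigO_one (F := ℝ)))
  have h2 := (hg.trans (abs_sub_rpow_isBigO x (min_le_right _ _) (lt_min hr hs))).const_mul_left (f x)
  simp only [mul_one] at h1
  refine (h1.add h2).congr_left fun y => ?_
  ring

lemma comp {𝕜 F : Type*} [NontriviallyNormedField 𝕜] [NormedAddCommGroup F] [NormedSpace 𝕜 E]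
    [NormedSpace 𝕜 F] {f : ℝ → E} {g : E → F} (hf : IsHolderAt f x)
    (hg : DifferentiableAt 𝕜 g (f x)) : IsHolderAt (fun y => g (f y)) x := by
  have hc := hf.continuousAt
  obtain ⟨r, hr, hf⟩ := hf
  exact ⟨r, hr, (hg.hasFDerivAt.isBigO_sub.comp_tendsto hc).trans hf⟩

lemma of_differentiableAt {f : ℝ → ℂ} (hf : DifferentiableAt ℝ f x) : IsHolderAt f x :=
  ⟨1, one_pos, by
    refine hf.hasFDerivAt.isBigO_sub.trans (Asymptotics.IsBigO.of_bound 1 (.of_forall fun y => ?_))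
    simp⟩

end IsHolderAt

lemma boundary_of_exp_rep {F G : ℂ → ℂ} {a b x : ℝ} (hf : Integrable f)
    (hfh : IsAEHolderOn f (Ioo a b)) (hG : ∀ y ∈ Ioo a b, DifferentiableAt ℂ G (y : ℂ))
    (hG0 : ∀ y ∈ Ioo a b, G (y : ℂ) ≠ 0)
    (hrep : ∀ w : ℂ, w.im ≠ 0 → F w = G w * exp (1 / π * cauchyInt f w))
    (hx : x ∈ Ioo a b) :
    Tendsto F (𝓝[upperHalf] (x : ℂ)) (𝓝 (extendFrom upperHalf F x)) ∧
      extendFrom upperHalf F x ≠ 0 ∧ IsHolderAt (fun y : ℝ => extendFrom upperHalf F y) x := by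
  obtain ⟨Φ, C, r, hr, hr1, hΦ, hΦh⟩ := exists_cauchyInt_boundary hf hfh
    (a' := (a + x) / 2) (b' := (x + b) / 2) (by linarith [hx.1]) (by linarith [hx.1, hx.2])
    (by linarith [hx.2])
  have hsub : Ioo ((a + x) / 2) ((x + b) / 2) ⊆ Ioo a b := fun y hy =>
    ⟨by linarith [hx.1, hy.1], by linarith [hx.2, hy.2]⟩
  have hx' : x ∈ Ioo ((a + x) / 2) ((x + b) / 2) := ⟨by linarith [hx.1], by linarith [hx.2]⟩
  have hlim : ∀ y ∈ Ioo ((a + x) / 2) ((x + b) / 2), Tendsto F (𝓝[upperHalf] (y : ℂ))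
      (𝓝 (G y * exp (1 / π * Φ y))) := by
    intro y hy
    have h1 : Tendsto G (𝓝[upperHalf] (y : ℂ)) (𝓝 (G y)) := (hG y (hsub hy)).continuousAt.continuousWithinAt
    refine (h1.mul ((hΦ y hy).const_mul (1 / π : ℂ)).cexp).congr' ?_
    filter_upwards [self_mem_nhdsWithin] with w hw
    exact (hrep w (ne_of_gt hw)).symm
  have heq : ∀ y ∈ Ioo ((a + x) / 2) ((x + b) / 2), extendFrom upperHalf F y =
      G y * exp (1 / π * Φ y) := fun y hy =>
    extendFrom_eq (ofReal_mem_closure_upperHalf y) (hlim y hy)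
  refine ⟨?_, ?_, ?_⟩
  · rw [heq x hx']; exact hlim x hx'
  · rw [heq x hx']; exact mul_ne_zero (hG0 x hx) (exp_ne_zero _)
  · have hΦx : IsHolderAt Φ x := by
      refine ⟨r, hr, Asymptotics.IsBigO.of_bound C ?_⟩
      filter_upwards [Ioo_mem_nhds hx'.1 hx'.2] with y hy
      rw [Real.norm_of_nonneg (by positivity)]; exact hΦh y hy x hx'
    have h1 : IsHolderAt (fun y => exp (1 / π * Φ y)) x :=
      hΦx.comp (𝕜 := ℂ) (g := fun u => exp (1 / π * u)) (by fun_prop)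
    have h2 : IsHolderAt (fun y : ℝ => G y) x :=
      IsHolderAt.of_differentiableAt ((hG x hx).hasDerivAt.comp_ofReal.differentiableAt)
    refine (h2.mul h1).congr ?_
    filter_upwards [Ioo_mem_nhds hx'.1 hx'.2] with y hy
    rw [heq y hy]

lemma boundaryArg_real_mul (hc : 0 < c) (F : ℂ → ℂ) :
    boundaryArg (fun w => c * F w) = boundaryArg F := by
  funext t; simp only [boundaryArg, arg_real_mul _ hc]

lemma analyticAt_of_isPick {S : Set ℝ} (hF : IsPick F S) (hx : x ∉ S) :
    AnalyticAt ℂ F x := by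
  have hopen : IsOpen (ofReal '' S)ᶜ := (isometry_ofReal.isClosedEmbedding.isClosedMap _ hF.closed).isOpen_compl
  have hd : DifferentiableOn ℂ F (ofReal '' S)ᶜ := fun w hw =>
    (hF.differentiableAt w fun y hy h => hw ⟨y, hy, h.symm⟩).differentiableWithinAt
  refine hd.analyticAt (hopen.mem_nhds ?_)
  rintro ⟨y, hy, h⟩; exact hx (by rwa [← ofReal_inj.1 h])

lemma isClosed_of_areSeparated {A B : Set ℝ} (h : IsClosed (A ∪ B)) (hs : Metric.AreSeparated A B) :
    IsClosed A := by
  refine isClosed_of_closure_subset fun x hx => ?_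
  rcases closure_minimal subset_union_left h hx with h1 | h1
  · exact h1
  · obtain ⟨r, hr, hs⟩ := hs
    obtain ⟨y, hy, hxy⟩ := EMetric.mem_closure_iff.1 hx r (pos_iff_ne_zero.2 hr)
    have := hs y hy x h1
    rw [edist_comm] at this; exact absurd hxy this.not_gt

namespace JacobiMatrix

variable (J : JacobiMatrix)

/-- `b_{-1} m^R`. -/
def FR (w : ℂ) : ℂ := stieltjes J.rhoR w

/-- `-1 / (b_{-1} m^L)`. -/
def FL (w : ℂ) : ℂ := ((1 / J.b (-1) : ℝ) : ℂ) * w + (J.leftData.1 : ℂ) + stieltjes J.rhoL w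

lemma b_neg_one_ne_zero : (J.b (-1) : ℂ) ≠ 0 := J.b_ofReal_ne_zero (-1)

lemma b_mul_mR (w : ℂ) : (J.b (-1) : ℂ) * J.mR w = J.FR w := by
  have := J.b_neg_one_ne_zero
  rw [mR, FR, stieltjes]; field_simp

lemma mR_eq (w : ℂ) : J.mR w = ((1 / J.b (-1) : ℝ) : ℂ) * J.FR w := by rw [mR, FR, stieltjes]; push_cast; rfl

lemma mL_eq (w : ℂ) : J.mL w = -1 / ((J.b (-1) : ℂ) * J.FL w) := by rw [mL, FL, stieltjes]; congr 3; push_cast; ring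

lemma neg_one_div_mL (w : ℂ) : -1 / J.mL w = (J.b (-1) : ℂ) * J.FL w := by
  rw [mL_eq]
  rcases eq_or_ne (J.FL w) 0 with h | h
  · simp [h]
  · have := J.b_neg_one_ne_zero
    field_simp

lemma neg_one_div_b_mul_mL (w : ℂ) : -1 / ((J.b (-1) : ℂ) * J.mL w) = J.FL w := by
  have h := J.neg_one_div_mL w
  have hb := J.b_neg_one_ne_zero
  rw [mul_comm, ← div_div, h, mul_div_cancel_left₀ _ hb]

lemma M_eq (w : ℂ) : J.M w = J.FR w + J.FL w := by rw [M, b_mul_mR, ← neg_one_div_b_mul_mL]; ring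

lemma etaR_eq : J.etaR = boundaryArg J.FR := by
  rw [etaR, ← boundaryArg_real_mul (one_div_pos.2 J.b_neg_one_pos) J.FR]
  congr 1; funext w; exact J.mR_eq w

lemma etaL_eq : J.etaL = boundaryArg J.FL := by
  rw [etaL, ← boundaryArg_real_mul J.b_neg_one_pos J.FL]
  congr 1; funext w; exact J.neg_one_div_mL w

lemma n_of_norm_lt (hz : ‖z‖ < 1) : J.n z = -J.FR (z + z⁻¹) := by rw [n, if_pos hz, b_mul_mR]

lemma n_of_one_le (hz : 1 ≤ ‖z‖) : J.n z = J.FL (z + z⁻¹) := by rw [n, if_neg hz.not_gt, neg_one_div_b_mul_mL]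

lemma N_of_one_lt (hz : 1 < ‖z‖) : J.N z = J.M (z + z⁻¹) := by
  have h : ‖z⁻¹‖ < 1 := by rw [norm_inv]; exact inv_lt_one_of_one_lt₀ hz
  rw [N, J.n_of_one_le hz.le, J.n_of_norm_lt h, inv_inv, M_eq, add_comm z⁻¹ z]; ring

lemma N_of_lt_one (h0 : z ≠ 0) (hz : ‖z‖ < 1) : J.N z = -J.M (z + z⁻¹) := by
  have h : 1 < ‖z⁻¹‖ := by rw [norm_inv]; exact (one_lt_inv₀ (norm_pos_iff.2 h0)).2 hz
  rw [N, J.n_of_norm_lt hz, J.n_of_one_le h.le, inv_inv, M_eq, add_comm z⁻¹ z]; ring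

lemma isPick_FL : IsPick J.FL J.specL :=
  isPick_nevanlinna J.rhoL (one_div_pos.2 J.b_neg_one_pos).le J.leftData.1
    (Or.inl (one_div_pos.2 J.b_neg_one_pos)) J.exists_support_rhoL_subset

variable {J} (hA : J.CondA)
include hA

lemma CondA.Icc_subset_specR : Icc (-2) 2 ⊆ J.specR := fun _ hx => (hA.2.2.2.1 hx).1.1

lemma CondA.rhoR_ne_zero : J.rhoR ≠ 0 := Measure.nonempty_support_iff.1 ⟨0, hA.Icc_subset_specR (by norm_num)⟩

lemma CondA.isPick_FR : IsPick J.FR J.specR := by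
  have := isPick_nevanlinna J.rhoR le_rfl 0 (Or.inr hA.rhoR_ne_zero) J.exists_support_rhoR_subset
  simp only [ofReal_zero, zero_mul, zero_add] at this; exact this

lemma CondA.isPick_M : IsPick J.M (J.specR ∪ J.specL) := by
  have := hA.isPick_FR.add J.isPick_FL
  have e : J.M = fun w => J.FR w + J.FL w := funext J.M_eq
  rwa [e]

lemma CondA.spec2s_subset : J.spec2s ⊆ J.specR ∩ J.specL := by
  rintro x ⟨h1, h2⟩
  constructor
  · by_contra hx
    have h := analyticAt_of_isPick hA.isPick_FR hx
    have h3 : AnalyticAt ℂ J.mR x := by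
      rw [show J.mR = fun w => ((1 / J.b (-1) : ℝ) : ℂ) * J.FR w from funext J.mR_eq]
      exact analyticAt_const.mul h
    exact h1.not_ge h3.meromorphicOrderAt_nonneg
  · by_contra hx
    have h := analyticAt_of_isPick J.isPick_FL hx
    have h3 : AnalyticAt ℂ (fun w => -1 / J.mL w) x := by
      rw [show (fun w => -1 / J.mL w) = fun w => (J.b (-1) : ℂ) * J.FL w from funext J.neg_one_div_mL]
      exact analyticAt_const.mul h
    exact h2.not_ge h3.meromorphicOrderAt_nonneg

lemma CondA.union_spec : J.spec1 ∪ J.spec2s ∪ J.spec2a = J.specR ∪ J.specL := by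
  have h := hA.spec2s_subset
  ext x
  have hx := @h x
  simp only [spec1, spec2a, mem_union, Set.mem_sdiff, mem_inter_iff] at *
  tauto

lemma CondA.isClosed_spec : IsClosed (J.spec1 ∪ J.spec2s ∪ J.spec2a) := by rw [hA.union_spec]; exact hA.isPick_M.closed

lemma CondA.isClosed_spec1 : IsClosed J.spec1 := by
  have := hA.isClosed_spec
  rw [union_assoc] at this; exact isClosed_of_areSeparated this (hA.1.union_right hA.2.1)

lemma CondA.isClosed_spec2a : IsClosed J.spec2a := by
  have := hA.isClosed_spec
  rw [union_comm] at this; exact isClosed_of_areSeparated this (hA.2.1.symm.union_right hA.2.2.1.symm)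

lemma CondA.isClosed_spec2s : IsClosed J.spec2s := hA.2.2.2.2.isClosed

/-! #### Exponential representations -/

lemma CondA.rhoR_univ_pos : 0 < J.rhoR.real univ := by
  rw [measureReal_def, ENNReal.toReal_pos_iff]
  exact ⟨Measure.measure_univ_pos.2 hA.rhoR_ne_zero, measure_lt_top _ _⟩

omit hA in
variable (J) in
lemma FL_growth : ∃ C K : ℝ, ∀ w : ℂ, K ≤ ‖w‖ → ‖J.FL w - ((1 / J.b (-1) : ℝ) : ℂ) * w‖ ≤ C := by
  obtain ⟨K, hK⟩ := J.exists_support_rhoL_subset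
  refine ⟨|J.leftData.1| + J.rhoL.real univ, K + 1, fun w hw => ?_⟩
  have h1 := norm_stieltjes_le J.rhoL hK (w := w) (by linarith)
  have e : J.FL w - ((1 / J.b (-1) : ℝ) : ℂ) * w = (J.leftData.1 : ℂ) + stieltjes J.rhoL w := by rw [FL]; ring
  rw [e]
  refine (norm_add_le _ _).trans (add_le_add (by simp) (h1.trans ?_))
  exact div_le_self measureReal_nonneg (by linarith)

omit hA in
variable (J) in
lemma FR_decay : ∃ C K : ℝ, ∀ w : ℂ, K ≤ ‖w‖ → ‖w * J.FR w + J.rhoR.real univ‖ ≤ C / ‖w‖ := by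
  obtain ⟨K, hK⟩ := J.exists_support_rhoR_subset
  refine ⟨2 * (|K| * J.rhoR.real univ), 2 * |K| + 1, fun w hw => ?_⟩
  have h0 : K < ‖w‖ := by linarith [le_abs_self K, abs_nonneg K]
  refine (norm_mul_stieltjes_add_le J.rhoR hK h0).trans ?_
  have h2 : 0 < ‖w‖ - K := by linarith
  have h3 : 0 < ‖w‖ := by linarith [abs_nonneg K]
  have h4 : 0 ≤ |K| * J.rhoR.real univ := mul_nonneg (abs_nonneg K) measureReal_nonneg
  rw [div_le_div_iff₀ h2 h3]; nlinarith [le_abs_self K]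

omit hA in
variable (J) in
lemma M_growth : ∃ C K : ℝ, ∀ w : ℂ, K ≤ ‖w‖ → ‖J.M w - ((1 / J.b (-1) : ℝ) : ℂ) * w‖ ≤ C := by
  obtain ⟨C, K, h⟩ := J.FL_growth
  obtain ⟨K', hK'⟩ := J.exists_support_rhoR_subset
  refine ⟨J.rhoR.real univ + C, max K (K' + 1), fun w hw => ?_⟩
  have h1 := norm_stieltjes_le J.rhoR hK' (w := w) (by linarith [le_max_right K (K' + 1)])
  rw [M_eq, add_sub_assoc]
  refine (norm_add_le _ _).trans (add_le_add (h1.trans ?_) (h w (le_trans (le_max_left _ _) hw)))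
  exact div_le_self measureReal_nonneg (by linarith [le_max_right K (K' + 1)])

open Classical in
lemma CondA.FR_rep (x₀ : ℝ) : (∀ᵐ t : ℝ, HasBoundaryArg J.FR t (J.etaR t)) ∧
    Integrable (fun t => J.etaR t - if x₀ < t then π else 0) ∧
    ∀ w : ℂ, w.im ≠ 0 → J.FR w = (J.rhoR.real univ : ℂ) / (x₀ - w) * exp (1 / π *
      cauchyInt (fun t => J.etaR t - if x₀ < t then π else 0) w) := by
  obtain ⟨C, K, h⟩ := J.FR_decay
  rw [etaR_eq]
  obtain ⟨⟨h1, -, h2⟩, h3⟩ := hA.isPick_FR.exp_rep_of_decay hA.rhoR_univ_pos h x₀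
  exact ⟨h1, h2, h3⟩

omit hA in
variable (J) in
open Classical in
lemma FL_rep (x₀ : ℝ) : (∀ᵐ t : ℝ, HasBoundaryArg J.FL t (J.etaL t)) ∧
    Integrable (fun t => J.etaL t - if t < x₀ then π else 0) ∧
    ∀ w : ℂ, w.im ≠ 0 → J.FL w = ((1 / J.b (-1) : ℝ) : ℂ) * (w - x₀) * exp (1 / π *
      cauchyInt (fun t => J.etaL t - if t < x₀ then π else 0) w) := by
  obtain ⟨C, K, h⟩ := J.FL_growth
  rw [etaL_eq]
  obtain ⟨⟨h1, -, h2⟩, h3⟩ := J.isPick_FL.exp_rep_of_linear (one_div_pos.2 J.b_neg_one_pos) h x₀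
  exact ⟨h1, h2, h3⟩

open Classical in
lemma CondA.M_rep (x₀ : ℝ) : (∀ᵐ t : ℝ, HasBoundaryArg J.M t (J.eta t)) ∧
    (∃ K : ℝ, ∀ᵐ t : ℝ, K ≤ |t| → J.eta t = if t < x₀ then π else 0) ∧
    Integrable (fun t => J.eta t - if t < x₀ then π else 0) ∧
    ∀ w : ℂ, w.im ≠ 0 → J.M w = ((1 / J.b (-1) : ℝ) : ℂ) * (w - x₀) * exp (1 / π *
      cauchyInt (fun t => J.eta t - if t < x₀ then π else 0) w) := by
  obtain ⟨C, K, h⟩ := J.M_growth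
  obtain ⟨⟨h1, h2, h3⟩, h4⟩ := hA.isPick_M.exp_rep_of_linear (one_div_pos.2 J.b_neg_one_pos) h x₀
  exact ⟨h1, h2, h3, h4⟩

lemma CondA.ae_etaR_mem : ∀ᵐ t, J.etaR t ∈ Icc 0 π := by
  have := hA.isPick_FR.ae_boundaryArg_mem (by rw [← etaR_eq]; exact (hA.FR_rep 0).1)
  rwa [← etaR_eq] at this

omit hA in
variable (J) in
lemma ae_etaL_mem : ∀ᵐ t, J.etaL t ∈ Icc 0 π := by
  have := J.isPick_FL.ae_boundaryArg_mem (by rw [← etaL_eq]; exact (J.FL_rep 0).1)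
  rwa [← etaL_eq] at this

lemma CondA.ae_eta_mem : ∀ᵐ t, J.eta t ∈ Icc 0 π := hA.isPick_M.ae_boundaryArg_mem (hA.M_rep 0).1

lemma CondA.ae_etaR_compl : ∀ᵐ t : ℝ, t ∉ J.specR →
    (J.etaR t = 0 ∧ 0 < (J.FR t).re) ∨ (J.etaR t = π ∧ (J.FR t).re < 0) := by
  rw [etaR_eq]; exact hA.isPick_FR.ae_boundaryArg_compl

omit hA in
variable (J) in
lemma ae_etaL_compl : ∀ᵐ t : ℝ, t ∉ J.specL → (J.etaL t = 0 ∧ 0 < (J.FL t).re) ∨ (J.etaL t = π ∧ (J.FL t).re < 0) := by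
  rw [etaL_eq]; exact J.isPick_FL.ae_boundaryArg_compl

lemma CondA.disjoint_specR {a b : ℝ} (h : (∀ᵐ t : ℝ, t ∈ Ioo a b → J.etaR t = 0) ∨
    ∀ᵐ t : ℝ, t ∈ Ioo a b → J.etaR t = π) : Disjoint (Ioo a b) J.specR := by
  classical
  have key : ∀ x₀ : ℝ, x₀ ∉ Ioo a b → (∀ᵐ t : ℝ, t ∈ Ioo a b → (J.etaR t - if x₀ < t then π else 0) = 0) →
      Disjoint (Ioo a b) J.specR := by
    intro x₀ hx₀ h0
    obtain ⟨-, h2, h3⟩ := hA.FR_rep x₀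
    have hne : ∀ x ∈ Ioo a b, (x₀ : ℂ) - x ≠ 0 := fun x hx h => by
      have : x₀ = x := by exact_mod_cast sub_eq_zero.1 h
      exact hx₀ (this ▸ hx)
    refine disjoint_support_of_exp_rep J.rhoR (F := J.FR) (c := 0) (β := 0)
      (fun w => by simp [FR]) (fun x hx => ?_) (fun x hx => ?_) h2 h0 h3
    · exact continuousAt_const.div (by fun_prop) (hne x hx)
    · rw [← ofReal_sub, ← ofReal_div, ofReal_im]
  rcases h with h | h
  · refine key b right_notMem_Ioo ?_
    filter_upwards [h] with t ht hI
    rw [ht hI, if_neg hI.2.not_gt, sub_zero]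
  · refine key a left_notMem_Ioo ?_
    filter_upwards [h] with t ht hI
    rw [ht hI, if_pos hI.1, sub_self]

omit hA in
variable (J) in
lemma disjoint_specL {a b : ℝ} (h : (∀ᵐ t : ℝ, t ∈ Ioo a b → J.etaL t = 0) ∨
    ∀ᵐ t : ℝ, t ∈ Ioo a b → J.etaL t = π) : Disjoint (Ioo a b) J.specL := by
  classical
  have key : ∀ x₀ : ℝ, (∀ᵐ t : ℝ, t ∈ Ioo a b → (J.etaL t - if t < x₀ then π else 0) = 0) →
      Disjoint (Ioo a b) J.specL := by
    intro x₀ h0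
    obtain ⟨-, h2, h3⟩ := J.FL_rep x₀
    refine disjoint_support_of_exp_rep J.rhoL (F := J.FL) (c := 1 / J.b (-1)) (β := J.leftData.1)
      (fun w => rfl) (fun x hx => ?_) (fun x hx => ?_) h2 h0 h3
    · fun_prop
    · rw [← ofReal_sub, ← ofReal_mul, ofReal_im]
  rcases h with h | h
  · refine key a ?_
    filter_upwards [h] with t ht hI
    rw [ht hI, if_neg hI.1.not_gt, sub_zero]
  · refine key b ?_
    filter_upwards [h] with t ht hI
    rw [ht hI, if_pos hI.2, sub_self]

end JacobiMatrix

lemma exists_mem_Ioo_of_ae {p : ℝ → Prop} (h : ∀ᵐ t : ℝ, p t) {a b : ℝ} (hab : a < b) : ∃ t ∈ Ioo a b, p t := by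
  by_contra hne
  push Not at hne
  have : volume (Ioo a b) = 0 := measure_mono_null (fun t ht => hne t ht) (ae_iff.1 h)
  rw [Real.volume_Ioo, ENNReal.ofReal_eq_zero] at this; linarith

lemma mul_sin_norm_le_im {ε : ℝ} (h0 : 0 < ε) (h1 : ε < z.arg) (h2 : z.arg < π - ε) : Real.sin ε * ‖z‖ ≤ z.im := by
  have h3 := norm_mul_sin_arg z
  rw [← h3, mul_comm]
  refine mul_le_mul_of_nonneg_left ?_ (norm_nonneg z)
  rcases le_total z.arg (π / 2) with h | h
  · exact Real.sin_le_sin_of_le_of_le_pi_div_two (by linarith) h h1.le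
  · rw [← Real.sin_pi_sub z.arg]
    exact Real.sin_le_sin_of_le_of_le_pi_div_two (by linarith) (by linarith) (by linarith)

lemma sector_of_ae {η : ℝ → ℝ} {a b ε : ℝ} (hε : 0 < ε) (hFc : ∀ w : ℂ, 0 < w.im → ContinuousAt F w)
    (hη : ∀ᵐ t : ℝ, HasBoundaryArg F t (η t))
    (hlim : ∀ x ∈ Ioo a b, Tendsto F (𝓝[upperHalf] (x : ℂ)) (𝓝 (extendFrom upperHalf F x)))
    (hB : ∀ᵐ t : ℝ, t ∈ Ioo a b → ε < η t ∧ η t < π - ε) (hx : x ∈ Ioo a b) :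
    Real.sin ε * ‖extendFrom upperHalf F x‖ ≤ (extendFrom upperHalf F x).im := by
  have hcont : ContinuousOn (fun x : ℝ => extendFrom upperHalf F x) (Ioo a b) :=
    (continuousOn_extendFrom_upperHalf hFc fun x hx => ⟨_, hlim x hx⟩).comp
      continuous_ofReal.continuousOn fun x hx => Or.inr ⟨x, hx, rfl⟩
  have hae : ∀ᵐ t : ℝ, t ∈ Ioo a b → Real.sin ε * ‖extendFrom upperHalf F t‖ ≤ (extendFrom upperHalf F t).im := by
    filter_upwards [hη, hB] with t h1 h2 ht
    have h3 := (hlim t ht).comp (tendsto_vertical_upperHalf t)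
    refine le_of_tendsto_of_tendsto (h3.norm.const_mul (Real.sin ε)) ((continuous_im.tendsto _).comp h3) ?_
    filter_upwards [h1.eventually (lt_mem_nhds (h2 ht).1), h1.eventually (gt_mem_nhds (h2 ht).2)] with δ h4 h5
    exact mul_sin_norm_le_im hε h4 h5
  by_contra hlt
  push Not at hlt
  have hev : ∀ᶠ y : ℝ in 𝓝 x, (extendFrom upperHalf F y).im < Real.sin ε * ‖extendFrom upperHalf F y‖ := by
    have hc := hcont.continuousAt (Ioo_mem_nhds hx.1 hx.2)
    exact (continuous_im.continuousAt.comp hc).eventually_lt ((hc.norm).const_mul (Real.sin ε)) hlt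
  obtain ⟨δ, hδ, hball⟩ := Metric.eventually_nhds_iff.1 (hev.and (Ioo_mem_nhds hx.1 hx.2))
  obtain ⟨t, ht, h1⟩ := exists_mem_Ioo_of_ae hae (show x < x + δ by linarith)
  have h2 := hball (y := t) (by rw [Real.dist_eq, abs_lt]; constructor <;> linarith [ht.1, ht.2])
  exact (h1 h2.2).not_gt h2.1

namespace JacobiMatrix

/-- Boundary value of `b_{-1} m^R` from the upper half plane. -/
def bdR (J : JacobiMatrix) (x : ℝ) : ℂ := extendFrom upperHalf J.FR x

/-- Boundary value of `-1 / (b_{-1} m^L)` from the upper half plane. -/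
def bdL (J : JacobiMatrix) (x : ℝ) : ℂ := extendFrom upperHalf J.FL x

lemma CondE.exists_gap_near_two (hE : J.CondE) (hA : J.CondA) : ∃ ε : ℝ, 0 < ε ∧
    Disjoint (Ioo 2 (2 + ε)) (J.specR ∪ J.specL) ∧ (∀ x ∈ Ioo 2 (2 + ε), 0 < (J.M x).re) ∧
    Disjoint (Ioo (-2 - ε) (-2)) (J.specR ∪ J.specL) ∧ ∀ x ∈ Ioo (-2 - ε) (-2), (J.M x).re < 0 := by
  obtain ⟨⟨ε, hε, h⟩, -⟩ := hE
  have hr : ∀ᵐ t : ℝ, t ∈ Ioo 2 (2 + ε) → J.etaR t = 0 ∧ J.etaL t = 0 := by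
    have := (measurePreserving_sub_right volume (2:ℝ)).quasiMeasurePreserving.ae h
    filter_upwards [this] with t ht htI
    have h1 := ht ⟨by linarith [htI.1], by linarith [htI.2]⟩
    rw [add_sub_cancel] at h1; exact ⟨h1.1, h1.2.1⟩
  have hl : ∀ᵐ t : ℝ, t ∈ Ioo (-2 - ε) (-2) → J.etaR t = π ∧ J.etaL t = π := by
    have := (Measure.measurePreserving_sub_left volume (-2:ℝ)).quasiMeasurePreserving.ae h
    filter_upwards [this] with t ht htI
    have h1 := ht ⟨by linarith [htI.2], by linarith [htI.1]⟩
    rw [sub_sub_cancel] at h1; exact ⟨h1.2.2.1, h1.2.2.2⟩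
  have d1 : Disjoint (Ioo 2 (2 + ε)) (J.specR ∪ J.specL) := Disjoint.union_right
    (hA.disjoint_specR (Or.inl (hr.mono fun t ht hI => (ht hI).1)))
    (J.disjoint_specL (Or.inl (hr.mono fun t ht hI => (ht hI).2)))
  have d2 : Disjoint (Ioo (-2 - ε) (-2)) (J.specR ∪ J.specL) := Disjoint.union_right
    (hA.disjoint_specR (Or.inr (hl.mono fun t ht hI => (ht hI).1)))
    (J.disjoint_specL (Or.inr (hl.mono fun t ht hI => (ht hI).2)))
  refine ⟨ε, hε, d1, fun x hx => ?_, d2, fun x hx => ?_⟩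
  · obtain ⟨y, hy, h1, h2, h3⟩ := exists_mem_Ioo_of_ae (hr.and (hA.ae_etaR_compl.and J.ae_etaL_compl)) hx.1
    have hyI : y ∈ Ioo 2 (2 + ε) := ⟨hy.1, hy.2.trans hx.2⟩
    have hyS := disjoint_left.1 d1 hyI
    have k1 := h2 fun h => hyS (Or.inl h)
    have k2 := h3 fun h => hyS (Or.inr h)
    rw [(h1 hyI).1] at k1; rw [(h1 hyI).2] at k2
    have p1 : 0 < (J.FR y).re := by
      rcases k1 with k | k
      · exact k.2
      · exact absurd k.1.symm Real.pi_ne_zero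
    have p2 : 0 < (J.FL y).re := by
      rcases k2 with k | k
      · exact k.2
      · exact absurd k.1.symm Real.pi_ne_zero
    have hmono := hA.isPick_M.strictMonoOn (x := y) (y := x) (fun t ht =>
      disjoint_left.1 d1 ⟨hyI.1.trans_le ht.1, ht.2.trans_lt hx.2⟩)
    have := hmono (left_mem_Icc.2 hy.2.le) (right_mem_Icc.2 hy.2.le) hy.2
    simp only [M_eq, add_re] at this ⊢; linarith
  · obtain ⟨y, hy, h1, h2, h3⟩ := exists_mem_Ioo_of_ae (hl.and (hA.ae_etaR_compl.and J.ae_etaL_compl)) hx.2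
    have hyI : y ∈ Ioo (-2 - ε) (-2) := ⟨hx.1.trans hy.1, hy.2⟩
    have hyS := disjoint_left.1 d2 hyI
    have k1 := h2 fun h => hyS (Or.inl h)
    have k2 := h3 fun h => hyS (Or.inr h)
    rw [(h1 hyI).1] at k1; rw [(h1 hyI).2] at k2
    have p1 : (J.FR y).re < 0 := by
      rcases k1 with k | k
      · exact absurd k.1 Real.pi_ne_zero
      · exact k.2
    have p2 : (J.FL y).re < 0 := by
      rcases k2 with k | k
      · exact absurd k.1 Real.pi_ne_zero
      · exact k.2
    have hmono := hA.isPick_M.strictMonoOn (x := x) (y := y) (fun t ht =>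
      disjoint_left.1 d2 ⟨hx.1.trans_le ht.1, ht.2.trans_lt hyI.2⟩)
    have := hmono (left_mem_Icc.2 hy.1.le) (right_mem_Icc.2 hy.1.le) hy.1
    simp only [M_eq, add_re] at this ⊢; linarith

lemma IsAEHolderOn.mono' {f g : ℝ → ℝ} {S T : Set ℝ} (h : IsAEHolderOn f S) (hT : T ⊆ S)
    (hfg : ∀ t ∈ T, g t = f t) : IsAEHolderOn g T := by
  obtain ⟨K, r, h, hr, hh, he⟩ := h
  refine ⟨K, r, h, hr, hh.mono hT, ?_⟩
  filter_upwards [he] with t ht hI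
  rw [hfg t hI, ht (hT hI)]

lemma CondE.boundary_FR (hE : J.CondE) (hA : J.CondA) (hx : x ∈ Ioo (-2 : ℝ) 2) :
    Tendsto J.FR (𝓝[upperHalf] (x : ℂ)) (𝓝 (J.bdR x)) ∧ J.bdR x ≠ 0 ∧ IsHolderAt J.bdR x := by
  classical
  obtain ⟨-, h2, h3⟩ := hA.FR_rep 3
  have hne : ∀ y ∈ Ioo (-2 : ℝ) 2, ((3 : ℝ) : ℂ) - y ≠ 0 := fun y hy h => by
    have : (3:ℝ) = y := by exact_mod_cast sub_eq_zero.1 h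
    linarith [hy.2]
  refine boundary_of_exp_rep h2 (IsAEHolderOn.mono' hE.2.1 Ioo_subset_Icc_self fun t ht => ?_)
    (fun y hy => ?_) (fun y hy => ?_) h3 hx
  · rw [if_neg (by linarith [ht.2]), sub_zero]
  · have := hne y hy
    fun_prop (disch := assumption)
  · exact div_ne_zero (ofReal_ne_zero.2 hA.rhoR_univ_pos.ne') (hne y hy)

lemma CondE.boundary_FL (hE : J.CondE) (hx : x ∈ Ioo (-2 : ℝ) 2) :
    Tendsto J.FL (𝓝[upperHalf] (x : ℂ)) (𝓝 (J.bdL x)) ∧ J.bdL x ≠ 0 ∧ IsHolderAt J.bdL x := by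
  classical
  obtain ⟨-, h2, h3⟩ := J.FL_rep (-3)
  have hne : ∀ y ∈ Ioo (-2 : ℝ) 2, (y : ℂ) - ((-3 : ℝ) : ℂ) ≠ 0 := fun y hy h => by
    have : y = -3 := by exact_mod_cast sub_eq_zero.1 h
    linarith [hy.1]
  refine boundary_of_exp_rep h2 (IsAEHolderOn.mono' hE.2.2 Ioo_subset_Icc_self fun t ht => ?_)
    (fun y hy => ?_) (fun y hy => ?_) h3 hx
  · rw [if_neg (by linarith [ht.1]), sub_zero]
  · fun_prop
  · exact mul_ne_zero (ofReal_ne_zero.2 (one_div_pos.2 J.b_neg_one_pos).ne') (hne y hy)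

lemma CondE.exists_sector (hE : J.CondE) (hA : J.CondA) (hB : J.CondB) : ∃ s : ℝ, 0 < s ∧
    ∀ x ∈ Ioo (-2 : ℝ) 2, s * ‖J.bdR x‖ ≤ (J.bdR x).im ∧ s * ‖J.bdL x‖ ≤ (J.bdL x).im := by
  obtain ⟨ε, hε, hB⟩ := hB
  have hpi : ε < π := by
    obtain ⟨t, ht, h⟩ := exists_mem_Ioo_of_ae hB (show (-2:ℝ) < 2 by norm_num)
    have := h (hA.2.2.2.1 (Ioo_subset_Icc_self ht))
    linarith [this.1.1, this.1.2]
  refine ⟨Real.sin ε, Real.sin_pos_of_pos_of_lt_pi hε hpi, fun x hx => ⟨?_, ?_⟩⟩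
  · refine sector_of_ae hε (fun w hw => (hA.isPick_FR.differentiableAt_of_im hw.ne').continuousAt)
      (hA.FR_rep 0).1 (fun y hy => (hE.boundary_FR hA hy).1) ?_ hx
    filter_upwards [hB] with t ht hI using (ht (hA.2.2.2.1 (Ioo_subset_Icc_self hI))).1
  · refine sector_of_ae hε (fun w hw => (J.isPick_FL.differentiableAt_of_im hw.ne').continuousAt)
      (J.FL_rep 0).1 (fun y hy => (hE.boundary_FL hy).1) ?_ hx
    filter_upwards [hB] with t ht hI using (ht (hA.2.2.2.1 (Ioo_subset_Icc_self hI))).2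

lemma CondC.exists_ratio_bound (hC : J.CondC) (hA : J.CondA) (hE : J.CondE) : ∃ κ : ℝ, 0 < κ ∧
    ∀ x ∈ Ioo (-2 : ℝ) 2, ‖J.bdR x‖ ≤ κ * ‖J.bdL x‖ ∧ ‖J.bdL x‖ ≤ κ * ‖J.bdR x‖ := by
  classical
  obtain ⟨U, hU, hsub, hH⟩ := hC
  have hIU : Icc (-2 : ℝ) 2 ⊆ U := hA.2.2.2.1.trans hsub
  obtain ⟨δ, hδ, hδ1, hδU⟩ : ∃ δ : ℝ, 0 < δ ∧ δ ≤ 1 ∧ Ioo (-2 - δ) (2 + δ) ⊆ U := by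
    obtain ⟨δ, hδ, h⟩ := (isCompact_Icc (a := (-2:ℝ)) (b := 2)).exists_thickening_subset_open hU hIU
    refine ⟨min δ 1, lt_min hδ one_pos, min_le_right _ _, fun x hx => h ?_⟩
    rw [mem_thickening_iff]
    have hm : min δ 1 ≤ δ := min_le_left _ _
    rcases lt_or_ge x (-2) with h1 | h1
    · exact ⟨-2, by norm_num, by rw [Real.dist_eq, abs_lt]; constructor <;> linarith [hx.1]⟩
    rcases lt_or_ge 2 x with h2 | h2
    · exact ⟨2, by norm_num, by rw [Real.dist_eq, abs_lt]; constructor <;> linarith [hx.2]⟩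
    · exact ⟨x, ⟨h1, h2⟩, by simpa using hδ⟩
  obtain ⟨-, i1, r1⟩ := hA.FR_rep 10
  obtain ⟨-, i2, r2⟩ := J.FL_rep (-10)
  set fR := fun t => J.etaR t - if (10:ℝ) < t then π else 0 with hfR
  set fL := fun t => J.etaL t - if t < (-10:ℝ) then π else 0 with hfL
  obtain ⟨Φ, C, r, hr, -, hΦ, hΦh⟩ := exists_cauchyInt_boundary (i1.sub i2)
    (a := -2 - δ) (b := 2 + δ) (a' := -2 - δ / 2) (b' := 2 + δ / 2)
    (IsAEHolderOn.mono' hH hδU fun t ht => by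
      simp only [hfR, hfL, Pi.sub_apply]
      rw [if_neg (by linarith [ht.2]), if_neg (by linarith [ht.1]), sub_zero, sub_zero])
    (by linarith) (by linarith) (by linarith)
  have hmem0 : (0:ℝ) ∈ Ioo (-2 - δ / 2) (2 + δ / 2) := ⟨by linarith, by linarith⟩
  set B := ‖Φ 0‖ + |C| * 2 ^ r with hB
  have hBd : ∀ x ∈ Ioo (-2:ℝ) 2, ‖Φ x‖ ≤ B := by
    intro x hx
    have h1 := hΦh x ⟨by linarith [hx.1], by linarith [hx.2]⟩ 0 hmem0
    have h2 : |x - 0| ^ r ≤ 2 ^ r := by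
      gcongr
      rw [sub_zero, abs_le]; constructor <;> linarith [hx.1, hx.2]
    have h3 := norm_sub_norm_le (Φ x) (Φ 0)
    have h4 : C * |x - 0| ^ r ≤ |C| * 2 ^ r := by refine mul_le_mul (le_abs_self C) h2 (by positivity) (abs_nonneg C)
    linarith
  have hcpos := hA.rhoR_univ_pos
  set c := J.rhoR.real univ
  have hb := J.b_neg_one_pos
  set b := J.b (-1)
  have hratio : ∀ x ∈ Ioo (-2:ℝ) 2, J.bdR x = J.bdL x * (c / ((10:ℝ) - x) * (b / ((x:ℂ) - ((-10:ℝ):ℂ))) *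
      exp (1 / π * Φ x)) := by
    intro x hx
    have n1 : ((10:ℝ):ℂ) - x ≠ 0 := fun h => by
      have : (10:ℝ) = x := by exact_mod_cast sub_eq_zero.1 h
      linarith [hx.2]
    have n2 : (x:ℂ) - ((-10:ℝ):ℂ) ≠ 0 := fun h => by
      have : x = (-10:ℝ) := by exact_mod_cast sub_eq_zero.1 h
      linarith [hx.1]
    refine tendsto_nhds_unique (hE.boundary_FR hA hx).1 ?_
    have t1 : Tendsto (fun w : ℂ => (c:ℂ) / ((10:ℝ) - w) * (b / (w - ((-10:ℝ):ℂ)))) (𝓝[upperHalf] (x:ℂ))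
        (𝓝 (c / ((10:ℝ) - x) * (b / ((x:ℂ) - ((-10:ℝ):ℂ))))) := by
      have : ContinuousAt (fun w : ℂ => (c:ℂ) / ((10:ℝ) - w) * (b / (w - ((-10:ℝ):ℂ)))) (x:ℂ) := by
        fun_prop (disch := assumption)
      exact this.continuousWithinAt
    refine ((hE.boundary_FL hx).1.mul (t1.mul (((hΦ x ⟨by linarith [hx.1], by linarith [hx.2]⟩).const_mul
      (1 / π : ℂ)).cexp))).congr' ?_
    filter_upwards [self_mem_nhdsWithin] with w hw
    have hw0 : w.im ≠ 0 := ne_of_gt hw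
    have m1 : ((10:ℝ):ℂ) - w ≠ 0 := ofReal_sub_ne_zero hw0 10
    have m2 : w - ((-10:ℝ):ℂ) ≠ 0 := by rw [← neg_sub]; exact neg_ne_zero.2 (ofReal_sub_ne_zero hw0 (-10))
    have e : cauchyInt (fR - fL) w = cauchyInt fR w - cauchyInt fL w := by
      rw [cauchyInt, cauchyInt, cauchyInt, ← integral_sub
        (integrable_mul_cauchyKernel' i1 hw0) (integrable_mul_cauchyKernel' i2 hw0)]
      refine integral_congr_ae (.of_forall fun t => ?_)
      simp only [Pi.sub_apply, ofReal_sub, sub_mul]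
    have hbb : (b:ℂ) ≠ 0 := ofReal_ne_zero.2 hb.ne'
    rw [e, r1 w hw0, r2 w hw0, mul_sub (1 / (π : ℂ)), exp_sub]
    have := exp_ne_zero (1 / π * cauchyInt fL w)
    push_cast at m1 m2 ⊢; field_simp
  have hexp : ∀ x ∈ Ioo (-2:ℝ) 2, Real.exp (-(1 / π * B)) ≤ ‖exp (1 / π * Φ x)‖ ∧
      ‖exp (1 / π * Φ x)‖ ≤ Real.exp (1 / π * B) := by
    intro x hx; rw [norm_exp]
    have e : (1 / (π : ℂ) * Φ x).re = 1 / π * (Φ x).re := by rw [← ofReal_one, ← ofReal_div, re_ofReal_mul]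
    have h1 := abs_le.1 ((abs_re_le_norm (Φ x)).trans (hBd x hx))
    have hp : 0 < 1 / π := by positivity
    rw [e, Real.exp_le_exp, Real.exp_le_exp]
    constructor
    · nlinarith [h1.1]
    · exact mul_le_mul_of_nonneg_left h1.2 hp.le
  set E := Real.exp (1 / π * B) with hE'
  have hEpos : 0 < E := Real.exp_pos _
  have hEinv : Real.exp (-(1 / π * B)) = E⁻¹ := by rw [Real.exp_neg]
  refine ⟨c * b * E + 144 / (c * b) * E, by positivity, fun x hx => ?_⟩
  have hnorm : ‖J.bdR x‖ = ‖J.bdL x‖ * (c / (10 - x) * (b / (x + 10)) * ‖exp (1 / π * Φ x)‖) := by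
    have q1 : ‖((10:ℝ):ℂ) - x‖ = 10 - x := by rw [← ofReal_sub, norm_real, Real.norm_of_nonneg (by linarith [hx.2])]
    have q2 : ‖(x:ℂ) - ((-10:ℝ):ℂ)‖ = x + 10 := by
      rw [← ofReal_sub, norm_real, Real.norm_of_nonneg (by linarith [hx.1])]; ring
    rw [hratio x hx, norm_mul, norm_mul, norm_mul, norm_div, norm_div, q1, q2, norm_real,
      norm_real, Real.norm_of_nonneg hcpos.le, Real.norm_of_nonneg hb.le]
  obtain ⟨e1, e2⟩ := hexp x hx
  rw [hEinv] at e1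
  set e := ‖exp (1 / π * Φ x)‖
  have hx1 : 1 ≤ 10 - x := by linarith [hx.2]
  have hx2 : 1 ≤ x + 10 := by linarith [hx.1]
  have hx3 : 10 - x ≤ 12 := by linarith [hx.1]
  have hx4 : x + 10 ≤ 12 := by linarith [hx.2]
  have up : c / (10 - x) * (b / (x + 10)) * e ≤ c * b * E := by
    gcongr
    · exact div_le_self hcpos.le hx1
    · exact div_le_self hb.le hx2
  have low : c * b / 144 * E⁻¹ ≤ c / (10 - x) * (b / (x + 10)) * e := by
    have : c * b / 144 ≤ c / (10 - x) * (b / (x + 10)) := by rw [div_mul_div_comm]; gcongr; nlinarith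
    exact mul_le_mul this e1 (by positivity) (by positivity)
  set t := c / (10 - x) * (b / (x + 10)) * e
  constructor
  · rw [hnorm, mul_comm]; gcongr
    have : 0 ≤ 144 / (c * b) * E := by positivity
    linarith
  · have h1 : 1 ≤ (144 / (c * b) * E) * t := by
      calc (1:ℝ) = (144 / (c * b) * E) * (c * b / 144 * E⁻¹) := by field_simp
        _ ≤ _ := by gcongr
    have h2 : 0 ≤ c * b * E * t := le_trans (by positivity) (mul_le_mul_of_nonneg_left low (by positivity))
    rw [hnorm]; nlinarith [norm_nonneg (J.bdL x)]

end JacobiMatrix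

lemma measurableSet_of_isOpen_frequently {s : Set ℝ} (hs : IsOpen s) (hne : s.Nonempty) {I : Set ℝ}
    (hI : MeasurableSet I) (hsI : s ⊆ I) {p : ℝ → Prop} (h : ∀ᵐ t : ℝ, t ∈ s → p t) :
    ∃ᶠ t in ae (volume.restrict I), p t := by
  intro hp; rw [ae_restrict_iff' hI] at hp
  have : ∀ᵐ t : ℝ, t ∉ s := by filter_upwards [h, hp] with t h1 h2 h3 using h2 (hsI h3) (h1 h3)
  exact (hs.measure_pos volume hne).ne' (measure_eq_zero_iff_ae_notMem.2 this)

namespace IsPick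

variable {F : ℂ → ℂ} {S : Set ℝ} (hF : IsPick F S)
include hF

/-- On an open set on which the boundary argument oscillates by less than `π`, the function has
constant sign off `S`. -/
lemma const_sign {I : Set ℝ} (hI : IsOpen I) (hη : ∀ᵐ t : ℝ, boundaryArg F t ∈ Icc 0 π)
    (hosc : essSup (boundaryArg F) (volume.restrict I) - essInf (boundaryArg F) (volume.restrict I) < π) :
    (∀ t ∈ I, t ∉ S → 0 < (F t).re) ∨ (∀ t ∈ I, t ∉ S → (F t).re < 0) := by
  by_contra hcon
  push Not at hcon
  obtain ⟨⟨t, ht, htS, h1⟩, ⟨u, hu, huS, h2⟩⟩ := hcon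
  have hη' : ∀ᵐ t ∂(volume.restrict I), boundaryArg F t ∈ Icc 0 π := ae_restrict_of_ae hη
  have hopen : ∀ x ∈ I, x ∉ S → ∃ δ > 0, Icc (x - δ) (x + δ) ⊆ I \ S := by
    intro x hx hxS
    obtain ⟨δ, hδ, h⟩ := isOpen_iff.1 (hI.sdiff hF.closed) x ⟨hx, hxS⟩
    refine ⟨δ / 2, half_pos hδ, fun y hy => h ?_⟩
    rw [Real.ball_eq_Ioo]
    constructor <;> linarith [hy.1, hy.2]
  have f1 : ∃ᶠ s in ae (volume.restrict I), π ≤ boundaryArg F s := by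
    obtain ⟨δ, hδ, hsub⟩ := hopen t ht htS
    refine measurableSet_of_isOpen_frequently (s := Ioo (t - δ) t) isOpen_Ioo (nonempty_Ioo.2 (by linarith))
      hI.measurableSet (fun y hy => (hsub ⟨hy.1.le, by linarith [hy.2]⟩).1) (.of_forall fun s hs => ?_)
    have hmono := hF.strictMonoOn (x := t - δ) (y := t + δ) (fun y hy => (hsub hy).2)
    have := hmono ⟨hs.1.le, by linarith [hs.2]⟩ ⟨by linarith, by linarith⟩ hs.2
    rw [hF.boundaryArg_of_neg (hsub ⟨hs.1.le, by linarith [hs.2]⟩).2 (this.trans_le h1)]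
  have f2 : ∃ᶠ s in ae (volume.restrict I), boundaryArg F s ≤ 0 := by
    obtain ⟨δ, hδ, hsub⟩ := hopen u hu huS
    refine measurableSet_of_isOpen_frequently (s := Ioo u (u + δ)) isOpen_Ioo (nonempty_Ioo.2 (by linarith))
      hI.measurableSet (fun y hy => (hsub ⟨by linarith [hy.1], hy.2.le⟩).1) (.of_forall fun s hs => ?_)
    have hmono := hF.strictMonoOn (x := u - δ) (y := u + δ) (fun y hy => (hsub hy).2)
    have := hmono ⟨by linarith, by linarith⟩ ⟨by linarith [hs.1], hs.2.le⟩ hs.1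
    rw [hF.boundaryArg_of_pos (hsub ⟨by linarith [hs.1], hs.2.le⟩).2 (h2.trans_lt this)]
  have k1 : π ≤ essSup (boundaryArg F) (volume.restrict I) :=
    le_limsup_of_frequently_le f1 (isBoundedUnder_of_eventually_le (hη'.mono fun t ht => ht.2))
  have k2 : essInf (boundaryArg F) (volume.restrict I) ≤ 0 :=
    liminf_le_of_frequently_le f2 (isBoundedUnder_of_eventually_ge (hη'.mono fun t ht => ht.1))
  linarith

lemma ae_boundaryArg_of_forall {I : Set ℝ}
    (h : (c = 0 ∧ ∀ t ∈ I, t ∉ S → 0 < (F t).re) ∨ (c = π ∧ ∀ t ∈ I, t ∉ S → (F t).re < 0)) :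
    ∀ t ∈ I, t ∉ S → boundaryArg F t = c := by
  intro t ht htS
  rcases h with ⟨rfl, h⟩ | ⟨rfl, h⟩
  · exact hF.boundaryArg_of_pos htS (h t ht htS)
  · exact hF.boundaryArg_of_neg htS (h t ht htS)

end IsPick

namespace JacobiMatrix

lemma CondA.notMem_spec (hA : J.CondA) (h1 : t ∉ J.spec1) (h2 : t ∉ J.spec2s)
    (h3 : t ∉ J.spec2a) : t ∉ J.specR ∪ J.specL := by
  rw [← hA.union_spec]
  rintro ((h | h) | h)
  exacts [h1 h, h2 h, h3 h]

lemma CondC.eq_of_accumulation (hC : J.CondC) (hA : J.CondA) (hB : J.CondB) {I : Set ℝ}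
    (hI : IsOpen I) {cR cL x p : ℝ} (hR : ∀ t ∈ I, t ∉ J.specR → J.etaR t = cR)
    (hL : ∀ t ∈ I, t ∉ J.specL → J.etaL t = cL) (hcR : cR = 0 ∨ cR = π)
    (hcL : cL = 0 ∨ cL = π) (hx : x ∈ I) (hxa : x ∈ J.spec2a) (hp : p < x)
    (hpx : ∀ t ∈ Ioo p x, t ∉ J.specR ∪ J.specL) : cR = cL := by
  obtain ⟨ε, hε, hB⟩ := hB
  obtain ⟨U, hU, hsub, K, r, h, hr, hh, hae⟩ := hC
  have hhc : ContinuousAt h x := (hh.continuousOn hr).continuousAt (hU.mem_nhds (hsub hxa))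
  have hx1 : x ∉ J.spec1 := fun h1 => by
    obtain ⟨r, hr, hs⟩ := hA.2.1
    have := hs x h1 x hxa
    simp at this; exact hr this
  have hx2 : x ∉ J.spec2s := hxa.2
  obtain ⟨δ, hδ, hball⟩ := isOpen_iff.1 (((hU.inter hI).inter hA.isClosed_spec1.isOpen_compl).inter
    hA.isClosed_spec2s.isOpen_compl) x ⟨⟨⟨hsub hxa, hx⟩, hx1⟩, hx2⟩
  have hmem : ∀ {t δ' : ℝ}, δ' ≤ δ → t ∈ Ioo (x - δ') (x + δ') → ((t ∈ U ∧ t ∈ I) ∧ t ∉ J.spec1) ∧ t ∉ J.spec2s := by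
    intro t δ' h1 h2
    refine hball ?_
    rw [Real.ball_eq_Ioo]
    constructor <;> linarith [h2.1, h2.2]
  have hval : h x = cR - cL := by
    by_contra hne
    obtain ⟨δ', hδ', hev⟩ := Metric.eventually_nhds_iff.1 (hhc.eventually_ne hne)
    obtain ⟨t, ht, h1⟩ := exists_mem_Ioo_of_ae hae
      (show max (max p (x - δ)) (x - δ') < x by simp only [max_lt_iff]; exact ⟨⟨hp, by linarith⟩, by linarith⟩)
    have ht1 : max p (x - δ) < t := (le_max_left _ _).trans_lt ht.1
    have ht2 : x - δ' < t := (le_max_right _ _).trans_lt ht.1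
    have ht3 : p < t := (le_max_left _ _).trans_lt ht1
    have ht4 : x - δ < t := (le_max_right _ _).trans_lt ht1
    have hm := hmem le_rfl ⟨ht4, by linarith [ht.2]⟩
    have hS := hpx t ⟨ht3, ht.2⟩
    refine hev (y := t) (by rw [Real.dist_eq, abs_lt]; constructor <;> linarith [ht.2]) ?_
    rw [← h1 hm.1.1.1]
    beta_reduce
    rw [hR t hm.1.1.2 fun h => hS (Or.inl h), hL t hm.1.1.2 fun h => hS (Or.inr h)]
  have hbound : |h x| ≤ π - ε := by
    by_contra hgt
    push Not at hgt
    obtain ⟨δ', hδ', hev⟩ := Metric.eventually_nhds_iff.1 (hhc.abs.eventually (lt_mem_nhds hgt))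
    have hm1 : min δ δ' ≤ δ := min_le_left _ _
    have hm2 : min δ δ' ≤ δ' := min_le_right _ _
    have hm0 : 0 < min δ δ' := lt_min hδ hδ'
    have hnot : ∀ᵐ t : ℝ, t ∈ Ioo (x - min δ δ') (x + min δ δ') → J.etaR t = cR := by
      filter_upwards [hae, hB] with t h1 h2 ht
      have hm := hmem hm1 ht
      by_cases hta : t ∈ J.spec2a
      · exfalso
        have h3 := hev (y := t) (by rw [Real.dist_eq, abs_lt]; constructor <;> linarith [ht.1, ht.2])
        rw [← h1 hm.1.1.1] at h3
        obtain ⟨⟨a1, a2⟩, a3, a4⟩ := h2 hta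
        refine h3.not_ge (abs_le.2 ⟨by linarith, by linarith⟩)
      · exact hR t hm.1.1.2 fun h => hA.notMem_spec hm.1.2 hm.2 hta (Or.inl h)
    have hd : Disjoint (Ioo (x - min δ δ') (x + min δ δ')) J.specR := by
      refine hA.disjoint_specR ?_
      rcases hcR with rfl | rfl
      · exact Or.inl hnot
      · exact Or.inr hnot
    exact disjoint_left.1 hd ⟨by linarith, by linarith⟩ hxa.1.1
  rw [hval] at hbound
  have := Real.pi_pos
  rcases hcR with rfl | rfl <;> rcases hcL with rfl | rfl
  · rfl
  · rw [zero_sub, abs_neg, abs_of_pos this] at hbound; linarith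
  · rw [sub_zero, abs_of_pos this] at hbound; linarith
  · rfl

lemma M_pos_of_le (hA : J.CondA) (hB : J.CondB) (hC : J.CondC) (hD : J.CondD) {x y : ℝ}
    (hxy : x ≤ y) (h1 : ∀ t ∈ Icc x y, t ∉ J.spec1 ∧ t ∉ J.spec2s ∧ t ∉ Icc (-2 : ℝ) 2)
    (hx : x ∉ J.spec2a) (hy : y ∉ J.spec2a) (hpos : 0 < (J.M x).re) : 0 < (J.M y).re := by
  have hM := hA.isPick_M
  by_contra hle
  set P : Set ℝ := {t | t ∈ Icc x y ∧ t ∉ J.spec2a ∧ 0 < (J.M t).re} with hP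
  have hxP : x ∈ P := ⟨left_mem_Icc.2 hxy, hx, hpos⟩
  have hPb : BddAbove P := ⟨y, fun t ht => ht.1.2⟩
  set T := sSup P with hT
  have hxT : x ≤ T := le_csSup hPb hxP
  have hTy : T ≤ y := csSup_le ⟨x, hxP⟩ fun t ht => ht.1.2
  have hTG : T ∈ Icc x y := ⟨hxT, hTy⟩
  have hspec : ∀ t ∈ Icc x y, t ∉ J.spec2a → t ∉ J.specR ∪ J.specL := fun t ht hta =>
    hA.notMem_spec (h1 t ht).1 (h1 t ht).2.1 hta
  have hyP : y ∉ P := fun h => hle h.2.2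
  have hnear : ∀ δ > 0, ∃ p ∈ P, T - δ < p ∧ p ≤ T := fun δ hδ => by
    obtain ⟨p, hp, h⟩ := exists_lt_of_lt_csSup ⟨x, hxP⟩ (show T - δ < sSup P by linarith)
    exact ⟨p, hp, h, le_csSup hPb hp⟩
  by_cases hTa : T ∈ J.spec2a
  swap
  · obtain ⟨δ, hδ, hball⟩ := isOpen_iff.1 hM.closed.isOpen_compl T (hspec T hTG hTa)
    obtain ⟨p, hp, h2, h3⟩ := hnear (δ / 2) (half_pos hδ)
    set u := min y (T + δ / 2) with hu
    have hpu : p ≤ u := le_min hp.1.2 (by linarith)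
    have hu2 : u ≤ T + δ / 2 := min_le_right _ _
    have hmono := hM.strictMonoOn (x := p) (y := u) (fun t ht => hball (by
      rw [Real.ball_eq_Ioo]
      constructor <;> linarith [ht.1, ht.2]))
    have huP : u ∈ P := by
      refine ⟨⟨hp.1.1.trans hpu, min_le_left _ _⟩, fun hua => ?_, ?_⟩
      · exact hball (a := u) (by
          rw [Real.ball_eq_Ioo]
          constructor <;> linarith) (Or.inl hua.1.1)
      · exact hp.2.2.trans_le (hmono.monotoneOn (left_mem_Icc.2 hpu) (right_mem_Icc.2 hpu) hpu)
    have huT : u ≤ T := le_csSup hPb huP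
    rcases min_choice y (T + δ / 2) with h | h
    · exact hyP (by rw [← h]; exact huP)
    · rw [hu, h] at huT; linarith
  · have hxT' : x < T := lt_of_le_of_ne hxT fun h => hx (h ▸ hTa)
    have hTy' : T < y := lt_of_le_of_ne hTy fun h => hy (h ▸ hTa)
    obtain ⟨S, hS, hdisj, hcov⟩ := hD
    obtain ⟨I, hIS, hTI⟩ := hcov ⟨hTa, (h1 T hTG).2.2⟩
    obtain ⟨hIo, hIc, hoR, hoL⟩ := hS I hIS
    have sR := hA.isPick_FR.const_sign hIo (by rw [← etaR_eq]; exact hA.ae_etaR_mem) (by rw [← etaR_eq]; exact hoR)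
    have sL := J.isPick_FL.const_sign hIo (by rw [← etaL_eq]; exact J.ae_etaL_mem) (by rw [← etaL_eq]; exact hoL)
    obtain ⟨δ, hδ, hball⟩ := isOpen_iff.1 hIo T hTI
    obtain ⟨p, hpP, hp1, hp2⟩ := hnear δ hδ
    have hpT : p < T := lt_of_le_of_ne hp2 fun h => hpP.2.1 (h ▸ hTa)
    have hpI : p ∈ I := hball (by rw [Real.ball_eq_Ioo]; constructor <;> linarith)
    set A := J.spec2a ∩ Icc p T with hAdef
    have hAc : IsCompact A := isCompact_Icc.inter_left hA.isClosed_spec2a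
    have hAne : A.Nonempty := ⟨T, hTa, hp2, le_rfl⟩
    have hvA := hAc.sInf_mem hAne
    set v := sInf A with hv
    have hpv : p < v := lt_of_le_of_ne hvA.2.1 fun h => hpP.2.1 (h ▸ hvA.1)
    have hpos' : (∀ t ∈ I, t ∉ J.specR → 0 < (J.FR t).re) ∧ ∀ t ∈ I, t ∉ J.specL → 0 < (J.FL t).re := by
      have hps := hspec p hpP.1 hpP.2.1
      have key : ∀ cR cL : ℝ, (∀ t ∈ I, t ∉ J.specR → J.etaR t = cR) → (∀ t ∈ I, t ∉ J.specL → J.etaL t = cL) →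
          (cR = 0 ∨ cR = π) → (cL = 0 ∨ cL = π) → cR = cL := by
        intro cR cL h2 h3 h4 h5
        refine hC.eq_of_accumulation hA hB hIo h2 h3 h4 h5 (hIc.out hpI hTI ⟨hpv.le, hvA.2.2⟩) hvA.1 hpv
          fun t ht => hspec t ⟨hpP.1.1.trans ht.1.le, (ht.2.le.trans hvA.2.2).trans hTy⟩ fun hta => ?_
        exact ht.2.not_ge (csInf_le ⟨p, fun s hs => hs.2.1⟩ ⟨hta, ht.1.le, ht.2.le.trans hvA.2.2⟩)
      have eR : ∀ {c : ℝ}, _ → ∀ t ∈ I, t ∉ J.specR → J.etaR t = c := fun {c} h => by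
        rw [etaR_eq]; exact hA.isPick_FR.ae_boundaryArg_of_forall (I := I) (c := c) h
      have eL : ∀ {c : ℝ}, _ → ∀ t ∈ I, t ∉ J.specL → J.etaL t = c := fun {c} h => by
        rw [etaL_eq]; exact J.isPick_FL.ae_boundaryArg_of_forall (I := I) (c := c) h
      rcases sR with sR | sR <;> rcases sL with sL | sL
      · exact ⟨sR, sL⟩
      · exact absurd (key 0 π (eR (Or.inl ⟨rfl, sR⟩)) (eL (Or.inr ⟨rfl, sL⟩)) (Or.inl rfl) (Or.inr rfl))
          Real.pi_ne_zero.symm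
      · exact absurd (key π 0 (eR (Or.inr ⟨rfl, sR⟩)) (eL (Or.inl ⟨rfl, sL⟩)) (Or.inr rfl) (Or.inl rfl)) Real.pi_ne_zero
      · exfalso
        have := hpP.2.2
        rw [M_eq, add_re] at this
        linarith [sR p hpI fun h => hps (Or.inl h), sL p hpI fun h => hps (Or.inr h)]
    have hright : ∀ t ∈ I, T < t → t ≤ y → t ∈ J.spec2a := by
      intro t ht hTt hty
      by_contra hta
      have hts := hspec t ⟨hxT.trans hTt.le, hty⟩ hta
      have : t ∈ P := by
        refine ⟨⟨hxT.trans hTt.le, hty⟩, hta, ?_⟩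
        rw [M_eq, add_re]
        linarith [hpos'.1 t ht fun h => hts (Or.inl h), hpos'.2 t ht fun h => hts (Or.inr h)]
      exact (le_csSup hPb this).not_gt hTt
    have hyI : y ∉ I := fun h => hy (hright y h hTy' le_rfl)
    have hIle : ∀ t ∈ I, t < y := by
      intro t ht
      by_contra hge
      push Not at hge; exact hyI (hIc.out hTI ht ⟨hTy, hge⟩)
    have hIb : BddAbove I := ⟨y, fun t ht => (hIle t ht).le⟩
    set u := sSup I with hu
    have huy : u ≤ y := csSup_le ⟨T, hTI⟩ fun t ht => (hIle t ht).le
    have hTu : T < u := by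
      obtain ⟨δ, hδ, hball⟩ := isOpen_iff.1 hIo T hTI
      have : T + δ / 2 ∈ I := hball (by rw [Real.ball_eq_Ioo]; constructor <;> linarith)
      linarith [le_csSup hIb this]
    have huI : u ∉ I := by
      intro h
      obtain ⟨δ, hδ, hball⟩ := isOpen_iff.1 hIo u h
      have : u + δ / 2 ∈ I := hball (by rw [Real.ball_eq_Ioo]; constructor <;> linarith)
      linarith [le_csSup hIb this]
    have hTuI : ∀ t, T ≤ t → t < u → t ∈ I := by
      intro t h2 h3
      obtain ⟨s, hs, hts⟩ := exists_lt_of_lt_csSup ⟨T, hTI⟩ h3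
      exact hIc.out hTI hs ⟨h2, hts.le⟩
    have hua : u ∈ J.spec2a := by
      have : Icc T u ⊆ J.spec2a := by
        rw [← closure_Ioo hTu.ne]
        refine closure_minimal (fun t ht => ?_) hA.isClosed_spec2a
        exact hright t (hTuI t ht.1.le ht.2) ht.1 (ht.2.le.trans huy)
      exact this (right_mem_Icc.2 hTu.le)
    obtain ⟨I', hIS', huI'⟩ := hcov ⟨hua, (h1 u ⟨hxT.trans hTu.le, huy⟩).2.2⟩
    have hne : I ≠ I' := fun h => huI (h ▸ huI')
    obtain ⟨δ', hδ', hball'⟩ := isOpen_iff.1 (hS I' hIS').1 u huI'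
    have hm : max T (u - δ' / 2) < u := max_lt hTu (by linarith)
    refine disjoint_left.1 (hdisj hIS hIS' hne) (hTuI _ (le_max_left _ _) hm) (hball' ?_)
    rw [Real.ball_eq_Ioo]
    constructor <;> linarith [le_max_right T (u - δ' / 2)]

end JacobiMatrix

/-! ### The map `t ↦ t + t⁻¹` on the real line -/

lemma add_inv_lt_add_inv {s t : ℝ} (h : s < t) (hst : 1 < s * t) : s + s⁻¹ < t + t⁻¹ := by
  have h0 : s * t ≠ 0 := by positivity
  have hs : s ≠ 0 := left_ne_zero_of_mul h0
  have ht : t ≠ 0 := right_ne_zero_of_mul h0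
  have e : t + t⁻¹ - (s + s⁻¹) = (t - s) * (s * t - 1) / (s * t) := by field_simp; ring
  have : 0 < (t - s) * (s * t - 1) / (s * t) := div_pos (mul_pos (by linarith) (by linarith)) (by linarith)
  linarith

lemma two_lt_add_inv (h : 1 < t) : 2 < t + t⁻¹ := by
  have h0 : (0:ℝ) < t := by linarith
  have e : t + t⁻¹ - 2 = (t - 1) ^ 2 / t := by field_simp; ring
  have : 0 < (t - 1) ^ 2 / t := div_pos (by have := sub_pos.2 h; positivity) h0
  linarith

lemma add_inv_lt_neg_two (h : t < -1) : t + t⁻¹ < -2 := by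
  have := two_lt_add_inv (t := -t) (by linarith)
  rw [inv_neg] at this; linarith

lemma two_lt_abs_add_inv (h : 1 < |t|) : 2 < |t + t⁻¹| := by
  rcases lt_abs.1 h with h | h
  · exact lt_abs.2 (Or.inl (two_lt_add_inv h))
  · exact lt_abs.2 (Or.inr (by linarith [add_inv_lt_neg_two (t := t) (by linarith)]))

lemma one_lt_mul_of_abs {s t : ℝ} (hs : 1 < |s|) (ht : 1 < |t|) (h : 0 < s * t) : 1 < s * t := by
  rw [← abs_of_pos h, abs_mul]; nlinarith

lemma exists_add_inv_eq {τ : ℝ} (h : 2 < |τ|) : ∃ t : ℝ, 1 < |t| ∧ t + t⁻¹ = τ := by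
  have key : ∀ τ : ℝ, 2 < τ → ∃ t : ℝ, 1 < t ∧ t + t⁻¹ = τ := by
    intro τ h
    have hs : 0 < τ ^ 2 - 4 := by nlinarith
    have hsq := Real.sq_sqrt hs.le
    have hs0 := Real.sqrt_nonneg (τ ^ 2 - 4)
    refine ⟨(τ + √(τ ^ 2 - 4)) / 2, by linarith, ?_⟩
    have : (τ + √(τ ^ 2 - 4)) ≠ 0 := by positivity
    field_simp; nlinarith
  rcases lt_abs.1 h with h | h
  · obtain ⟨t, ht, e⟩ := key τ h
    exact ⟨t, lt_abs.2 (Or.inl ht), e⟩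
  · obtain ⟨t, ht, e⟩ := key (-τ) h
    exact ⟨-t, by rw [abs_neg]; exact lt_abs.2 (Or.inl ht), by rw [inv_neg]; linarith⟩

lemma add_inv_injOn : InjOn (fun t : ℝ => t + t⁻¹) {t | 1 < |t|} := by
  have key : ∀ s t : ℝ, 1 < |s| → 1 < |t| → s < t → s + s⁻¹ ≠ t + t⁻¹ := by
    intro s t hs ht hst
    rcases lt_abs.1 hs with h1 | h1
    · exact (add_inv_lt_add_inv hst (one_lt_mul_of_abs hs ht (by nlinarith))).ne
    · rcases lt_abs.1 ht with h2 | h2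
      · have := two_lt_add_inv h2
        linarith [add_inv_lt_neg_two (t := s) (by linarith)]
      · exact (add_inv_lt_add_inv hst (one_lt_mul_of_abs hs ht (by nlinarith))).ne
  intro s hs t ht hst
  rcases lt_trichotomy s t with h | h | h
  · exact absurd hst (key s t hs ht h)
  · exact h
  · exact absurd hst.symm (key t s ht hs h)

lemma continuousOn_add_inv : ContinuousOn (fun t : ℝ => t + t⁻¹) {t | t ≠ 0} := continuousOn_id.add (continuousOn_inv₀)

lemma isOpen_one_lt_abs : IsOpen {t : ℝ | 1 < |t|} := isOpen_lt continuous_const continuous_abs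

lemma ne_zero_of_one_lt_abs (h : 1 < |t|) : t ≠ 0 := by rintro rfl; simp at h; linarith

lemma abs_inv_lt_one (h : 1 < |t|) : |t⁻¹| < 1 := by rw [abs_inv]; exact inv_lt_one_of_one_lt₀ h

lemma one_lt_abs_inv (h0 : t ≠ 0) (h : |t| < 1) : 1 < |t⁻¹| := by rw [abs_inv]; exact (one_lt_inv₀ (abs_pos.2 h0)).2 h

namespace JacobiMatrix

lemma mem_Omega_of_one_lt (h : 1 < |t|) : t ∈ J.Omega ↔ t + t⁻¹ ∈ J.specL := by
  simp only [Omega, mem_union, mem_ofPred_eq, h, true_and, h.not_gt, false_and, and_false, false_or]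

lemma mem_Omega_of_lt_one (h0 : t ≠ 0) (h : |t| < 1) : t ∈ J.Omega ↔ t + t⁻¹ ∈ J.specR := by
  simp only [Omega, mem_union, mem_ofPred_eq, h, true_and, h.not_gt, false_and, h0, ne_eq, not_false_eq_true, or_false]

lemma notMem_Omega (h : t = 0 ∨ |t| = 1) : t ∉ J.Omega := by
  rcases h with rfl | h
  · simp [Omega]
  · simp [Omega, h]

lemma mem_invSet_Omega_of_one_lt (h : 1 < |t|) :
    t ∈ invSet J.Omega ↔ t + t⁻¹ ∈ J.specR := by
  have h0 := ne_zero_of_one_lt_abs h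
  simp only [invSet, mem_ofPred_eq, ne_eq, h0, not_false_eq_true, true_and]
  rw [mem_Omega_of_lt_one (inv_ne_zero h0) (abs_inv_lt_one h), inv_inv, add_comm]

lemma mem_invSet_Omega_of_lt_one (h0 : t ≠ 0) (h : |t| < 1) :
    t ∈ invSet J.Omega ↔ t + t⁻¹ ∈ J.specL := by
  simp only [invSet, mem_ofPred_eq, ne_eq, h0, not_false_eq_true, true_and]
  rw [mem_Omega_of_one_lt (one_lt_abs_inv h0 h), inv_inv, add_comm]

lemma mem_Omega1_of_one_lt (h : 1 < |t|) :
    t ∈ J.Omega1 ↔ t + t⁻¹ ∈ J.specL \ J.specR := by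
  rw [Omega1, Set.mem_sdiff, mem_Omega_of_one_lt h, mem_invSet_Omega_of_one_lt h, Set.mem_sdiff]

lemma mem_Omega1_of_lt_one (h0 : t ≠ 0) (h : |t| < 1) :
    t ∈ J.Omega1 ↔ t + t⁻¹ ∈ J.specR \ J.specL := by
  rw [Omega1, Set.mem_sdiff, mem_Omega_of_lt_one h0 h, mem_invSet_Omega_of_lt_one h0 h, Set.mem_sdiff]

lemma notMem_Omega1 (h : t = 0 ∨ |t| = 1) : t ∉ J.Omega1 := fun h1 => notMem_Omega h h1.1

lemma mem_invSet_Omega1_of_one_lt (h : 1 < |t|) :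
    t ∈ invSet J.Omega1 ↔ t + t⁻¹ ∈ J.specR \ J.specL := by
  have h0 := ne_zero_of_one_lt_abs h
  simp only [invSet, mem_ofPred_eq, ne_eq, h0, not_false_eq_true, true_and]
  rw [mem_Omega1_of_lt_one (inv_ne_zero h0) (abs_inv_lt_one h), inv_inv, add_comm]

lemma disjoint_Omega1 : Disjoint J.Omega1 (invSet J.Omega1) := by
  rw [disjoint_left]
  rintro t h1 ⟨h0, h2⟩; exact h1.2 ⟨h0, h2.1⟩

lemma mem_Omega2a_iff (h0 : t ≠ 0) (h : |t| ≠ 1) :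
    t ∈ J.Omega2a ↔ t + t⁻¹ ∈ J.spec2a := by
  have h1 : t ≠ 1 := by rintro rfl; simp at h
  have h2 : t ≠ -1 := by rintro rfl; simp at h
  simp [Omega2a, h0, h1, h2]

lemma mem_Delta_iff :
    t ∈ J.Delta ↔ 1 < |t| ∧ t + t⁻¹ ∉ J.spec1 ∧ t + t⁻¹ ∉ J.spec2s := by
  rw [Delta, Set.mem_sdiff, mem_ofPred_eq]
  refine and_congr_right fun h => ?_
  have h0 := ne_zero_of_one_lt_abs h
  rw [mem_union, mem_union, mem_Omega1_of_one_lt h, mem_invSet_Omega1_of_one_lt h, spec1, mem_union]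
  simp only [Omega2s, mem_ofPred_eq, ne_eq, h0, not_false_eq_true, true_and]
  tauto

lemma CondA.isOpen_Delta (hA : J.CondA) : IsOpen J.Delta := by
  have e : J.Delta = {t | 1 < |t|} ∩ (fun t : ℝ => t + t⁻¹) ⁻¹' (J.spec1 ∪ J.spec2s)ᶜ := by
    ext t; rw [mem_Delta_iff]; simp
  rw [e]
  exact (continuousOn_add_inv.mono fun t ht => ne_zero_of_one_lt_abs ht).isOpen_inter_preimage
    isOpen_one_lt_abs (hA.isClosed_spec1.union hA.isClosed_spec2s).isOpen_compl

/-! ### The intervals `Δ_k` -/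

lemma gap_subset {I : Set ℝ} (hI : I ∈ J.gaps) : I ⊆ J.Delta := by
  obtain ⟨t, ht, rfl⟩ := hI
  exact connectedComponentIn_subset _ _

lemma gap_nonempty {I : Set ℝ} (hI : I ∈ J.gaps) : I.Nonempty := by
  obtain ⟨t, ht, rfl⟩ := hI
  exact ⟨t, mem_connectedComponentIn ht⟩

lemma gap_ordConnected {I : Set ℝ} (hI : I ∈ J.gaps) : I.OrdConnected := by
  obtain ⟨t, ht, rfl⟩ := hI
  exact isPreconnected_connectedComponentIn.ordConnected

lemma CondA.isOpen_gap (hA : J.CondA) {I : Set ℝ} (hI : I ∈ J.gaps) : IsOpen I := by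
  obtain ⟨t, ht, rfl⟩ := hI
  exact hA.isOpen_Delta.connectedComponentIn

lemma gap_disjoint : J.gaps.PairwiseDisjoint id := by
  rintro _ ⟨s, hs, rfl⟩ _ ⟨t, ht, rfl⟩ hne; simp only [Function.onFun, id]
  by_contra h
  obtain ⟨u, hu1, hu2⟩ := Set.not_disjoint_iff.1 h
  exact hne ((connectedComponentIn_eq hu1).trans (connectedComponentIn_eq hu2).symm)

lemma gap_eq_of_mem {I I' : Set ℝ} (hI : I ∈ J.gaps) (hI' : I' ∈ J.gaps) (h : t ∈ I) (h' : t ∈ I') : I = I' := by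
  by_contra hne; exact disjoint_left.1 (gap_disjoint hI hI' hne) h h'

lemma exists_gap (ht : t ∈ J.Delta) : ∃ I ∈ J.gaps, t ∈ I := ⟨_, ⟨t, ht, rfl⟩, mem_connectedComponentIn ht⟩

lemma CondA.countable_gaps (hA : J.CondA) : J.gaps.Countable :=
  gap_disjoint.countable_of_isOpen (fun _ hI => hA.isOpen_gap hI) fun _ hI => gap_nonempty hI

lemma subset_gap {I : Set ℝ} (hI : I ∈ J.gaps) {s t u : ℝ} (hu : u ∈ I) (h : u ∈ Icc s t)
    (hst : Icc s t ⊆ J.Delta) : Icc s t ⊆ I := by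
  obtain ⟨v, hv, rfl⟩ := hI
  rw [connectedComponentIn_eq hu]; exact isPreconnected_Icc.subset_connectedComponentIn h hst

lemma gap_side {I : Set ℝ} (hI : I ∈ J.gaps) : (∀ t ∈ I, 1 < t) ∨ ∀ t ∈ I, t < -1 := by
  have habs : ∀ t ∈ I, 1 < |t| := fun t ht => (mem_Delta_iff.1 (gap_subset hI ht)).1
  by_contra hcon
  push Not at hcon
  obtain ⟨⟨s, hs, h1⟩, ⟨t, ht, h2⟩⟩ := hcon
  have h3 : s < -1 := by rcases lt_abs.1 (habs s hs) with h | h <;> linarith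
  have h4 : 1 < t := by rcases lt_abs.1 (habs t ht) with h | h <;> linarith
  have := habs 0 ((gap_ordConnected hI).out hs ht ⟨by linarith, by linarith⟩)
  simp at this; linarith

lemma gap_mul_pos {I : Set ℝ} (hI : I ∈ J.gaps) {s t : ℝ} (hs : s ∈ I) (ht : t ∈ I) : 1 < s * t := by
  rcases gap_side hI with h | h
  · nlinarith [h s hs, h t ht]
  · nlinarith [h s hs, h t ht]

lemma gap_Ioo_subset {I : Set ℝ} (hI : I ∈ J.gaps) {t u : ℝ} (hu : u ∈ I) (htu : t ≤ u)
    (hb : BddBelow I → sInf I < t) : t ∈ I := by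
  by_cases hbd : BddBelow I
  · obtain ⟨s, hs, hst⟩ := exists_lt_of_csInf_lt ⟨u, hu⟩ (hb hbd)
    exact (gap_ordConnected hI).out hs hu ⟨hst.le, htu⟩
  · obtain ⟨s, hs, hst⟩ := not_bddBelow_iff.1 hbd t
    exact (gap_ordConnected hI).out hs hu ⟨hst.le, htu⟩

lemma gap_Ioo_subset' {I : Set ℝ} (hI : I ∈ J.gaps) {t u : ℝ} (hu : u ∈ I) (htu : u ≤ t)
    (hb : BddAbove I → t < sSup I) : t ∈ I := by
  by_cases hbd : BddAbove I
  · obtain ⟨s, hs, hst⟩ := exists_lt_of_lt_csSup ⟨u, hu⟩ (hb hbd)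
    exact (gap_ordConnected hI).out hu hs ⟨htu, hst.le⟩
  · obtain ⟨s, hs, hst⟩ := not_bddAbove_iff.1 hbd t
    exact (gap_ordConnected hI).out hu hs ⟨htu, hst.le⟩

lemma CondA.exists_Icc_subset_gap (hA : J.CondA) {I : Set ℝ} (hI : I ∈ J.gaps) (ht : t ∈ J.Delta)
    (hcl : t ∈ closure I) : t ∈ I := by
  obtain ⟨δ, hδ, hball⟩ := isOpen_iff.1 hA.isOpen_Delta t ht
  obtain ⟨u, hu, hd⟩ := mem_closure_iff.1 hcl (δ / 2) (half_pos hδ)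
  rw [Real.dist_eq, abs_lt] at hd
  refine subset_gap hI hu (s := t - δ / 2) (t := t + δ / 2) ⟨by linarith, by linarith⟩ (fun v hv => hball ?_)
    ⟨by linarith, by linarith⟩
  rw [Real.ball_eq_Ioo]
  constructor <;> linarith [hv.1, hv.2]

lemma CondA.sInf_notMem (hA : J.CondA) {I : Set ℝ} (hI : I ∈ J.gaps) (hb : BddBelow I) : sInf I ∉ I := by
  intro h
  obtain ⟨δ, hδ, hball⟩ := isOpen_iff.1 (hA.isOpen_gap hI) _ h
  have : sInf I - δ / 2 ∈ I := hball (by rw [Real.ball_eq_Ioo]; constructor <;> linarith)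
  linarith [csInf_le hb this]

lemma CondA.sSup_notMem (hA : J.CondA) {I : Set ℝ} (hI : I ∈ J.gaps) (hb : BddAbove I) : sSup I ∉ I := by
  intro h
  obtain ⟨δ, hδ, hball⟩ := isOpen_iff.1 (hA.isOpen_gap hI) _ h
  have : sSup I + δ / 2 ∈ I := hball (by rw [Real.ball_eq_Ioo]; constructor <;> linarith)
  linarith [le_csSup hb this]

lemma one_le_abs_of_mem_closure {I : Set ℝ} (hI : I ∈ J.gaps) (ht : t ∈ closure I) : 1 ≤ |t| := by
  have : closure I ⊆ {t | 1 ≤ |t|} := closure_minimal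
    (fun t ht => (mem_Delta_iff.1 (gap_subset hI ht)).1.le) (isClosed_le continuous_const continuous_abs)
  exact this ht

lemma endpoint_mem {I : Set ℝ} (hA : J.CondA) (hI : I ∈ J.gaps) (ht : t ∈ closure I)
    (htI : t ∉ I) : |t| = 1 ∨ (1 < |t| ∧ t + t⁻¹ ∈ J.spec1 ∪ J.spec2s) := by
  rcases (one_le_abs_of_mem_closure hI ht).eq_or_lt with h | h
  · exact Or.inl h.symm
  · right
    refine ⟨h, ?_⟩
    by_contra hcon
    rw [mem_union, not_or] at hcon; exact htI (hA.exists_Icc_subset_gap hI (mem_Delta_iff.2 ⟨h, hcon⟩) ht)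

lemma abs_le_of_add_inv {t K : ℝ} (h : 1 ≤ |t|) (hK : |t + t⁻¹| ≤ K) : |t| ≤ K + 1 := by
  have h1 : |t⁻¹| ≤ 1 := by rw [abs_inv]; exact inv_le_one_of_one_le₀ h
  have h2 := abs_sub_abs_le_abs_sub t (-t⁻¹)
  rw [abs_neg, sub_neg_eq_add] at h2; linarith

end JacobiMatrix

lemma eventually_lt_add_inv {ε : ℝ} (hε : 0 < ε) : ∃ δ > 0, ∀ ⦃t : ℝ⦄, dist t (-1) < δ → -2 - ε < t + t⁻¹ := by
  have hcont : ContinuousAt (fun t : ℝ => t + t⁻¹) (-1) := by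
    have : (-1:ℝ) ≠ 0 := by norm_num
    fun_prop (disch := assumption)
  exact Metric.eventually_nhds_iff.1 (hcont.eventually (lt_mem_nhds (by norm_num; linarith)))

lemma add_inv_le_add_inv {s t : ℝ} (h : s ≤ t) (hst : 1 ≤ s * t) :
    s + s⁻¹ ≤ t + t⁻¹ ∧ t + t⁻¹ - (s + s⁻¹) ≤ t - s := by
  have h0 : s * t ≠ 0 := by positivity
  have hs : s ≠ 0 := left_ne_zero_of_mul h0
  have ht : t ≠ 0 := right_ne_zero_of_mul h0
  have e : t + t⁻¹ - (s + s⁻¹) = (t - s) * (1 - (s * t)⁻¹) := by field_simp; ring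
  have h1 : (s * t)⁻¹ ≤ 1 := inv_le_one_of_one_le₀ hst
  have h2 : 0 ≤ (s * t)⁻¹ := by positivity
  constructor
  · nlinarith
  · rw [e]; nlinarith

lemma lt_of_add_inv_lt {s t : ℝ} (hst : 1 ≤ s * t) (h : s + s⁻¹ < t + t⁻¹) : s < t := by
  by_contra hle
  push Not at hle; exact (add_inv_le_add_inv hle (by rwa [mul_comm])).1.not_gt h

lemma ofReal_add_inv (t : ℝ) : (t : ℂ) + (t : ℂ)⁻¹ = ((t + t⁻¹ : ℝ) : ℂ) := by push_cast; rfl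

namespace JacobiMatrix

lemma gap_closure_side {I : Set ℝ} (hI : I ∈ J.gaps) : (∀ t ∈ closure I, 1 ≤ t) ∨ ∀ t ∈ closure I, t ≤ -1 := by
  rcases gap_side hI with h | h
  · exact Or.inl fun t ht => closure_minimal (fun t ht => (h t ht).le) isClosed_Ici ht
  · exact Or.inr fun t ht => closure_minimal (fun t ht => (h t ht).le) isClosed_Iic ht

lemma one_le_mul_of_mem_closure {I : Set ℝ} (hI : I ∈ J.gaps) {s t : ℝ} (hs : s ∈ closure I)
    (ht : t ∈ closure I) : 1 ≤ s * t := by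
  rcases gap_closure_side hI with h | h
  · nlinarith [h s hs, h t ht]
  · nlinarith [h s hs, h t ht]

lemma one_lt_mul_of_mem {I : Set ℝ} (hI : I ∈ J.gaps) {s t : ℝ} (hs : s ∈ closure I) (ht : t ∈ I) : 1 < s * t := by
  rcases gap_closure_side hI with h | h <;> rcases gap_side hI with h' | h'
  · nlinarith [h s hs, h' t ht]
  · linarith [h t (subset_closure ht), h' t ht]
  · linarith [h t (subset_closure ht), h' t ht]
  · nlinarith [h s hs, h' t ht]

lemma mem_negPart_iff {I : Set ℝ} (hI : I ∈ J.gaps) :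
    t ∈ J.negPart I ↔ t ∈ I ∧ t + t⁻¹ ∉ J.spec2a ∧ (J.M ((t + t⁻¹ : ℝ) : ℂ)).re < 0 := by
  rw [negPart, mem_ofPred_eq]
  refine and_congr_right fun ht => ?_
  have h1 := (mem_Delta_iff.1 (gap_subset hI ht)).1
  rw [mem_Omega2a_iff (ne_zero_of_one_lt_abs h1) h1.ne', N_of_one_lt _ (by simpa using h1), ofReal_add_inv]

lemma gap_M_pos (hA : J.CondA) (hB : J.CondB) (hC : J.CondC) (hD : J.CondD) {I : Set ℝ}
    (hI : I ∈ J.gaps) {s t : ℝ} (hs : s ∈ I) (ht : t ∈ I) (hst : s ≤ t) (hsa : s + s⁻¹ ∉ J.spec2a)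
    (hta : t + t⁻¹ ∉ J.spec2a) (hpos : 0 < (J.M ((s + s⁻¹ : ℝ) : ℂ)).re) :
    0 < (J.M ((t + t⁻¹ : ℝ) : ℂ)).re := by
  refine M_pos_of_le hA hB hC hD (add_inv_le_add_inv hst (gap_mul_pos hI hs ht).le).1 (fun u hu => ?_) hsa hta hpos
  have hs1 := (mem_Delta_iff.1 (gap_subset hI hs)).1
  have ht1 := (mem_Delta_iff.1 (gap_subset hI ht)).1
  have hu2 : 2 < |u| := by
    rcases gap_side hI with h | h
    · exact lt_abs.2 (Or.inl ((two_lt_add_inv (h s hs)).trans_le hu.1))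
    · exact lt_abs.2 (Or.inr (by linarith [add_inv_lt_neg_two (h t ht), hu.2]))
  obtain ⟨v, hv, rfl⟩ := exists_add_inv_eq hu2
  have hside : 1 ≤ s * v ∧ 1 ≤ t * v := by
    rcases gap_side hI with h | h
    · have : 1 < v := by
        rcases lt_abs.1 hv with h' | h'
        · exact h'
        · linarith [add_inv_lt_neg_two (t := v) (by linarith), two_lt_add_inv (h s hs), hu.1]
      constructor <;> nlinarith [h s hs, h t ht]
    · have : v < -1 := by
        rcases lt_abs.1 hv with h' | h'
        · linarith [two_lt_add_inv h', add_inv_lt_neg_two (h t ht), hu.2]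
        · linarith
      constructor <;> nlinarith [h s hs, h t ht]
  have hsv : s ≤ v := by
    by_contra hlt
    push Not at hlt
    have h1 : 1 < v * s := one_lt_mul_of_abs hv hs1 (by linarith [hside.1, mul_comm s v])
    linarith [add_inv_lt_add_inv hlt h1, hu.1]
  have hvt : v ≤ t := by
    by_contra hlt
    push Not at hlt
    have h1 : 1 < t * v := one_lt_mul_of_abs ht1 hv (by linarith [hside.2])
    linarith [add_inv_lt_add_inv hlt h1, hu.2]
  have hvD := mem_Delta_iff.1 (gap_subset hI ((gap_ordConnected hI).out hs ht ⟨hsv, hvt⟩))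
  refine ⟨hvD.2.1, hvD.2.2, fun h => ?_⟩
  have : |v + v⁻¹| ≤ 2 := abs_le.2 h
  linarith

lemma M_sign_at_infinity (J : JacobiMatrix) :
    ∃ K : ℝ, (∀ x, K < x → 0 < (J.M (x : ℂ)).re) ∧ ∀ x, x < -K → (J.M (x : ℂ)).re < 0 := by
  obtain ⟨C, K, h⟩ := J.M_growth
  have hb := J.b_neg_one_pos
  set b := J.b (-1)
  have key : ∀ x : ℝ, K ≤ |x| → |(J.M (x : ℂ)).re - 1 / b * x| ≤ C := by
    intro x hx
    have h1 := (abs_re_le_norm _).trans (h x (by simpa using hx))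
    rwa [sub_re, ← ofReal_mul, ofReal_re] at h1
  have hx : ∀ x, max K (b * C) < x → C < 1 / b * x := fun x hx => by
    have h1 : b * C < x := (le_max_right _ _).trans_lt hx
    rw [one_div, inv_mul_eq_div, lt_div_iff₀ hb]; linarith
  refine ⟨max (max K (b * C)) 0, fun x h0 => ?_, fun x h0 => ?_⟩
  · have h1 : max K (b * C) < x := (le_max_left _ _).trans_lt h0
    have h2 : K < x := (le_max_left _ _).trans_lt h1
    linarith [abs_le.1 (key x (h2.le.trans (le_abs_self x))), hx x h1]
  · have h1 : max K (b * C) < -x := (le_max_left _ _).trans_lt (by linarith)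
    have h2 : K < -x := (le_max_left _ _).trans_lt h1
    have := abs_le.1 (key x (h2.le.trans (neg_le_abs x)))
    linarith [hx (-x) h1]

lemma negPart_bddAbove {I : Set ℝ} (hI : I ∈ J.gaps) : BddAbove (J.negPart I) := by
  obtain ⟨K, hK, -⟩ := J.M_sign_at_infinity
  refine ⟨max K 1, fun t ht => ?_⟩
  rw [mem_negPart_iff hI] at ht
  by_contra hlt; rw [not_le, max_lt_iff] at hlt
  have : 0 < t⁻¹ := inv_pos.2 (by linarith)
  linarith [hK (t + t⁻¹) (by linarith), ht.2.2]

lemma negPart_nonempty_of_not_bddBelow (hA : J.CondA) {I : Set ℝ} (hI : I ∈ J.gaps) (hb : ¬BddBelow I) :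
    (J.negPart I).Nonempty := by
  obtain ⟨K, -, hK⟩ := J.M_sign_at_infinity
  obtain ⟨L, hL⟩ := hA.isPick_M.bounded
  obtain ⟨t, ht, h1⟩ := not_bddBelow_iff.1 hb (min (min (-K) (-L)) (-1))
  rw [lt_min_iff, lt_min_iff] at h1
  have : t⁻¹ < 0 := inv_lt_zero.2 (by linarith)
  refine ⟨t, (mem_negPart_iff hI).2 ⟨ht, fun h => ?_, hK _ (by linarith)⟩⟩
  linarith [(hL (Or.inl h.1.1)).1]

lemma phi_mem_closure (hA : J.CondA) {I : Set ℝ} (hI : I ∈ J.gaps) : J.phi I ∈ closure I := by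
  rw [phi]
  split_ifs with h
  · exact closure_mono (fun t ht => ht.1) (csSup_mem_closure h (negPart_bddAbove hI))
  · refine csInf_mem_closure (gap_nonempty hI) ?_
    by_contra hb; exact h (negPart_nonempty_of_not_bddBelow hA hI hb)

lemma not_pos_of_lt_phi (hA : J.CondA) (hB : J.CondB) (hC : J.CondC) (hD : J.CondD) {I : Set ℝ}
    (hI : I ∈ J.gaps) (ht : t ∈ I) (hta : t + t⁻¹ ∉ J.spec2a) (hlt : t < J.phi I) :
    ¬0 < (J.M ((t + t⁻¹ : ℝ) : ℂ)).re := by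
  intro hpos; rw [phi] at hlt
  split_ifs at hlt with h
  · obtain ⟨u, hu, htu⟩ := exists_lt_of_lt_csSup h hlt
    rw [mem_negPart_iff hI] at hu
    exact (gap_M_pos hA hB hC hD hI ht hu.1 htu.le hta hu.2.1 hpos).not_gt hu.2.2
  · have hb : BddBelow I := by by_contra hb; exact h (negPart_nonempty_of_not_bddBelow hA hI hb)
    exact (csInf_le hb ht).not_gt hlt

lemma le_phi_of_neg {I : Set ℝ} (hI : I ∈ J.gaps) (ht : t ∈ I) (hta : t + t⁻¹ ∉ J.spec2a)
    (hneg : (J.M ((t + t⁻¹ : ℝ) : ℂ)).re < 0) : t ≤ J.phi I := by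
  have h : t ∈ J.negPart I := (mem_negPart_iff hI).2 ⟨ht, hta, hneg⟩
  rw [phi, if_pos ⟨t, h⟩]; exact le_csSup (negPart_bddAbove hI) h

/-- Image of `Delta1` under `t ↦ t + t⁻¹`. -/
def negSet (J : JacobiMatrix) : Set ℝ := {τ | ∃ t ∈ J.Delta1, t + t⁻¹ = τ}

lemma mem_negSet_iff (ht : 1 < |t|) : t + t⁻¹ ∈ J.negSet ↔ t ∈ J.Delta1 := by
  refine ⟨fun ⟨s, hs, h⟩ => ?_, fun h => ⟨t, h, rfl⟩⟩
  obtain ⟨I, hI, hsI, -⟩ := id hs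
  rwa [← add_inv_injOn (mem_Delta_iff.1 (gap_subset hI hsI)).1 ht h]

lemma ae_eta_eq (hA : J.CondA) (hB : J.CondB) (hC : J.CondC) (hD : J.CondD) :
    ∀ᵐ τ : ℝ, 2 < |τ| → τ ∉ J.spec1 → τ ∉ J.spec2a → (τ ∈ J.negSet ∧ J.eta τ = π) ∨ (τ ∉ J.negSet ∧ J.eta τ = 0) := by
  have hnull : volume ((fun I => J.phi I + (J.phi I)⁻¹) '' J.gaps) = 0 := (hA.countable_gaps.image _).measure_zero _
  filter_upwards [hA.isPick_M.ae_boundaryArg_compl, measure_eq_zero_iff_ae_notMem.1 hnull,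
    measure_eq_zero_iff_ae_notMem.1 (hA.2.2.2.2.measure_zero volume)] with τ h1 h2 h3 hτ k1 k2
  obtain ⟨t, ht, rfl⟩ := exists_add_inv_eq hτ
  obtain ⟨I, hI, htI⟩ := exists_gap (mem_Delta_iff.2 ⟨ht, k1, h3⟩)
  rw [mem_negSet_iff ht]
  have hne : t ≠ J.phi I := fun h => h2 ⟨I, hI, by simp only [← h]⟩
  rcases h1 (hA.notMem_spec k1 h3 k2) with ⟨h4, h5⟩ | ⟨h4, h5⟩
  · right
    refine ⟨fun ⟨I', hI', htI', hlt⟩ => ?_, h4⟩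
    exact not_pos_of_lt_phi hA hB hC hD hI' htI' k2 hlt h5
  · left; exact ⟨⟨I, hI, htI, lt_of_le_of_ne (le_phi_of_neg hI htI k2 h5) hne⟩, h4⟩

lemma bddAbove_of_sSup_eq {I : Set ℝ} (h : sSup I = -1) : BddAbove I := by
  by_contra hb; rw [Real.sSup_of_not_bddAbove hb] at h; norm_num at h

lemma phi_eq_neg_one (hA : J.CondA) (hE : J.CondE) {I : Set ℝ} (hI : I ∈ J.gaps) (h : sSup I = -1) : J.phi I = -1 := by
  have hb := bddAbove_of_sSup_eq h
  obtain ⟨ε, hε, -, -, hd, hneg⟩ := hE.exists_gap_near_two hA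
  have hside : ∀ t ∈ I, t < -1 := fun t ht =>
    lt_of_le_of_ne (h ▸ le_csSup hb ht) fun h' => hA.sSup_notMem hI hb (by rw [h, ← h']; exact ht)
  obtain ⟨δ, hδ, hδ'⟩ := eventually_lt_add_inv hε
  have hmem : ∀ t ∈ I, -1 - δ < t → t ∈ J.negPart I := by
    intro t ht h1
    have h2 := hδ' (t := t) (by rw [Real.dist_eq, abs_lt]; constructor <;> linarith [hside t ht])
    have h3 : t + t⁻¹ ∈ Ioo (-2 - ε) (-2) := ⟨h2, add_inv_lt_neg_two (hside t ht)⟩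
    exact (mem_negPart_iff hI).2 ⟨ht, fun h => disjoint_left.1 hd h3 (Or.inl h.1.1), hneg _ h3⟩
  have hnear : ∀ δ' > 0, ∃ t ∈ J.negPart I, -1 - δ' < t := by
    intro δ' hδ'
    obtain ⟨t, ht, h1⟩ := exists_lt_of_lt_csSup (gap_nonempty hI)
      (show max (-1 - δ) (-1 - δ') < sSup I by rw [h]; exact max_lt (by linarith) (by linarith))
    exact ⟨t, hmem t ht ((le_max_left _ _).trans_lt h1), (le_max_right _ _).trans_lt h1⟩
  obtain ⟨t₀, ht₀, -⟩ := hnear 1 one_pos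
  rw [phi, if_pos ⟨t₀, ht₀⟩]
  refine le_antisymm (csSup_le ⟨t₀, ht₀⟩ fun t ht => (hside t ht.1).le) ?_
  by_contra hlt
  push Not at hlt
  obtain ⟨t, ht, h1⟩ := hnear (-1 - sSup (J.negPart I)) (by linarith)
  linarith [le_csSup (negPart_bddAbove hI) ht]

/-! ### Zeros and poles of `R₀` -/

open Classical in
/-- The zero of the factor of `R₀` that belongs to `I`, after a factor `z + 1` has been put into the
numerator for the gap with `α = -∞` and into the denominator for the gap with `β = -1`. -/
def gapZero (J : JacobiMatrix) (I : Set ℝ) : ℝ := if BddBelow I then J.alphaStar I else -1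

open Classical in
/-- The pole of the factor of `R₀` that belongs to `I`. -/
def gapPole (J : JacobiMatrix) (I : Set ℝ) : ℝ := if sSup I = -1 then -1 else J.phiStar I

lemma alphaStar_eq_or (I : Set ℝ) : J.alphaStar I = sInf I ∨ J.alphaStar I = (sInf I)⁻¹ := by
  rw [alphaStar]; split_ifs <;> simp

lemma phiStar_eq_or (I : Set ℝ) : J.phiStar I = J.phi I ∨ J.phiStar I = (J.phi I)⁻¹ := by
  rw [phiStar]; split_ifs <;> simp

lemma gapPole_eq_or (hA : J.CondA) (hE : J.CondE) {I : Set ℝ} (hI : I ∈ J.gaps) :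
    J.gapPole I = J.phi I ∨ J.gapPole I = (J.phi I)⁻¹ := by
  rw [gapPole]
  split_ifs with h
  · left; rw [phi_eq_neg_one hA hE hI h]
  · exact phiStar_eq_or I

/-- The point over which the zero lies. -/
def gapLo (J : JacobiMatrix) (I : Set ℝ) : ℝ := J.gapZero I + (J.gapZero I)⁻¹

/-- The point over which the pole lies. -/
def gapHi (J : JacobiMatrix) (I : Set ℝ) : ℝ := J.gapPole I + (J.gapPole I)⁻¹

lemma gapLo_of_bddBelow {I : Set ℝ} (hb : BddBelow I) : J.gapLo I = sInf I + (sInf I)⁻¹ := by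
  rw [gapLo, gapZero, if_pos hb]
  rcases J.alphaStar_eq_or I with h | h <;> rw [h]
  rw [inv_inv, add_comm]

lemma gapLo_of_not_bddBelow {I : Set ℝ} (hb : ¬BddBelow I) : J.gapLo I = -2 := by
  rw [gapLo, gapZero, if_neg hb]; norm_num

lemma gapHi_eq (hA : J.CondA) (hE : J.CondE) {I : Set ℝ} (hI : I ∈ J.gaps) : J.gapHi I = J.phi I + (J.phi I)⁻¹ := by
  rw [gapHi]
  rcases gapPole_eq_or hA hE hI with h | h <;> rw [h]
  rw [inv_inv, add_comm]

lemma phi_ne_zero (hA : J.CondA) {I : Set ℝ} (hI : I ∈ J.gaps) : J.phi I ≠ 0 := by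
  have := one_le_abs_of_mem_closure hI (phi_mem_closure hA hI)
  intro h; rw [h] at this; norm_num at this

lemma image_gap_Iio (hA : J.CondA) (hE : J.CondE) {I : Set ℝ} (hI : I ∈ J.gaps) (τ : ℝ) :
    (∃ t ∈ I, t < J.phi I ∧ t + t⁻¹ = τ) ↔ ((BddBelow I → J.gapLo I < τ) ∧ τ < J.gapHi I) := by
  have hφ := phi_mem_closure hA hI
  rw [gapHi_eq hA hE hI]
  constructor
  · rintro ⟨t, ht, hlt, rfl⟩
    refine ⟨fun hb => ?_, add_inv_lt_add_inv hlt (by rw [mul_comm]; exact one_lt_mul_of_mem hI hφ ht)⟩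
    rw [gapLo_of_bddBelow hb]
    have hα := csInf_mem_closure (gap_nonempty hI) hb
    have : sInf I < t := lt_of_le_of_ne (csInf_le hb ht) fun h => hA.sInf_notMem hI hb (h ▸ ht)
    exact add_inv_lt_add_inv this (one_lt_mul_of_mem hI hα ht)
  · rintro ⟨h1, h2⟩
    have hτ : ∃ t : ℝ, 1 < |t| ∧ t + t⁻¹ = τ ∧ 1 ≤ t * J.phi I ∧ (BddBelow I → 1 ≤ sInf I * t) := by
      rcases gap_closure_side hI with h | h
      · have hb : BddBelow I := ⟨1, fun t ht => h t (subset_closure ht)⟩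
        have hα := csInf_mem_closure (gap_nonempty hI) hb
        have h3 := h1 hb
        rw [gapLo_of_bddBelow hb] at h3
        have h4 := (add_inv_le_add_inv (h _ hα) (by linarith [h _ hα])).1
        norm_num at h4
        obtain ⟨t, ht, e⟩ := exists_add_inv_eq (τ := τ) (lt_abs.2 (Or.inl (by linarith)))
        have ht1 : 1 < t := by
          rcases lt_abs.1 ht with h' | h'
          · exact h'
          · linarith [add_inv_lt_neg_two (t := t) (by linarith)]
        exact ⟨t, ht, e, by nlinarith [h _ hφ], fun _ => by nlinarith [h _ hα]⟩
      · have h4 := (add_inv_le_add_inv (h _ hφ) (by linarith [h _ hφ])).1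
        norm_num at h4
        obtain ⟨t, ht, e⟩ := exists_add_inv_eq (τ := τ) (lt_abs.2 (Or.inr (by linarith)))
        have ht1 : t < -1 := by
          rcases lt_abs.1 ht with h' | h'
          · linarith [two_lt_add_inv h']
          · linarith
        exact ⟨t, ht, e, by nlinarith [h _ hφ], fun hb => by nlinarith [h _ (csInf_mem_closure (gap_nonempty hI) hb)]⟩
    obtain ⟨t, ht, rfl, hp, hq⟩ := hτ
    have h3 : t < J.phi I := lt_of_add_inv_lt hp h2
    obtain ⟨u, hu, hd⟩ := mem_closure_iff.1 hφ (J.phi I - t) (by linarith)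
    rw [Real.dist_eq, abs_lt] at hd
    refine ⟨t, gap_Ioo_subset hI hu (by linarith) fun hb => ?_, h3, rfl⟩
    have := h1 hb
    rw [gapLo_of_bddBelow hb] at this; exact lt_of_add_inv_lt (hq hb) this

end JacobiMatrix

lemma abs_inv_sub_inv_le {s t : ℝ} (hst : 1 ≤ s * t) : |s⁻¹ - t⁻¹| ≤ |s - t| := by
  have h0 : s * t ≠ 0 := by positivity
  have hs : s ≠ 0 := left_ne_zero_of_mul h0
  have ht : t ≠ 0 := right_ne_zero_of_mul h0
  rw [inv_sub_inv hs ht, abs_div, abs_of_pos (by linarith : 0 < s * t), abs_sub_comm]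
  exact div_le_self (abs_nonneg _) hst

namespace JacobiMatrix

lemma gap_eq_of_sInf {I I' : Set ℝ} (hI : I ∈ J.gaps) (hI' : I' ∈ J.gaps)
    (h : BddBelow I ∧ BddBelow I' ∧ sInf I = sInf I' ∨ ¬BddBelow I ∧ ¬BddBelow I') (hA : J.CondA) : I = I' := by
  obtain ⟨s, hs⟩ := gap_nonempty hI
  obtain ⟨t, ht⟩ := gap_nonempty hI'
  have key : ∀ {I : Set ℝ} {u : ℝ}, I ∈ J.gaps → u ∈ I → BddBelow I → sInf I < u := fun hI hu hb =>
    lt_of_le_of_ne (csInf_le hb hu) fun h => hA.sInf_notMem hI hb (h ▸ hu)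
  refine gap_eq_of_mem hI hI' (t := min s t) (gap_Ioo_subset hI hs (min_le_left _ _) fun hb => ?_)
    (gap_Ioo_subset hI' ht (min_le_right _ _) fun hb => ?_)
  · rcases h with ⟨h1, h2, h3⟩ | ⟨h1, -⟩
    · exact lt_min (key hI hs h1) (h3 ▸ key hI' ht h2)
    · exact absurd hb h1
  · rcases h with ⟨h1, h2, h3⟩ | ⟨-, h1⟩
    · exact lt_min (h3 ▸ key hI hs h1) (key hI' ht h2)
    · exact absurd hb h1

lemma gap_eq_of_sSup {I I' : Set ℝ} (hI : I ∈ J.gaps) (hI' : I' ∈ J.gaps)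
    (h : BddAbove I ∧ BddAbove I' ∧ sSup I = sSup I' ∨ ¬BddAbove I ∧ ¬BddAbove I') (hA : J.CondA) : I = I' := by
  obtain ⟨s, hs⟩ := gap_nonempty hI
  obtain ⟨t, ht⟩ := gap_nonempty hI'
  have key : ∀ {I : Set ℝ} {u : ℝ}, I ∈ J.gaps → u ∈ I → BddAbove I → u < sSup I := fun hI hu hb =>
    lt_of_le_of_ne (le_csSup hb hu) fun h => hA.sSup_notMem hI hb (h ▸ hu)
  refine gap_eq_of_mem hI hI' (t := max s t) (gap_Ioo_subset' hI hs (le_max_left _ _) fun hb => ?_)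
    (gap_Ioo_subset' hI' ht (le_max_right _ _) fun hb => ?_)
  · rcases h with ⟨h1, h2, h3⟩ | ⟨h1, -⟩
    · exact max_lt (key hI hs h1) (h3 ▸ key hI' ht h2)
    · exact absurd hb h1
  · rcases h with ⟨h1, h2, h3⟩ | ⟨-, h1⟩
    · exact max_lt (h3 ▸ key hI hs h1) (key hI' ht h2)
    · exact absurd hb h1

lemma exists_unbounded_gap (hA : J.CondA) : ∃ I ∈ J.gaps, ¬BddBelow I := by
  obtain ⟨K, hK⟩ := hA.isPick_M.bounded
  have hmem : ∀ t, t < min (-K) (-1) → t ∈ J.Delta := by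
    intro t ht; rw [lt_min_iff] at ht
    have h1 : 1 < |t| := lt_abs.2 (Or.inr (by linarith))
    have h2 : t⁻¹ < 0 := inv_lt_zero.2 (by linarith)
    have h3 : t + t⁻¹ ∉ J.spec1 ∪ J.spec2s ∪ J.spec2a := by rw [hA.union_spec]; intro h; linarith [(hK h).1]
    exact mem_Delta_iff.2 ⟨h1, fun h => h3 (Or.inl (Or.inl h)), fun h => h3 (Or.inl (Or.inr h))⟩
  set t := min (-K) (-1) - 1
  obtain ⟨I, hI, ht⟩ := exists_gap (hmem t (by simp only [t]; linarith))
  refine ⟨I, hI, not_bddBelow_iff.2 fun x => ?_⟩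
  have hs : min (x - 1) t ≤ t := min_le_right _ _
  refine ⟨min (x - 1) t, subset_gap hI ht (right_mem_Icc.2 hs) (fun u hu => hmem u ?_) (left_mem_Icc.2 hs), ?_⟩
  · exact hu.2.trans_lt (by simp only [t]; linarith)
  · exact (min_le_left _ _).trans_lt (by linarith)

lemma exists_gap_sSup_eq (hA : J.CondA) (hE : J.CondE) : ∃ I ∈ J.gaps, sSup I = -1 := by
  obtain ⟨ε, hε, -, -, hd, -⟩ := hE.exists_gap_near_two hA
  obtain ⟨δ, hδ, hδ'⟩ := eventually_lt_add_inv hε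
  have hmem : ∀ t ∈ Ioo (-1 - δ) (-1), t ∈ J.Delta := by
    intro t ht
    have h2 := hδ' (t := t) (by rw [Real.dist_eq, abs_lt]; constructor <;> linarith [ht.1, ht.2])
    have h3 : t + t⁻¹ ∈ Ioo (-2 - ε) (-2) := ⟨h2, add_inv_lt_neg_two ht.2⟩
    have h4 : t + t⁻¹ ∉ J.spec1 ∪ J.spec2s ∪ J.spec2a := by rw [hA.union_spec]; exact disjoint_left.1 hd h3
    exact mem_Delta_iff.2 ⟨lt_abs.2 (Or.inr (by linarith [ht.2])), fun h => h4 (Or.inl (Or.inl h)),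
      fun h => h4 (Or.inl (Or.inr h))⟩
  set t := -1 - δ / 2 with ht
  obtain ⟨I, hI, htI⟩ := exists_gap (hmem t ⟨by simp only [t]; linarith, by simp only [t]; linarith⟩)
  have hside : ∀ u ∈ I, u < -1 := by
    rcases gap_side hI with h | h
    · linarith [h t htI]
    · exact h
  refine ⟨I, hI, le_antisymm (csSup_le ⟨t, htI⟩ fun u hu => (hside u hu).le) ?_⟩
  by_contra hlt
  push Not at hlt
  set u := max t ((sSup I + -1) / 2) with hu
  have hu1 : u < -1 := max_lt (by simp only [t]; linarith) (by linarith)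
  have htu : t ≤ u := le_max_left _ _
  have huI : u ∈ I := subset_gap hI htI (left_mem_Icc.2 htu) (fun v hv => hmem v
    ⟨by simp only [t] at hv ⊢; linarith [hv.1], hv.2.trans_lt hu1⟩) (right_mem_Icc.2 htu)
  linarith [le_csSup ⟨-1, fun u hu => (hside u hu).le⟩ huI, le_max_right t ((sSup I + -1) / 2)]

lemma exists_endpoint_bound (hA : J.CondA) : ∃ L : ℝ, 1 ≤ L ∧ ∀ I ∈ J.gaps, ∀ t ∈ closure I, t ∉ I → |t| ≤ L := by
  obtain ⟨K, hK⟩ := hA.isPick_M.bounded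
  refine ⟨|K| + 1, by linarith [abs_nonneg K], fun I hI t ht htI => ?_⟩
  rcases endpoint_mem hA hI ht htI with h | ⟨h, h'⟩
  · rw [h]; linarith [abs_nonneg K]
  · refine abs_le_of_add_inv h.le ?_
    have : t + t⁻¹ ∈ J.specR ∪ J.specL := by rw [← hA.union_spec]; exact Or.inl h'
    exact (abs_le.2 (hK this)).trans (le_abs_self K)

lemma gap_closure_subset_Icc {I : Set ℝ} (hb : BddBelow I) (ha : BddAbove I) :
    closure I ⊆ Icc (sInf I) (sSup I) :=
  closure_minimal (fun _ ht => ⟨csInf_le hb ht, le_csSup ha ht⟩) isClosed_Icc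

lemma exists_lengths (hA : J.CondA) : ∃ len : J.gaps → ℝ, Summable len ∧ (∀ I, 0 ≤ len I) ∧
    ∀ I : J.gaps, BddBelow (I : Set ℝ) → BddAbove (I : Set ℝ) →
      sSup (I : Set ℝ) - sInf (I : Set ℝ) ≤ len I := by
  obtain ⟨L, hL1, hL⟩ := exists_endpoint_bound hA
  have : Countable J.gaps := hA.countable_gaps.to_subtype
  refine ⟨fun I => volume.real ((I : Set ℝ) ∩ Icc (-L) L), ?_, fun I => measureReal_nonneg, fun I hb ha => ?_⟩
  · refine ENNReal.summable_toReal ?_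
    rw [← measure_iUnion]
    · exact ((measure_mono (iUnion_subset fun I => inter_subset_right)).trans_lt measure_Icc_lt_top).ne
    · intro I I' hne
      have := gap_disjoint I.2 I'.2 fun h => hne (Subtype.ext h)
      exact this.mono inter_subset_left inter_subset_left
    · exact fun I => (hA.isOpen_gap I.2).measurableSet.inter measurableSet_Icc
  · obtain ⟨u, hu⟩ := gap_nonempty I.2
    have h1 := abs_le.1 (hL I I.2 _ (csInf_mem_closure ⟨u, hu⟩ hb) (hA.sInf_notMem I.2 hb))
    have h2 := abs_le.1 (hL I I.2 _ (csSup_mem_closure ⟨u, hu⟩ ha) (hA.sSup_notMem I.2 ha))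
    have hsub : Ioo (sInf (I : Set ℝ)) (sSup I) ⊆ (I : Set ℝ) ∩ Icc (-L) L := by
      intro t ht
      refine ⟨?_, by linarith [ht.1], by linarith [ht.2]⟩
      rcases le_total t u with h | h
      · exact gap_Ioo_subset I.2 hu h fun _ => ht.1
      · exact gap_Ioo_subset' I.2 hu h fun _ => ht.2
    have := measureReal_mono (μ := volume) hsub ((measure_mono inter_subset_right).trans_lt measure_Icc_lt_top).ne
    rw [Real.volume_real_Ioo_of_le (Real.sInf_le_sSup _ hb ha)] at this; exact this

lemma eventually_bddBelow (hA : J.CondA) : ∀ᶠ I : J.gaps in cofinite, BddBelow (I : Set ℝ) := by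
  rw [eventually_cofinite]
  refine Set.Subsingleton.finite fun I hI I' hI' => Subtype.ext (gap_eq_of_sInf I.2 I'.2 (Or.inr ⟨hI, hI'⟩) hA)

lemma eventually_bddAbove (hA : J.CondA) : ∀ᶠ I : J.gaps in cofinite, BddAbove (I : Set ℝ) := by
  rw [eventually_cofinite]
  refine Set.Subsingleton.finite fun I hI I' hI' => Subtype.ext (gap_eq_of_sSup I.2 I'.2 (Or.inr ⟨hI, hI'⟩) hA)

lemma eventually_sInf_notMem (hA : J.CondA) {F : Set ℝ} (hF : F.Finite) :
    ∀ᶠ I : J.gaps in cofinite, sInf (I : Set ℝ) ∉ F := by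
  have h : ∀ᶠ I : J.gaps in cofinite, ¬(BddBelow (I : Set ℝ) ∧ sInf (I : Set ℝ) ∈ F) := by
    rw [eventually_cofinite]; simp only [not_not]
    exact Set.Finite.of_injOn (f := fun I : J.gaps => sInf (I : Set ℝ)) (fun I hI => hI.2)
      (fun I hI I' hI' he => Subtype.ext (gap_eq_of_sInf I.2 I'.2 (Or.inl ⟨hI.1, hI'.1, he⟩) hA)) hF
  filter_upwards [h, eventually_bddBelow hA] with I h1 h2 h3 using h1 ⟨h2, h3⟩

lemma eventually_sSup_notMem (hA : J.CondA) {F : Set ℝ} (hF : F.Finite) :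
    ∀ᶠ I : J.gaps in cofinite, sSup (I : Set ℝ) ∉ F := by
  have h : ∀ᶠ I : J.gaps in cofinite, ¬(BddAbove (I : Set ℝ) ∧ sSup (I : Set ℝ) ∈ F) := by
    rw [eventually_cofinite]; simp only [not_not]
    exact Set.Finite.of_injOn (f := fun I : J.gaps => sSup (I : Set ℝ)) (fun I hI => hI.2)
      (fun I hI I' hI' he => Subtype.ext (gap_eq_of_sSup I.2 I'.2 (Or.inl ⟨hI.1, hI'.1, he⟩) hA)) hF
  filter_upwards [h, eventually_bddAbove hA] with I h1 h2 h3 using h1 ⟨h2, h3⟩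

lemma exists_separation_spec1 (hA : J.CondA) : ∃ δ : ℝ, 0 < δ ∧
    ∀ x ∈ J.specL \ J.specR, ∀ y ∈ J.specR \ J.specL, δ ≤ |x - y| := by
  have e1 : J.specL \ J.specR = J.spec1 ∩ J.specL := by ext x; simp only [spec1, mem_inter_iff, mem_union, Set.mem_sdiff]; tauto
  have e2 : J.specR \ J.specL = J.spec1 ∩ J.specR := by ext x; simp only [spec1, mem_inter_iff, mem_union, Set.mem_sdiff]; tauto
  have c1 : IsClosed (J.specL \ J.specR) := by rw [e1]; exact hA.isClosed_spec1.inter J.isPick_FL.closed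
  have c2 : IsClosed (J.specR \ J.specL) := by rw [e2]; exact hA.isClosed_spec1.inter hA.isPick_FR.closed
  obtain ⟨K, hK⟩ := J.isPick_FL.bounded
  have k1 : IsCompact (J.specL \ J.specR) := isCompact_Icc.of_isClosed_subset c1 (sdiff_subset.trans hK)
  have hd : Disjoint (J.specL \ J.specR) (J.specR \ J.specL) := by rw [disjoint_left]; exact fun x h1 h2 => h1.2 h2.1
  obtain ⟨δ, hδ, h⟩ := hd.exists_thickenings k1 c2
  refine ⟨δ, hδ, fun x hx y hy => ?_⟩
  by_contra hlt
  push Not at hlt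
  refine disjoint_left.1 h (mem_thickening_iff.2 ⟨x, hx, ?_⟩) (self_subset_thickening hδ _ hy)
  rwa [dist_comm, Real.dist_eq]

lemma summable_gaps (hA : J.CondA) (hE : J.CondE) : Summable (fun I : J.gaps => J.gapZero I - J.gapPole I) ∧
    Summable (fun I : J.gaps => J.gapHi I - J.gapLo I) := by
  obtain ⟨len, hlen, -, hlen'⟩ := exists_lengths hA
  obtain ⟨δ, hδ, hsep⟩ := exists_separation_spec1 hA
  have hfin : {t : ℝ | |t| = 1 ∨ (1 < |t| ∧ t + t⁻¹ ∈ J.spec2s)}.Finite := by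
    have f1 : {t : ℝ | |t| = 1}.Finite := by
      refine ((Set.finite_singleton (1:ℝ)).insert (-1)).subset fun t ht => ?_
      rcases (abs_eq one_pos.le).1 ht with h | h <;> simp [h]
    have f2 : {t : ℝ | 1 < |t| ∧ t + t⁻¹ ∈ J.spec2s}.Finite :=
      Set.Finite.of_injOn (f := fun t : ℝ => t + t⁻¹) (fun t ht => ht.2)
        (add_inv_injOn.mono fun t ht => ht.1) hA.2.2.2.2
    exact f1.union f2
  constructor
  · refine Summable.of_norm_bounded_eventually hlen ?_
    filter_upwards [eventually_bddBelow hA, eventually_bddAbove hA, eventually_sInf_notMem hA hfin,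
      eventually_sSup_notMem hA hfin, hlen.tendsto_cofinite_zero.eventually (gt_mem_nhds hδ)]
      with I hb ha h1 h2 hlt
    have hne := gap_nonempty I.2
    have hα := csInf_mem_closure hne hb
    have hβ := csSup_mem_closure hne ha
    have hφ := phi_mem_closure hA I.2
    have hlenI := hlen' I hb ha
    have hαφ := one_le_mul_of_mem_closure I.2 hα hφ
    have hφI := gap_closure_subset_Icc hb ha hφ
    have habs : |sInf (I : Set ℝ) - J.phi I| ≤ len I := by
      rw [abs_sub_comm, abs_of_nonneg (by linarith [hφI.1])]; linarith [hφI.2]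
    rw [not_or] at h1 h2
    have e1 := (endpoint_mem hA I.2 hα (hA.sInf_notMem I.2 hb)).resolve_left h1.1
    have e2 := (endpoint_mem hA I.2 hβ (hA.sSup_notMem I.2 ha)).resolve_left h2.1
    have s1 := e1.2.resolve_right fun h => h1.2 ⟨e1.1, h⟩
    have s2 := e2.2.resolve_right fun h => h2.2 ⟨e2.1, h⟩
    have hτ : |(sInf (I : Set ℝ) + (sInf (I : Set ℝ))⁻¹) - (sSup (I : Set ℝ) + (sSup (I : Set ℝ))⁻¹)| < δ := by
      have := add_inv_le_add_inv (Real.sInf_le_sSup _ hb ha) (one_le_mul_of_mem_closure I.2 hα hβ)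
      rw [abs_sub_comm, abs_of_nonneg (by linarith)]; linarith
    have hne1 : sSup (I : Set ℝ) ≠ -1 := fun h => h2.1 (by rw [h]; norm_num)
    rw [Real.norm_eq_abs, gapZero, gapPole, if_pos hb, if_neg hne1, alphaStar, phiStar]
    rcases s1 with s1 | s1 <;> rcases s2 with s2 | s2
    · have a1 := (mem_invSet_Omega1_of_one_lt e1.1).2 s1
      have b1 := (mem_invSet_Omega1_of_one_lt e2.1).2 s2
      have a2 : sInf (I : Set ℝ) ∉ J.Omega1 := fun h => disjoint_left.1 disjoint_Omega1 h a1
      rw [if_pos a1, if_neg (fun h => a2 h.1), if_pos ⟨a1, b1⟩]; exact (abs_inv_sub_inv_le hαφ).trans habs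
    · exact absurd hτ (by rw [abs_sub_comm]; exact (hsep _ s2 _ s1).not_gt)
    · exact absurd hτ (hsep _ s1 _ s2).not_gt
    · have a1 := (mem_Omega1_of_one_lt e1.1).2 s1
      have b1 := (mem_Omega1_of_one_lt e2.1).2 s2
      have a2 : sInf (I : Set ℝ) ∉ invSet J.Omega1 := fun h => disjoint_left.1 disjoint_Omega1 a1 h
      rw [if_neg a2, if_pos ⟨a1, b1⟩]; exact habs
  · refine Summable.of_norm_bounded_eventually hlen ?_
    filter_upwards [eventually_bddBelow hA, eventually_bddAbove hA] with I hb ha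
    have hα := csInf_mem_closure (gap_nonempty I.2) hb
    have hφ := phi_mem_closure hA I.2
    have hφI := gap_closure_subset_Icc hb ha hφ
    have h := add_inv_le_add_inv hφI.1 (one_le_mul_of_mem_closure I.2 hα hφ)
    rw [gapHi_eq hA hE I.2, gapLo_of_bddBelow hb, Real.norm_of_nonneg (by linarith)]
    linarith [hlen' I hb ha, hφI.2]

lemma gapZero_ne_zero {I : Set ℝ} (hI : I ∈ J.gaps) : J.gapZero I ≠ 0 := by
  rw [gapZero]
  split_ifs with hb
  · have := one_le_abs_of_mem_closure hI (csInf_mem_closure (gap_nonempty hI) hb)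
    have h0 : sInf I ≠ 0 := by intro h; rw [h] at this; norm_num at this
    rcases J.alphaStar_eq_or I with h | h <;> rw [h]
    · exact h0
    · exact inv_ne_zero h0
  · norm_num

lemma gapPole_ne_zero (hA : J.CondA) (hE : J.CondE) {I : Set ℝ} (hI : I ∈ J.gaps) : J.gapPole I ≠ 0 := by
  have h0 := phi_ne_zero hA hI
  rcases gapPole_eq_or hA hE hI with h | h <;> rw [h]
  · exact h0
  · exact inv_ne_zero h0

lemma gapZero_div_gapPole_pos (hA : J.CondA) (hE : J.CondE) {I : Set ℝ} (hI : I ∈ J.gaps) :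
    0 < J.gapZero I / J.gapPole I := by
  have key : ∀ c : ℝ, c ≠ 0 → (c < 0 ∨ 0 < c) := fun c hc => lt_or_gt_of_ne hc
  have hφ := phi_mem_closure hA hI
  rcases gap_closure_side hI with h | h
  · have hb : BddBelow I := ⟨1, fun t ht => h t (subset_closure ht)⟩
    have h1 := h _ (csInf_mem_closure (gap_nonempty hI) hb)
    have h2 := h _ hφ
    have z : 0 < J.gapZero I := by
      rw [gapZero, if_pos hb]
      rcases J.alphaStar_eq_or I with e | e <;> rw [e]
      · linarith
      · exact inv_pos.2 (by linarith)
    have p : 0 < J.gapPole I := by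
      rcases gapPole_eq_or hA hE hI with e | e <;> rw [e]
      · linarith
      · exact inv_pos.2 (by linarith)
    exact div_pos z p
  · have h2 := h _ hφ
    have z : J.gapZero I < 0 := by
      rw [gapZero]
      split_ifs with hb
      · have h1 := h _ (csInf_mem_closure (gap_nonempty hI) hb)
        rcases J.alphaStar_eq_or I with e | e <;> rw [e]
        · linarith
        · exact inv_lt_zero.2 (by linarith)
      · norm_num
    have p : J.gapPole I < 0 := by
      rcases gapPole_eq_or hA hE hI with e | e <;> rw [e]
      · linarith
      · exact inv_lt_zero.2 (by linarith)
    exact div_pos_of_neg_of_neg z p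

lemma exists_gapPole_bound (hA : J.CondA) (hE : J.CondE) : ∃ P : ℝ, 0 < P ∧ ∀ I ∈ J.gaps, |J.gapPole I| ≤ P := by
  obtain ⟨L, hL1, hL⟩ := exists_endpoint_bound hA
  have hs := (summable_gaps hA hE).1.norm
  have hT : ∀ I : J.gaps, |J.gapZero I - J.gapPole I| ≤ ∑' I : J.gaps, ‖J.gapZero I - J.gapPole I‖ :=
    fun I => hs.le_tsum I fun _ _ => norm_nonneg _
  have hT0 : 0 ≤ ∑' I : J.gaps, ‖J.gapZero I - J.gapPole I‖ := tsum_nonneg fun _ => norm_nonneg _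
  refine ⟨L + ∑' I : J.gaps, ‖J.gapZero I - J.gapPole I‖, by linarith, fun I hI => ?_⟩
  have hz : |J.gapZero I| ≤ L := by
    rw [gapZero]
    split_ifs with hb
    · have hα := csInf_mem_closure (gap_nonempty hI) hb
      have h1 := hL I hI _ hα (hA.sInf_notMem hI hb)
      rcases J.alphaStar_eq_or I with e | e <;> rw [e]
      · exact h1
      · rw [abs_inv]; exact (inv_le_one_of_one_le₀ (one_le_abs_of_mem_closure hI hα)).trans hL1
    · norm_num; exact hL1
  have h1 := hT ⟨I, hI⟩
  have h2 := abs_sub_abs_le_abs_sub (J.gapPole I) (J.gapZero I)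
  rw [abs_sub_comm] at h2; simp only at h1; linarith

end JacobiMatrix

/-- The difference of the indicators of `(-∞, b)` and `(-∞, a)`. -/
def rayDiff (a b τ : ℝ) : ℝ := (if τ < b then 1 else 0) - (if τ < a then 1 else 0)

lemma ae_ne_of_real (a : ℝ) : ∀ᵐ τ : ℝ, τ ≠ a := compl_mem_ae_iff.2 (measure_singleton a)

lemma rayDiff_mul_ae (a b : ℝ) (f : ℝ → ℂ) : (fun τ => (rayDiff a b τ : ℂ) * f τ) =ᵐ[volume]
      (Set.uIoc a b).indicator fun τ => (if a ≤ b then (1:ℂ) else -1) * f τ := by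
  filter_upwards [ae_ne_of_real a, ae_ne_of_real b] with τ ha hb
  rw [rayDiff]
  by_cases h : a ≤ b
  · rw [Set.uIoc_of_le h, Set.indicator_apply]
    rcases lt_or_gt_of_ne ha with h1 | h1 <;> rcases lt_or_gt_of_ne hb with h2 | h2 <;>
      simp [h, h1, h2, h1.le, h2.le, h1.not_gt, h2.not_gt, h1.not_ge, h2.not_ge] <;> linarith
  · rw [Set.uIoc_of_ge (not_le.1 h).le, Set.indicator_apply]
    rcases lt_or_gt_of_ne ha with h1 | h1 <;> rcases lt_or_gt_of_ne hb with h2 | h2 <;>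
      simp [h, h1, h2, h1.le, h2.le, h1.not_gt, h2.not_gt, h1.not_ge, h2.not_ge] <;> linarith

lemma integral_rayDiff_mul (a b : ℝ) (f : ℝ → ℂ) : ∫ τ, (rayDiff a b τ : ℂ) * f τ = ∫ τ in a..b, f τ := by
  rw [integral_congr_ae (rayDiff_mul_ae a b f), integral_indicator measurableSet_uIoc,
    integral_const_mul, intervalIntegral.intervalIntegral_eq_integral_uIoc]
  split_ifs <;> simp

lemma integrable_rayDiff_mul {a b : ℝ} {f : ℝ → ℂ} (hf : Continuous f) :
    Integrable fun τ => (rayDiff a b τ : ℂ) * f τ := by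
  rw [integrable_congr (rayDiff_mul_ae a b f), integrable_indicator_iff measurableSet_uIoc]
  exact ((hf.intervalIntegrable a b).def').const_mul _

lemma integral_norm_rayDiff_mul_le {a b B : ℝ} {f : ℝ → ℂ} (hf : Continuous f)
    (hB : ∀ τ, ‖f τ‖ ≤ B) : ∫ τ, ‖(rayDiff a b τ : ℂ) * f τ‖ ≤ B * |b - a| := by
  have : (fun τ => ‖(Set.uIoc a b).indicator (fun τ => (if a ≤ b then (1:ℂ) else -1) * f τ) τ‖) =
      (Set.uIoc a b).indicator fun τ => ‖f τ‖ := by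
    ext τ; rw [norm_indicator_eq_indicator_norm]
    congr 1; ext τ; split_ifs <;> simp
  have h2 : (fun τ => ‖(rayDiff a b τ : ℂ) * f τ‖) =ᵐ[volume] (Set.uIoc a b).indicator fun τ => ‖f τ‖ :=
    ((rayDiff_mul_ae a b f).fun_comp norm).trans (.of_forall fun τ => congrFun this τ)
  rw [integral_congr_ae h2, integral_indicator measurableSet_uIoc]
  calc ∫ τ in Set.uIoc a b, ‖f τ‖ ≤ ∫ τ in Set.uIoc a b, B := by
        refine setIntegral_mono_on ?_ ?_ measurableSet_uIoc fun τ _ => hB τ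
        · exact ((hf.norm.intervalIntegrable a b).def')
        · exact integrableOn_const (by simp [Set.uIoc])
    _ = B * |b - a| := by simp [Set.uIoc, mul_comm, abs_sub_comm, max_sub_min_eq_abs]

lemma exp_neg_integral_cauchyKernel (hw : w.im ≠ 0) (a b : ℝ) :
    exp (-∫ τ in a..b, 1 / (τ - w)) = (a - w) / (b - w) := by
  have hs : ∀ τ : ℝ, w - τ ∈ slitPlane := fun τ => Or.inr (by simpa using hw)
  have hd : ∀ τ ∈ Set.uIcc a b, HasDerivAt (fun τ : ℝ => log (w - τ)) (1 / (τ - w)) τ := by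
    intro τ _
    have h1 : HasDerivAt (fun τ : ℝ => w - (τ : ℂ)) (-1) τ := by simpa using (ofRealCLM.hasDerivAt (x := τ)).const_sub w
    refine (h1.clog_real (hs τ)).congr_deriv ?_
    rw [← neg_sub (τ : ℂ) w, neg_div_neg_eq]
  rw [intervalIntegral.integral_eq_sub_of_hasDerivAt hd
    ((continuous_cauchyKernel hw).intervalIntegrable a b), neg_sub, exp_sub,
    exp_log (slitPlane_ne_zero (hs a)), exp_log (slitPlane_ne_zero (hs b)),
    ← neg_sub, ← neg_sub (b : ℂ), neg_div_neg_eq]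

lemma im_add_inv_ne_zero (hz : z.im ≠ 0) (h1 : ‖z‖ ≠ 1) : (z + z⁻¹).im ≠ 0 := by
  have h0 : normSq z ≠ 0 := fun h => hz (by rw [normSq_eq_zero.1 h]; rfl)
  have h2 : normSq z ≠ 1 := fun h => h1 (by rw [normSq_eq_norm_sq] at h; nlinarith [norm_nonneg z])
  rw [add_im, inv_im]
  have : z.im + -z.im / normSq z = z.im * (normSq z - 1) / normSq z := by field_simp; ring
  rw [this]; exact div_ne_zero (mul_ne_zero hz (sub_ne_zero.2 h2)) h0

namespace JacobiMatrix
lemma one_add_div_eq {a p z : ℂ} (h : z - p ≠ 0) : 1 + (p - a) / (z - p) = (z - a) / (z - p) := by field_simp; ring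

lemma summable_gapTerms (hA : J.CondA) (hE : J.CondE) {d : ℝ} (hd : 0 < d) (hz : ∀ I ∈ J.gaps, d ≤ ‖z - J.gapPole I‖) :
    Summable fun I : J.gaps => ‖((J.gapPole I : ℂ) - J.gapZero I) / (z - J.gapPole I)‖ := by
  refine Summable.of_nonneg_of_le (fun _ => norm_nonneg _) (fun I => ?_) ((summable_gaps hA hE).1.norm.mul_right d⁻¹)
  rw [norm_div, div_eq_mul_inv, ← norm_neg ((J.gapPole I : ℂ) - _), neg_sub, ← ofReal_sub, norm_real]
  gcongr; exact hz I I.2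

lemma R0_eq (hA : J.CondA) (hE : J.CondE) {d : ℝ} (hd : 0 < d) (hz : ∀ I ∈ J.gaps, d ≤ ‖z - J.gapPole I‖) :
    J.R0 z = ∏' I : J.gaps, (1 + ((J.gapPole I : ℂ) - J.gapZero I) / (z - J.gapPole I)) := by
  classical
  obtain ⟨I₀, hI₀, hb₀⟩ := exists_unbounded_gap hA
  obtain ⟨I₁, hI₁, hs₁⟩ := exists_gap_sSup_eq hA hE
  have hp₁ : J.gapPole I₁ = -1 := if_pos hs₁
  have hz1 : z + 1 ≠ 0 := by
    have := hz I₁ hI₁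
    rw [hp₁] at this; intro h; rw [ofReal_neg, ofReal_one, sub_neg_eq_add, h, norm_zero] at this; linarith
  have hne : ∀ I ∈ J.gaps, z - (J.gapPole I : ℂ) ≠ 0 := fun I hI h => by
    have := hz I hI
    rw [h, norm_zero] at this; linarith
  have h := ((multipliable_one_add_of_summable (summable_gapTerms hA hE hd hz)).hasProd.mul
    (hasProd_ite_eq (⟨I₀, hI₀⟩ : J.gaps) (z + 1)⁻¹)).mul (hasProd_ite_eq (⟨I₁, hI₁⟩ : J.gaps) (z + 1))
  rw [mul_assoc, inv_mul_cancel₀ hz1, mul_one] at h; rw [← h.tprod_eq, R0]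
  refine tprod_congr fun I => ?_
  have e0 : (I = ⟨I₀, hI₀⟩) ↔ ¬BddBelow (I : Set ℝ) :=
    ⟨fun e => by rw [e]; exact hb₀, fun e => Subtype.ext (gap_eq_of_sInf I.2 hI₀ (Or.inr ⟨e, hb₀⟩) hA)⟩
  have e1 : (I = ⟨I₁, hI₁⟩) ↔ sSup (I : Set ℝ) = -1 :=
    ⟨fun e => by rw [e]; exact hs₁, fun e => Subtype.ext (gap_eq_of_sSup I.2 hI₁
      (Or.inl ⟨bddAbove_of_sSup_eq e, bddAbove_of_sSup_eq hs₁, e.trans hs₁.symm⟩) hA)⟩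
  rw [one_add_div_eq (hne I I.2)]
  have hn := hne I I.2
  simp only [e0, e1]; rw [gapZero, gapPole] at *
  by_cases hb : BddBelow (I : Set ℝ) <;> by_cases hs : sSup (I : Set ℝ) = -1 <;>
    simp only [hb, hs, not_true, not_false_iff, if_true, if_false, ofReal_neg,
      ofReal_one, sub_neg_eq_add] at hn ⊢ <;> field_simp

lemma abs_im_le_norm_sub_pole (z : ℂ) (I : Set ℝ) : |z.im| ≤ ‖z - J.gapPole I‖ := by
  rw [← norm_neg, neg_sub]; exact abs_im_le_norm_ofReal_sub z _

lemma sub_ofReal_ne_zero (hz : z.im ≠ 0) (x : ℝ) : z - (x : ℂ) ≠ 0 := by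
  rw [← neg_sub]; exact neg_ne_zero.2 (ofReal_sub_ne_zero hz x)

lemma R0_eq_of_im (hA : J.CondA) (hE : J.CondE) (hz : z.im ≠ 0) :
    J.R0 z = ∏' I : J.gaps, (1 + ((J.gapPole I : ℂ) - J.gapZero I) / (z - J.gapPole I)) :=
  R0_eq hA hE (abs_pos.2 hz) fun I _ => abs_im_le_norm_sub_pole z I

lemma R0_ne_zero (hA : J.CondA) (hE : J.CondE) (hz : z.im ≠ 0) : J.R0 z ≠ 0 := by
  rw [R0_eq_of_im hA hE hz]
  refine tprod_one_add_ne_zero_of_summable (fun I => ?_)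
    (summable_gapTerms hA hE (abs_pos.2 hz) fun I _ => abs_im_le_norm_sub_pole z I)
  rw [one_add_div_eq (sub_ofReal_ne_zero hz _)]
  exact div_ne_zero (sub_ofReal_ne_zero hz _) (sub_ofReal_ne_zero hz _)

lemma norm_gapTerm_le {d : ℝ} (hd : 0 < d) {I : Set ℝ} (h : d ≤ ‖z - J.gapPole I‖) :
    ‖((J.gapPole I : ℂ) - J.gapZero I) / (z - J.gapPole I)‖ ≤ ‖J.gapZero I - J.gapPole I‖ * d⁻¹ := by
  rw [norm_div, div_eq_mul_inv, ← norm_neg ((J.gapPole I : ℂ) - _), neg_sub, ← ofReal_sub, norm_real]; gcongr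

lemma continuousAt_R0 (hA : J.CondA) (hE : J.CondE) (hz : z.im ≠ 0) : ContinuousAt J.R0 z := by
  have hd : 0 < |z.im| / 2 := by have := abs_pos.2 hz; linarith
  have hev : ∀ᶠ z' : ℂ in 𝓝 z, |z.im| / 2 < |z'.im| := (continuous_im.abs.tendsto z).eventually_const_lt (by linarith)
  rw [ContinuousAt, R0_eq_of_im hA hE hz]
  refine (tendsto_tprod_one_add_of_dominated_convergence ((summable_gaps hA hE).1.norm.mul_right (|z.im| / 2)⁻¹)
    (fun I => ?_) (hev.mono fun z' h I => norm_gapTerm_le hd (h.le.trans (abs_im_le_norm_sub_pole z' I)))).congr'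
    (hev.mono fun z' h => (R0_eq_of_im hA hE (abs_pos.1 (hd.trans h))).symm)
  exact tendsto_const_nhds.div (tendsto_id.sub tendsto_const_nhds) (sub_ofReal_ne_zero hz _)

lemma tendsto_R0_cobounded (hA : J.CondA) (hE : J.CondE) :
    Tendsto J.R0 (Bornology.cobounded ℂ) (𝓝 1) := by
  obtain ⟨P, hP0, hP⟩ := exists_gapPole_bound hA hE
  have hev : ∀ᶠ z : ℂ in Bornology.cobounded ℂ, P + 1 ≤ ‖z‖ := tendsto_norm_cobounded_atTop.eventually_ge_atTop _
  have hd : ∀ z : ℂ, P + 1 ≤ ‖z‖ → ∀ I ∈ J.gaps, 1 ≤ ‖z - J.gapPole I‖ := by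
    intro z h I hI
    have h1 := norm_sub_norm_le z (J.gapPole I : ℂ)
    rw [norm_ofReal] at h1; linarith [hP I hI]
  have h := tendsto_tprod_one_add_of_dominated_convergence (𝓕 := Bornology.cobounded ℂ)
    (f := fun z (I : J.gaps) => ((J.gapPole I : ℂ) - J.gapZero I) / (z - J.gapPole I)) (g := fun _ => 0)
    ((summable_gaps hA hE).1.norm.mul_right (1:ℝ)⁻¹) (fun I => ?_)
    (hev.mono fun z h I => norm_gapTerm_le one_pos (hd z h I I.2))
  · simp only [add_zero, tprod_one] at h
    exact h.congr' (hev.mono fun z h => (R0_eq hA hE one_pos (hd z h)).symm)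
  · simp only [div_eq_mul_inv]; rw [← mul_zero ((J.gapPole I : ℂ) - J.gapZero I)]
    refine tendsto_const_nhds.mul (tendsto_inv₀_cobounded.comp ?_)
    exact tendsto_sub_const_cobounded _

lemma R0_conj (hA : J.CondA) (hE : J.CondE) (hz : z.im ≠ 0) : J.R0 (conj z) = conj (J.R0 z) := by
  have hz' : (conj z).im ≠ 0 := by simpa using hz
  rw [R0_eq_of_im hA hE hz, R0_eq_of_im hA hE hz',
    (multipliable_one_add_of_summable (summable_gapTerms hA hE (abs_pos.2 hz)
      fun I _ => abs_im_le_norm_sub_pole z I)).map_tprod conj continuous_conj]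
  refine tprod_congr fun I => ?_
  simp

/-- The indicator of `negSet` minus that of `(-∞, -2)`. -/
def negDiff (J : JacobiMatrix) (τ : ℝ) : ℝ := by
  classical exact (if τ ∈ J.negSet then 1 else 0) - (if τ < -2 then 1 else 0)

lemma hasSum_rayDiff (hA : J.CondA) (hE : J.CondE) {τ : ℝ} (hlo : ∀ I ∈ J.gaps, τ ≠ J.gapLo I) :
    HasSum (fun I : J.gaps => rayDiff (J.gapLo I) (J.gapHi I) τ) (J.negDiff τ) := by
  classical
  obtain ⟨I₀, hI₀, hb₀⟩ := exists_unbounded_gap hA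
  have e0 : ∀ I : J.gaps, (I = ⟨I₀, hI₀⟩) ↔ ¬BddBelow (I : Set ℝ) := fun I =>
    ⟨fun e => by rw [e]; exact hb₀, fun e => Subtype.ext (gap_eq_of_sInf I.2 hI₀ (Or.inr ⟨e, hb₀⟩) hA)⟩
  have hterm : ∀ I : J.gaps, rayDiff (J.gapLo I) (J.gapHi I) τ =
      (if ∃ t ∈ (I : Set ℝ), t < J.phi I ∧ t + t⁻¹ = τ then 1 else 0) -
        (if I = ⟨I₀, hI₀⟩ then (if τ < -2 then 1 else 0) else 0) := by
    intro I; simp only [image_gap_Iio hA hE I.2, e0 I, rayDiff]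
    by_cases hb : BddBelow (I : Set ℝ)
    · have hle : J.gapLo I ≤ J.gapHi I := by
        have hα := csInf_mem_closure (gap_nonempty I.2) hb
        have hφ := phi_mem_closure hA I.2
        rw [gapLo_of_bddBelow hb, gapHi_eq hA hE I.2]
        exact (add_inv_le_add_inv ((closure_minimal (fun _ ht => csInf_le hb ht) isClosed_Ici hφ : _ ∈ Ici _))
          (one_le_mul_of_mem_closure I.2 hα hφ)).1
      simp only [hb, not_true, if_false, true_imp_iff, sub_zero]
      rcases lt_or_gt_of_ne (hlo I I.2) with h | h
      · simp [h, h.not_gt, h.trans_le hle]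
      · simp [h, h.not_gt]
    · simp only [hb, not_false_iff, if_true, false_imp_iff, true_and, gapLo_of_not_bddBelow hb]
  simp only [hterm]
  refine HasSum.sub ?_ (hasSum_ite_eq _ _)
  by_cases hτ : τ ∈ J.negSet
  · obtain ⟨t, ⟨I, hI, htI, htφ⟩, rfl⟩ := hτ
    have : ∀ I' : J.gaps, (∃ s ∈ (I' : Set ℝ), s < J.phi I' ∧ s + s⁻¹ = t + t⁻¹) ↔ I' = ⟨I, hI⟩ := by
      intro I'
      constructor
      · rintro ⟨s, hs, -, e⟩
        have := add_inv_injOn (mem_Delta_iff.1 (gap_subset I'.2 hs)).1 (mem_Delta_iff.1 (gap_subset hI htI)).1 e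
        exact Subtype.ext (gap_eq_of_mem I'.2 hI (this ▸ hs) htI)
      · rintro rfl; exact ⟨t, htI, htφ, rfl⟩
    simp only [this]; rw [if_pos ⟨t, ⟨I, hI, htI, htφ⟩, rfl⟩]; exact hasSum_ite_eq _ _
  · rw [if_neg hτ]
    have : ∀ I' : J.gaps, ¬∃ s ∈ (I' : Set ℝ), s < J.phi I' ∧ s + s⁻¹ = τ := by
      rintro I' ⟨s, hs, h, e⟩; exact hτ ⟨s, ⟨I', I'.2, hs, h⟩, e⟩
    simp only [this, if_false]; exact hasSum_zero

lemma hasSum_integral_gaps (hA : J.CondA) (hE : J.CondE) (hw : w.im ≠ 0) :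
    HasSum (fun I : J.gaps => ∫ τ in (J.gapLo I)..(J.gapHi I), 1 / (τ - w)) (cauchyInt J.negDiff w) := by
  have := hA.countable_gaps.to_subtype
  have h := hasSum_integral_of_summable_integral_norm (μ := (volume : Measure ℝ))
    (F := fun (I : J.gaps) τ => (rayDiff (J.gapLo I) (J.gapHi I) τ : ℂ) * (1 / (τ - w)))
    (fun I => integrable_rayDiff_mul (continuous_cauchyKernel hw))
    (Summable.of_nonneg_of_le (fun _ => integral_nonneg fun _ => norm_nonneg _)
      (fun I => integral_norm_rayDiff_mul_le (continuous_cauchyKernel hw) (norm_cauchyKernel_le hw))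
      ((summable_gaps hA hE).2.abs.mul_left _))
  simp only [integral_rayDiff_mul] at h
  convert! h using 1
  refine integral_congr_ae ?_
  have : ∀ᵐ τ : ℝ, ∀ I : J.gaps, τ ≠ J.gapLo I := ae_all_iff.2 fun I => ae_ne_of_real _
  filter_upwards [this] with τ hτ
  have h2 := (hasSum_rayDiff hA hE fun I hI => hτ ⟨I, hI⟩)
  exact ((hasSum_ofReal.2 h2).mul_right _).tsum_eq.symm

lemma norm_ne_one_inv (h1 : ‖z‖ ≠ 1) : ‖z⁻¹‖ ≠ 1 := by rw [norm_inv]; simpa using h1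

/-- `R₀(z) R₀(z⁻¹)` in the variable `z + z⁻¹`. -/
lemma exists_R0_mul_R0_inv (hA : J.CondA) (hE : J.CondE) : ∃ X : ℝ, 0 < X ∧ ∀ z : ℂ, z.im ≠ 0 → ‖z‖ ≠ 1 →
      J.R0 z * J.R0 z⁻¹ = X * exp (-cauchyInt J.negDiff (z + z⁻¹)) := by
  have key : ∀ z : ℂ, z.im ≠ 0 → ‖z‖ ≠ 1 → HasProd (fun I : J.gaps => ((J.gapZero I / J.gapPole I : ℝ) : ℂ))
        (J.R0 z * J.R0 z⁻¹ * exp (cauchyInt J.negDiff (z + z⁻¹))) := by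
    intro z hz h1
    have h0 := ne_zero_of_im hz
    have hw := im_add_inv_ne_zero hz h1
    have hz' : z⁻¹.im ≠ 0 := by rw [inv_im]; exact div_ne_zero (neg_ne_zero.2 hz) (normSq_pos.2 h0).ne'
    have hm : ∀ v : ℂ, v.im ≠ 0 → HasProd (fun I : J.gaps =>
        (1 + ((J.gapPole I : ℂ) - J.gapZero I) / (v - J.gapPole I))) (J.R0 v) := fun v hv => by
      rw [R0_eq_of_im hA hE hv]
      exact (multipliable_one_add_of_summable (summable_gapTerms hA hE (abs_pos.2 hv)
        fun I _ => abs_im_le_norm_sub_pole v I)).hasProd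
    refine (((hm z hz).mul (hm z⁻¹ hz')).mul (hasSum_integral_gaps hA hE hw).cexp).congr_fun fun I => ?_
    have e := exp_neg_integral_cauchyKernel hw (J.gapLo I) (J.gapHi I)
    rw [exp_neg, inv_eq_iff_eq_inv, inv_div] at e
    have ha : (J.gapZero I : ℂ) ≠ 0 := ofReal_ne_zero.2 (gapZero_ne_zero I.2)
    have hp : (J.gapPole I : ℂ) ≠ 0 := ofReal_ne_zero.2 (gapPole_ne_zero hA hE I.2)
    have h2 := ofReal_sub_ne_zero hw (J.gapLo I)
    have h3 := ofReal_sub_ne_zero hw (J.gapHi I)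
    have h4 := sub_ofReal_ne_zero hz (J.gapPole I)
    have h5 := sub_ofReal_ne_zero hz' (J.gapPole I)
    have f : ∀ c : ℂ, c ≠ 0 → (z - c) * (z⁻¹ - c) = c * (c + c⁻¹ - (z + z⁻¹)) := fun c hc => by field_simp; ring
    have fa := f _ ha
    have fp := f _ hp
    have ela : (J.gapLo I : ℂ) = J.gapZero I + (J.gapZero I : ℂ)⁻¹ := by rw [gapLo]; push_cast; rfl
    have elp : (J.gapHi I : ℂ) = J.gapPole I + (J.gapPole I : ℂ)⁻¹ := by rw [gapHi]; push_cast; rfl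
    rw [← ela] at fa; rw [← elp] at fp; simp only [Function.comp]
    rw [e, one_add_div_eq h4, one_add_div_eq h5, div_mul_div_comm, fa, fp]; push_cast
    rw [div_mul_div_comm, div_eq_div_iff hp (mul_ne_zero (mul_ne_zero hp h3) h2)]; ring
  have hI : (2 * Complex.I).im ≠ 0 := by simp
  have hI1 : ‖2 * Complex.I‖ ≠ 1 := by simp
  have hI' : (2 * Complex.I)⁻¹.im ≠ 0 := by simp
  have h := key _ hI hI1
  set X := J.R0 (2 * Complex.I) * J.R0 (2 * Complex.I)⁻¹ *
    exp (cauchyInt J.negDiff (2 * Complex.I + (2 * Complex.I)⁻¹)) with hX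
  have hX0 : X ≠ 0 := mul_ne_zero (mul_ne_zero (R0_ne_zero hA hE hI) (R0_ne_zero hA hE hI')) (exp_ne_zero _)
  have hXr : X ∈ {x : ℂ | 0 ≤ x.re ∧ x.im = 0} := by
    refine IsClosed.mem_of_tendsto ?_ h (.of_forall fun s => ?_)
    · exact (isClosed_le continuous_const continuous_re).inter (isClosed_eq continuous_im continuous_const)
    · rw [← ofReal_prod]
      refine ⟨?_, ofReal_im _⟩
      rw [ofReal_re]; exact Finset.prod_nonneg fun I _ => (gapZero_div_gapPole_pos hA hE I.2).le
  have hXe : X = (X.re : ℂ) := Complex.ext (by simp) (by simpa using hXr.2)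
  refine ⟨X.re, lt_of_le_of_ne hXr.1 fun h0 => hX0 (by rw [hXe, ← h0]; simp), fun z hz h1 => ?_⟩
  rw [← hXe, ← (key z hz h1).unique h, mul_assoc, ← exp_add, add_neg_cancel, exp_zero, mul_one]

end JacobiMatrix

lemma exists_bound_boundaryArg : ∃ B : ℝ, ∀ f τ, |boundaryArg f τ| ≤ B := by
  refine ⟨max π |Classical.epsilon fun _ : ℝ => False|, fun f τ => ?_⟩
  by_cases h : ∃ y, Tendsto (fun ε : ℝ => arg (f (τ + ε * I))) (𝓝[>] (0:ℝ)) (𝓝 y)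
  · obtain ⟨y, hy⟩ := h
    rw [boundaryArg, hy.limUnder_eq]
    exact (le_of_tendsto hy.abs (.of_forall fun ε => abs_arg_le_pi _)).trans (le_max_left _ _)
  · have : boundaryArg f τ = Classical.epsilon fun _ : ℝ => False := by
      rw [boundaryArg, limUnder, lim]
      congr 1
      ext y; simp only [iff_false]; exact fun hy => h ⟨y, hy⟩
    rw [this]; exact le_max_right _ _

lemma aestronglyMeasurable_comp_of_deriv {u f f' : ℝ → ℝ} {s : Set ℝ} (hs : MeasurableSet s)
    (hf' : ∀ x ∈ s, HasDerivWithinAt f (f' x) s x) (hf : InjOn f s) (hm : Measurable f')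
    (h0 : ∀ x ∈ s, f' x ≠ 0) (hu : Integrable u) :
    AEStronglyMeasurable (fun x => u (f x)) (volume.restrict s) := by
  have h := ((integrableOn_image_iff_integrableOn_abs_deriv_smul hs hf' hf u).1 hu.integrableOn).1
  refine (((hm.abs.inv).aestronglyMeasurable (μ := volume.restrict s)).mul h).congr ?_
  filter_upwards [ae_restrict_mem hs] with x hx
  have := abs_pos.2 (h0 x hx)
  simp only [Pi.mul_apply, smul_eq_mul]
  change |f' x|⁻¹ * _ = _
  field_simp

lemma integrable_of_bounded_support {B L : ℝ} (hm : AEStronglyMeasurable f)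
    (hB : ∀ t, |f t| ≤ B) (hL : ∀ t, L < |t| → f t = 0) : Integrable f := by
  have h : IntegrableOn f (Icc (-L) L) := Measure.integrableOn_of_bounded (M := B) (by simp) hm (.of_forall hB)
  refine h.integrable_of_forall_notMem_eq_zero fun t ht => hL t ?_
  rw [mem_Icc, ← abs_le, not_le] at ht; exact ht

/-- The function equal to `u (t + t⁻¹)` outside and `-v (t + t⁻¹)` inside the unit circle. -/
def foldInv (u v : ℝ → ℝ) (t : ℝ) : ℝ :=
  {t : ℝ | 1 < |t|}.indicator (fun t => u (t + t⁻¹)) t -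
    {t : ℝ | t ≠ 0 ∧ |t| < 1}.indicator (fun t => v (t + t⁻¹)) t

lemma hasDerivAt_add_inv (ht : t ≠ 0) : HasDerivAt (fun t : ℝ => t + t⁻¹) (1 - (t ^ 2)⁻¹) t :=
  ((hasDerivAt_id t).add (hasDerivAt_inv ht)).congr_deriv (by ring)

lemma measurableSet_outside : MeasurableSet {t : ℝ | 1 < |t|} := isOpen_one_lt_abs.measurableSet

lemma measurableSet_inside : MeasurableSet {t : ℝ | t ≠ 0 ∧ |t| < 1} :=
  (isOpen_ne.inter (isOpen_lt continuous_abs continuous_const)).measurableSet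

lemma add_inv_injOn_inside : InjOn (fun t : ℝ => t + t⁻¹) {t | t ≠ 0 ∧ |t| < 1} := by
  intro s hs t ht e
  refine inv_injective (add_inv_injOn (one_lt_abs_inv hs.1 hs.2) (one_lt_abs_inv ht.1 ht.2) ?_)
  simpa [add_comm] using e

lemma image_add_inv_outside : (fun t : ℝ => t + t⁻¹) '' {t | 1 < |t|} = {τ | 2 < |τ|} := by
  ext τ; exact ⟨fun ⟨t, ht, e⟩ => e ▸ two_lt_abs_add_inv ht, fun h => exists_add_inv_eq h⟩

lemma image_add_inv_inside : (fun t : ℝ => t + t⁻¹) '' {t | t ≠ 0 ∧ |t| < 1} = {τ | 2 < |τ|} := by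
  rw [← image_add_inv_outside]
  ext τ
  constructor
  · rintro ⟨t, ht, e⟩; exact ⟨t⁻¹, one_lt_abs_inv ht.1 ht.2, by simpa [add_comm] using e⟩
  · rintro ⟨t, ht, e⟩
    exact ⟨t⁻¹, ⟨inv_ne_zero (ne_zero_of_one_lt_abs ht), abs_inv_lt_one ht⟩, by simpa [add_comm] using e⟩

lemma abs_one_sub_outside (ht : 1 < |t|) : |1 - (t ^ 2)⁻¹| = 1 - (t ^ 2)⁻¹ ∧ 1 - (t ^ 2)⁻¹ ≠ 0 := by
  have h : (t ^ 2)⁻¹ < 1 := inv_lt_one_of_one_lt₀ (by rw [← sq_abs]; nlinarith)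
  exact ⟨abs_of_pos (by linarith), by linarith⟩

lemma abs_one_sub_inside (ht : t ≠ 0 ∧ |t| < 1) :
    |1 - (t ^ 2)⁻¹| = -(1 - (t ^ 2)⁻¹) ∧ 1 - (t ^ 2)⁻¹ ≠ 0 := by
  have h0 := abs_pos.2 ht.1
  have h : 1 < (t ^ 2)⁻¹ := (one_lt_inv₀ (by rw [← sq_abs]; positivity)).2 (by rw [← sq_abs]; nlinarith [ht.2])
  exact ⟨abs_of_neg (by linarith), by linarith⟩

lemma foldInv_of_outside (ht : 1 < |t|) : foldInv u v t = u (t + t⁻¹) := by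
  have h2 : t ∉ {t : ℝ | t ≠ 0 ∧ |t| < 1} := fun h => by linarith [h.2]
  rw [foldInv, indicator_of_mem (show t ∈ {t : ℝ | 1 < |t|} from ht), indicator_of_notMem h2, sub_zero]

lemma foldInv_of_inside (ht : t ≠ 0 ∧ |t| < 1) : foldInv u v t = -v (t + t⁻¹) := by
  have h2 : t ∉ {t : ℝ | 1 < |t|} := fun h => by linarith [ht.2, show 1 < |t| from h]
  rw [foldInv, indicator_of_notMem h2, indicator_of_mem (show t ∈ {t : ℝ | t ≠ 0 ∧ |t| < 1} from ht), zero_sub]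

lemma foldInv_of_else (ht : t = 0 ∨ |t| = 1) : foldInv u v t = 0 := by
  have h1 : t ∉ {t : ℝ | 1 < |t|} := fun h => by
    rcases ht with rfl | h'
    · simp only [mem_ofPred_eq, abs_zero] at h; linarith
    · exact (h'.symm ▸ h : (1:ℝ) < 1).ne rfl
  have h2 : t ∉ {t : ℝ | t ≠ 0 ∧ |t| < 1} := fun h => by
    rcases ht with h' | h'
    · exact h.1 h'
    · linarith [h.2]
  rw [foldInv, indicator_of_notMem h1, indicator_of_notMem h2, sub_zero]

/-- Integrable, bounded, and vanishing far away. -/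
structure IsCompactDensity (u : ℝ → ℝ) : Prop where
  integrable : Integrable u
  bounded : ∃ B, ∀ τ, |u τ| ≤ B
  support : ∃ K, ∀ τ, K < |τ| → u τ = 0

lemma abs_add_inv_lt {K t : ℝ} (hK : 0 ≤ K) (ht : K + 1 < |t|) : K < |t + t⁻¹| := by
  have h1 : |t⁻¹| ≤ 1 := by rw [abs_inv]; exact inv_le_one_of_one_le₀ (by linarith)
  have h2 := abs_sub_abs_le_abs_sub t (-t⁻¹)
  rw [abs_neg, sub_neg_eq_add] at h2; linarith

lemma exists_foldInv_bounds (hu : IsCompactDensity u) (hv : IsCompactDensity v) :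
    ∃ B K : ℝ, 0 ≤ K ∧ (∀ t, |foldInv u v t| ≤ B) ∧ (∀ t, K + 1 < |t| → foldInv u v t = 0) ∧
      ∀ t, |t| < (K + 1)⁻¹ → foldInv u v t = 0 := by
  obtain ⟨Bu, hBu⟩ := hu.bounded
  obtain ⟨Bv, hBv⟩ := hv.bounded
  obtain ⟨Ku, hKu⟩ := hu.support
  obtain ⟨Kv, hKv⟩ := hv.support
  have hK0 : 0 ≤ max |Ku| |Kv| := (abs_nonneg _).trans (le_max_left _ _)
  have hu' : ∀ τ, max |Ku| |Kv| < |τ| → u τ = 0 := fun τ h =>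
    hKu τ ((le_abs_self _).trans_lt ((le_max_left _ _).trans_lt h))
  have hv' : ∀ τ, max |Ku| |Kv| < |τ| → v τ = 0 := fun τ h =>
    hKv τ ((le_abs_self _).trans_lt ((le_max_right _ _).trans_lt h))
  refine ⟨max Bu Bv, max |Ku| |Kv|, hK0, fun t => ?_, fun t ht => ?_, fun t ht => ?_⟩
  · rcases lt_trichotomy |t| 1 with h | h | h
    · by_cases h0 : t = 0
      · rw [foldInv_of_else (Or.inl h0), abs_zero]
        exact (abs_nonneg _).trans ((hBu 0).trans (le_max_left _ _))
      · rw [foldInv_of_inside ⟨h0, h⟩, abs_neg]; exact (hBv _).trans (le_max_right _ _)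
    · rw [foldInv_of_else (Or.inr h), abs_zero]; exact (abs_nonneg _).trans ((hBu 0).trans (le_max_left _ _))
    · rw [foldInv_of_outside h]; exact (hBu _).trans (le_max_left _ _)
  · rw [foldInv_of_outside (by linarith)]; exact hu' _ (abs_add_inv_lt hK0 ht)
  · by_cases h0 : t = 0
    · exact foldInv_of_else (Or.inl h0)
    have h1 : |t| < 1 := ht.trans_le (inv_le_one_of_one_le₀ (by linarith))
    rw [foldInv_of_inside ⟨h0, h1⟩, neg_eq_zero]
    refine hv' _ ?_
    have := abs_add_inv_lt (t := t⁻¹) hK0 (by rw [abs_inv]; exact (lt_inv_comm₀ (by linarith) (abs_pos.2 h0)).2 ht)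
    rwa [inv_inv, add_comm] at this

lemma measurable_one_sub : Measurable fun t : ℝ => 1 - (t ^ 2)⁻¹ := measurable_const.sub (measurable_id.pow_const 2).inv

lemma integrable_foldInv (hu : IsCompactDensity u) (hv : IsCompactDensity v) :
    Integrable (foldInv u v) := by
  obtain ⟨B, K, hK, hB, hL, -⟩ := exists_foldInv_bounds hu hv
  refine integrable_of_bounded_support ?_ hB hL
  refine AEStronglyMeasurable.sub ?_ ?_
  · exact (aestronglyMeasurable_indicator_iff measurableSet_outside).2 (aestronglyMeasurable_comp_of_deriv measurableSet_outside
      (fun t ht => (hasDerivAt_add_inv (ne_zero_of_one_lt_abs ht)).hasDerivWithinAt) add_inv_injOn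
      measurable_one_sub (fun t ht => (abs_one_sub_outside ht).2) hu.integrable)
  · exact (aestronglyMeasurable_indicator_iff measurableSet_inside).2 (aestronglyMeasurable_comp_of_deriv measurableSet_inside
      (fun t ht => (hasDerivAt_add_inv ht.1).hasDerivWithinAt) add_inv_injOn_inside
      measurable_one_sub (fun t ht => (abs_one_sub_inside ht).2) hv.integrable)

/-- Change of variables `τ = t + t⁻¹` on both sides of the unit circle. -/
lemma integral_foldInv_mul (hu : IsCompactDensity u) (hv : IsCompactDensity v) (hw : w.im ≠ 0) :
    Integrable (fun t : ℝ => (foldInv u v t : ℂ) * ((1 - ((t : ℂ) ^ 2)⁻¹) / (((t + t⁻¹ : ℝ) : ℂ) - w))) ∧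
    ∫ t : ℝ, (foldInv u v t : ℂ) * ((1 - ((t : ℂ) ^ 2)⁻¹) / (((t + t⁻¹ : ℝ) : ℂ) - w)) =
      cauchyInt ({τ : ℝ | 2 < |τ|}.indicator fun τ => u τ + v τ) w := by
  have hS : MeasurableSet {τ : ℝ | 2 < |τ|} := (isOpen_lt continuous_const continuous_abs).measurableSet
  have iu := integrable_mul_cauchyKernel' hu.integrable hw
  have iv := integrable_mul_cauchyKernel' hv.integrable hw
  have do' : ∀ t ∈ {t : ℝ | 1 < |t|}, HasDerivWithinAt (fun t : ℝ => t + t⁻¹) (1 - (t ^ 2)⁻¹) {t : ℝ | 1 < |t|} t :=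
    fun t ht => (hasDerivAt_add_inv (ne_zero_of_one_lt_abs ht)).hasDerivWithinAt
  have di' : ∀ t ∈ {t : ℝ | t ≠ 0 ∧ |t| < 1}, HasDerivWithinAt (fun t : ℝ => t + t⁻¹) (1 - (t ^ 2)⁻¹) {t : ℝ | t ≠ 0 ∧ |t| < 1} t :=
    fun t ht => (hasDerivAt_add_inv ht.1).hasDerivWithinAt
  have io := (integrableOn_image_iff_integrableOn_abs_deriv_smul measurableSet_outside do' add_inv_injOn
    (fun τ : ℝ => (u τ : ℂ) * (1 / (τ - w)))).1 iu.integrableOn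
  have ii := (integrableOn_image_iff_integrableOn_abs_deriv_smul measurableSet_inside di' add_inv_injOn_inside
    (fun τ : ℝ => (v τ : ℂ) * (1 / (τ - w)))).1 iv.integrableOn
  have eo := integral_image_eq_integral_abs_deriv_smul measurableSet_outside do' add_inv_injOn
    (fun τ : ℝ => (u τ : ℂ) * (1 / (τ - w)))
  have ei := integral_image_eq_integral_abs_deriv_smul measurableSet_inside di' add_inv_injOn_inside
    (fun τ : ℝ => (v τ : ℂ) * (1 / (τ - w)))
  rw [image_add_inv_outside] at eo; rw [image_add_inv_inside] at ei
  rw [← integrable_indicator_iff measurableSet_outside] at io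
  rw [← integrable_indicator_iff measurableSet_inside] at ii
  rw [← integral_indicator measurableSet_outside] at eo; rw [← integral_indicator measurableSet_inside] at ei
  have hpt : ∀ t : ℝ, (foldInv u v t : ℂ) * ((1 - ((t : ℂ) ^ 2)⁻¹) / (((t + t⁻¹ : ℝ) : ℂ) - w)) =
      {t : ℝ | 1 < |t|}.indicator (fun x : ℝ => |1 - (x ^ 2)⁻¹| • ((u (x + x⁻¹) : ℂ) * (1 / (((x + x⁻¹ : ℝ) : ℂ) - w)))) t +
      {t : ℝ | t ≠ 0 ∧ |t| < 1}.indicator (fun x : ℝ => |1 - (x ^ 2)⁻¹| • ((v (x + x⁻¹) : ℂ) * (1 / (((x + x⁻¹ : ℝ) : ℂ) - w)))) t := by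
    intro t
    by_cases h1 : 1 < |t|
    · have h2 : t ∉ {t : ℝ | t ≠ 0 ∧ |t| < 1} := fun h => by linarith [h.2]
      rw [foldInv_of_outside h1, indicator_of_mem (show t ∈ {t : ℝ | 1 < |t|} from h1),
        indicator_of_notMem h2, (abs_one_sub_outside h1).1, real_smul]
      push_cast; ring
    · by_cases h2 : t ≠ 0 ∧ |t| < 1
      · rw [foldInv_of_inside h2, indicator_of_notMem (show t ∉ {t : ℝ | 1 < |t|} from h1),
          indicator_of_mem (show t ∈ {t : ℝ | t ≠ 0 ∧ |t| < 1} from h2), (abs_one_sub_inside h2).1, real_smul]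
        push_cast; ring
      · rw [foldInv_of_else (by
            by_contra h; rw [not_or] at h
            exact h2 ⟨h.1, lt_of_le_of_ne (not_lt.1 h1) h.2⟩),
          indicator_of_notMem (show t ∉ {t : ℝ | 1 < |t|} from h1),
          indicator_of_notMem (show t ∉ {t : ℝ | t ≠ 0 ∧ |t| < 1} from h2)]
        simp
  simp only [hpt]
  refine ⟨io.add ii, ?_⟩
  rw [integral_add io ii, ← eo, ← ei, ← integral_add iu.integrableOn iv.integrableOn, ← integral_indicator hS, cauchyInt]
  congr 1
  ext τ
  by_cases h : τ ∈ {τ : ℝ | 2 < |τ|}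
  · rw [indicator_of_mem h, indicator_of_mem h]; push_cast; ring
  · rw [indicator_of_notMem h, indicator_of_notMem h]; simp

lemma integrable_mul_div_one_add_sq {γ : ℝ → ℝ} (hγ : Integrable γ) :
    Integrable fun t : ℝ => (γ t : ℂ) * ((t : ℂ) / (1 + (t : ℂ) ^ 2)) := by
  have h : ∀ t : ℝ, (t : ℂ) / (1 + (t : ℂ) ^ 2) = ((t / (1 + t ^ 2) : ℝ) : ℂ) := fun t => by push_cast; rfl
  simp only [h]
  refine hγ.ofReal.mul_bdd (c := 1) (Continuous.aestronglyMeasurable ?_) (.of_forall fun t => ?_)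
  · exact continuous_ofReal.comp (continuous_id.div (by fun_prop) fun t => by positivity)
  · rw [norm_ofReal, abs_div, abs_of_pos (by positivity : 0 < 1 + t ^ 2)]
    exact div_le_one_of_le₀ (by nlinarith [sq_abs t, sq_nonneg (|t| - 1), abs_nonneg t]) (by positivity)

lemma expLine_neg_eq {γ : ℝ → ℝ} (hγ : Integrable γ) (hz : Integrable fun t : ℝ => γ t * (1 / (t - z))) :
    expLine z (fun t => -γ t) = exp (-(1 / π) * cauchyInt γ z) *
      exp (1 / π * ∫ t, (γ t : ℂ) * ((t : ℂ) / (1 + (t : ℂ) ^ 2))) := by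
  rw [expLine, ← exp_add]
  congr 1
  have : ∀ t : ℝ, ((-γ t : ℝ) : ℂ) * (1 / (t - z) - (t : ℂ) / (1 + (t : ℂ) ^ 2)) =
      -(γ t * (1 / (t - z)) - (γ t : ℂ) * ((t : ℂ) / (1 + (t : ℂ) ^ 2))) := fun t => by
    push_cast; ring
  simp only [this]; rw [integral_neg, integral_sub hz (integrable_mul_div_one_add_sq hγ), cauchyInt]; ring

lemma expLine_foldInv_mul_inv (hu : IsCompactDensity u) (hv : IsCompactDensity v) :
    ∃ c : ℝ, 0 < c ∧ ∀ z : ℂ, z.im ≠ 0 → ‖z‖ ≠ 1 →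
      expLine z (fun t => -foldInv u v t) * expLine z⁻¹ (fun t => -foldInv u v t) = c * exp (-(1 / π) *
          cauchyInt ({τ : ℝ | 2 < |τ|}.indicator fun τ => u τ + v τ) (z + z⁻¹)) := by
  have hf := integrable_foldInv hu hv
  have hr := integrable_mul_div_one_add_sq hf
  refine ⟨Real.exp (-(1 / π) * ∫ t : ℝ, foldInv u v t * (t⁻¹ - 2 * (t / (1 + t ^ 2)))),
    Real.exp_pos _, fun z hz h1 => ?_⟩
  have h0 := ne_zero_of_im hz
  have hz' : z⁻¹.im ≠ 0 := by rw [inv_im]; exact div_ne_zero (neg_ne_zero.2 hz) (normSq_pos.2 h0).ne'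
  have hw := im_add_inv_ne_zero hz h1
  have i1 := integrable_mul_cauchyKernel' hf hz
  have i2 := integrable_mul_cauchyKernel' hf hz'
  obtain ⟨i3, e3⟩ := integral_foldInv_mul hu hv hw
  rw [expLine_neg_eq hf i1, expLine_neg_eq hf i2, ← e3, cauchyInt, cauchyInt, ofReal_exp,
    ← exp_add, ← exp_add, ← exp_add, ← exp_add]
  congr 1
  have j1 : Integrable fun t : ℝ => (foldInv u v t : ℂ) * (1 / (t - z)) +
      (foldInv u v t : ℂ) * (1 / ((t : ℂ) - z⁻¹)) := i1.add i2
  have j2 : Integrable fun t : ℝ => (foldInv u v t : ℂ) * (1 / (t - z)) +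
      (foldInv u v t : ℂ) * (1 / ((t : ℂ) - z⁻¹)) - 2 * ((foldInv u v t : ℂ) * ((t : ℂ) / (1 + (t : ℂ) ^ 2))) :=
    j1.sub (hr.const_mul 2)
  have hpt : ∀ t : ℝ, (foldInv u v t : ℂ) * (1 / (t - z)) + (foldInv u v t : ℂ) * (1 / ((t : ℂ) - z⁻¹)) -
      2 * ((foldInv u v t : ℂ) * ((t : ℂ) / (1 + (t : ℂ) ^ 2))) -
      (foldInv u v t : ℂ) * ((1 - ((t : ℂ) ^ 2)⁻¹) / (((t + t⁻¹ : ℝ) : ℂ) - (z + z⁻¹))) =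
      ((foldInv u v t * (t⁻¹ - 2 * (t / (1 + t ^ 2))) : ℝ) : ℂ) := by
    intro t
    by_cases ht : t = 0
    · rw [foldInv_of_else (Or.inl ht)]; simp
    have ht' : (t : ℂ) ≠ 0 := ofReal_ne_zero.2 ht
    have n1 := ofReal_sub_ne_zero hz t
    have n2 := ofReal_sub_ne_zero hz' t
    have n3 := ofReal_sub_ne_zero hw (t + t⁻¹)
    have key : 1 / (t - z) + 1 / ((t : ℂ) - z⁻¹) -
        (1 - ((t : ℂ) ^ 2)⁻¹) / (((t + t⁻¹ : ℝ) : ℂ) - (z + z⁻¹)) = (t : ℂ)⁻¹ := by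
      have e : ((t + t⁻¹ : ℝ) : ℂ) - (z + z⁻¹) = (t - z) * ((t : ℂ) - z⁻¹) / t := by push_cast; field_simp; ring
      rw [e]
      have n2' : (t : ℂ) * z - 1 ≠ 0 := by intro h; apply n2; field_simp; rw [h, mul_zero]
      field_simp; ring
    rw [ofReal_mul, ofReal_sub, ofReal_inv, ← key]; push_cast; ring
  have e5 := integral_congr_ae (μ := (volume : Measure ℝ)) (.of_forall hpt)
  rw [integral_complex_ofReal, integral_sub j2 i3, integral_sub j1 (hr.const_mul 2), integral_add i1 i2, integral_const_mul] at e5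
  push_cast at e5 ⊢
  linear_combination (-(1 / (π : ℂ))) * e5

lemma exp_mul_I_sub_ne_zero (h1 : ‖z‖ ≠ 1) (θ : ℝ) : exp (θ * I) - z ≠ 0 := by
  intro h; rw [← sub_eq_zero.1 h, norm_exp_ofReal_mul_I] at h1; exact h1 rfl

lemma hasDerivAt_two_mul_cos (θ : ℝ) : HasDerivAt (fun θ : ℝ => 2 * Real.cos θ) (-(2 * Real.sin θ)) θ :=
  ((Real.hasDerivAt_cos θ).const_mul 2).congr_deriv (by ring)

lemma injOn_two_mul_cos : InjOn (fun θ : ℝ => 2 * Real.cos θ) (Ioo 0 π) := fun s hs t ht e =>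
  Real.injOn_cos (Ioo_subset_Icc_self hs) (Ioo_subset_Icc_self ht) (by simpa using e)

lemma two_mul_cos_mem {θ : ℝ} (h : θ ∈ Ioo 0 π) : 2 * Real.cos θ ∈ Ioo (-2:ℝ) 2 := by
  have h1 := Real.cos_lt_cos_of_nonneg_of_le_pi le_rfl h.2.le h.1
  have h2 := Real.cos_lt_cos_of_nonneg_of_le_pi h.1.le le_rfl h.2
  rw [Real.cos_zero] at h1; rw [Real.cos_pi] at h2; exact ⟨by linarith, by linarith⟩

lemma image_two_mul_cos : (fun θ : ℝ => 2 * Real.cos θ) '' Ioo 0 π = Ioo (-2) 2 := by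
  ext τ
  refine ⟨fun ⟨θ, h, e⟩ => e ▸ two_mul_cos_mem h, fun h => ⟨Real.arccos (τ / 2), ⟨?_, ?_⟩, ?_⟩⟩
  · rw [Real.arccos_pos]; linarith [h.2]
  · refine lt_of_le_of_ne (Real.arccos_le_pi _) fun e => ?_
    rw [Real.arccos_eq_pi] at e; linarith [h.1]
  · simp only; rw [Real.cos_arccos (by linarith [h.1]) (by linarith [h.2])]; ring

lemma continuous_circleKernel (h1 : ‖z‖ ≠ 1) :
    Continuous fun θ : ℝ => (exp (θ * I) + z) / (exp (θ * I) - z) :=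
  Continuous.div (by fun_prop) (by fun_prop) (exp_mul_I_sub_ne_zero h1)

lemma circleKernel_sub (h0 : z ≠ 0) (h1 : ‖z‖ ≠ 1) (θ : ℝ) : (exp (θ * I) + z) / (exp (θ * I) - z) -
      (exp ((-θ : ℝ) * I) + z) / (exp ((-θ : ℝ) * I) - z) =
      4 * I * (Real.sin θ : ℂ) * (1 / (((2 * Real.cos θ : ℝ) : ℂ) - (z + z⁻¹))) := by
  have e := exp_mul_I_sub_ne_zero h1 θ
  have e' := exp_mul_I_sub_ne_zero h1 (-θ)
  have hmul : exp (θ * I) * exp ((-θ : ℝ) * I) = 1 := by rw [← exp_add]; simp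
  have hadd : exp (θ * I) + exp ((-θ : ℝ) * I) = 2 * cos θ := by rw [cos]; push_cast; rw [neg_mul]; ring
  have hsub : exp (θ * I) - exp ((-θ : ℝ) * I) = 2 * I * sin θ := by
    rw [sin]; push_cast; rw [neg_mul]
    linear_combination (exp (θ * I) - exp (-(θ * I))) * I_sq
  push_cast at e' hmul hadd hsub ⊢
  set a := exp (θ * I)
  set b := exp (-θ * I)
  have hden : (2 * cos θ - (z + z⁻¹)) * z = -((a - z) * (b - z)) := by rw [← hadd]; field_simp; linear_combination hmul
  have hd0 : 2 * cos θ - (z + z⁻¹) ≠ 0 := fun h => by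
    rw [h, zero_mul] at hden; exact mul_ne_zero e e' (neg_eq_zero.1 hden.symm)
  rw [div_sub_div _ _ e e', ← mul_div_assoc, mul_one, div_eq_div_iff (mul_ne_zero e e') hd0]
  rw [show (a - z) * (b - z) = -((2 * cos θ - (z + z⁻¹)) * z) by rw [hden, neg_neg]]
  have : (a + z) * (b - z) - (a - z) * (b + z) = -2 * z * (a - b) := by ring
  rw [this, hsub]; ring

lemma expCircle_eq {u : ℝ → ℝ} (hu : IsCompactDensity u) (h0 : z ≠ 0) (h1 : ‖z‖ ≠ 1) :
    expCircle z (fun θ => -(if 0 < θ then -u (2 * Real.cos θ) else u (2 * Real.cos θ)) / 2) =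
      exp (-(1 / (2 * π)) * cauchyInt ((Ioo (-2) 2).indicator u) (z + z⁻¹)) := by
  set k : ℝ → ℂ := fun θ => (exp (θ * I) + z) / (exp (θ * I) - z) with hk
  have hkc : Continuous k := continuous_circleKernel h1
  have hpi := Real.pi_pos
  obtain ⟨B, hB⟩ := hu.bounded
  have hd : ∀ θ ∈ Ioo 0 π, HasDerivWithinAt (fun θ : ℝ => 2 * Real.cos θ) (-(2 * Real.sin θ)) (Ioo 0 π) θ :=
    fun θ _ => (hasDerivAt_two_mul_cos θ).hasDerivWithinAt
  have hm : AEStronglyMeasurable (fun θ => u (2 * Real.cos θ)) (volume.restrict (Ioo 0 π)) :=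
    aestronglyMeasurable_comp_of_deriv measurableSet_Ioo hd injOn_two_mul_cos
      (Real.measurable_sin.const_mul 2).neg (fun θ hθ => by
        have := Real.sin_pos_of_mem_Ioo hθ
        simp [this.ne']) hu.integrable
  have hI0 : IntervalIntegrable (fun θ => (u (2 * Real.cos θ) : ℂ)) volume 0 π := by
    rw [intervalIntegrable_iff_integrableOn_Ioo_of_le hpi.le]
    exact (Integrable.of_bound hm B (.of_forall fun θ => hB _)).ofReal
  have hI0' : IntervalIntegrable (fun θ => (u (2 * Real.cos θ) : ℂ)) volume (-π) 0 := by
    have := hI0.comp_sub_left 0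
    simp only [zero_sub, sub_zero, Real.cos_neg] at this; exact this.symm
  have hpos : ∫ θ in (0:ℝ)..Real.pi, k θ * ((-(if 0 < θ then -u (2 * Real.cos θ) else u (2 * Real.cos θ)) / 2 : ℝ) : ℂ) =
      ∫ θ in (0:ℝ)..Real.pi, k θ * ((u (2 * Real.cos θ) : ℂ) / 2) := by
    refine intervalIntegral.integral_congr_ae (.of_forall fun θ hθ => ?_)
    rw [uIoc_of_le hpi.le] at hθ; rw [if_pos hθ.1]; push_cast; ring
  have hneg : ∫ θ in (-π)..0, k θ * ((-(if 0 < θ then -u (2 * Real.cos θ) else u (2 * Real.cos θ)) / 2 : ℝ) : ℂ) =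
      ∫ θ in (0:ℝ)..Real.pi, -(k (-θ) * ((u (2 * Real.cos θ) : ℂ) / 2)) := by
    have := intervalIntegral.integral_comp_neg (a := 0) (b := π) (fun θ => -(k θ * ((u (2 * Real.cos θ) : ℂ) / 2)))
    simp only [neg_zero, Real.cos_neg] at this; rw [this]
    refine intervalIntegral.integral_congr_ae (.of_forall fun θ hθ => ?_)
    rw [uIoc_of_le (by linarith)] at hθ; rw [if_neg (not_lt.2 hθ.2)]; push_cast; ring
  have c1 : IntervalIntegrable (fun θ => k θ * ((u (2 * Real.cos θ) : ℂ) / 2)) volume 0 π :=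
    (hI0.div_const 2).continuousOn_mul hkc.continuousOn
  have c2 : IntervalIntegrable (fun θ => -(k (-θ) * ((u (2 * Real.cos θ) : ℂ) / 2))) volume 0 π :=
    ((hI0.div_const 2).continuousOn_mul (hkc.comp continuous_neg).continuousOn).neg
  have d1 : IntervalIntegrable (fun θ => k θ * ((-(if 0 < θ then -u (2 * Real.cos θ) else u (2 * Real.cos θ)) / 2 : ℝ) : ℂ)) volume 0 π := by
    refine c1.congr_ae ?_
    rw [uIoc_of_le hpi.le]
    filter_upwards [ae_restrict_mem measurableSet_Ioc] with θ hθ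
    rw [if_pos hθ.1]; push_cast; ring
  have d2 : IntervalIntegrable (fun θ => k θ * ((-(if 0 < θ then -u (2 * Real.cos θ) else u (2 * Real.cos θ)) / 2 : ℝ) : ℂ)) volume (-π) 0 := by
    refine (((hI0'.div_const 2).continuousOn_mul hkc.continuousOn).neg).congr_ae ?_
    rw [uIoc_of_le (by linarith)]
    filter_upwards [ae_restrict_mem measurableSet_Ioc] with θ hθ
    rw [if_neg (not_lt.2 hθ.2)]; push_cast; simp; ring
  have hchange := integral_image_eq_integral_abs_deriv_smul measurableSet_Ioo hd injOn_two_mul_cos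
    (fun τ : ℝ => (u τ : ℂ) * (1 / ((τ : ℂ) - (z + z⁻¹))))
  rw [image_two_mul_cos] at hchange
  have hCI : cauchyInt ((Ioo (-2) 2).indicator u) (z + z⁻¹) =
      ∫ τ in Ioo (-2:ℝ) 2, (u τ : ℂ) * (1 / ((τ : ℂ) - (z + z⁻¹))) := by
    rw [cauchyInt, ← integral_indicator measurableSet_Ioo]
    congr 1; ext τ
    by_cases h : τ ∈ Ioo (-2:ℝ) 2
    · rw [indicator_of_mem h, indicator_of_mem h]
    · rw [indicator_of_notMem h, indicator_of_notMem h]; simp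
  rw [expCircle, ← intervalIntegral.integral_add_adjacent_intervals d2 d1, hpos, hneg,
    ← intervalIntegral.integral_add c2 c1, hCI, hchange, intervalIntegral.integral_of_le hpi.le,
    integral_Ioc_eq_integral_Ioo]
  have : ∫ θ in Ioo 0 π, (-(k (-θ) * ((u (2 * Real.cos θ) : ℂ) / 2)) + k θ * ((u (2 * Real.cos θ) : ℂ) / 2)) =
      ∫ θ in Ioo 0 π, I * (|-(2 * Real.sin θ)| • ((u (2 * Real.cos θ) : ℂ) * (1 / (((2 * Real.cos θ : ℝ) : ℂ) - (z + z⁻¹))))) := by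
    refine setIntegral_congr_fun measurableSet_Ioo fun θ hθ => ?_
    have hs := Real.sin_pos_of_mem_Ioo hθ
    have := circleKernel_sub h0 h1 θ
    simp only [hk]; rw [abs_neg, abs_of_pos (by linarith), real_smul]
    rw [show ((2 * Real.sin θ : ℝ) : ℂ) = 2 * (Real.sin θ : ℂ) by push_cast; rfl]
    linear_combination ((u (2 * Real.cos θ) : ℂ) / 2) * this
  rw [this, integral_const_mul]
  congr 1
  have hpiC : (π : ℂ) ≠ 0 := ofReal_ne_zero.2 hpi.ne'
  have hX : ∀ X : ℂ, -(1 / (2 * (π : ℂ) * I)) * (I * X) = -(1 / (2 * π)) * X := fun X => by field_simp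
  exact hX _

instance isCountablyGenerated_cobounded : (Bornology.cobounded ℂ).IsCountablyGenerated := by
  rw [← comap_norm_atTop]; infer_instance

/-- `exp (-(1/2π) ∫ e^{iθ} / (e^{iθ} - z) L(θ) dθ)`. -/
def expCircleLog (L : ℝ → ℝ) (z : ℂ) : ℂ :=
  exp (-(1 / (2 * (π : ℂ))) * ∫ θ in (-π)..Real.pi, exp (θ * I) / (exp (θ * I) - z) * (L θ : ℂ))

lemma continuous_circleKernel' (h1 : ‖z‖ ≠ 1) :
    Continuous fun θ : ℝ => exp (θ * I) / (exp (θ * I) - z) :=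
  Continuous.div (by fun_prop) (by fun_prop) (exp_mul_I_sub_ne_zero h1)

lemma expCircleLog_mul_inv {L : ℝ → ℝ} (hL : IntervalIntegrable L volume (-π) π)
    (heven : ∀ θ, L (-θ) = L θ) (h0 : z ≠ 0) (h1 : ‖z‖ ≠ 1) :
    expCircleLog L z * expCircleLog L z⁻¹ = (Real.exp (-(1 / (2 * π)) * ∫ θ in (-π)..Real.pi, L θ) : ℂ) := by
  have hLc : IntervalIntegrable (fun θ => (L θ : ℂ)) volume (-π) π := ⟨hL.1.ofReal, hL.2.ofReal⟩
  have h1' : ‖z⁻¹‖ ≠ 1 := JacobiMatrix.norm_ne_one_inv h1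
  have e := intervalIntegral.integral_comp_neg (a := -π) (b := π)
    (fun θ : ℝ => exp (θ * I) / (exp (θ * I) - z⁻¹) * (L θ : ℂ))
  rw [neg_neg] at e; simp only [heven] at e
  have i2 : IntervalIntegrable (fun θ : ℝ => exp ((-θ : ℝ) * I) /
      (exp ((-θ : ℝ) * I) - z⁻¹) * (L θ : ℂ)) volume (-π) π :=
    hLc.continuousOn_mul ((continuous_circleKernel' h1').comp continuous_neg).continuousOn
  rw [expCircleLog, expCircleLog, ← e, ← exp_add, ← mul_add, ← intervalIntegral.integral_add
    (hLc.continuousOn_mul (continuous_circleKernel' h1).continuousOn) i2]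
  have hpt : ∀ θ : ℝ, exp (θ * I) / (exp (θ * I) - z) * (L θ : ℂ) +
      exp ((-θ : ℝ) * I) / (exp ((-θ : ℝ) * I) - z⁻¹) * (L θ : ℂ) = (L θ : ℂ) := by
    intro θ
    have n1 := exp_mul_I_sub_ne_zero h1 θ
    have n2 := exp_mul_I_sub_ne_zero h1' (-θ)
    have hinv : exp ((-θ : ℝ) * I) = (exp (θ * I))⁻¹ := by rw [← exp_neg]; congr 1; push_cast; ring
    have ne := exp_ne_zero (θ * I)
    rw [hinv] at n2 ⊢
    set a := exp (θ * I)
    have : a⁻¹ / (a⁻¹ - z⁻¹) = -z / (a - z) := by rw [div_eq_div_iff n2 n1]; field_simp; ring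
    rw [this, ← add_mul, ← add_div, ← sub_eq_add_neg, div_self n1, one_mul]
  simp only [hpt]; rw [intervalIntegral.integral_ofReal, ofReal_exp]; push_cast; rfl

lemma tendsto_expCircleLog_cobounded (L : ℝ → ℝ) (hL : IntervalIntegrable L volume (-π) π) :
    Tendsto (expCircleLog L) (Bornology.cobounded ℂ) (𝓝 1) := by
  have hLc : IntervalIntegrable (fun θ => (L θ : ℂ)) volume (-π) π := ⟨hL.1.ofReal, hL.2.ofReal⟩
  have h : Tendsto (fun z : ℂ => ∫ θ in (-π)..Real.pi,
      exp (θ * I) / (exp (θ * I) - z) * (L θ : ℂ)) (Bornology.cobounded ℂ)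
      (𝓝 (∫ θ in (-π)..Real.pi, (0:ℂ))) := by
    have hev : ∀ᶠ z : ℂ in Bornology.cobounded ℂ, 2 ≤ ‖z‖ := tendsto_norm_cobounded_atTop.eventually_ge_atTop _
    refine intervalIntegral.tendsto_integral_filter_of_dominated_convergence (fun θ => ‖(L θ : ℂ)‖) ?_ ?_ hLc.norm ?_
    · refine hev.mono fun z hz => ?_
      rw [uIoc_of_le (by linarith [Real.pi_pos])]
      exact (hLc.continuousOn_mul (continuous_circleKernel' (z := z) (by intro h; linarith)).continuousOn).1.1
    · refine hev.mono fun z hz => .of_forall fun θ _ => ?_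
      rw [norm_mul, norm_div, norm_exp_ofReal_mul_I]
      have h2 : 1 ≤ ‖exp (θ * I) - z‖ := by
        have := norm_sub_norm_le z (exp (θ * I))
        rw [norm_exp_ofReal_mul_I, norm_sub_rev] at this; linarith
      exact mul_le_of_le_one_left (norm_nonneg _) (by rw [one_div]; exact inv_le_one_of_one_le₀ h2)
    · refine .of_forall fun θ _ => ?_
      rw [← zero_mul (L θ : ℂ), ← mul_zero (exp (θ * I))]; simp only [div_eq_mul_inv]
      refine (tendsto_const_nhds.mul (tendsto_inv₀_cobounded.comp ?_)).mul_const _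
      exact tendsto_const_sub_cobounded _
  have h2 := (h.const_mul (-(1 / (2 * (π : ℂ))))).cexp
  rw [intervalIntegral.integral_zero, mul_zero, exp_zero] at h2; exact h2

lemma tendsto_cauchyInt_cobounded {u : ℝ → ℝ} (hu : IsCompactDensity u) :
    Tendsto (cauchyInt u) (Bornology.cobounded ℂ) (𝓝 0) ∧
    ∀ᶠ z in Bornology.cobounded ℂ, Integrable fun t : ℝ => u t * (1 / ((t : ℂ) - z)) := by
  obtain ⟨K, hK⟩ := hu.support
  have hev : ∀ᶠ z : ℂ in Bornology.cobounded ℂ, |K| + 1 ≤ ‖z‖ := tendsto_norm_cobounded_atTop.eventually_ge_atTop _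
  have hm : ∀ z : ℂ, AEStronglyMeasurable fun t : ℝ => u t * (1 / (t - z)) := fun z =>
    hu.integrable.ofReal.1.mul (by fun_prop : Measurable fun t : ℝ => 1 / (t - z)).aestronglyMeasurable
  have hb : ∀ z : ℂ, |K| + 1 ≤ ‖z‖ → ∀ t : ℝ, ‖u t * (1 / (t - z))‖ ≤ ‖u t‖ := by
    intro z hz t
    by_cases ht : K < |t|
    · rw [hK t ht]; simp
    · have h1 := norm_sub_norm_le z (t : ℂ)
      rw [norm_ofReal, norm_sub_rev] at h1
      have h2 : 1 ≤ ‖(t : ℂ) - z‖ := by linarith [le_abs_self K, not_lt.1 ht]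
      rw [norm_mul, norm_real, norm_div, norm_one, one_div]
      exact mul_le_of_le_one_right (norm_nonneg _) (inv_le_one_of_one_le₀ h2)
  refine ⟨?_, hev.mono fun z hz => hu.integrable.norm.mono' (hm z) (.of_forall (hb z hz))⟩
  rw [← integral_zero ℝ ℂ]
  refine tendsto_integral_filter_of_dominated_convergence (fun t => ‖u t‖) (.of_forall hm)
    (hev.mono fun z hz => .of_forall (hb z hz)) hu.integrable.norm (.of_forall fun t => ?_)
  rw [← mul_zero (u t : ℂ)]; simp only [one_div]
  exact (tendsto_inv₀_cobounded.comp (tendsto_const_sub_cobounded _)).const_mul _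

lemma tendsto_add_inv_cobounded : Tendsto (fun z : ℂ => z + z⁻¹) (Bornology.cobounded ℂ) (Bornology.cobounded ℂ) := by
  rw [← tendsto_norm_atTop_iff_cobounded]
  refine tendsto_atTop_mono' _ (f₁ := fun z : ℂ => ‖z‖ - 1) ?_ (tendsto_atTop_add_const_right _ _ tendsto_norm_cobounded_atTop)
  filter_upwards [(tendsto_norm_cobounded_atTop (E := ℂ)).eventually_ge_atTop 1] with z hz
  have h1 := norm_sub_norm_le z (-z⁻¹)
  rw [norm_neg, sub_neg_eq_add, norm_inv] at h1; linarith [inv_le_one_of_one_le₀ hz]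

namespace JacobiMatrix
lemma CondA.hasDerivAt_rhoR (hA : J.CondA) (hE : J.CondE) (hx : x ∈ Ioo (-2) 2) :
    HasDerivAt (fun t => J.rhoR.real (Iic t)) (1 / π * (J.bdR x).im) x := by
  have := J.isFiniteMeasure_rhoR
  exact hasDerivAt_distribution J.rhoR (fun y hy => ⟨_, (hE.boundary_FR hA hy).1⟩) hx

lemma CondE.hasDerivAt_rhoL (hE : J.CondE) (hx : x ∈ Ioo (-2) 2) :
    HasDerivAt (fun t => J.rhoL.real (Iic t)) (1 / π * (J.bdL x).im) x := by
  have := J.isFiniteMeasure_rhoL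
  have hlim : ∀ y ∈ Ioo (-2:ℝ) 2, Tendsto (stieltjes J.rhoL) (𝓝[upperHalf] (y : ℂ))
      (𝓝 (J.bdL y - (((1 / J.b (-1) : ℝ) : ℂ) * y + J.leftData.1))) := by
    intro y hy
    have h2 : Tendsto (fun w : ℂ => ((1 / J.b (-1) : ℝ) : ℂ) * w + J.leftData.1) (𝓝[upperHalf] (y : ℂ))
        (𝓝 (((1 / J.b (-1) : ℝ) : ℂ) * y + J.leftData.1)) :=
      ((continuous_const.mul continuous_id).add continuous_const).continuousAt.tendsto.mono_left nhdsWithin_le_nhds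
    refine ((hE.boundary_FL hy).1.sub h2).congr fun w => ?_
    rw [FL]; push_cast; ring
  have h := hasDerivAt_distribution J.rhoL (fun y hy => ⟨_, hlim y hy⟩) hx
  rw [extendFrom_eq (ofReal_mem_closure_upperHalf x) (hlim x hx)] at h
  refine h.congr_deriv ?_
  congr 1; rw [← ofReal_mul, ← ofReal_add, sub_im, ofReal_im, sub_zero]

lemma rhoR'_eq (hA : J.CondA) (hE : J.CondE) (hx : x ∈ Ioo (-2) 2) :
    J.rhoR' x = 1 / π * (J.bdR x).im := (hA.hasDerivAt_rhoR hE hx).deriv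

lemma rhoL'_eq (hE : J.CondE) (hx : x ∈ Ioo (-2) 2) : J.rhoL' x = 1 / π * (J.bdL x).im := (hE.hasDerivAt_rhoL hx).deriv

lemma im_bd_pos (hA : J.CondA) (hB : J.CondB) (hE : J.CondE) (hx : x ∈ Ioo (-2) 2) :
    0 < (J.bdR x).im ∧ 0 < (J.bdL x).im := by
  obtain ⟨s, hs, h⟩ := hE.exists_sector hA hB
  exact ⟨(mul_pos hs (norm_pos_iff.2 (hE.boundary_FR hA hx).2.1)).trans_le (h x hx).1,
    (mul_pos hs (norm_pos_iff.2 (hE.boundary_FL hx).2.1)).trans_le (h x hx).2⟩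

lemma mu_eq (hA : J.CondA) (hE : J.CondE) (hx : x ∈ Ioo (-2) 2) : J.mu x = √((J.bdR x).im / (J.bdL x).im) := by
  rw [mu, rhoR'_eq hA hE hx, rhoL'_eq hE hx, mul_div_mul_left _ _ (by positivity)]

lemma exists_log_mu_bound (hA : J.CondA) (hB : J.CondB) (hC : J.CondC) (hE : J.CondE) :
    ∃ B : ℝ, ∀ x ∈ Ioo (-2:ℝ) 2, |Real.log (J.mu x)| ≤ B := by
  obtain ⟨s, hs, h⟩ := hE.exists_sector hA hB
  obtain ⟨κ, hκ, h'⟩ := hC.exists_ratio_bound hA hE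
  refine ⟨|Real.log (κ / s)| / 2, fun x hx => ?_⟩
  obtain ⟨hR, hL⟩ := im_bd_pos hA hB hE hx
  have key : ∀ a b : ℂ, 0 < a.im → 0 < b.im → s * ‖b‖ ≤ b.im → ‖a‖ ≤ κ * ‖b‖ → a.im / b.im ≤ κ / s := by
    intro a b ha hb h1 h2; rw [div_le_div_iff₀ hb hs]
    have h3 := abs_im_le_norm a
    rw [abs_of_pos ha] at h3; nlinarith
  have k1 := key _ _ hR hL (h x hx).2 (h' x hx).1
  have k2 := key _ _ hL hR (h x hx).1 (h' x hx).2
  rw [mu_eq hA hE hx, Real.log_sqrt (div_pos hR hL).le, abs_div, abs_two]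
  refine div_le_div_of_nonneg_right ?_ (by norm_num)
  refine (abs_le.2 ⟨?_, Real.log_le_log (div_pos hR hL) k1⟩).trans (le_abs_self _)
  have := Real.log_le_log (div_pos hL hR) k2
  rw [← inv_div, Real.log_inv] at this; linarith

lemma intervalIntegrable_log_mu (hA : J.CondA) (hB : J.CondB) (hC : J.CondC) (hE : J.CondE) :
    IntervalIntegrable (fun θ => Real.log (J.mu (2 * Real.cos θ))) volume (-π) π := by
  obtain ⟨B, hB'⟩ := exists_log_mu_bound hA hB hC hE
  have hm : Measurable fun θ => Real.log (J.mu (2 * Real.cos θ)) :=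
    Real.measurable_log.comp ((((measurable_deriv _).div (measurable_deriv _)).sqrt).comp (by fun_prop))
  rw [intervalIntegrable_iff_integrableOn_Ioo_of_le (by linarith [Real.pi_pos])]
  refine Integrable.of_bound hm.aestronglyMeasurable B ?_
  filter_upwards [ae_restrict_mem measurableSet_Ioo, ae_restrict_of_ae (ae_ne_of_real 0)] with θ hθ h0
  rw [Real.norm_eq_abs]
  refine hB' _ ?_
  rcases lt_or_gt_of_ne h0 with h | h
  · rw [← Real.cos_neg]; exact two_mul_cos_mem ⟨by linarith, by linarith [hθ.1]⟩
  · exact two_mul_cos_mem ⟨h, hθ.2⟩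

lemma isClosed_specR : IsClosed J.specR := Measure.isClosed_support
lemma isClosed_specL : IsClosed J.specL := Measure.isClosed_support

lemma aestronglyMeasurable_eta (hA : J.CondA) : AEStronglyMeasurable J.eta := by
  obtain ⟨-, -, hint, -⟩ := hA.M_rep 0
  have h2 : Measurable fun t : ℝ => if t < 0 then π else 0 :=
    Measurable.ite measurableSet_Iio measurable_const measurable_const
  refine (hint.1.add h2.aestronglyMeasurable).congr (.of_forall fun t => ?_)
  simp

lemma measurableSet_negSet (hA : J.CondA) (hE : J.CondE) : MeasurableSet J.negSet := by
  have := hA.countable_gaps.to_subtype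
  have : J.negSet = ⋃ I : J.gaps, {τ | (BddBelow (I : Set ℝ) → J.gapLo I < τ) ∧ τ < J.gapHi I} := by
    ext τ; rw [mem_iUnion]; simp only [mem_ofPred_eq, ← image_gap_Iio hA hE (Subtype.coe_prop _)]
    constructor
    · rintro ⟨t, ⟨I, hI, h1, h2⟩, e⟩; exact ⟨⟨I, hI⟩, t, h1, h2, e⟩
    · rintro ⟨I, t, h1, h2, e⟩; exact ⟨t, ⟨I, I.2, h1, h2⟩, e⟩
  rw [this]
  refine MeasurableSet.iUnion fun I => MeasurableSet.inter ?_ measurableSet_Iio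
  by_cases hb : BddBelow (I : Set ℝ)
  · simp only [hb, true_imp_iff]; exact measurableSet_Ioi
  · simp only [hb, false_imp_iff]; exact MeasurableSet.univ

lemma isCompactDensity_indicator {S : Set ℝ} (hm : AEStronglyMeasurable f) (hS : MeasurableSet S)
    {B K : ℝ} (hB : ∀ t, |f t| ≤ B) (hK : S ⊆ Icc (-K) K) : IsCompactDensity (S.indicator f) := by
  have h1 : ∀ t, |S.indicator f t| ≤ B := fun t => by
    by_cases h : t ∈ S
    · rw [indicator_of_mem h]; exact hB t
    · rw [indicator_of_notMem h, abs_zero]; exact (abs_nonneg _).trans (hB t)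
  have h2 : ∀ t, K < |t| → S.indicator f t = 0 := fun t ht => indicator_of_notMem (fun h => by
    have := abs_le.2 (hK h); linarith) _
  exact ⟨integrable_of_bounded_support (hm.indicator hS) h1 h2, ⟨B, h1⟩, ⟨K, h2⟩⟩

open Classical in
/-- The density of the exponent of `R₂`. -/
def density2 (J : JacobiMatrix) (τ : ℝ) : ℝ := 1 / 2 * (J.eta τ - if τ ∈ J.negSet then π else 0)

lemma isCompactDensity_spec1 (hA : J.CondA) : IsCompactDensity ((J.specL \ J.specR).indicator J.eta) ∧
    IsCompactDensity ((J.specR \ J.specL).indicator J.eta) := by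
  obtain ⟨B, hB⟩ := exists_bound_boundaryArg
  obtain ⟨K, hK⟩ := hA.isPick_M.bounded
  have hm := aestronglyMeasurable_eta hA
  exact ⟨isCompactDensity_indicator hm (isClosed_specL.measurableSet.diff isClosed_specR.measurableSet) (hB _)
      fun x hx => hK (Or.inr hx.1),
    isCompactDensity_indicator hm (isClosed_specR.measurableSet.diff isClosed_specL.measurableSet) (hB _)
      fun x hx => hK (Or.inl hx.1)⟩

lemma isCompactDensity_spec2a (hA : J.CondA) (hE : J.CondE) :
    IsCompactDensity (J.spec2a.indicator J.density2) := by
  classical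
  obtain ⟨B, hB⟩ := exists_bound_boundaryArg
  obtain ⟨K, hK⟩ := hA.isPick_M.bounded
  refine isCompactDensity_indicator (B := 1 / 2 * (B + π)) ?_ hA.isClosed_spec2a.measurableSet (fun t => ?_)
    fun x hx => hK (Or.inl hx.1.1)
  · have h2 : Measurable fun t : ℝ => if t ∈ J.negSet then π else 0 :=
      Measurable.ite (measurableSet_negSet hA hE) measurable_const measurable_const
    exact ((aestronglyMeasurable_eta hA).sub h2.aestronglyMeasurable).const_mul _
  · rw [density2, abs_mul, abs_of_pos (by norm_num : (0:ℝ) < 1 / 2)]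
    refine mul_le_mul_of_nonneg_left ((abs_sub _ _).trans (add_le_add (hB _ _) ?_)) (by norm_num)
    split_ifs
    · rw [abs_of_pos Real.pi_pos]
    · rw [abs_zero]; exact Real.pi_pos.le

lemma isCompactDensity_circle (hA : J.CondA) :
    IsCompactDensity ((Ioo (-2) 2).indicator fun τ => J.eta τ - π / 2) := by
  obtain ⟨B, hB⟩ := exists_bound_boundaryArg
  refine isCompactDensity_indicator (B := B + |π / 2|) (K := 2)
    ((aestronglyMeasurable_eta hA).sub aestronglyMeasurable_const) measurableSet_Ioo
    (fun t => (abs_sub _ _).trans (add_le_add (hB _ _) le_rfl)) Ioo_subset_Icc_self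

lemma gamma1_eq : J.gamma1 = foldInv ((J.specL \ J.specR).indicator J.eta) ((J.specR \ J.specL).indicator J.eta) := by
  ext t; rw [gamma1]
  rcases lt_trichotomy |t| 1 with h | h | h
  · by_cases h0 : t = 0
    · rw [foldInv_of_else (Or.inl h0), indicator_of_notMem (notMem_Omega1 (Or.inl h0))]
    · rw [foldInv_of_inside ⟨h0, h⟩]
      by_cases hm : t ∈ J.Omega1
      · rw [indicator_of_mem hm, indicator_of_mem ((mem_Omega1_of_lt_one h0 h).1 hm), sideSign, if_neg h.not_gt]; ring
      · rw [indicator_of_notMem hm, indicator_of_notMem (fun h' => hm ((mem_Omega1_of_lt_one h0 h).2 h')), neg_zero]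
  · rw [foldInv_of_else (Or.inr h), indicator_of_notMem (notMem_Omega1 (Or.inr h))]
  · rw [foldInv_of_outside h]
    by_cases hm : t ∈ J.Omega1
    · rw [indicator_of_mem hm, indicator_of_mem ((mem_Omega1_of_one_lt h).1 hm), sideSign, if_pos h]; ring
    · rw [indicator_of_notMem hm, indicator_of_notMem (fun h' => hm ((mem_Omega1_of_one_lt h).2 h'))]

lemma one_lt_abs_of_mem_Delta1 (ht : t ∈ J.Delta1) : 1 < |t| := by
  obtain ⟨I, hI, h, -⟩ := ht
  exact (mem_Delta_iff.1 (gap_subset hI h)).1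

lemma gamma2_eq : J.gamma2 = foldInv (J.spec2a.indicator J.density2) (J.spec2a.indicator J.density2) := by
  classical
  ext t
  have hval : t ≠ 0 → |t| ≠ 1 → ∀ c : ℝ, (if t ∈ J.Delta1 ∪ invSet J.Delta1 then c else 0) =
      if t + t⁻¹ ∈ J.negSet then c else 0 := by
    intro h0 h1 c
    congr 1; rw [eq_iff_iff]
    rcases lt_or_gt_of_ne h1 with h | h
    · have h' := one_lt_abs_inv h0 h
      have e : t + t⁻¹ = t⁻¹ + t⁻¹⁻¹ := by rw [inv_inv, add_comm]
      rw [e, mem_negSet_iff h']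
      exact ⟨fun hm => hm.elim (fun hm => by linarith [one_lt_abs_of_mem_Delta1 hm]) fun hm => hm.2,
        fun hm => Or.inr ⟨h0, hm⟩⟩
    · rw [mem_negSet_iff h]
      exact ⟨fun hm => hm.elim id fun hm => by linarith [one_lt_abs_of_mem_Delta1 hm.2, abs_inv_lt_one h], Or.inl⟩
  rw [gamma2]
  by_cases h0 : t = 0
  · rw [foldInv_of_else (Or.inl h0), indicator_of_notMem fun h => h.1 h0]
  rcases lt_trichotomy |t| 1 with h | h | h
  · rw [foldInv_of_inside ⟨h0, h⟩]
    by_cases hm : t ∈ J.Omega2a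
    · rw [indicator_of_mem hm, indicator_of_mem ((mem_Omega2a_iff h0 h.ne).1 hm), sideSign, if_neg h.not_gt,
        hval h0 h.ne, density2]; ring
    · rw [indicator_of_notMem hm, indicator_of_notMem (fun h' => hm ((mem_Omega2a_iff h0 h.ne).2 h')), neg_zero]
  · rw [foldInv_of_else (Or.inr h), indicator_of_notMem]; intro hm
    rcases eq_or_eq_neg_of_abs_eq h with h' | h'
    · exact hm.2.1 h'
    · exact hm.2.2.1 h'
  · rw [foldInv_of_outside h]
    by_cases hm : t ∈ J.Omega2a
    · rw [indicator_of_mem hm, indicator_of_mem ((mem_Omega2a_iff h0 h.ne').1 hm), sideSign, if_pos h,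
        hval h0 h.ne', density2]; ring
    · rw [indicator_of_notMem hm, indicator_of_notMem (fun h' => hm ((mem_Omega2a_iff h0 h.ne').2 h'))]

/-- The factor `R₁`. -/
def R1 (J : JacobiMatrix) (z : ℂ) : ℂ := expLine z fun t => -J.gamma1 t
/-- The factor `R₂`. -/
def R2 (J : JacobiMatrix) (z : ℂ) : ℂ := expLine z fun t => -J.gamma2 t
/-- The factor `R₃`. -/
def R3 (J : JacobiMatrix) (z : ℂ) : ℂ := expCircle z fun θ => -J.gamma3 θ / 2

/-- The Cauchy integral in the exponent of `R₃`. -/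
def circleExponent (J : JacobiMatrix) : ℂ → ℂ := cauchyInt ((Ioo (-2) 2).indicator fun τ => J.eta τ - π / 2)

lemma R_eq (C : ℝ) (z : ℂ) : J.R C z = C * J.R0 z * J.R1 z * J.R2 z * J.R3 z * J.Rmu z := rfl

lemma R3_eq (hA : J.CondA) (h0 : z ≠ 0) (h1 : ‖z‖ ≠ 1) :
    J.R3 z = exp (-(1 / (2 * π)) * J.circleExponent (z + z⁻¹)) := by
  obtain ⟨B, hB⟩ := exists_bound_boundaryArg
  have hu : IsCompactDensity ((Icc (-2) 2).indicator fun τ => J.eta τ - π / 2) :=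
    isCompactDensity_indicator (B := B + |π / 2|) (K := 2)
      ((aestronglyMeasurable_eta hA).sub aestronglyMeasurable_const) measurableSet_Icc
      (fun t => (abs_sub _ _).trans (add_le_add (hB _ _) le_rfl)) le_rfl
  have h := expCircle_eq hu h0 h1
  rw [indicator_indicator, inter_eq_left.2 Ioo_subset_Icc_self] at h; rw [circleExponent, ← h, R3]
  congr 1
  ext θ
  have hmem : 2 * Real.cos θ ∈ Icc (-2:ℝ) 2 := ⟨by linarith [Real.neg_one_le_cos θ], by linarith [Real.cos_le_one θ]⟩
  rw [gamma3, indicator_of_mem hmem]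
  split_ifs <;> ring

lemma Rmu_eq (z : ℂ) : J.Rmu z = expCircleLog (fun θ => Real.log (J.mu (2 * Real.cos θ))) z := rfl

end JacobiMatrix

lemma cauchyInt_congr_ae {f g : ℝ → ℝ} (h : f =ᵐ[volume] g) (w : ℂ) : cauchyInt f w = cauchyInt g w :=
  integral_congr_ae (h.mono fun t ht => by simp only [ht])

lemma cauchyInt_add {f g : ℝ → ℝ} (hf : Integrable f) (hg : Integrable g) (hw : w.im ≠ 0) :
    cauchyInt (fun t => f t + g t) w = cauchyInt f w + cauchyInt g w := by
  rw [cauchyInt, cauchyInt, cauchyInt, ← integral_add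
    (integrable_mul_cauchyKernel' hf hw) (integrable_mul_cauchyKernel' hg hw)]
  congr 1; ext t; push_cast; ring

lemma cauchyInt_const_mul (c : ℝ) (f : ℝ → ℝ) (w : ℂ) :
    cauchyInt (fun t => c * f t) w = c * cauchyInt f w := by
  rw [cauchyInt, cauchyInt, ← integral_const_mul]
  congr 1; ext t; push_cast; ring

lemma abs_im_cauchyInt_le {u : ℝ → ℝ} {B : ℝ} (hu : Integrable u) (hB : ∀ᵐ t, |u t| ≤ B)
    (hw : w.im ≠ 0) : |(cauchyInt u w).im| ≤ B * π := by
  have hint := integrable_mul_cauchyKernel' hu hw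
  have hy := abs_pos.2 hw
  obtain ⟨pi, pv⟩ := integral_poisson_univ w.re hy
  have hk : ∀ t : ℝ, |(u t * (1 / (t - w))).im| = |u t| * (|w.im| / ((t - w.re) ^ 2 + |w.im| ^ 2)) := by
    intro t
    rw [im_ofReal_mul, one_div, inv_im, abs_mul, abs_div, abs_of_nonneg (normSq_nonneg _), normSq_apply, sq_abs]
    simp [sq]
  have him : (cauchyInt u w).im = ∫ t, (u t * (1 / (t - w))).im := (imCLM.integral_comp_comm hint).symm
  rw [him]
  refine (abs_integral_le_integral_abs).trans ?_
  rw [← pv, ← integral_const_mul]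
  refine integral_mono_ae hint.im.abs (pi.const_mul B) (hB.mono fun t ht => ?_)
  simp only
  have := hk t
  refine this.le.trans ?_
  gcongr

lemma add_inv_sub_ne_zero (hw : (z + z⁻¹).im ≠ 0) : z + 1 ≠ 0 := fun h => by
  rw [eq_neg_of_add_eq_zero_left h] at hw; simp at hw

lemma exp_half_cauchyInt (hz : z.im ≠ 0) (h1 : 1 < ‖z‖) :
    exp (1 / 2 * cauchyInt ((Ioo (-2) 2).indicator 1) (z + z⁻¹)) = (z - 1) / (z + 1) := by
  have h0 := ne_zero_of_im hz
  have hw := im_add_inv_ne_zero hz h1.ne'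
  have hp := add_inv_sub_ne_zero hw
  set w := z + z⁻¹ with hwdef
  have hCI : cauchyInt ((Ioo (-2) 2).indicator 1) w = ∫ τ in (-2:ℝ)..2, 1 / (τ - w) := by
    rw [intervalIntegral.integral_of_le (by norm_num), integral_Ioc_eq_integral_Ioo,
      ← integral_indicator measurableSet_Ioo, cauchyInt]
    congr 1; ext τ
    by_cases h : τ ∈ Ioo (-2:ℝ) 2
    · rw [indicator_of_mem h, indicator_of_mem h]; simp
    · rw [indicator_of_notMem h, indicator_of_notMem h]; simp
  have hsq : exp (1 / 2 * cauchyInt ((Ioo (-2) 2).indicator 1) w) ^ 2 = ((z - 1) / (z + 1)) ^ 2 := by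
    rw [← exp_nat_mul]
    have e := exp_neg_integral_cauchyKernel hw (-2) 2
    rw [exp_neg, inv_eq_iff_eq_inv, inv_div] at e
    rw [hCI, show ((2 : ℕ) : ℂ) * (1 / 2 * ∫ τ in (-2:ℝ)..2, 1 / (τ - w)) = ∫ τ in (-2:ℝ)..2, 1 / (τ - w) by
      push_cast; ring, e, div_pow, div_eq_div_iff (ofReal_sub_ne_zero hw _) (pow_ne_zero 2 hp), hwdef]
    push_cast; field_simp; ring
  have hre : 0 ≤ (exp (1 / 2 * cauchyInt ((Ioo (-2) 2).indicator 1) w)).re := by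
    have h := abs_le.1 (abs_im_cauchyInt_le (u := (Ioo (-2) 2).indicator 1) (B := 1)
      ((integrable_indicator_iff measurableSet_Ioo).2 (integrableOn_const (by simp)))
      (.of_forall fun t => by
        by_cases ht : t ∈ Ioo (-2:ℝ) 2
        · rw [indicator_of_mem ht]; simp
        · rw [indicator_of_notMem ht]; simp) hw)
    rw [exp_re]
    refine mul_nonneg (Real.exp_pos _).le (Real.cos_nonneg_of_mem_Icc ?_)
    have : (1 / 2 * cauchyInt ((Ioo (-2) 2).indicator 1) w).im =
        1 / 2 * (cauchyInt ((Ioo (-2) 2).indicator 1) w).im := by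
      rw [mul_im]; norm_num
    rw [this]; exact ⟨by linarith [h.1], by linarith [h.2]⟩
  have hre' : 0 < ((z - 1) / (z + 1)).re := by
    have hn : 0 < normSq (z + 1) := normSq_pos.2 hp
    rw [div_re, ← add_div]
    refine div_pos ?_ hn
    have : 1 < normSq z := by rw [normSq_eq_norm_sq]; nlinarith
    rw [normSq_apply] at this; simp; nlinarith
  rcases sq_eq_sq_iff_eq_or_eq_neg.1 hsq with h | h
  · exact h
  · rw [h, neg_re] at hre; linarith

namespace JacobiMatrix
lemma exists_R_mul_inv (hA : J.CondA) (hB : J.CondB) (hC : J.CondC) (hD : J.CondD) (hE : J.CondE) :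
    ∃ K : ℝ, 0 < K ∧ ∀ z : ℂ, z.im ≠ 0 → ‖z‖ ≠ 1 → ∀ C : ℝ, J.R C z * J.R C z⁻¹ * J.N z = C ^ 2 * K * (z - z⁻¹) := by
  obtain ⟨X, hX, hR0⟩ := exists_R0_mul_R0_inv hA hE
  obtain ⟨d1, d1'⟩ := isCompactDensity_spec1 hA
  have d2 := isCompactDensity_spec2a hA hE
  have d3 := isCompactDensity_circle hA
  obtain ⟨c1, hc1, hR1⟩ := expLine_foldInv_mul_inv d1 d1'
  obtain ⟨c2, hc2, hR2⟩ := expLine_foldInv_mul_inv d2 d2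
  rw [← gamma1_eq] at hR1; rw [← gamma2_eq] at hR2
  have hRmu : ∀ z : ℂ, z ≠ 0 → ‖z‖ ≠ 1 → J.Rmu z * J.Rmu z⁻¹ = _ := fun z h0 h1 =>
    expCircleLog_mul_inv (intervalIntegrable_log_mu hA hB hC hE) (fun θ => by rw [Real.cos_neg]) h0 h1
  obtain ⟨-, -, hint, hM⟩ := hA.M_rep (-2)
  set c4 := Real.exp (-(1 / (2 * π)) * ∫ θ in (-π)..Real.pi, Real.log (J.mu (2 * Real.cos θ)))
  set e1 : ℝ → ℝ := {τ : ℝ | 2 < |τ|}.indicator fun τ =>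
    (J.specL \ J.specR).indicator J.eta τ + (J.specR \ J.specL).indicator J.eta τ with he1
  set e2 : ℝ → ℝ := {τ : ℝ | 2 < |τ|}.indicator fun τ =>
    J.spec2a.indicator J.density2 τ + J.spec2a.indicator J.density2 τ with he2
  set e3 : ℝ → ℝ := (Ioo (-2) 2).indicator fun τ => J.eta τ - π / 2 with he3
  set e0 : ℝ → ℝ := fun t => J.eta t - if t < -2 then π else 0 with he0
  have hS : MeasurableSet {τ : ℝ | 2 < |τ|} := (isOpen_lt continuous_const continuous_abs).measurableSet
  have i1 : Integrable e1 := (d1.integrable.add d1'.integrable).indicator hS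
  have i2 : Integrable e2 := (d2.integrable.add d2.integrable).indicator hS
  have i3 : Integrable e3 := d3.integrable
  have iI : Integrable ((Ioo (-2:ℝ) 2).indicator (1 : ℝ → ℝ)) :=
    (integrable_indicator_iff measurableSet_Ioo).2 (integrableOn_const (by simp))
  have hae : e0 =ᵐ[volume] fun τ => π * J.negDiff τ + (e1 τ + (e2 τ + (e3 τ +
      π / 2 * (Ioo (-2:ℝ) 2).indicator 1 τ))) := by
    filter_upwards [ae_eta_eq hA hB hC hD, ae_ne_of_real 2, ae_ne_of_real (-2)] with τ hη n1 n2
    have hneg : τ ∈ J.negSet → 2 < |τ| ∧ τ ∉ J.spec1 := by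
      rintro ⟨t, ⟨I, hI, ht, -⟩, rfl⟩
      have h := mem_Delta_iff.1 (gap_subset hI ht)
      exact ⟨two_lt_abs_add_inv h.1, h.2.1⟩
    simp only [he0, he1, he2, he3, negDiff]
    rcases lt_or_ge 2 |τ| with h | h
    · have hI : τ ∉ Ioo (-2:ℝ) 2 := fun h' => by linarith [abs_lt.2 h']
      rw [indicator_of_mem (show τ ∈ {τ : ℝ | 2 < |τ|} from h), indicator_of_mem (show τ ∈ {τ : ℝ | 2 < |τ|} from h),
        indicator_of_notMem hI, indicator_of_notMem hI]
      by_cases hL : τ ∈ J.specL <;> by_cases hR : τ ∈ J.specR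
      · have hs : τ ∉ J.spec1 := fun h' => h'.elim (fun h' => h'.2 hL) fun h' => h'.2 hR
        rw [indicator_of_notMem (fun h' => h'.2 hR), indicator_of_notMem (fun h' => h'.2 hL)]
        by_cases ha : τ ∈ J.spec2a
        · rw [indicator_of_mem ha, density2]
          split_ifs <;> ring
        · rw [indicator_of_notMem ha]
          rcases hη h hs ha with ⟨h1, h2⟩ | ⟨h1, h2⟩
          · rw [if_pos h1, h2]; split_ifs <;> ring
          · rw [if_neg h1, h2]; split_ifs <;> ring
      · have ha : τ ∉ J.spec2a := fun h' => hR h'.1.1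
        have hs : τ ∈ J.spec1 := Or.inr ⟨hL, hR⟩
        rw [indicator_of_mem (show τ ∈ J.specL \ J.specR from ⟨hL, hR⟩), indicator_of_notMem (fun h' => h'.2 hL),
          indicator_of_notMem ha, if_neg fun h' => (hneg h').2 hs]
        split_ifs <;> ring
      · have ha : τ ∉ J.spec2a := fun h' => hL h'.1.2
        have hs : τ ∈ J.spec1 := Or.inl ⟨hR, hL⟩
        rw [indicator_of_mem (show τ ∈ J.specR \ J.specL from ⟨hR, hL⟩), indicator_of_notMem (fun h' => h'.2 hR),
          indicator_of_notMem ha, if_neg fun h' => (hneg h').2 hs]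
        split_ifs <;> ring
      · have ha : τ ∉ J.spec2a := fun h' => hL h'.1.2
        have hs : τ ∉ J.spec1 := fun h' => h'.elim (fun h' => hR h'.1) fun h' => hL h'.1
        rw [indicator_of_notMem (fun h' => hL h'.1), indicator_of_notMem (fun h' => hR h'.1), indicator_of_notMem ha]
        rcases hη h hs ha with ⟨h1, h2⟩ | ⟨h1, h2⟩
        · rw [if_pos h1, h2]; split_ifs <;> ring
        · rw [if_neg h1, h2]; split_ifs <;> ring
    · have h' := abs_le.1 h
      have hI : τ ∈ Ioo (-2:ℝ) 2 := ⟨lt_of_le_of_ne h'.1 n2.symm, lt_of_le_of_ne h'.2 n1⟩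
      have h2 : τ ∉ {τ : ℝ | 2 < |τ|} := not_lt.2 h
      rw [indicator_of_notMem h2, indicator_of_notMem h2, indicator_of_mem hI, indicator_of_mem hI,
        if_neg fun h'' => not_lt.2 h (hneg h'').1, Pi.one_apply]
      have q := not_lt.2 h'.1
      simp only [q, if_false]; ring
  have i0 : Integrable J.negDiff := by
    have h := ((hint.sub i1).sub (i2.add (i3.add (iI.const_mul (π / 2))))).const_mul π⁻¹
    refine h.congr (hae.mono fun τ hτ => ?_)
    have hpi := Real.pi_ne_zero
    simp only [Pi.sub_apply, Pi.add_apply]; rw [hτ]; field_simp; ring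
  have hexp : ∀ w : ℂ, w.im ≠ 0 → cauchyInt e0 w = π * cauchyInt J.negDiff w +
      (cauchyInt e1 w + (cauchyInt e2 w + (cauchyInt e3 w +
        (π / 2 : ℝ) * cauchyInt ((Ioo (-2:ℝ) 2).indicator 1) w))) := by
    intro w hw
    have iI' := iI.const_mul (π / 2)
    have j3 : Integrable fun τ => e3 τ + π / 2 * (Ioo (-2:ℝ) 2).indicator 1 τ := i3.add iI'
    have j2 : Integrable fun τ => e2 τ + (e3 τ + π / 2 * (Ioo (-2:ℝ) 2).indicator 1 τ) := i2.add j3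
    have j1 : Integrable fun τ => e1 τ + (e2 τ + (e3 τ + π / 2 * (Ioo (-2:ℝ) 2).indicator 1 τ)) := i1.add j2
    rw [cauchyInt_congr_ae hae w, cauchyInt_add (i0.const_mul _) j1 hw, cauchyInt_add i1 j2 hw, cauchyInt_add i2 j3 hw,
      cauchyInt_add i3 iI' hw, cauchyInt_const_mul, cauchyInt_const_mul]
  have hout : ∀ z : ℂ, z.im ≠ 0 → 1 < ‖z‖ → ∀ C : ℝ,
      J.R C z * J.R C z⁻¹ * J.M (z + z⁻¹) = C ^ 2 * (X * c1 * c2 * c4 * (1 / J.b (-1)) : ℝ) * (z - z⁻¹) := by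
    intro z hz h1 C
    have h0 := ne_zero_of_im hz
    have hw := im_add_inv_ne_zero hz h1.ne'
    have r0 := hR0 z hz h1.ne'
    have r1 : J.R1 z * J.R1 z⁻¹ = _ := hR1 z hz h1.ne'
    have r2 : J.R2 z * J.R2 z⁻¹ = _ := hR2 z hz h1.ne'
    have r3 := R3_eq hA h0 h1.ne'
    have r3' := R3_eq hA (inv_ne_zero h0) (norm_ne_one_inv h1.ne')
    have r4 := hRmu z h0 h1.ne'
    have hE := exp_half_cauchyInt hz h1
    rw [inv_inv, add_comm z⁻¹] at r3'
    have hp := add_inv_sub_ne_zero hw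
    have r3m : J.R3 z * J.R3 z⁻¹ = exp (-(1 / π) * cauchyInt e3 (z + z⁻¹)) := by
      rw [r3, r3', ← exp_add]
      congr 1; rw [circleExponent]; ring
    have hpi : (π : ℂ) ≠ 0 := ofReal_ne_zero.2 Real.pi_ne_zero
    calc J.R C z * J.R C z⁻¹ * J.M (z + z⁻¹)
        = C ^ 2 * (J.R0 z * J.R0 z⁻¹) * (J.R1 z * J.R1 z⁻¹) * (J.R2 z * J.R2 z⁻¹) * (J.R3 z * J.R3 z⁻¹) *
            (J.Rmu z * J.Rmu z⁻¹) * J.M (z + z⁻¹) := by rw [R_eq, R_eq]; ring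
      _ = C ^ 2 * (X * c1 * c2 * c4 * (1 / J.b (-1)) : ℝ) * (z + z⁻¹ - (-2 : ℝ)) *
            (exp (-cauchyInt J.negDiff (z + z⁻¹)) *
            exp (-(1 / π) * cauchyInt e1 (z + z⁻¹)) *
            exp (-(1 / π) * cauchyInt e2 (z + z⁻¹)) *
            exp (-(1 / π) * cauchyInt e3 (z + z⁻¹)) *
            exp (1 / π * cauchyInt e0 (z + z⁻¹))) := by
          rw [r0, r1, r2, r3m, r4, hM _ hw]; push_cast; ring
      _ = C ^ 2 * (X * c1 * c2 * c4 * (1 / J.b (-1)) : ℝ) * (z + z⁻¹ - (-2 : ℝ)) *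
            exp (1 / 2 * cauchyInt ((Ioo (-2) 2).indicator 1) (z + z⁻¹)) := by
          rw [← exp_add, ← exp_add, ← exp_add, ← exp_add]
          congr 2; rw [hexp _ hw]; push_cast; field_simp; ring
      _ = _ := by rw [hE]; push_cast; field_simp; ring
  have hb := J.b_neg_one_pos
  refine ⟨X * c1 * c2 * c4 * (1 / J.b (-1)), by positivity, fun z hz h1 C => ?_⟩
  have h0 := ne_zero_of_im hz
  rcases lt_or_gt_of_ne h1 with h | h
  · have hz' : z⁻¹.im ≠ 0 := by rw [inv_im]; exact div_ne_zero (neg_ne_zero.2 hz) (normSq_pos.2 h0).ne'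
    have h' : 1 < ‖z⁻¹‖ := by rw [norm_inv]; exact (one_lt_inv₀ (norm_pos_iff.2 h0)).2 h
    have := hout z⁻¹ hz' h' C
    rw [inv_inv, add_comm z⁻¹] at this; rw [N_of_lt_one _ h0 h]
    linear_combination -this
  · rw [N_of_one_lt _ h]; exact hout z hz h C

end JacobiMatrix

lemma IsCompactDensity.foldInv (hu : IsCompactDensity u) (hv : IsCompactDensity v) :
    IsCompactDensity (foldInv u v) := by
  obtain ⟨B, K, -, hB, hK, -⟩ := exists_foldInv_bounds hu hv
  exact ⟨integrable_foldInv hu hv, ⟨B, hB⟩, ⟨K + 1, hK⟩⟩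

lemma IsCompactDensity.tendsto_expLine {γ : ℝ → ℝ} (hγ : IsCompactDensity γ) :
    ∃ c : ℂ, c ≠ 0 ∧ Tendsto (fun z => expLine z fun t => -γ t) (Bornology.cobounded ℂ) (𝓝 c) := by
  obtain ⟨h1, h2⟩ := tendsto_cauchyInt_cobounded hγ
  refine ⟨_, exp_ne_zero _, Tendsto.congr' (h2.mono fun z hz => (expLine_neg_eq hγ.integrable hz).symm)
    (?_ : Tendsto _ _ (𝓝 (exp (1 / π * ∫ t, (γ t : ℂ) * ((t : ℂ) / (1 + (t : ℂ) ^ 2))))))⟩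
  simpa using ((h1.const_mul (-(1 / (π : ℂ)))).cexp).mul_const _

lemma IsCompactDensity.continuousAt_expLine {γ : ℝ → ℝ} (hγ : IsCompactDensity γ) (hz : z.im ≠ 0) :
    ContinuousAt (fun z => expLine z fun t => -γ t) z := by
  have hev : ∀ᶠ z' : ℂ in 𝓝 z, z'.im ≠ 0 := continuous_im.continuousAt.eventually_ne hz
  refine ContinuousAt.congr_of_eventuallyEq ?_ (hev.mono fun z' hz' =>
    expLine_neg_eq hγ.integrable (integrable_mul_cauchyKernel' hγ.integrable hz'))
  have := (hasDerivAt_cauchyInt hγ.integrable hz).continuousAt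
  fun_prop

lemma expLine_conj (z : ℂ) (γ : ℝ → ℝ) : expLine (conj z) γ = conj (expLine z γ) := by
  rw [expLine, expLine, ← exp_conj, map_mul, ← integral_conj]; simp

lemma expLine_ne_zero (z : ℂ) (γ : ℝ → ℝ) : expLine z γ ≠ 0 := exp_ne_zero _

lemma intervalIntegrable_abs_rpow {s : ℝ} (hs : -1 < s) (a b c : ℝ) :
    IntervalIntegrable (fun θ => |θ - c| ^ s) volume a b := by
  have h : ∀ x y, IntervalIntegrable (fun θ : ℝ => |θ| ^ s) volume x y :=
    fun x y => intervalIntegrable_of_even (fun θ => by rw [abs_neg]) (fun y hy => by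
      refine (intervalIntegral.intervalIntegrable_rpow' hs).congr_ae ?_
      rw [uIoc_of_le hy.le]
      filter_upwards [ae_restrict_mem measurableSet_Ioc] with θ hθ
      rw [abs_of_pos hθ.1])
  simpa using (h (a - c) (b - c)).comp_sub_right c

lemma norm_exp_sub_le (hξ : ‖ξ‖ = 1) {r : ℝ} (hr : 0 ≤ r) (θ : ℝ) : ‖exp (θ * I) - ξ‖ ≤ 2 * ‖exp (θ * I) - r * ξ‖ := by
  have h1 := norm_sub_norm_le (exp (θ * I)) (r * ξ)
  have h2 := norm_sub_norm_le (r * ξ) (exp (θ * I))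
  rw [norm_sub_rev] at h2
  rw [norm_mul, hξ, norm_exp_ofReal_mul_I, norm_real, Real.norm_of_nonneg hr, mul_one] at h1 h2
  have h3 : ‖(r * ξ) - ξ‖ = |r - 1| := by
    rw [show (r : ℂ) * ξ - ξ = ((r - 1 : ℝ) : ℂ) * ξ by push_cast; ring, norm_mul, hξ, mul_one, norm_real,
      Real.norm_eq_abs]
  have h4 : |r - 1| ≤ ‖exp (θ * I) - r * ξ‖ := abs_le.2 ⟨by linarith, by linarith⟩
  have h5 := norm_sub_le_norm_sub_add_norm_sub (exp (θ * I)) (r * ξ) ξ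
  linarith

lemma exists_norm_exp_sub_ge {θ₀ : ℝ} (h0 : θ₀ ∈ Ioo 0 π) : ∃ κ : ℝ, 0 < κ ∧ ∀ θ ∈ Icc (-π) π,
      κ * |θ - θ₀| ≤ ‖exp (θ * I) - exp (θ₀ * I)‖ := by
  set f : ℝ → ℂ := fun θ => exp (θ * I) with hf
  have hfd : ∀ θ : ℝ, HasDerivAt f (exp (θ * I) * I) θ := fun θ => by
    have := (((ofRealCLM.hasDerivAt (x := θ)).mul_const I).cexp)
    simpa using this
  have hmem : θ₀ ∈ Icc (-π) π := ⟨by linarith [h0.1, Real.pi_pos], h0.2.le⟩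
  have hnhds : Icc (-π) π ∈ 𝓝 θ₀ := Icc_mem_nhds (by linarith [h0.1, Real.pi_pos]) h0.2
  have hc : ContinuousOn (fun θ => ‖dslope f θ₀ θ‖) (Icc (-π) π) :=
    ((continuousOn_dslope hnhds).2 ⟨fun θ _ => (hfd θ).continuousAt.continuousWithinAt, (hfd θ₀).differentiableAt⟩).norm
  obtain ⟨θm, hθm, hmin⟩ := isCompact_Icc.exists_isMinOn ⟨θ₀, hmem⟩ hc
  have hpos : 0 < ‖dslope f θ₀ θm‖ := by
    rw [norm_pos_iff]
    by_cases h : θm = θ₀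
    · rw [h, dslope_same, (hfd θ₀).deriv]; exact mul_ne_zero (exp_ne_zero _) I_ne_zero
    · rw [dslope_of_ne _ h, slope_def_module]
      refine smul_ne_zero (inv_ne_zero (sub_ne_zero.2 h)) (sub_ne_zero.2 fun e => ?_)
      obtain ⟨n, hn⟩ := exp_eq_exp_iff_exists_int.1 e
      have hn' : θm = θ₀ + n * (2 * π) := by
        have := congrArg im hn
        simpa using this
      have hpi := Real.pi_pos
      have n1 : (n : ℝ) < 1 := by by_contra hh; nlinarith [hθm.2, h0.1, not_lt.1 hh]
      have n2 : (-1 : ℝ) < n := by by_contra hh; nlinarith [hθm.1, h0.2, not_lt.1 hh]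
      have : n = 0 := by
        have a : n < 1 := by exact_mod_cast n1
        have b : -1 < n := by exact_mod_cast n2
        omega
      rw [this] at hn'; exact h (by simpa using hn')
  refine ⟨_, hpos, fun θ hθ => ?_⟩
  have := mul_le_mul_of_nonneg_right (hmin hθ) (abs_nonneg (θ - θ₀))
  refine this.trans (le_of_eq ?_)
  rw [← Real.norm_eq_abs, mul_comm, ← norm_smul, sub_smul_dslope]

/-- Boundary values of the Cauchy transform on the circle at a Hölder point. -/
lemma exists_circle_cauchy_limit {L : ℝ → ℝ} {B θ₀ : ℝ} (h0 : θ₀ ∈ Ioo 0 π)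
    (hL : IntervalIntegrable L volume (-π) π) (hB : ∀ᵐ θ, θ ∈ Ioo (-π) π → |L θ| ≤ B)
    (hH : IsHolderAt L θ₀) :
    ∃ T : ℂ, Tendsto (fun r : ℝ => ∫ θ in (-π)..Real.pi, exp (θ * I) /
      (exp (θ * I) - r * exp (θ₀ * I)) * ((L θ - L θ₀ : ℝ) : ℂ)) (𝓝[≠] 1) (𝓝 T) := by
  have hpi := Real.pi_pos
  obtain ⟨κ, hκ, hκ'⟩ := exists_norm_exp_sub_ge h0
  obtain ⟨s, hs, hO⟩ := hH
  obtain ⟨C, hC0, hC⟩ := hO.exists_pos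
  rw [Asymptotics.isBigOWith_iff] at hC
  obtain ⟨δ, hδ, hball⟩ := Metric.eventually_nhds_iff.1 hC
  have hbound : ∀ᵐ θ, θ ∈ Ioo (-π) π →
      |L θ - L θ₀| ≤ (C + (B + |L θ₀|) / δ ^ s) * |θ - θ₀| ^ s := by
    filter_upwards [hB] with θ hθ hmem
    have hB0 : 0 ≤ B := (abs_nonneg _).trans (hθ hmem)
    have hδs : 0 < δ ^ s := Real.rpow_pos_of_pos hδ s
    have hn : 0 ≤ |θ - θ₀| ^ s := Real.rpow_nonneg (abs_nonneg _) s
    rw [add_mul]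
    rcases lt_or_ge |θ - θ₀| δ with h | h
    · have := hball (y := θ) (by rwa [Real.dist_eq])
      rw [Real.norm_eq_abs, Real.norm_of_nonneg hn] at this
      have h2 : 0 ≤ (B + |L θ₀|) / δ ^ s * |θ - θ₀| ^ s := by positivity
      linarith
    · have h1 : δ ^ s ≤ |θ - θ₀| ^ s := Real.rpow_le_rpow hδ.le h hs.le
      have h2 : B + |L θ₀| ≤ (B + |L θ₀|) / δ ^ s * |θ - θ₀| ^ s := by
        rw [div_mul_eq_mul_div, le_div_iff₀ hδs]; exact mul_le_mul_of_nonneg_left h1 (by positivity)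
      have h3 : 0 ≤ C * |θ - θ₀| ^ s := by positivity
      linarith [abs_sub (L θ) (L θ₀), hθ hmem]
  refine ⟨_, intervalIntegral.tendsto_integral_filter_of_dominated_convergence (F := fun (r : ℝ) θ => exp (θ * I) /
      (exp (θ * I) - r * exp (θ₀ * I)) * ((L θ - L θ₀ : ℝ) : ℂ))
    (f := fun θ => exp (θ * I) / (exp (θ * I) - (1 : ℝ) * exp (θ₀ * I)) * ((L θ - L θ₀ : ℝ) : ℂ))
    (fun θ => 2 / κ * (C + (B + |L θ₀|) / δ ^ s) * |θ - θ₀| ^ (s - 1)) ?_ ?_ ?_ ?_⟩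
  · refine .of_forall fun r => ?_
    rw [uIoc_of_le (by linarith)]
    refine AEStronglyMeasurable.mul ?_ ((hL.1.1.sub aestronglyMeasurable_const).aemeasurable.complex_ofReal.aestronglyMeasurable)
    exact (by fun_prop : Measurable fun θ : ℝ => exp (θ * I) /
      (exp (θ * I) - r * exp (θ₀ * I))).aestronglyMeasurable
  · have hev : ∀ᶠ r : ℝ in 𝓝[≠] 1, 0 ≤ r := (eventually_ge_nhds (by norm_num : (0:ℝ) < 1)).filter_mono nhdsWithin_le_nhds
    refine hev.mono fun r hr => ?_
    filter_upwards [hbound, ae_ne_of_real θ₀, ae_ne_of_real π] with θ hb hne hne' hθ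
    rw [uIoc_of_le (by linarith)] at hθ
    have hlt : θ < π := lt_of_le_of_ne hθ.2 hne'
    have hp : 0 < |θ - θ₀| := abs_pos.2 (sub_ne_zero.2 hne)
    have h1 := norm_exp_sub_le (norm_exp_ofReal_mul_I θ₀) hr θ
    have h2 := hκ' θ ⟨hθ.1.le, hθ.2⟩
    have h3 : κ / 2 * |θ - θ₀| ≤ ‖exp (θ * I) - r * exp (θ₀ * I)‖ := by linarith
    rw [norm_mul, norm_div, norm_exp_ofReal_mul_I, norm_ofReal, Real.rpow_sub_one hp.ne']
    calc _ ≤ 1 / (κ / 2 * |θ - θ₀|) * ((C + (B + |L θ₀|) / δ ^ s) * |θ - θ₀| ^ s) := by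
          refine mul_le_mul (one_div_le_one_div_of_le (by positivity) h3) (hb ⟨hθ.1, hlt⟩) (abs_nonneg _) (by positivity)
      _ = _ := by field_simp
  · exact (intervalIntegrable_abs_rpow (by linarith) _ _ _).const_mul _
  · filter_upwards [ae_ne_of_real θ₀, ae_ne_of_real π] with θ hne hne' hθ
    rw [uIoc_of_le (by linarith)] at hθ
    have h2 := hκ' θ ⟨hθ.1.le, hθ.2⟩
    have hp : 0 < |θ - θ₀| := abs_pos.2 (sub_ne_zero.2 hne)
    have hne0 : exp (θ * I) - ((1 : ℝ) : ℂ) * exp (θ₀ * I) ≠ 0 := by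
      rw [ofReal_one, one_mul]; exact norm_pos_iff.1 ((mul_pos hκ hp).trans_le h2)
    have : ContinuousAt (fun r : ℝ => exp (θ * I) / (exp (θ * I) - r * exp (θ₀ * I)) * ((L θ - L θ₀ : ℝ) : ℂ)) 1 := by
      fun_prop (disch := assumption)
    exact this.tendsto.mono_left nhdsWithin_le_nhds

lemma integral_circleKernel (z : ℂ) : ∫ θ in (-π)..Real.pi,
    exp (θ * I) / (exp (θ * I) - z) = -I * ∮ ζ in C(0, 1), (ζ - z)⁻¹ := by
  have hper : Function.Periodic (fun θ : ℝ => exp (θ * I) / (exp (θ * I) - z)) (2 * π) := fun θ => by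
    have : exp ((θ + 2 * π : ℝ) * I) = exp (θ * I) := by push_cast; rw [add_mul, exp_add, exp_two_pi_mul_I, mul_one]
    simp only [this]
  have := hper.intervalIntegral_add_eq (-π) 0
  rw [zero_add, show -π + 2 * π = π by ring] at this
  rw [this, circleIntegral, ← intervalIntegral.integral_const_mul]
  congr 1
  ext θ; simp only [deriv_circleMap, circleMap, zero_add, ofReal_one, one_mul, smul_eq_mul]
  rw [div_eq_mul_inv]
  linear_combination (exp (θ * I) * (exp (θ * I) - z)⁻¹) * I_sq

lemma integral_circleKernel_of_lt (hz : ‖z‖ < 1) : ∫ θ in (-π)..Real.pi,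
    exp (θ * I) / (exp (θ * I) - z) = 2 * π := by
  rw [integral_circleKernel, circleIntegral.integral_sub_inv_of_mem_ball (by simpa using hz)]
  linear_combination (-2 * (π : ℂ)) * I_sq

lemma integral_circleKernel_of_gt (hz : 1 < ‖z‖) : ∫ θ in (-π)..Real.pi,
    exp (θ * I) / (exp (θ * I) - z) = 0 := by
  rw [integral_circleKernel, DiffContOnCl.circleIntegral_eq_zero zero_le_one, mul_zero]
  refine DifferentiableOn.diffContOnCl fun ζ hζ => ?_
  rw [closure_ball _ one_ne_zero, mem_closedBall_zero_iff] at hζ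
  have : ζ - z ≠ 0 := fun h => by rw [sub_eq_zero.1 h] at hζ; linarith
  exact DifferentiableAt.differentiableWithinAt (by fun_prop (disch := assumption))

lemma exists_expCircleLog_limits {L : ℝ → ℝ} {B θ₀ : ℝ} (h0 : θ₀ ∈ Ioo 0 π)
    (hL : IntervalIntegrable L volume (-π) π) (hB : ∀ᵐ θ, θ ∈ Ioo (-π) π → |L θ| ≤ B)
    (hH : IsHolderAt L θ₀) : ∃ p : ℂ, p ≠ 0 ∧
    Tendsto (fun r : ℝ => expCircleLog L (r * exp (θ₀ * I))) (𝓝[<] 1) (𝓝 p) ∧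
    Tendsto (fun r : ℝ => expCircleLog L (r * exp (θ₀ * I))) (𝓝[>] 1) (𝓝 (Real.exp (L θ₀) * p)) := by
  obtain ⟨T, hT⟩ := exists_circle_cauchy_limit h0 hL hB hH
  have hpiC : (π : ℂ) ≠ 0 := ofReal_ne_zero.2 Real.pi_ne_zero
  have hsplit : ∀ r : ℝ, 0 < r → r ≠ 1 → expCircleLog L (r * exp (θ₀ * I)) =
      exp (-(1 / (2 * (π : ℂ))) * ((∫ θ in (-π)..Real.pi, exp (θ * I) /
        (exp (θ * I) - r * exp (θ₀ * I)) * ((L θ - L θ₀ : ℝ) : ℂ)) +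
        (∫ θ in (-π)..Real.pi, exp (θ * I) / (exp (θ * I) - r * exp (θ₀ * I))) * L θ₀)) := by
    intro r hr hr1
    have hn : ‖(r : ℂ) * exp (θ₀ * I)‖ ≠ 1 := by
      rwa [norm_mul, norm_exp_ofReal_mul_I, mul_one, norm_real, Real.norm_of_nonneg hr.le]
    have hc := (continuous_circleKernel' hn)
    have i1 : IntervalIntegrable (fun θ => ((L θ - L θ₀ : ℝ) : ℂ)) volume (-π) π :=
      let h := hL.sub (intervalIntegrable_const (c := L θ₀)); ⟨h.1.ofReal, h.2.ofReal⟩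
    rw [expCircleLog, ← intervalIntegral.integral_mul_const, ← intervalIntegral.integral_add
      (i1.continuousOn_mul hc.continuousOn) ((hc.intervalIntegrable _ _).mul_const _)]
    congr 3
    ext θ; push_cast; ring
  have hnorm : ∀ r : ℝ, 0 < r → ‖(r : ℂ) * exp (θ₀ * I)‖ = r := fun r hr => by
    rw [norm_mul, norm_exp_ofReal_mul_I, mul_one, norm_real, Real.norm_of_nonneg hr.le]
  have hpos : ∀ᶠ r : ℝ in 𝓝 1, 0 < r := eventually_gt_nhds one_pos
  refine ⟨exp (-(1 / (2 * (π : ℂ))) * (T + 2 * π * L θ₀)), exp_ne_zero _, ?_, ?_⟩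
  · refine Tendsto.congr' ?_ (((hT.mono_left (nhdsWithin_mono 1 fun r (hr : r < 1) => hr.ne)).add_const
      (2 * π * L θ₀ : ℂ)).const_mul (-(1 / (2 * (π : ℂ))))).cexp
    filter_upwards [hpos.filter_mono nhdsWithin_le_nhds, self_mem_nhdsWithin] with r hr hr1
    rw [hsplit r hr (ne_of_lt hr1), integral_circleKernel_of_lt (by rw [hnorm r hr]; exact hr1)]
  · have e : (Real.exp (L θ₀) : ℂ) * exp (-(1 / (2 * (π : ℂ))) * (T + 2 * π * L θ₀)) =
        exp (-(1 / (2 * (π : ℂ))) * T) := by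
      rw [ofReal_exp, ← exp_add]
      congr 1; field_simp; ring
    rw [e]
    refine Tendsto.congr' ?_ ((hT.mono_left (nhdsWithin_mono 1 fun r (hr : 1 < r) => hr.ne')).const_mul
      (-(1 / (2 * (π : ℂ))))).cexp
    filter_upwards [hpos.filter_mono nhdsWithin_le_nhds, self_mem_nhdsWithin] with r hr hr1
    rw [hsplit r hr (ne_of_gt hr1), integral_circleKernel_of_gt (by rw [hnorm r hr]; exact hr1), zero_mul, add_zero]

lemma expCircleLog_conj {L : ℝ → ℝ} (heven : ∀ θ, L (-θ) = L θ) (z : ℂ) :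
    expCircleLog L (conj z) = conj (expCircleLog L z) := by
  have e := intervalIntegral.integral_comp_neg (a := -π) (b := π)
    (fun θ : ℝ => exp (θ * I) / (exp (θ * I) - conj z) * (L θ : ℂ))
  rw [neg_neg] at e
  rw [expCircleLog, expCircleLog, ← e, ← exp_conj, map_mul, ← intervalIntegral.intervalIntegral_conj]
  simp [heven, ← exp_conj, map_ofNat]

/-- `a` and `b` are the radial limits of `f` at `ξ` from inside and outside. -/
def CircleLim (f : ℂ → ℂ) (ξ a b : ℂ) : Prop :=
  Tendsto (fun r : ℝ => f (r * ξ)) (𝓝[<] 1) (𝓝 a) ∧ Tendsto (fun r : ℝ => f (r * ξ)) (𝓝[>] 1) (𝓝 b)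

namespace CircleLim
variable {f g : ℂ → ℂ} {ξ a b c d : ℂ}

lemma hasCircleLimits (h : CircleLim f ξ a b) : HasCircleLimits f ξ := ⟨⟨a, h.1⟩, ⟨b, h.2⟩⟩
lemma innerLim_eq (h : CircleLim f ξ a b) : innerLim f ξ = a := h.1.limUnder_eq
lemma outerLim_eq (h : CircleLim f ξ a b) : outerLim f ξ = b := h.2.limUnder_eq
lemma mul (h : CircleLim f ξ a b) (h' : CircleLim g ξ c d) : CircleLim (fun z => f z * g z) ξ (a * c) (b * d) :=
  ⟨h.1.mul h'.1, h.2.mul h'.2⟩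
lemma add (h : CircleLim f ξ a b) (h' : CircleLim g ξ c d) : CircleLim (fun z => f z + g z) ξ (a + c) (b + d) :=
  ⟨h.1.add h'.1, h.2.add h'.2⟩

lemma of_continuousAt (h : ContinuousAt f ξ) : CircleLim f ξ (f ξ) (f ξ) := by
  have h1 : Tendsto (fun r : ℝ => (r : ℂ) * ξ) (𝓝 1) (𝓝 ξ) := by
    have : ContinuousAt (fun r : ℝ => (r : ℂ) * ξ) 1 := by fun_prop
    simpa [ContinuousAt] using this
  exact ⟨h.tendsto.comp (h1.mono_left nhdsWithin_le_nhds), h.tendsto.comp (h1.mono_left nhdsWithin_le_nhds)⟩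

lemma star (h : CircleLim f ξ a b) (h1 : ‖ξ‖ = 1) (him : ξ.im ≠ 0)
    (hf : ∀ z : ℂ, z.im ≠ 0 → ‖z‖ ≠ 1 → f (conj z) = conj (f z)) :
    CircleLim f (conj ξ) (conj a) (conj b) := by
  have key : ∀ r : ℝ, 0 < r → r ≠ 1 → conj (f (r * ξ)) = f (r * conj ξ) := by
    intro r hr hr1
    rw [← hf _ (by simpa using ⟨hr.ne', him⟩) (by simpa [h1, abs_of_pos hr] using hr1), map_mul, conj_ofReal]
  have hpos : ∀ᶠ r : ℝ in 𝓝 1, 0 < r := eventually_gt_nhds one_pos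
  refine ⟨Tendsto.congr' ?_ ((continuous_conj.tendsto a).comp h.1),
    Tendsto.congr' ?_ ((continuous_conj.tendsto b).comp h.2)⟩
  · filter_upwards [hpos.filter_mono nhdsWithin_le_nhds, self_mem_nhdsWithin] with r hr hr1
    exact key r hr (ne_of_lt hr1)
  · filter_upwards [hpos.filter_mono nhdsWithin_le_nhds, self_mem_nhdsWithin] with r hr hr1
    exact key r hr (ne_of_gt hr1)

end CircleLim

lemma add_inv_of_norm_eq_one (h1 : ‖ξ‖ = 1) : ξ + ξ⁻¹ = ((2 * ξ.re : ℝ) : ℂ) := by rw [inv_eq_conj h1, add_conj]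

lemma im_mul_add_inv (h1 : ‖ξ‖ = 1) (r : ℝ) : ((r : ℂ) * ξ + ((r : ℂ) * ξ)⁻¹).im = (r - r⁻¹) * ξ.im := by
  rw [mul_inv, inv_eq_conj h1, ← ofReal_inv, add_im, im_ofReal_mul, im_ofReal_mul, conj_im]; ring

lemma tendsto_mul_add_inv (h1 : ‖ξ‖ = 1) :
    Tendsto (fun r : ℝ => (r : ℂ) * ξ + ((r : ℂ) * ξ)⁻¹) (𝓝 1) (𝓝 ((2 * ξ.re : ℝ) : ℂ)) := by
  have h0 : ((1 : ℝ) : ℂ) * ξ ≠ 0 := by rw [ofReal_one, one_mul]; rintro rfl; simp at h1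
  have : ContinuousAt (fun r : ℝ => (r : ℂ) * ξ + ((r : ℂ) * ξ)⁻¹) 1 := by fun_prop (disch := assumption)
  have h := this.tendsto
  rwa [ofReal_one, one_mul, add_inv_of_norm_eq_one h1] at h

lemma tendsto_outer_upperHalf (h1 : ‖ξ‖ = 1) (him : 0 < ξ.im) :
    Tendsto (fun r : ℝ => (r : ℂ) * ξ + ((r : ℂ) * ξ)⁻¹) (𝓝[>] 1) (𝓝[upperHalf] ((2 * ξ.re : ℝ) : ℂ)) := by
  refine tendsto_nhdsWithin_iff.2 ⟨(tendsto_mul_add_inv h1).mono_left nhdsWithin_le_nhds, ?_⟩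
  filter_upwards [self_mem_nhdsWithin] with r hr
  have hr' : (1:ℝ) < r := hr
  change 0 < im _
  rw [im_mul_add_inv h1]; exact mul_pos (by linarith [inv_lt_one_of_one_lt₀ hr']) him

lemma tendsto_inner_upperHalf (h1 : ‖ξ‖ = 1) (him : 0 < ξ.im) :
    Tendsto (fun r : ℝ => conj ((r : ℂ) * ξ + ((r : ℂ) * ξ)⁻¹)) (𝓝[<] 1) (𝓝[upperHalf] ((2 * ξ.re : ℝ) : ℂ)) := by
  refine tendsto_nhdsWithin_iff.2 ⟨?_, ?_⟩
  · have := (continuous_conj.tendsto _).comp ((tendsto_mul_add_inv h1).mono_left (nhdsWithin_le_nhds (s := Iio 1)))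
    rwa [conj_ofReal] at this
  · filter_upwards [self_mem_nhdsWithin, (eventually_gt_nhds (one_pos : (0:ℝ) < 1)).filter_mono nhdsWithin_le_nhds] with r hr hr0
    have hr' : r < (1:ℝ) := hr
    change 0 < im _
    rw [conj_im, im_mul_add_inv h1, ← neg_mul]; exact mul_pos (by linarith [(one_lt_inv₀ hr0).2 hr']) him

lemma two_mul_re_mem (h1 : ‖ξ‖ = 1) (him : ξ.im ≠ 0) : 2 * ξ.re ∈ Ioo (-2:ℝ) 2 := by
  have h := normSq_eq_norm_sq ξ
  rw [h1, normSq_apply] at h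
  have := mul_self_pos.2 him
  exact ⟨by nlinarith, by nlinarith⟩

lemma IsHolderAt.comp_right {E : Type*} [NormedAddCommGroup E] {f : ℝ → E} {φ : ℝ → ℝ}
    (h : IsHolderAt f (φ x)) (hφ : DifferentiableAt ℝ φ x) : IsHolderAt (fun y => f (φ y)) x := by
  obtain ⟨r, hr, h⟩ := h
  refine ⟨r, hr, (h.comp_tendsto hφ.continuousAt).trans ?_⟩
  exact ((hφ.hasFDerivAt.isBigO_sub).norm_norm).rpow hr.le (.of_forall fun y => abs_nonneg _)

lemma norm_ofReal_mul (h1 : ‖ξ‖ = 1) (r : ℝ) (hr : 0 < r) : ‖(r : ℂ) * ξ‖ = r := by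
  rw [norm_mul, h1, mul_one, norm_real, Real.norm_of_nonneg hr.le]

lemma eventually_one_lt : ∀ᶠ r : ℝ in 𝓝[>] 1, (0:ℝ) < r ∧ 1 < r := by
  filter_upwards [self_mem_nhdsWithin] with r hr using ⟨one_pos.trans hr, hr⟩

namespace JacobiMatrix
lemma n_conj (hA : J.CondA) : J.n (conj z) = conj (J.n z) := by
  have e : conj z + (conj z)⁻¹ = conj (z + z⁻¹) := by rw [map_add, map_inv₀]
  rcases lt_or_ge ‖z‖ 1 with h | h
  · rw [J.n_of_norm_lt h, J.n_of_norm_lt (by rwa [norm_conj]), e, hA.isPick_FR.conj_eq, map_neg]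
  · rw [J.n_of_one_le h, J.n_of_one_le (by rwa [norm_conj]), e, J.isPick_FL.conj_eq]

lemma circleLim_n (hA : J.CondA) (hE : J.CondE) (h1 : ‖ξ‖ = 1) (him : 0 < ξ.im) :
    CircleLim J.n ξ (-conj (J.bdR (2 * ξ.re))) (J.bdL (2 * ξ.re)) := by
  have hx := two_mul_re_mem h1 him.ne'
  have hn := norm_ofReal_mul h1
  have hpos : ∀ᶠ r : ℝ in 𝓝 1, 0 < r := eventually_gt_nhds one_pos
  constructor
  · refine Tendsto.congr' ?_ ((continuous_conj.tendsto _).comp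
      ((hE.boundary_FR hA hx).1.comp (tendsto_inner_upperHalf h1 him))).neg
    filter_upwards [hpos.filter_mono nhdsWithin_le_nhds, self_mem_nhdsWithin] with r hr hr1
    rw [J.n_of_norm_lt (by rw [hn r hr]; exact hr1)]; simp only [Function.comp]
    rw [hA.isPick_FR.conj_eq, conj_conj]
  · refine Tendsto.congr' ?_ ((hE.boundary_FL hx).1.comp (tendsto_outer_upperHalf h1 him))
    filter_upwards [hpos.filter_mono nhdsWithin_le_nhds, self_mem_nhdsWithin] with r hr hr1
    rw [J.n_of_one_le (by rw [hn r hr]; exact le_of_lt hr1)]; rfl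

lemma isHolderAt_log_mu (hA : J.CondA) (hB : J.CondB) (hE : J.CondE) {θ : ℝ} (hθ : θ ∈ Ioo 0 π) :
    IsHolderAt (fun θ => Real.log (J.mu (2 * Real.cos θ))) θ := by
  have hx := two_mul_cos_mem hθ
  obtain ⟨hR, hL⟩ := im_bd_pos hA hB hE hx
  have hg : ∀ u : ℂ, 0 < u.im → DifferentiableAt ℝ (fun u : ℂ => Real.log u.im) u := fun u hu =>
    (imCLM.differentiableAt (x := u)).log hu.ne'
  have h1 := (((hE.boundary_FR hA hx).2.2.comp (𝕜 := ℝ) (hg _ hR)).sub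
    ((hE.boundary_FL hx).2.2.comp (𝕜 := ℝ) (hg _ hL))).comp (𝕜 := ℝ) (g := fun s : ℝ => s / 2) (by fun_prop)
  refine (h1.congr ?_).comp_right (f := fun τ => Real.log (J.mu τ)) (φ := fun θ => 2 * Real.cos θ) (hasDerivAt_two_mul_cos θ).differentiableAt
  filter_upwards [Ioo_mem_nhds hx.1 hx.2] with τ hτ
  obtain ⟨hR, hL⟩ := im_bd_pos hA hB hE hτ
  rw [mu_eq hA hE hτ, Real.log_sqrt (div_pos hR hL).le, Real.log_div hR.ne' hL.ne']

lemma mu_pos (hA : J.CondA) (hB : J.CondB) (hE : J.CondE) (hx : x ∈ Ioo (-2) 2) : 0 < J.mu x := by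
  obtain ⟨hR, hL⟩ := im_bd_pos hA hB hE hx
  rw [mu_eq hA hE hx]; exact Real.sqrt_pos.2 (div_pos hR hL)

lemma exists_circleLim_Rmu (hA : J.CondA) (hB : J.CondB) (hC : J.CondC) (hE : J.CondE)
    (h1 : ‖ξ‖ = 1) (him : 0 < ξ.im) : ∃ p : ℂ, p ≠ 0 ∧ CircleLim J.Rmu ξ p (J.mu (2 * ξ.re) * p) := by
  have hθ : ξ.arg ∈ Ioo 0 π := ⟨lt_of_le_of_ne (arg_nonneg_iff.2 him.le) fun h => him.ne'
    (arg_eq_zero_iff.1 h.symm).2, lt_of_le_of_ne (arg_le_pi _) fun h => him.ne' (arg_eq_pi_iff.1 h).2⟩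
  have hexp : exp (ξ.arg * I) = ξ := by
    have := norm_mul_exp_arg_mul_I ξ
    rwa [h1, ofReal_one, one_mul] at this
  have hcos : Real.cos ξ.arg = ξ.re := by
    have := norm_mul_cos_arg ξ
    rwa [h1, one_mul] at this
  obtain ⟨B, hB'⟩ := exists_log_mu_bound hA hB hC hE
  obtain ⟨p, hp, hi, ho⟩ := exists_expCircleLog_limits hθ (intervalIntegrable_log_mu hA hB hC hE) (B := B) (by
    filter_upwards [ae_ne_of_real 0] with θ h0 hθ
    refine hB' _ ?_
    rcases lt_or_gt_of_ne h0 with h | h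
    · rw [← Real.cos_neg]; exact two_mul_cos_mem ⟨by linarith, by linarith [hθ.1]⟩
    · exact two_mul_cos_mem ⟨h, hθ.2⟩) (isHolderAt_log_mu hA hB hE hθ)
  rw [hexp, hcos, Real.exp_log (mu_pos hA hB hE (two_mul_re_mem h1 him.ne'))] at ho
  rw [hexp] at hi; exact ⟨p, hp, hi, ho⟩

lemma R3_inv (hA : J.CondA) (h0 : z ≠ 0) (h1 : ‖z‖ ≠ 1) : J.R3 z⁻¹ = J.R3 z := by
  rw [R3_eq hA h0 h1, R3_eq hA (inv_ne_zero h0) (norm_ne_one_inv h1), inv_inv, add_comm]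

lemma R3_conj (hA : J.CondA) (h0 : z ≠ 0) (h1 : ‖z‖ ≠ 1) : J.R3 (conj z) = conj (J.R3 z) := by
  rw [R3_eq hA h0 h1, R3_eq hA (by simpa using h0) (by rwa [norm_conj]), ← map_inv₀, ← map_add,
    circleExponent, cauchyInt_conj, ← exp_conj, map_mul]
  simp [map_ofNat]

lemma R3_eq_exp_log (hA : J.CondA) (hz : z.im ≠ 0) (h1 : ‖z‖ ≠ 1) :
    J.R3 z = exp (1 / 2 * log (J.R3 z ^ 2)) ∧ 0 ≤ (J.R3 z ^ 2).re := by
  have h0 := ne_zero_of_im hz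
  have hpi := Real.pi_pos
  have hB := abs_im_cauchyInt_le (isCompactDensity_circle hA).integrable (B := π / 2) (by
    filter_upwards [hA.ae_eta_mem] with t ht
    by_cases h : t ∈ Ioo (-2:ℝ) 2
    · rw [indicator_of_mem h]; exact abs_le.2 ⟨by linarith [ht.1], by linarith [ht.2]⟩
    · rw [indicator_of_notMem h, abs_zero]; positivity) (im_add_inv_ne_zero hz h1)
  set e : ℂ := -(1 / π) * J.circleExponent (z + z⁻¹) with he
  have hR : J.R3 z = exp (1 / 2 * e) := by rw [R3_eq hA h0 h1, he]; congr 1; ring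
  have hR2 : J.R3 z ^ 2 = exp e := by rw [hR, ← exp_nat_mul]; congr 1; push_cast; ring
  have him : |e.im| ≤ π / 2 := by
    have : e = ((-(1 / π) : ℝ) : ℂ) * J.circleExponent (z + z⁻¹) := by rw [he]; push_cast; rfl
    rw [this, im_ofReal_mul, abs_mul, abs_neg, abs_of_pos (by positivity : 0 < 1 / π)]
    calc _ ≤ 1 / π * (π / 2 * π) := mul_le_mul_of_nonneg_left hB (by positivity)
      _ = _ := by field_simp
  have him' := abs_le.1 him
  refine ⟨?_, ?_⟩
  · rw [hR2, log_exp (by linarith [him'.1]) (by linarith [him'.2]), hR]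
  · rw [hR2, exp_re]; exact mul_nonneg (Real.exp_pos _).le (Real.cos_nonneg_of_mem_Icc ⟨him'.1, him'.2⟩)

/-- The factor of `R` that is continuous off the real line. -/
def regularPart (J : JacobiMatrix) (C : ℝ) (z : ℂ) : ℂ := C * J.R0 z * J.R1 z * J.R2 z

lemma R_eq_regularPart (C : ℝ) (z : ℂ) : J.R C z = J.regularPart C z * J.R3 z * J.Rmu z := rfl

lemma continuousAt_regularPart (hA : J.CondA) (hE : J.CondE) (C : ℝ) (hz : z.im ≠ 0) :
    ContinuousAt (J.regularPart C) z := by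
  obtain ⟨d1, d1'⟩ := isCompactDensity_spec1 hA
  have d2 := isCompactDensity_spec2a hA hE
  have c0 := continuousAt_R0 hA hE hz
  have c1 : ContinuousAt J.R1 z := by
    have := (d1.foldInv d1').continuousAt_expLine hz
    rwa [← gamma1_eq] at this
  have c2 : ContinuousAt J.R2 z := by
    have := (d2.foldInv d2).continuousAt_expLine hz
    rwa [← gamma2_eq] at this
  exact ((continuousAt_const.mul c0).mul c1).mul c2

lemma regularPart_ne_zero (hA : J.CondA) (hE : J.CondE) (hC : C ≠ 0) (hz : z.im ≠ 0) : J.regularPart C z ≠ 0 :=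
  mul_ne_zero (mul_ne_zero (mul_ne_zero (ofReal_ne_zero.2 hC) (R0_ne_zero hA hE hz))
    (expLine_ne_zero _ _)) (expLine_ne_zero _ _)

lemma regularPart_conj (hA : J.CondA) (hE : J.CondE) (C : ℝ) (hz : z.im ≠ 0) :
    J.regularPart C (conj z) = conj (J.regularPart C z) := by
  simp only [regularPart, R0_conj hA hE hz, R1, R2, expLine_conj, map_mul, conj_ofReal]

lemma tendsto_N_outer (hA : J.CondA) (hE : J.CondE) (h1 : ‖ξ‖ = 1) (him : 0 < ξ.im) :
    Tendsto (fun r : ℝ => J.N (r * ξ)) (𝓝[>] 1) (𝓝 (J.bdR (2 * ξ.re) + J.bdL (2 * ξ.re))) := by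
  have hx := two_mul_re_mem h1 him.ne'
  refine Tendsto.congr' ?_ (((hE.boundary_FR hA hx).1.add (hE.boundary_FL hx).1).comp (tendsto_outer_upperHalf h1 him))
  filter_upwards [eventually_one_lt] with r hr
  rw [J.N_of_one_lt (by rw [norm_ofReal_mul h1 r hr.1]; exact hr.2), J.M_eq]; rfl

lemma R_conj (hA : J.CondA) (hE : J.CondE) (C : ℝ) (hz : z.im ≠ 0) (h1 : ‖z‖ ≠ 1) :
    J.R C (conj z) = conj (J.R C z) := by
  have h0 := ne_zero_of_im hz
  rw [R_eq_regularPart, R_eq_regularPart, regularPart_conj hA hE C hz, R3_conj hA h0 h1, Rmu_eq, Rmu_eq,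
    expCircleLog_conj fun θ => by rw [Real.cos_neg]]
  simp

lemma exists_circleLim_R3 (hA : J.CondA) (hB : J.CondB) (hC : J.CondC) (hE : J.CondE)
    (hF : J.IsFactorConstant C) (h1 : ‖ξ‖ = 1) (him : 0 < ξ.im) :
    ∃ ρ : ℂ, ρ ≠ 0 ∧ CircleLim J.R3 ξ (conj ρ) ρ := by
  have hx := two_mul_re_mem h1 him.ne'
  have hξ0 : ξ ≠ 0 := by rintro rfl; simp at h1
  have hξi : ξ⁻¹.im ≠ 0 := by rw [inv_eq_conj h1]; simpa using him.ne'
  set m := J.bdR (2 * ξ.re) + J.bdL (2 * ξ.re) with hm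
  obtain ⟨hR, hL⟩ := im_bd_pos hA hB hE hx
  have hm0 : m ≠ 0 := fun h => by
    have := congrArg im h
    rw [hm, add_im, zero_im] at this; linarith
  set c4 : ℂ := ((Real.exp (-(1 / (2 * π)) * ∫ θ in (-π)..Real.pi, Real.log (J.mu (2 * Real.cos θ))) : ℝ) : ℂ) with hc4
  have hc40 : c4 ≠ 0 := ofReal_ne_zero.2 (Real.exp_pos _).ne'
  have hRmu : ∀ z : ℂ, z ≠ 0 → ‖z‖ ≠ 1 → J.Rmu z * J.Rmu z⁻¹ = c4 := fun z h0 h1 =>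
    expCircleLog_mul_inv (intervalIntegrable_log_mu hA hB hC hE) (fun θ => by rw [Real.cos_neg]) h0 h1
  have hn := norm_ofReal_mul h1
  have hpos := eventually_one_lt
  have hS := regularPart_ne_zero hA hE hF.1.ne' him.ne'
  have hS' := regularPart_ne_zero hA hE hF.1.ne' hξi
  set Λ := (ξ - ξ⁻¹) / m / (J.regularPart C ξ * J.regularPart C ξ⁻¹ * c4) with hΛ
  have hξξ : ξ - ξ⁻¹ ≠ 0 := fun h => by
    have := congrArg im h
    rw [inv_eq_conj h1] at this; simp at this; linarith
  have hΛ0 : Λ ≠ 0 := div_ne_zero (div_ne_zero hξξ hm0) (mul_ne_zero (mul_ne_zero hS hS') hc40)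
  have hrξ : Tendsto (fun r : ℝ => (r : ℂ) * ξ) (𝓝[>] 1) (𝓝 ξ) :=
    (CircleLim.of_continuousAt (f := id) continuousAt_id).2
  have hrξ' : Tendsto (fun r : ℝ => ((r : ℂ) * ξ)⁻¹) (𝓝[>] 1) (𝓝 ξ⁻¹) := hrξ.inv₀ hξ0
  have hN := tendsto_N_outer hA hE h1 him
  have hsq : Tendsto (fun r : ℝ => J.R3 (r * ξ) ^ 2) (𝓝[>] 1) (𝓝 Λ) := by
    refine Tendsto.congr' ?_ (((hrξ.sub hrξ').div hN hm0).div
      ((((continuousAt_regularPart hA hE C him.ne').tendsto.comp hrξ).mul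
        ((continuousAt_regularPart hA hE C hξi).tendsto.comp hrξ')).mul_const c4) (mul_ne_zero (mul_ne_zero hS hS') hc40))
    filter_upwards [hpos] with r hr
    have hz : ((r : ℂ) * ξ).im ≠ 0 := by simpa using ⟨hr.1.ne', him.ne'⟩
    have hz1 : ‖(r : ℂ) * ξ‖ ≠ 1 := by rw [hn r hr.1]; exact hr.2.ne'
    have hz0 : (r : ℂ) * ξ ≠ 0 := mul_ne_zero (ofReal_ne_zero.2 hr.1.ne') hξ0
    have hzi := im_inv_ne_zero hz
    have e := hF.2 _ hz hz1
    simp only [Function.comp, Pi.div_apply]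
    rw [e, R_eq_regularPart, R_eq_regularPart, R3_inv hA hz0 hz1, ← hRmu _ hz0 hz1]
    have a1 := regularPart_ne_zero hA hE hF.1.ne' hz
    have a2 := regularPart_ne_zero hA hE hF.1.ne' hzi
    have a3 : J.Rmu (r * ξ) ≠ 0 := exp_ne_zero _
    have a4 : J.Rmu (r * ξ)⁻¹ ≠ 0 := exp_ne_zero _
    rw [div_eq_iff (mul_ne_zero (mul_ne_zero a1 a2) (mul_ne_zero a3 a4))]; ring
  have hre : 0 ≤ Λ.re := ge_of_tendsto ((continuous_re.tendsto _).comp hsq) (by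
    filter_upwards [hpos] with r hr
    exact (R3_eq_exp_log hA (by simpa using ⟨hr.1.ne', him.ne'⟩) (by rw [hn r hr.1]; exact hr.2.ne')).2)
  have hslit : Λ ∈ slitPlane := by
    rcases hre.lt_or_eq with h | h
    · exact Or.inl h
    · exact Or.inr fun h' => hΛ0 (Complex.ext h.symm h')
  have hout : Tendsto (fun r : ℝ => J.R3 (r * ξ)) (𝓝[>] 1) (𝓝 (exp (1 / 2 * log Λ))) := by
    refine Tendsto.congr' ?_ ((hsq.clog hslit).const_mul (1 / 2)).cexp
    filter_upwards [hpos] with r hr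
    exact (R3_eq_exp_log hA (by simpa using ⟨hr.1.ne', him.ne'⟩) (by rw [hn r hr.1]; exact hr.2.ne')).1.symm
  refine ⟨_, exp_ne_zero _, ?_, hout⟩
  have hinv : Tendsto (fun r : ℝ => r⁻¹) (𝓝[<] 1) (𝓝[>] 1) := by
    refine tendsto_nhdsWithin_iff.2 ⟨?_, ?_⟩
    · have := (continuousAt_inv₀ (one_ne_zero : (1:ℝ) ≠ 0)).tendsto
      rw [inv_one] at this; exact this.mono_left nhdsWithin_le_nhds
    · filter_upwards [self_mem_nhdsWithin, (eventually_gt_nhds (one_pos : (0:ℝ) < 1)).filter_mono nhdsWithin_le_nhds] with r hr hr0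
      exact (one_lt_inv₀ hr0).2 hr
  refine Tendsto.congr' ?_ ((continuous_conj.tendsto _).comp (hout.comp hinv))
  filter_upwards [self_mem_nhdsWithin, (eventually_gt_nhds (one_pos : (0:ℝ) < 1)).filter_mono nhdsWithin_le_nhds] with r hr hr0
  have hz1 : ‖(r : ℂ) * ξ‖ ≠ 1 := by rw [hn r hr0]; exact ne_of_lt hr
  have hz0 : (r : ℂ) * ξ ≠ 0 := mul_ne_zero (ofReal_ne_zero.2 hr0.ne') hξ0
  have hz1' : ‖((r⁻¹ : ℝ) : ℂ) * ξ‖ ≠ 1 := by rw [hn _ (inv_pos.2 hr0)]; exact ((one_lt_inv₀ hr0).2 hr).ne'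
  have hz0' : ((r⁻¹ : ℝ) : ℂ) * ξ ≠ 0 := mul_ne_zero (ofReal_ne_zero.2 (inv_pos.2 hr0).ne') hξ0
  simp only [Function.comp]; rw [← R3_conj hA hz0' hz1', ← R3_inv hA hz0 hz1]
  congr 1; rw [map_mul, conj_ofReal, mul_inv, ← inv_eq_conj h1]; push_cast; rfl

/-- The boundary values of `R` at a point of the upper half circle. -/
lemma exists_circleLim_R (hA : J.CondA) (hB : J.CondB) (hC : J.CondC) (hE : J.CondE)
    (hF : J.IsFactorConstant C) (h1 : ‖ξ‖ = 1) (him : 0 < ξ.im) :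
    ∃ A u : ℂ, A ≠ 0 ∧ ‖u‖ = 1 ∧ CircleLim (J.R C) ξ A (J.mu (2 * ξ.re) * u * A) ∧
      J.mu (2 * ξ.re) * u * A * conj A * (J.bdR (2 * ξ.re) + J.bdL (2 * ξ.re)) = 2 * ξ.im * I := by
  obtain ⟨ρ, hρ, h3⟩ := exists_circleLim_R3 hA hB hC hE hF h1 him
  obtain ⟨p, hp, hμ⟩ := exists_circleLim_Rmu hA hB hC hE h1 him
  have hlim := ((CircleLim.of_continuousAt (continuousAt_regularPart hA hE C him.ne')).mul h3).mul hμ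
  have hS := regularPart_ne_zero hA hE hF.1.ne' him.ne'
  have hρ' : conj ρ ≠ 0 := by simpa using hρ
  have hx := two_mul_re_mem h1 him.ne'
  have hξ0 : ξ ≠ 0 := by rintro rfl; simp at h1
  set A := J.regularPart C ξ * conj ρ * p with hAdef
  have hlim' : CircleLim (J.R C) ξ A (J.mu (2 * ξ.re) * (ρ / conj ρ) * A) := by
    refine ⟨hlim.1, ?_⟩
    have e : J.mu (2 * ξ.re) * (ρ / conj ρ) * A =
        J.regularPart C ξ * ρ * (J.mu (2 * ξ.re) * p) := by rw [hAdef]; field_simp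
    rw [e]; exact hlim.2
  refine ⟨A, ρ / conj ρ, mul_ne_zero (mul_ne_zero hS hρ') hp, ?_, hlim', ?_⟩
  · rw [norm_div, norm_conj, div_self (norm_ne_zero_iff.2 hρ)]
  · have hn := norm_ofReal_mul h1
    have hpos := eventually_one_lt
    have hrξ : Tendsto (fun r : ℝ => (r : ℂ) * ξ) (𝓝[>] 1) (𝓝 ξ) :=
      (CircleLim.of_continuousAt (f := id) continuousAt_id).2
    have hinv : Tendsto (fun r : ℝ => r⁻¹) (𝓝[>] 1) (𝓝[<] 1) := by
      refine tendsto_nhdsWithin_iff.2 ⟨?_, ?_⟩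
      · have := (continuousAt_inv₀ (one_ne_zero : (1:ℝ) ≠ 0)).tendsto
        rw [inv_one] at this; exact this.mono_left nhdsWithin_le_nhds
      · filter_upwards [self_mem_nhdsWithin] with r hr using inv_lt_one_of_one_lt₀ (mem_Ioi.1 hr)
    have hM := tendsto_N_outer hA hE h1 him
    have hLHS := (hlim'.2.mul ((continuous_conj.tendsto _).comp (hlim'.1.comp hinv))).mul hM
    have hRHS := hrξ.sub (hrξ.inv₀ hξ0)
    have hfin : ξ - ξ⁻¹ = 2 * ξ.im * I := by rw [inv_eq_conj h1, sub_conj]; push_cast; ring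
    rw [← hfin]
    refine tendsto_nhds_unique (hLHS.congr' ?_) hRHS
    filter_upwards [hpos] with r hr
    have hr' := inv_pos.2 hr.1
    have hz : ((r : ℂ) * ξ).im ≠ 0 := by simpa using ⟨hr.1.ne', him.ne'⟩
    have hz1 : ‖(r : ℂ) * ξ‖ ≠ 1 := by rw [hn r hr.1]; exact hr.2.ne'
    have hz' : (((r⁻¹ : ℝ) : ℂ) * ξ).im ≠ 0 := by rw [im_ofReal_mul]; exact mul_ne_zero hr'.ne' him.ne'
    have hz1' : ‖((r⁻¹ : ℝ) : ℂ) * ξ‖ ≠ 1 := by rw [hn _ hr']; exact (inv_lt_one_of_one_lt₀ hr.2).ne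
    have hN0 : J.N (r * ξ) ≠ 0 := by
      rw [J.N_of_one_lt (by rw [hn r hr.1]; exact hr.2)]
      exact hA.isPick_M.ne_zero (im_add_inv_ne_zero hz hz1)
    simp only [Function.comp]; rw [← R_conj hA hE C hz' hz1']
    have e : conj (((r⁻¹ : ℝ) : ℂ) * ξ) = ((r : ℂ) * ξ)⁻¹ := by
      rw [map_mul, conj_ofReal, mul_inv, ← inv_eq_conj h1]; push_cast; rfl
    rw [e, ← hF.2 _ hz hz1, div_mul_cancel₀ _ hN0]

end JacobiMatrix

lemma jump_algebra {F L A u : ℂ} {s μ q : ℝ} (hF : 0 < F.im) (hL : 0 < L.im) (hs : 0 < s) (hA : A ≠ 0)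
    (hu : ‖u‖ = 1) (hμ : μ = √(F.im / L.im)) (hq : q = 2 * √(F.im * L.im) / ‖F + L‖)
    (hprod : μ * u * A * conj A * (F + L) = 2 * s * I) {r : ℂ}
    (hr : r = 1 / (1 + (q : ℂ)) * ((-conj F - L) / (2 * s * I)) * A * (μ * u * A)) :
    (∀ P Q : ℂ, A * (-conj F * P + Q) - μ * u * A * (L * P + Q) =
      -r * (conj A * (-F * P + Q) + conj (μ * u * A) * (conj L * P + Q))) ∧
    ‖r‖ ≤ 1 / (1 + q) := by
  obtain ⟨f, c⟩ := F
  obtain ⟨l, d⟩ := L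
  simp only at hF hL hμ hq
  obtain ⟨a, ha, rfl⟩ : ∃ a : ℝ, 0 < a ∧ a ^ 2 = c := ⟨_, Real.sqrt_pos.2 hF, Real.sq_sqrt hF.le⟩
  obtain ⟨b, hb, rfl⟩ : ∃ b : ℝ, 0 < b ∧ b ^ 2 = d := ⟨_, Real.sqrt_pos.2 hL, Real.sq_sqrt hL.le⟩
  rw [← div_pow, Real.sqrt_sq (by positivity)] at hμ; rw [← mul_pow, Real.sqrt_sq (by positivity)] at hq
  set F : ℂ := ⟨f, a ^ 2⟩ with hFdef
  set L : ℂ := ⟨l, b ^ 2⟩ with hLdef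
  set m := F + L with hm
  set n := ‖m‖ with hn
  have hm0 : m ≠ 0 := fun h => by
    have := congrArg im h
    simp [hm, hFdef, hLdef] at this; nlinarith
  have hnpos : 0 < n := norm_pos_iff.2 hm0
  have hn2 : n ^ 2 = (f + l) ^ 2 + (a ^ 2 + b ^ 2) ^ 2 := by
    rw [hn, ← normSq_eq_norm_sq, normSq_apply]; simp [hm, hFdef, hLdef]; ring
  have hmm : m * conj m = (n : ℂ) ^ 2 := by rw [mul_conj, normSq_eq_norm_sq]; push_cast; rfl
  set K := conj F + L with hK
  have hAA : A * conj A = ((‖A‖ ^ 2 : ℝ) : ℂ) := by rw [mul_conj, normSq_eq_norm_sq]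
  have hApos : 0 < ‖A‖ := norm_pos_iff.2 hA
  have hμpos : 0 < μ := by rw [hμ]; positivity
  have hnorm : μ * ‖A‖ ^ 2 * n = 2 * s := by
    have := congrArg norm hprod
    simp [hu, abs_of_pos hμpos, abs_of_pos hs] at this; rw [← this]; ring
  have hum : u * m = n * I := by
    have h0 : ((μ * ‖A‖ ^ 2 : ℝ) : ℂ) ≠ 0 := ofReal_ne_zero.2 (by positivity)
    apply mul_left_cancel₀ h0
    have h2 : ((2 * s : ℝ) : ℂ) = ((μ * ‖A‖ ^ 2 * n : ℝ) : ℂ) := by rw [hnorm]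
    push_cast at h2 hAA ⊢
    linear_combination hprod + I * h2 - (μ * u * m) * hAA
  have hsC : (2 * s * I : ℂ) ≠ 0 := by simp [hs.ne', I_ne_zero]
  have hsC' : (s : ℂ) ≠ 0 := ofReal_ne_zero.2 hs.ne'
  have hnC : (n : ℂ) ≠ 0 := ofReal_ne_zero.2 hnpos.ne'
  have haC : (a : ℂ) ≠ 0 := ofReal_ne_zero.2 ha.ne'
  have hbC : (b : ℂ) ≠ 0 := ofReal_ne_zero.2 hb.ne'
  have hnab : (n : ℂ) + 2 * a * b ≠ 0 := by
    have : (0:ℝ) < n + 2 * a * b := by positivity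
    exact_mod_cast this.ne'
  have hqC : 1 + (q : ℂ) = (n + 2 * a * b) / n := by rw [hq]; push_cast; field_simp
  have hB : μ * u * A = a * n * I * A / (b * m) := by
    rw [hμ, eq_div_iff (mul_ne_zero hbC hm0)]; push_cast; field_simp
    linear_combination hum
  have hcm0 : conj m ≠ 0 := by simpa using hm0
  have hcm : conj m = n ^ 2 / m := by rw [eq_div_iff hm0, mul_comm]; exact hmm
  have hprod' : conj (μ * u * A) * A * conj m = -(2 * s * I) := by
    have := congrArg conj hprod
    simp only [map_mul, conj_ofReal, conj_conj, conj_I, map_ofNat] at this ⊢; rw [← mul_neg, ← this]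
  have hrA : r * conj A = -(K * A * n / (m * (n + 2 * a * b))) := by
    rw [hr, hqC, hK]
    have : A * (μ * u * A) * conj A = 2 * s * I * A / m := by rw [eq_div_iff hm0, ← hprod]; ring
    calc _ = 1 / ((n + 2 * a * b) / n) * ((-conj F - L) / (2 * s * I)) * (A * (μ * u * A) * conj A) := by ring
      _ = _ := by rw [this]; field_simp; ring
  have hrB : r * conj (μ * u * A) = K * a * I * A / (b * (n + 2 * a * b)) := by
    rw [hr, hqC, hK]
    have : A * conj (μ * u * A) = -(2 * s * I) / conj m := by rw [eq_div_iff hcm0, ← hprod']; ring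
    calc _ = 1 / ((n + 2 * a * b) / n) * ((-conj F - L) / (2 * s * I)) * (A * conj (μ * u * A)) * (μ * u * A) := by ring
      _ = _ := by rw [this, hB, hcm]; field_simp; ring
  have idQ : ((n : ℂ) + 2 * a * b) * (b * m - a * n * I) = K * (n * b - a * I * m) := by
    apply Complex.ext
    · simp [hm, hK, hFdef, hLdef]; ring
    · simp [hm, hK, hFdef, hLdef]
      linear_combination (-a) * hn2
  have idP : ((n : ℂ) + 2 * a * b) * (conj F * (b * m) + L * (a * n * I)) =
      K * (n * b * F + a * I * m * conj L) := by
    apply Complex.ext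
    · simp [hm, hK, hFdef, hLdef]
      linear_combination (-(a * b ^ 2)) * hn2
    · simp [hm, hK, hFdef, hLdef]
      linear_combination (a * l) * hn2
  refine ⟨fun P Q => ?_, ?_⟩
  · have e : -r * (conj A * (-F * P + Q) + conj (μ * u * A) * (conj L * P + Q)) =
        -(r * conj A * (-F * P + Q) + r * conj (μ * u * A) * (conj L * P + Q)) := by ring
    rw [e, hrA, hrB, hB]
    have hden : b * m * (n + 2 * a * b) ≠ 0 := mul_ne_zero (mul_ne_zero hbC hm0) hnab
    apply mul_left_cancel₀ hden
    have e1 : b * m * (n + 2 * a * b) * (A * (-conj F * P + Q) - a * n * I * A / (b * m) * (L * P + Q)) =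
        A * (((n : ℂ) + 2 * a * b) * (b * m - a * n * I) * Q -
          ((n : ℂ) + 2 * a * b) * (conj F * (b * m) + L * (a * n * I)) * P) := by
      field_simp; ring
    have e2 : b * m * (n + 2 * a * b) * -(-(K * A * n / (m * (n + 2 * a * b))) * (-F * P + Q) +
        K * a * I * A / (b * (n + 2 * a * b)) * (conj L * P + Q)) =
        A * (K * (n * b - a * I * m) * Q - K * (n * b * F + a * I * m * conj L) * P) := by
      generalize (n : ℂ) + 2 * a * b = D at hnab ⊢
      field_simp; ring
    rw [e1, e2, idQ, idP]
  · have hq0 : 0 ≤ q := by rw [hq]; positivity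
    have hKn : ‖K‖ ≤ n := by
      refine abs_le_of_sq_le_sq' ?_ hnpos.le |>.2
      rw [← normSq_eq_norm_sq, normSq_apply, hn2]; simp [hK, hFdef, hLdef]
      nlinarith [mul_pos (pow_pos ha 2) (pow_pos hb 2)]
    have e : ‖r‖ = 1 / (1 + q) * (‖K‖ / n) := by
      rw [hr, show -conj F - L = -K by rw [hK]; ring]
      have h1 : ‖(1 : ℂ) + q‖ = 1 + q := by
        rw [← ofReal_one, ← ofReal_add, norm_real, Real.norm_of_nonneg (by linarith)]
      simp only [norm_mul, norm_div, norm_neg, norm_one, h1, hu, norm_real, norm_I, Real.norm_eq_abs,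
        abs_of_pos hμpos, abs_of_pos hs, mul_one, RCLike.norm_ofNat]
      rw [← hnorm]; field_simp
    rw [e]; exact mul_le_of_le_one_right (by positivity) ((div_le_one hnpos).2 hKn)

namespace JacobiMatrix
lemma continuous_solution (init : ℂ × ℂ) (k : ℤ) : Continuous fun w => J.solution w init k := by
  have hf : ∀ n : ℕ, Continuous fun w => J.forward w init n := by
    intro n
    induction n with
    | zero => exact continuous_const
    | succ n ih => simp only [forward]; fun_prop
  have hb : ∀ n : ℕ, Continuous fun w => J.backward w init n := by
    intro n
    induction n with
    | zero => exact continuous_const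
    | succ n ih => simp only [backward]; fun_prop
  cases k with
  | ofNat n => exact (hf n).snd
  | negSucc n => exact (hb n).fst

lemma exists_isFactorConstant (hA : J.CondA) (hB : J.CondB) (hC : J.CondC) (hD : J.CondD) (hE : J.CondE) :
    ∃ C : ℝ, J.IsFactorConstant C := by
  obtain ⟨K, hK, h⟩ := exists_R_mul_inv hA hB hC hD hE
  refine ⟨Real.sqrt K⁻¹, Real.sqrt_pos.2 (inv_pos.2 hK), fun z hz h1 => ?_⟩
  have h0 := ne_zero_of_im hz
  have hM := hA.isPick_M.ne_zero (im_add_inv_ne_zero hz h1)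
  have hN : J.N z ≠ 0 := by
    rcases lt_or_gt_of_ne h1 with h | h
    · rw [J.N_of_lt_one h0 h]; exact neg_ne_zero.2 hM
    · rw [J.N_of_one_lt h]; exact hM
  rw [div_eq_iff hN, h z hz h1, ← ofReal_pow, Real.sq_sqrt (inv_pos.2 hK).le, ← ofReal_mul,
    inv_mul_cancel₀ hK.ne', ofReal_one, one_mul]

lemma exists_tendsto_R (hA : J.CondA) (hB : J.CondB) (hC : J.CondC) (hE : J.CondE) (hC0 : C ≠ 0) :
    ∃ c : ℂ, c ≠ 0 ∧ Tendsto (J.R C) (Bornology.cobounded ℂ) (𝓝 c) := by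
  obtain ⟨d1, d1'⟩ := isCompactDensity_spec1 hA
  have d2 := isCompactDensity_spec2a hA hE
  obtain ⟨c1, hc1, t1⟩ := (d1.foldInv d1').tendsto_expLine
  obtain ⟨c2, hc2, t2⟩ := (d2.foldInv d2).tendsto_expLine
  rw [← gamma1_eq] at t1; rw [← gamma2_eq] at t2
  have t3 : Tendsto J.R3 (Bornology.cobounded ℂ) (𝓝 1) := by
    have h := (((tendsto_cauchyInt_cobounded (isCompactDensity_circle hA)).1.comp
      tendsto_add_inv_cobounded).const_mul (-(1 / (2 * (π : ℂ))))).cexp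
    rw [mul_zero, exp_zero] at h
    refine h.congr' ?_
    filter_upwards [(tendsto_norm_cobounded_atTop (E := ℂ)).eventually_gt_atTop 1] with z hz
    exact (R3_eq hA (norm_pos_iff.1 (one_pos.trans hz)) hz.ne').symm
  have t4 := tendsto_expCircleLog_cobounded _ (intervalIntegrable_log_mu hA hB hC hE)
  refine ⟨_, ?_, ((((tendsto_const_nhds (x := (C : ℂ))).mul (tendsto_R0_cobounded hA hE)).mul t1).mul t2 |>.mul t3).mul t4⟩
  simp [hc1, hc2, hC0]

/-- The boundary data of `n` and `R` at a point of the circle. -/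
structure BoundaryData (J : JacobiMatrix) (C : ℝ) (ξ a b A B : ℂ) : Prop where
  n : CircleLim J.n ξ a b
  R : CircleLim (J.R C) ξ A B

lemma BoundaryData.star (hA : J.CondA) (hE : J.CondE) {ξ a b A B : ℂ} (h : BoundaryData J C ξ a b A B)
    (h1 : ‖ξ‖ = 1) (him : ξ.im ≠ 0) : BoundaryData J C ξ⁻¹ (conj a) (conj b) (conj A) (conj B) := by
  rw [inv_eq_conj h1]
  exact ⟨h.n.star h1 him fun _ _ _ => n_conj hA, h.R.star h1 him fun _ hz hz1 => R_conj hA hE C hz hz1⟩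

lemma BoundaryData.g {ξ a b A B : ℂ} (h : BoundaryData J C ξ a b A B) (h0 : ξ ≠ 0) (k : ℤ) : CircleLim (J.g C k) ξ
      (A / J.Rinfty C * ξ ^ (-(k + 1)) * (J.h k : ℂ) * (a * J.P k (ξ + ξ⁻¹) + J.Q k (ξ + ξ⁻¹)))
      (B / J.Rinfty C * ξ ^ (-(k + 1)) * (J.h k : ℂ) * (b * J.P k (ξ + ξ⁻¹) + J.Q k (ξ + ξ⁻¹))) := by
  have hw : ContinuousAt (fun z : ℂ => z + z⁻¹) ξ := by fun_prop (disch := assumption)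
  have hP := CircleLim.of_continuousAt (f := fun z => J.P k (z + z⁻¹)) (ξ := ξ)
    ((continuous_solution (J := J) (0, 1) k).continuousAt.comp hw)
  have hQ := CircleLim.of_continuousAt (f := fun z => J.Q k (z + z⁻¹)) (ξ := ξ)
    ((continuous_solution (J := J) (1, 0) k).continuousAt.comp hw)
  have hz := CircleLim.of_continuousAt (f := fun z => z ^ (-(k + 1))) (ξ := ξ) (continuousAt_zpow₀ _ _ (Or.inl h0))
  have hc := CircleLim.of_continuousAt (f := fun _ => (J.Rinfty C)⁻¹) (ξ := ξ) continuousAt_const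
  have hh := CircleLim.of_continuousAt (f := fun _ => (J.h k : ℂ)) (ξ := ξ) continuousAt_const
  exact (((h.R.mul hc).mul hz).mul hh).mul ((h.n.mul hP).add hQ)

lemma BoundaryData.jump {ξ a b A B a' b' A' B' r : ℂ} (h : BoundaryData J C ξ a b A B)
    (h' : BoundaryData J C ξ⁻¹ a' b' A' B') (h0 : ξ ≠ 0) (hr : J.rHat C ξ = r)
    (halg : ∀ P Q : ℂ, A * (a * P + Q) - B * (b * P + Q) = -r * (A' * (a' * P + Q) + B' * (b' * P + Q))) (k : ℤ) :
    HasCircleLimits (J.g C k) ξ ∧ HasCircleLimits (J.g C k) ξ⁻¹ ∧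
      ξ ^ (2 * (k + 1)) * (innerLim (J.g C k) ξ - outerLim (J.g C k) ξ) =
        -J.rHat C ξ * (innerLim (J.g C k) ξ⁻¹ + outerLim (J.g C k) ξ⁻¹) := by
  have hg := h.g h0 k
  have hg' := h'.g (inv_ne_zero h0) k
  refine ⟨hg.hasCircleLimits, hg'.hasCircleLimits, ?_⟩
  have e := halg (J.P k (ξ + ξ⁻¹)) (J.Q k (ξ + ξ⁻¹))
  rw [hg.innerLim_eq, hg.outerLim_eq, hg'.innerLim_eq, hg'.outerLim_eq, hr, inv_inv, add_comm ξ⁻¹ ξ]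
  have z1 : ξ ^ (2 * (k + 1)) = ξ ^ (k + 1) * ξ ^ (k + 1) := by rw [two_mul, zpow_add₀ h0]
  have z2 : ξ ^ (-(k + 1)) = (ξ ^ (k + 1))⁻¹ := zpow_neg _ _
  have z3 : ξ⁻¹ ^ (-(k + 1)) = ξ ^ (k + 1) := by rw [inv_zpow, zpow_neg, inv_inv]
  rw [z1, z2, z3]
  have hz := zpow_ne_zero (k + 1) h0
  set y := ξ ^ (k + 1)
  have hy : y * y * y⁻¹ = y := by field_simp
  calc _ = (y * y * y⁻¹) * (J.h k : ℂ) / J.Rinfty C * (A * (a * J.P k (ξ + ξ⁻¹) + J.Q k (ξ + ξ⁻¹)) -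
        B * (b * J.P k (ξ + ξ⁻¹) + J.Q k (ξ + ξ⁻¹))) := by ring
    _ = _ := by rw [e, hy]; ring

lemma q_eq (hA : J.CondA) (hE : J.CondE) {ξ a b a' b' : ℂ} (h1 : ‖ξ‖ = 1) (him : ξ.im ≠ 0)
    (h : CircleLim J.n ξ a b) (h' : CircleLim J.n ξ⁻¹ a' b') :
    J.q ξ = 2 * √((J.bdR (2 * ξ.re)).im * (J.bdL (2 * ξ.re)).im) / ‖a - b'‖ := by
  have hx := two_mul_re_mem h1 him
  have hpi := Real.pi_pos
  rw [q, add_inv_of_norm_eq_one h1, ofReal_re, rhoR'_eq hA hE hx, rhoL'_eq hE hx, h.innerLim_eq, h'.outerLim_eq,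
    mul_mul_mul_comm, Real.sqrt_mul (by positivity), Real.sqrt_mul_self (by positivity)]
  congr 1; field_simp

/-- The jump relation and the bound of the coefficient, away from `±1`. -/
lemma exists_boundaryData (hA : J.CondA) (hB : J.CondB) (hC : J.CondC) (hE : J.CondE)
    (hF : J.IsFactorConstant C) (h1 : ‖ξ‖ = 1) (him : ξ.im ≠ 0) :
    ∃ a b A B a' b' A' B' : ℂ, BoundaryData J C ξ a b A B ∧ BoundaryData J C ξ⁻¹ a' b' A' B' ∧
      (∀ P Q : ℂ, A * (a * P + Q) - B * (b * P + Q) = -J.rHat C ξ * (A' * (a' * P + Q) + B' * (b' * P + Q))) ∧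
      ‖J.rHat C ξ‖ ≤ 1 / (1 + 2 * √((J.bdR (2 * ξ.re)).im * (J.bdL (2 * ξ.re)).im) /
        ‖J.bdR (2 * ξ.re) + J.bdL (2 * ξ.re)‖) := by
  have upper : ∀ ξ : ℂ, ‖ξ‖ = 1 → 0 < ξ.im → ∃ a b A B : ℂ, BoundaryData J C ξ a b A B ∧
      (∀ P Q : ℂ, A * (a * P + Q) - B * (b * P + Q) = -J.rHat C ξ * (conj A * (conj a * P + Q) +
        conj B * (conj b * P + Q))) ∧ J.rHat C ξ⁻¹ = conj (J.rHat C ξ) ∧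
      ‖J.rHat C ξ‖ ≤ 1 / (1 + 2 * √((J.bdR (2 * ξ.re)).im * (J.bdL (2 * ξ.re)).im) /
        ‖J.bdR (2 * ξ.re) + J.bdL (2 * ξ.re)‖) := by
    intro ξ h1 him
    have hx := two_mul_re_mem h1 him.ne'
    obtain ⟨iR, iL⟩ := im_bd_pos hA hB hE hx
    obtain ⟨A, u, hA0, hu, hR, hprod⟩ := exists_circleLim_R hA hB hC hE hF h1 him
    have hdata : BoundaryData J C ξ _ _ _ _ := ⟨circleLim_n hA hE h1 him, hR⟩
    have hdata' := hdata.star hA hE h1 him.ne'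
    have hq := q_eq hA hE h1 him.ne' hdata.n hdata'.n
    have hξi : ‖ξ⁻¹‖ = 1 := by rw [norm_inv, h1, inv_one]
    have hre : ξ⁻¹.re = ξ.re := by rw [inv_eq_conj h1, conj_re]
    have him' : ξ⁻¹.im ≠ 0 := by rw [inv_eq_conj h1]; simpa using him.ne'
    have hq' := q_eq hA hE hξi him' hdata'.n (by rw [inv_inv]; exact hdata.n)
    rw [hre] at hq'
    have hn1 : ‖-conj (J.bdR (2 * ξ.re)) - conj (J.bdL (2 * ξ.re))‖ = ‖J.bdR (2 * ξ.re) + J.bdL (2 * ξ.re)‖ := by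
      rw [← neg_add', norm_neg, ← map_add, norm_conj]
    have hn2 : ‖conj (-conj (J.bdR (2 * ξ.re))) - J.bdL (2 * ξ.re)‖ = ‖J.bdR (2 * ξ.re) + J.bdL (2 * ξ.re)‖ := by
      rw [map_neg, conj_conj, ← neg_add', norm_neg]
    rw [hn1] at hq; rw [hn2, ← hq] at hq'
    have hξξ : ξ - ξ⁻¹ = 2 * ξ.im * I := by rw [inv_eq_conj h1, sub_conj]; push_cast; ring
    have hr : J.rHat C ξ = 1 / (1 + (J.q ξ : ℂ)) * ((-conj (J.bdR (2 * ξ.re)) - J.bdL (2 * ξ.re)) /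
        (2 * ξ.im * I)) * A * (J.mu (2 * ξ.re) * u * A) := by
      rw [rHat, hdata.n.innerLim_eq, hdata.n.outerLim_eq, hdata.R.innerLim_eq, hdata.R.outerLim_eq, hξξ]
    have key := jump_algebra iR iL him hA0 hu (mu_eq hA hE hx) hq hprod hr
    refine ⟨_, _, _, _, hdata, ?_, ?_, ?_⟩
    · simpa only [map_neg, conj_conj] using key.1
    · rw [hr, rHat, hdata'.n.innerLim_eq, hdata'.n.outerLim_eq, hdata'.R.innerLim_eq, hdata'.R.outerLim_eq, hq',
        inv_inv, show ξ⁻¹ - ξ = -(ξ - ξ⁻¹) by ring, hξξ]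
      simp [map_ofNat]
    · rw [← hq]; exact key.2
  rcases lt_or_gt_of_ne him with h | h
  · have hξi : ‖ξ⁻¹‖ = 1 := by rw [norm_inv, h1, inv_one]
    have hre : ξ⁻¹.re = ξ.re := by rw [inv_eq_conj h1, conj_re]
    have him' : 0 < ξ⁻¹.im := by rw [inv_eq_conj h1]; simpa using h
    obtain ⟨a, b, A, B, hd, halg, hrr, hb⟩ := upper ξ⁻¹ hξi him'
    have hd' := hd.star hA hE hξi him'.ne'
    rw [inv_inv] at hd' hrr
    refine ⟨_, _, _, _, _, _, _, _, hd', hd, fun P Q => ?_, ?_⟩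
    · have := congrArg conj (halg (conj P) (conj Q))
      simp only [map_sub, map_mul, map_add, map_neg, conj_conj] at this; rw [hrr]; exact this
    · rw [hrr, norm_conj, ← hre]; exact hb
  · obtain ⟨a, b, A, B, hd, halg, -, hb⟩ := upper ξ h1 h
    exact ⟨_, _, _, _, _, _, _, _, hd, hd.star hA hE h1 h.ne', halg, hb⟩

lemma exists_rHat_bound (hA : J.CondA) (hB : J.CondB) (hC : J.CondC) (hE : J.CondE)
    (hF : J.IsFactorConstant C) : ∃ c : ℝ, c < 1 ∧ ∀ ξ : ℂ, ‖ξ‖ = 1 → ξ.im ≠ 0 → ‖J.rHat C ξ‖ < c := by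
  obtain ⟨s, hs, hsec⟩ := hE.exists_sector hA hB
  obtain ⟨κ, hκ, hrat⟩ := hC.exists_ratio_bound hA hE
  set δ := s / (1 + κ) with hδ
  have hδ0 : 0 < δ := by positivity
  refine ⟨1 / (1 + δ), by rw [div_lt_one (by positivity)]; linarith, fun ξ h1 him => ?_⟩
  have hx := two_mul_re_mem h1 him
  obtain ⟨_, _, _, _, _, _, _, _, -, -, -, hb⟩ := exists_boundaryData hA hB hC hE hF h1 him
  refine hb.trans_lt (one_div_lt_one_div_of_lt (by positivity) ?_)
  set F := J.bdR (2 * ξ.re)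
  set L := J.bdL (2 * ξ.re)
  obtain ⟨iR, iL⟩ := im_bd_pos hA hB hE hx
  obtain ⟨s1, s2⟩ := hsec _ hx
  obtain ⟨k1, k2⟩ := hrat _ hx
  have hm0 : 0 < ‖F + L‖ := norm_pos_iff.2 fun h => by
    have := congrArg im h
    rw [add_im, zero_im] at this; linarith
  have hnF : ‖F + L‖ ≤ (1 + κ) * ‖F‖ := by linarith [norm_add_le F L]
  have hnL : ‖F + L‖ ≤ (1 + κ) * ‖L‖ := by linarith [norm_add_le F L]
  have hsq : δ * ‖F + L‖ ≤ √(F.im * L.im) := by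
    apply Real.le_sqrt_of_sq_le
    have e1 : δ * ‖F + L‖ ≤ F.im := by
      calc δ * ‖F + L‖ ≤ δ * ((1 + κ) * ‖F‖) := by gcongr
        _ = s * ‖F‖ := by rw [hδ]; field_simp
        _ ≤ _ := s1
    have e2 : δ * ‖F + L‖ ≤ L.im := by
      calc δ * ‖F + L‖ ≤ δ * ((1 + κ) * ‖L‖) := by gcongr
        _ = s * ‖L‖ := by rw [hδ]; field_simp
        _ ≤ _ := s2
    rw [sq]; exact mul_le_mul e1 e2 (by positivity) iR.le
  have : δ < 2 * √(F.im * L.im) / ‖F + L‖ := by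
    rw [lt_div_iff₀ hm0]
    have : 0 < δ * ‖F + L‖ := by positivity
    linarith
  linarith

end JacobiMatrix

end

theorem lemma3p7 (J : JacobiMatrix) (hA : J.CondA) (hB : J.CondB) (hC : J.CondC)
    (hD : J.CondD) (hE : J.CondE) :
    ∃ C : ℝ, J.IsFactorConstant C ∧
      (J.Rinfty C ≠ 0 ∧ Tendsto (J.R C) (Bornology.cobounded ℂ) (𝓝 (J.Rinfty C))) ∧
      (∀ k : ℤ, ∀ᵐ θ : ℝ, ∀ ξ : ℂ, ξ = Complex.exp (θ * Complex.I) →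
        HasCircleLimits (J.g C k) ξ ∧ HasCircleLimits (J.g C k) ξ⁻¹ ∧
        ξ ^ (2 * (k + 1)) * (innerLim (J.g C k) ξ - outerLim (J.g C k) ξ) =
          -J.rHat C ξ * (innerLim (J.g C k) ξ⁻¹ + outerLim (J.g C k) ξ⁻¹)) ∧
      (∀ ξ : ℂ, ‖ξ‖ = 1 → ξ ≠ 1 → ξ ≠ -1 →
        HasCircleLimits J.n ξ ∧ HasCircleLimits (J.R C) ξ ∧
        DifferentiableAt ℝ (fun t => J.rhoR.real (Iic t)) (ξ + ξ⁻¹).re ∧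
        DifferentiableAt ℝ (fun t => J.rhoL.real (Iic t)) (ξ + ξ⁻¹).re) ∧
      (∃ c : ℝ, c < 1 ∧ ∀ ξ : ℂ, ‖ξ‖ = 1 → ξ ≠ 1 → ξ ≠ -1 → ‖J.rHat C ξ‖ < c) := by
  obtain ⟨C, hF⟩ := JacobiMatrix.exists_isFactorConstant hA hB hC hD hE
  obtain ⟨c, hc0, hc⟩ := JacobiMatrix.exists_tendsto_R hA hB hC hE hF.1.ne'
  have hRc : J.Rinfty C = c := hc.limUnder_eq
  have him : ∀ ξ : ℂ, ‖ξ‖ = 1 → ξ ≠ 1 → ξ ≠ -1 → ξ.im ≠ 0 := by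
    intro ξ h1 hp hm h0
    have hre : ξ = (ξ.re : ℂ) := Complex.ext (by simp) (by simpa using h0)
    rw [hre, Complex.norm_real, Real.norm_eq_abs] at h1
    rcases eq_or_eq_neg_of_abs_eq h1 with h | h
    · exact hp (by rw [hre, h]; simp)
    · exact hm (by rw [hre, h]; simp)
  refine ⟨C, hF, ⟨by rwa [hRc], by rwa [hRc]⟩, fun k => ?_, fun ξ h1 hp hm => ?_, ?_⟩
  · have hcount : (range fun n : ℤ => (n : ℝ) * Real.pi).Countable := countable_range _
    filter_upwards [hcount.ae_notMem volume] with θ hθ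
    rintro ξ rfl
    have h1 : ‖Complex.exp (θ * Complex.I)‖ = 1 := Complex.norm_exp_ofReal_mul_I θ
    have hi : (Complex.exp (θ * Complex.I)).im ≠ 0 := by
      rw [Complex.exp_ofReal_mul_I_im]
      intro h
      obtain ⟨n, hn⟩ := Real.sin_eq_zero_iff.1 h
      exact hθ ⟨n, hn⟩
    obtain ⟨_, _, _, _, _, _, _, _, hd, hd', halg, -⟩ := JacobiMatrix.exists_boundaryData hA hB hC hE hF h1 hi
    exact hd.jump hd' (Complex.exp_ne_zero _) rfl halg k
  · have hi := him ξ h1 hp hm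
    obtain ⟨_, _, _, _, _, _, _, _, hd, -, -, -⟩ := JacobiMatrix.exists_boundaryData hA hB hC hE hF h1 hi
    have hx := two_mul_re_mem h1 hi
    rw [add_inv_of_norm_eq_one h1, Complex.ofReal_re]
    exact ⟨hd.n.hasCircleLimits, hd.R.hasCircleLimits, (hA.hasDerivAt_rhoR hE hx).differentiableAt,
      (hE.hasDerivAt_rhoL hx).differentiableAt⟩
  · obtain ⟨c, hc1, hb⟩ := JacobiMatrix.exists_rHat_bound hA hB hC hE hF
    exact ⟨c, hc1, fun ξ h1 hp hm => hb ξ h1 (him ξ h1 hp hm)⟩
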